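/- **Setting.** Let $W$ be a finite reflection group on a Euclidean space $V$, fixing only $0$, of type $A_n$ ($n\ge 2$), $B_n$ ($n\ge 2$), $D_n$ ($n\ge 4$), $I_2(m)$ ($m\ge 3$) or $H_3$, with a reduced root system $\Phi$, simple roots $\alpha_1,\dots,\alpha_n$ and simple reflections $S=\{s_1,\dots,s_n\}$. Let $S=S_+\sqcup S_-$ be a bipartition of the Coxeter diagram, $c_\varepsilon=\prod_{s\in S_\varepsilon}s$, $c=c_-c_+$, and $h$ the order of $c$. Let $\Phi_{\ge-1}=\Phi^+\cup\{-\alpha_1,\dots,-\alpha_n\}$ be the set of almost positive roots. Let $\tau_\varepsilon$ fix $-\alpha_i$ for $s_i\in S_{-\varepsilon}$ and act as $c_\varepsilon$ on the other elements of $\Phi_{\ge-1}$. *Compatibility* is the unique $\langle\tau_+,\tau_-\rangle$-invariant relation on $\Phi_{\ge-1}$ such that $-\alpha_i$ is compatible with $\beta$ iff $\alpha_i$ has coefficient $0$ in the expansion of $\beta$ in simple roots. **Diagrams.** Let $P$ be the Coxeter plane, i.e. the plane on which $c$ acts as a rotation by $2\pi/h$, and let $L_\varepsilon\subset P$ be the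 intersection of $P$ with the reflecting hyperplanes of all $s\in S_\varepsilon$. Let $o$ be a nontrivial $W$-orbit of smallest size. Its orthogonal projection to $P$ consists of the vertices of a regular $h$-gon and possibly several points at the origin, which are labeled by the elements of $o$ projecting there. Subdivide each edge of the $h$-gon perpendicular to $L_+$ or $L_-$ by a new vertex in convex position, and make the resulting $(h+2)$-gon regular, preserving the cyclic order of the vertices (this is unique up to scaling and rotation). Represent $-\alpha_i$ by the collection of segments joining the points corresponding to $x$ and $s_ix$, for all $x\in o$ with $s_ix\ne x$; a segment with an endpoint at the origin is labeled by its origin point. Let $L'_\varepsilon$ be the line through the origin perpendicular to the segments representing the $-\alpha_i$ with $s_i\in S_{-\varepsilon}$; the reflection in $L'_\varepsilon$ preserves the unlabeled diagrams of these $-\alpha_i$. Let $\tau_\varepsilon$ act on segments by the reflection in $L'_\varepsilon$ on polygon vertices and by $c_\varepsilon$ on labels of origin points, except that a segment having an endpoint at the origin and perpendicular to $L'_\varepsilon$ is fixed. There is a unique assignment of a collection of segments (its *diagram*) to each almost positive root that has the given values on the negative simple roots and commutes with $\tau_+$ and $\tau_-$. The *gray zone* is the union of the two acute wedges bounded by the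 two lines through the origin perpendicular to $L'_+$ and to $L'_-$. Two segments *cross* if their relative interiors meet; a union of two segments *crosses the gray zone* if it contains nonzero points on both sides of it, where the nonzero boundary points of the gray zone are counted as belonging to the adjacent side. **Compatibility criterion.** In all of these types, two distinct almost positive roots, represented by collections $C_1$ and $C_2$ of segments, are compatible if and only if both of the following conditions hold: 1. No segment in $C_1$ crosses any segment in $C_2$, unless the two segments coincide (as unlabeled segments in $P$). 2. If two segments, one from $C_1$ and one from $C_2$, involve the same origin point, then either both segments are contained in a common line or the union of the two segments does not cross the gray zone. **Correspondence in type $D_n$** ($n\ge4$). Number the simple roots so that $s_1,\dots,s_{n-1}$ form a path and $s_n$ is joined to $s_{n-2}$ only, let $s_1\in S_+$, and let $o$ be the orbit of a nonzero vector orthogonal to $\alpha_2,\dots,\alpha_n$ (in the usual coordinates, up to scaling, $o=\{\pm e_1,\dots,\pm e_n\}$). *Fomin–Zelevinsky's model* lives in a regular $2n$-gon with vertices numbered cyclically modulo $2n$. Let $d_1=\{-1,1\}$, $d_2=\{1,-2\}$, $d_3=\{-2,2\}$, $d_4=\{2,-3\},\dots$ be the diagonals of the snake. For $i\le n-2$ the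 root $-\alpha_i$ is represented by $d_i$ and its antipode; $-\alpha_{n-1}$ by the dashed diameter $d_{n-1}$; and $-\alpha_n$ by the gray diameter $d_{n-1}$. The representation is extended (uniquely) to all almost positive roots so that $\tau_-$ and $\tau_+$ act as the reflections of the polygon fixing $d_1$ and $d_2$ respectively, where moreover $\tau_{(-1)^n}$ changes the color of all diameters and $\tau_{(-1)^{n-1}}$ fixes it. Two distinct almost positive roots are compatible iff their figures are: two colored diameters are compatible iff they have the same color or the same location, and all other pairs of figures are compatible iff they do not cross. There are exactly two origin points. Calling either side of the gray zone the left one, color the origin points red and blue so that the diagram of $-\alpha_{n-1}$ has a red segment to the left of the gray zone and a blue segment to the right. Then the diagram of $-\alpha_n$ has a blue segment to the left and a red segment to the right. Moreover $h+2=2n$, and the $2n$-gon of the model can be placed on the regular $(h+2)$-gon so that the diagram of every almost positive root is obtained from its figure in the model by keeping uncolored diagonals, and by replacing a dashed diameter by its two halves, labeled red on the left and blue on the right, and a gray diameter by its two halves, labeled blue on the left and red on the right. -/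

import Mathlib

open scoped InnerProductSpace

noncomputable section

namespace CoxeterDiagram

/-- The Coxeter matrix of type `D n`: nodes `0, …, n - 2` form a path and node `n - 1` is joined to
node `n - 3`.  (`CoxeterMatrix.D` is not used, because it also joins node `n - 1` to node `n - 2`.) -/
def matrixD (n : ℕ) : CoxeterMatrix (Fin n) where
  M := Matrix.of fun i j : Fin n ↦
    if i = j then 1
    else if ((i : ℕ) + 1 = j ∧ (j : ℕ) + 1 < n) ∨ ((j : ℕ) + 1 = i ∧ (i : ℕ) + 1 < n) ∨
        ((i : ℕ) + 3 = n ∧ (j : ℕ) + 1 = n) ∨ ((j : ℕ) + 3 = n ∧ (i : ℕ) + 1 = n) then 3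
    else 2
  isSymm := by unfold Matrix.IsSymm; aesop
  diagonal := by simp
  off_diagonal := by aesop

/-- The types `A n` (`n ≥ 2`), `B n` (`n ≥ 2`), `D n` (`n ≥ 4`), `I₂(m)` (`m ≥ 3`) and `H₃`.
`CoxeterMatrix.I m` is the type `I₂(m + 2)`. -/
inductive IsListedType : ∀ {n : ℕ}, CoxeterMatrix (Fin n) → Prop
  | typeA (n : ℕ) (hn : 2 ≤ n) : IsListedType (CoxeterMatrix.A n)
  | typeB (n : ℕ) (hn : 2 ≤ n) : IsListedType (CoxeterMatrix.B n)
  | typeD (n : ℕ) (hn : 4 ≤ n) : IsListedType (matrixD n)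
  | typeI (m : ℕ) (hm : 1 ≤ m) : IsListedType (CoxeterMatrix.I m)
  | typeH : IsListedType CoxeterMatrix.H₃

section RootSystems

variable {n : ℕ} {V : Type*} [NormedAddCommGroup V] [InnerProductSpace ℝ V]

/-- The orthogonal reflection in the hyperplane orthogonal to `v`. -/
def refl (v : V) : V ≃ₗᵢ[ℝ] V := (ℝ ∙ v)ᗮ.reflection

/-- `Φ` is a finite reduced root system in `V` (not necessarily crystallographic) and the basis `α`
of `V` is a simple system (base) for it. -/
structure IsRootSystemWithBase (Φ : Set V) (α : Module.Basis (Fin n) ℝ V) : Prop where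
  finite : Φ.Finite
  zero_notMem : (0 : V) ∉ Φ
  refl_mem : ∀ β ∈ Φ, ∀ γ ∈ Φ, refl β γ ∈ Φ
  reduced : ∀ β ∈ Φ, ∀ t : ℝ, t • β ∈ Φ → t = 1 ∨ t = -1
  simple_mem : ∀ i, α i ∈ Φ
  pos_or_neg : ∀ β ∈ Φ, (∀ i, 0 ≤ α.repr β i) ∨ (∀ i, α.repr β i ≤ 0)

variable (α : Module.Basis (Fin n) ℝ V) (σ : Fin n → Bool)

/-- The reflection group `W` generated by the simple reflections. -/
def weylGroup : Subgroup (V ≃ₗᵢ[ℝ] V) := Subgroup.closure (Set.range fun i => refl (α i))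

/-- `W` has Coxeter matrix `M`: the product `s_i s_j` has order `M i j`. -/
def HasCoxeterMatrix (M : CoxeterMatrix (Fin n)) : Prop :=
  ∀ i j, orderOf (refl (α i) * refl (α j)) = M i j

/-- The `W`-orbit of `x`. -/
def orbitOf (x : V) : Set V := {y | ∃ w ∈ weylGroup α, y = w x}

/-- `o` is a nontrivial `W`-orbit of the smallest possible cardinality. -/
def IsSmallestOrbit (o : Set V) : Prop :=
  ∃ x : V, x ≠ 0 ∧ o = orbitOf α x ∧ ∀ y : V, y ≠ 0 → o.encard ≤ (orbitOf α y).encard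

/-- `σ` is a bipartition `S = S₊ ∪ S₋` of the Coxeter diagram; `σ i = true` means `s_i ∈ S₊`
and `σ i = false` means `s_i ∈ S₋`. -/
def IsBipartition (M : CoxeterMatrix (Fin n)) (σ : Fin n → Bool) : Prop :=
  ∀ i j, 3 ≤ M i j → σ i ≠ σ j

/-- `c_ε`, the product of the (commuting) simple reflections in `S_ε`. -/
def cSign (ε : Bool) : V ≃ₗᵢ[ℝ] V :=
  (((List.finRange n).filter fun i => σ i = ε).map fun i => refl (α i)).prod

/-- The bipartite Coxeter element `c = c₋ c₊`. -/
def coxElt : V ≃ₗᵢ[ℝ] V := cSign α σ false * cSign α σ true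

/-- The Coxeter number `h`, the order of `c`. -/
def coxNum : ℕ := orderOf (coxElt α σ)

/-- The Coxeter plane `P`: the subspace on which the Coxeter element acts as a rotation
through the angle `2π/h`, i.e. on which `c + c⁻¹ = 2 cos (2π/h)`. -/
def coxPlane : Submodule ℝ V where
  carrier := {v | coxElt α σ v + (coxElt α σ)⁻¹ v =
    (2 * Real.cos (2 * Real.pi / coxNum α σ)) • v}
  add_mem' := by
    intro a b ha hb
    simp only [Set.mem_ofPred_eq, map_add, smul_add] at *
    rw [← ha, ← hb]; abel
  zero_mem' := by simp
  smul_mem' := by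
    intro t a ha
    simp only [Set.mem_ofPred_eq, map_smul] at *
    rw [← smul_add, ha, smul_comm]

/-- The almost positive roots: the positive roots and the negatives of the simple roots. -/
def almostPos (Φ : Set V) : Set V :=
  {β | β ∈ Φ ∧ ∀ i, 0 ≤ α.repr β i} ∪ Set.range fun i => -α i

open Classical in
/-- The involution `τ_ε` of the set of almost positive roots. -/
def tau (ε : Bool) (β : V) : V :=
  if ∃ i, σ i ≠ ε ∧ β = -α i then β else cSign α σ ε β

/-- `R` is a compatibility relation on the almost positive roots: it is invariant under
`⟨τ₊, τ₋⟩`, and `-α_i` is related to `β` if and only if `α_i` has coefficient `0` in `β`. -/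
structure IsCompatibility (Φ : Set V) (R : almostPos α Φ → almostPos α Φ → Prop) : Prop where
  invariant : ∀ (ε : Bool) (β γ β' γ' : almostPos α Φ),
    (β' : V) = tau α σ ε β → (γ' : V) = tau α σ ε γ → (R β γ ↔ R β' γ')
  negSimple : ∀ (i : Fin n) (β γ : almostPos α Φ),
    (β : V) = -α i → (R β γ ↔ α.repr (γ : V) i = 0)

end RootSystems

/-- A point of a diagram: a vertex of the `(h + 2)`-gon in the plane, or one of the points at the
origin, labeled by the element of the orbit that projects to the origin. -/
inductive DiagramPoint (V : Type*)
  | vertex (z : ℂ) : DiagramPoint V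
  | origin (x : V) : DiagramPoint V

/-- The position in the plane of a point of a diagram. -/
def DiagramPoint.pos {V : Type*} : DiagramPoint V → ℂ
  | .vertex z => z
  | .origin _ => 0

/-- A diagram: a collection of segments, each given by its unordered pair of labeled endpoints. -/
abbrev Diagram (V : Type*) := Set (Sym2 (DiagramPoint V))

/-- The data entering the construction of the diagrams: the simple roots, the bipartition, the
orbit, an isometric identification `f` of the Coxeter plane with `ℂ`, and a complex number `z`
that fixes the global scaling and rotation of the regular `(h + 2)`-gon. -/
structure Setup (n : ℕ) (V : Type*) [NormedAddCommGroup V] [InnerProductSpace ℝ V] where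
  α : Module.Basis (Fin n) ℝ V
  σ : Fin n → Bool
  o : Set V
  f : coxPlane α σ ≃ₗᵢ[ℝ] ℂ
  z : ℂ

namespace Setup

variable {n : ℕ} {V : Type*} [NormedAddCommGroup V] [InnerProductSpace ℝ V]
  [FiniteDimensional ℝ V] (X : Setup n V)

/-- The orthogonal projection to the Coxeter plane, followed by the identification with `ℂ`. -/
def proj (x : V) : ℂ := X.f ((coxPlane X.α X.σ).orthogonalProjectionOnto x)

/-- The vertices of the projected orbit other than the origin (an `h`-gon). -/
def hgon : Set ℂ := {a | ∃ x ∈ X.o, X.proj x = a ∧ a ≠ 0}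

/-- The line `L_ε` in the Coxeter plane: the intersection of `P` with the reflecting hyperplanes
of the simple reflections in `S_ε`. -/
def lineL (ε : Bool) : Set ℂ :=
  {l | ∃ x : V, x ∈ coxPlane X.α X.σ ∧ (∀ i, X.σ i = ε → ⟪x, X.α i⟫_ℝ = 0) ∧ X.proj x = l}

/-- `a b` is a distinguished edge of the `h`-gon: an edge perpendicular to `L₊` or `L₋`.
As `c` rotates the `h`-gon through `2π/h`, its edges are those joining the projections of `x`
and `c x`. -/
def IsDistinguishedEdge (a b : ℂ) : Prop :=
  (∃ x ∈ X.o, a = X.proj x ∧ b = X.proj (coxElt X.α X.σ x) ∧ a ≠ 0) ∧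
    ∃ ε, ∀ l ∈ X.lineL ε, ⟪b - a, l⟫_ℝ = 0

/-- The `h`-gon with each distinguished edge subdivided by a new vertex, placed on the circumscribed
circle over the midpoint of the edge. -/
def expandedPolygon : Set ℂ :=
  X.hgon ∪ {d | ∃ a b, X.IsDistinguishedEdge a b ∧ d = ((‖a‖ / ‖a + b‖ : ℝ) : ℂ) * (a + b)}

/-- The vertices of the regular `(h + 2)`-gon, in counterclockwise order. -/
def polygonVertex (k : ℕ) : ℂ :=
  X.z * Complex.exp (2 * Real.pi * Complex.I * k / ((coxNum X.α X.σ + 2 : ℕ) : ℂ))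

/-- The map making the expanded polygon regular: a vertex `a` is sent to the vertex of the
regular `(h + 2)`-gon having the same position in the counterclockwise order. -/
def regularize (a : ℂ) : ℂ :=
  X.polygonVertex {b ∈ X.expandedPolygon | b.arg < a.arg}.ncard

open Classical in
/-- The inclusion of the projected orbit in the points of the new diagram. -/
def place (x : V) : DiagramPoint V :=
  if X.proj x = 0 then .origin x else .vertex (X.regularize (X.proj x))

/-- The diagram representing `-α_i`: the segments connecting `x` and `s_i x` for all `x` in the
orbit that are not fixed by `s_i`. -/
def negSimpleDiagram (i : Fin n) : Diagram V :=
  {e | ∃ x ∈ X.o, refl (X.α i) x ≠ x ∧ e = s(X.place x, X.place (refl (X.α i) x))}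

/-- The line `L'_ε`, the line through the origin perpendicular to the segments in the diagrams of
the `-α_i` with `s_i ∈ S_{-ε}`. -/
def axis (ε : Bool) : Submodule ℝ ℂ :=
  (Submodule.span ℝ {d | ∃ i A B, X.σ i ≠ ε ∧ s(A, B) ∈ X.negSimpleDiagram i ∧
    d = A.pos - B.pos})ᗮ

/-- `L'_ε` is a line, and reflection in it preserves the (unlabeled) diagrams of the `-α_i` with
`s_i ∈ S_{-ε}`. -/
def AxisSpec (ε : Bool) : Prop :=
  Module.finrank ℝ (X.axis ε) = 1 ∧
    ∀ i, X.σ i ≠ ε →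
      Sym2.map (X.axis ε).reflection '' (Sym2.map DiagramPoint.pos '' X.negSimpleDiagram i) =
        Sym2.map DiagramPoint.pos '' X.negSimpleDiagram i

/-- The action of `τ_ε` on points: the reflection in `L'_ε` on vertices, and `c_ε` on labels of
origin points. -/
def tauPoint (ε : Bool) : DiagramPoint V → DiagramPoint V
  | .vertex z => .vertex ((X.axis ε).reflection z)
  | .origin x => .origin (cSign X.α X.σ ε x)

open Classical in
/-- The action of `τ_ε` on segments: endpointwise, except that a segment with an endpoint at the
origin that is perpendicular to `L'_ε` is fixed. -/
def tauSegment (ε : Bool) (e : Sym2 (DiagramPoint V)) : Sym2 (DiagramPoint V) :=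
  if ∃ x z, e = s(.origin x, .vertex z) ∧ z ∈ (X.axis ε)ᗮ then e
  else Sym2.map (X.tauPoint ε) e

/-- `D` assigns to each almost positive root its diagram: it has the prescribed values on the
negative simple roots, and is equivariant for the actions of `τ₊` and `τ₋`. -/
structure IsDiagramAssignment (Φ : Set V) (D : almostPos X.α Φ → Diagram V) : Prop where
  negSimple : ∀ (i : Fin n) (β : almostPos X.α Φ), (β : V) = -X.α i → D β = X.negSimpleDiagram i
  equivariant : ∀ (ε : Bool) (β γ : almostPos X.α Φ), (γ : V) = tau X.α X.σ ε β →
    D γ = X.tauSegment ε '' D β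

/-- `u` and `v` span `L'₊` and `L'₋` and make an acute angle. -/
def AreAxisVectors (u v : ℂ) : Prop := u ∈ X.axis true ∧ v ∈ X.axis false ∧ 0 < ⟪u, v⟫_ℝ

end Setup

/-- Two segments cross if their relative interiors meet. -/
def Crosses (a b c d : ℂ) : Prop := (openSegment ℝ a b ∩ openSegment ℝ c d).Nonempty

/-- The gray zone, if `u`, `v` span `L'₊`, `L'₋` and make an acute angle: the double wedge that
is bounded by the lines `uᗮ` and `vᗮ` perpendicular to `L'₊` and `L'₋`, and is acute. -/
def grayZone (u v : ℂ) : Set ℂ := {z | ⟪z, u⟫_ℝ * ⟪z, v⟫_ℝ ≤ 0}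

/-- One of the two (closed) sides of the gray zone; the other one is `graySide (-u) (-v)`.
Points on the boundary of the gray zone, other than the origin, belong to a side. -/
def graySide (u v : ℂ) : Set ℂ := {z | z ≠ 0 ∧ 0 ≤ ⟪z, u⟫_ℝ ∧ 0 ≤ ⟪z, v⟫_ℝ}

/-- The two sides are the connected components of the complement of the gray zone, with boundary
points other than the origin added. -/
theorem compl_grayZone (u v : ℂ) :
    (grayZone u v)ᶜ = (graySide u v \ grayZone u v) ∪ (graySide (-u) (-v) \ grayZone u v) := by
  ext z
  simp only [grayZone, graySide, Set.mem_compl_iff, Set.mem_ofPred_eq, not_le, Set.mem_union,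
    Set.mem_sdiff, inner_neg_right, Left.nonneg_neg_iff]
  constructor
  · intro h
    have hz : z ≠ 0 := by rintro rfl; simp at h
    rcases pos_and_pos_or_neg_and_neg_of_mul_pos h with ⟨h1, h2⟩ | ⟨h1, h2⟩
    · exact Or.inl ⟨⟨hz, h1.le, h2.le⟩, h⟩
    · exact Or.inr ⟨⟨hz, h1.le, h2.le⟩, h⟩
  · rintro (h | h) <;> exact h.2

namespace Setup

variable {n : ℕ} {V : Type*} [NormedAddCommGroup V] [InnerProductSpace ℝ V]
  [FiniteDimensional ℝ V] (X : Setup n V)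

/-- A set (the union of two segments) crosses the gray zone if it has points on both sides. -/
def CrossesGrayZone (T : Set ℂ) : Prop :=
  ∃ u v, X.AreAxisVectors u v ∧ (T ∩ graySide u v).Nonempty ∧ (T ∩ graySide (-u) (-v)).Nonempty

/-- First condition: no segment in `C₁` crosses any segment in `C₂`, unless the two segments
coincide as unlabeled segments. -/
def NoCrossing (C₁ C₂ : Diagram V) : Prop :=
  ∀ A B A' B', s(A, B) ∈ C₁ → s(A', B') ∈ C₂ → Crosses A.pos B.pos A'.pos B'.pos →
    s(A.pos, B.pos) = s(A'.pos, B'.pos)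

/-- Second condition: if a segment in `C₁` and a segment in `C₂` involve the same origin point,
then they are contained in a common line or their union does not cross the gray zone. -/
def OriginCondition (C₁ C₂ : Diagram V) : Prop :=
  ∀ x A B, s(.origin x, A) ∈ C₁ → s(.origin x, B) ∈ C₂ →
    Collinear ℝ {0, A.pos, B.pos} ∨
      ¬ X.CrossesGrayZone (segment ℝ 0 A.pos ∪ segment ℝ 0 B.pos)

end Setup

/-! ### The colored-diameter model in type `D n` -/

/-- The two colors of diameters. -/
inductive DiamColor
  | gray
  | dashed

/-- The other color. -/
def DiamColor.swap : DiamColor → DiamColor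
  | .gray => .dashed
  | .dashed => .gray

/-- A figure in a polygon with vertices indexed by `ZMod m`: a set of diagonals,
with a color if it consists of a diameter. -/
@[ext] structure Figure (m : ℕ) where
  chords : Set (Sym2 (ZMod m))
  color : Option DiamColor

/-- The vertices `-1, 1, -2, 2, -3, …` of the snake, in order. -/
def snakeVertex (m k : ℕ) : ZMod m :=
  if Even k then -((k / 2 + 1 : ℕ) : ZMod m) else ((k / 2 + 1 : ℕ) : ZMod m)

/-- The `i`-th diagonal of the snake. -/
def snakeChord (m i : ℕ) : Sym2 (ZMod m) := s(snakeVertex m i, snakeVertex m (i + 1))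

/-- The figure of `-α_i` (nodes indexed from `0`) in the `2n`-gon: for the first `n - 2` nodes, a
centrally symmetric pair of diagonals of the snake; for the last two, the diameter of the snake,
dashed for node `n - 2` and gray for node `n - 1`. -/
def snakeFigure (n i : ℕ) : Figure (2 * n) :=
  if i + 2 < n then
    ⟨{snakeChord (2 * n) i, Sym2.map (fun k => k + (n : ZMod (2 * n))) (snakeChord (2 * n) i)},
      none⟩
  else ⟨{snakeChord (2 * n) (n - 2)}, some (if i + 2 = n then .dashed else .gray)⟩

/-- The symmetry of the `2n`-gon by which `τ_ε` acts: for `τ₋` the reflection fixing the first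
diagonal `{-1, 1}` of the snake, and for `τ₊` the one fixing the second diagonal `{1, -2}`. -/
def polygonRefl (m : ℕ) (ε : Bool) (k : ZMod m) : ZMod m := if ε then -1 - k else -k

open Classical in
/-- The action of `τ_ε` on figures: geometric on diagonals; `τ_{(-1)^n}` changes the colors of the
diameters and `τ_{(-1)^(n-1)}` fixes them. -/
def tauFigure (n : ℕ) (ε : Bool) (F : Figure (2 * n)) : Figure (2 * n) where
  chords := Sym2.map (polygonRefl (2 * n) ε) '' F.chords
  color := if (ε = true ↔ Even n) then F.color.map DiamColor.swap else F.color

/-- Two chords of a regular `m`-gon cross. -/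
def ChordsCross {m : ℕ} (a b c d : ZMod m) : Prop :=
  let p : ZMod m → ℂ := fun k => Complex.exp (2 * Real.pi * Complex.I * k.val / m)
  Crosses (p a) (p b) (p c) (p d)

/-- Compatibility of two different figures in the model: two colored diameters are compatible if
they have the same color or the same location; in all other cases, figures are compatible
if they do not cross. -/
def FigureCompatible {m : ℕ} (F G : Figure m) : Prop :=
  if F.color.isSome ∧ G.color.isSome then F.color = G.color ∨ F.chords = G.chords
  else ∀ a b c d, s(a, b) ∈ F.chords → s(c, d) ∈ G.chords → ¬ ChordsCross a b c d

namespace Setup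

variable {n : ℕ} {V : Type*} [NormedAddCommGroup V] [InnerProductSpace ℝ V]
  [FiniteDimensional ℝ V] (X : Setup n V)

/-- `F` assigns to each almost positive root of type `D n` its figure in the model. -/
structure IsModelAssignment (Φ : Set V) (F : almostPos X.α Φ → Figure (2 * n)) : Prop where
  negSimple : ∀ (i : Fin n) (β : almostPos X.α Φ), (β : V) = -X.α i → F β = snakeFigure n i
  equivariant : ∀ (ε : Bool) (β γ : almostPos X.α Φ), (γ : V) = tau X.α X.σ ε β →
    F γ = tauFigure n ε (F β)

/-- The pair of half-diameters that replaces the full diameters in `chords`: origin point `x` is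
joined to the endpoint in `left`, and origin point `y` to the endpoint in `right`. -/
def halfDiameters (pt : ZMod (2 * n) → ℂ) (left right : Set ℂ) (x y : V)
    (chords : Set (Sym2 (ZMod (2 * n)))) : Diagram V :=
  {e | ∃ a b, s(a, b) ∈ chords ∧ pt a ∈ left ∧ pt b ∈ right ∧
    (e = s(.origin x, .vertex (pt a)) ∨ e = s(.origin y, .vertex (pt b)))}

/-- The diagram corresponding to a figure, where `pt` gives the positions of the vertices of the
polygon: diagonals are kept, a dashed diameter becomes a pair of half-diameters with the red one on
the left, and a gray diameter a pair of half-diameters with the blue one on the left. -/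
def figureDiagram (pt : ZMod (2 * n) → ℂ) (left right : Set ℂ) (red blue : V)
    (F : Figure (2 * n)) : Diagram V :=
  match F.color with
  | none => Sym2.map (fun k => DiagramPoint.vertex (pt k)) '' F.chords
  | some .dashed => halfDiameters pt left right red blue F.chords
  | some .gray => halfDiameters pt left right blue red F.chords

/-- The diagrams `D` correspond to the figures `F`.  For either choice of which side of the gray
zone is the left one, the two origin points of the orbit can be colored red and blue so that the
diagram of `-α_{n-1}` (node `n - 2`) has a red segment on the left and a blue one on the right, and
the diagram of `-α_n` (node `n - 1`) a blue one on the left and a red one on the right; and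
the `2n`-gon of the model can be placed on the regular `(h + 2)`-gon so that the diagram of
every almost positive root is the one corresponding to its figure. -/
def Corresponds (Φ : Set V) (D : almostPos X.α Φ → Diagram V)
    (F : almostPos X.α Φ → Figure (2 * n)) : Prop :=
  coxNum X.α X.σ + 2 = 2 * n ∧
  ∀ u v, X.AreAxisVectors u v → ∃ red blue : V,
    red ≠ blue ∧ {x ∈ X.o | X.proj x = 0} = {red, blue} ∧
    (∀ i : Fin n, (i : ℕ) + 2 = n →
      (∃ p ∈ graySide (-u) (-v), s(.origin red, .vertex p) ∈ X.negSimpleDiagram i) ∧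
      (∃ p ∈ graySide u v, s(.origin blue, .vertex p) ∈ X.negSimpleDiagram i)) ∧
    (∀ i : Fin n, (i : ℕ) + 1 = n →
      (∃ p ∈ graySide (-u) (-v), s(.origin blue, .vertex p) ∈ X.negSimpleDiagram i) ∧
      (∃ p ∈ graySide u v, s(.origin red, .vertex p) ∈ X.negSimpleDiagram i)) ∧
    ∃ g : ℂ ≃ₗᵢ[ℝ] ℂ, g '' Set.range X.polygonVertex = Set.range X.polygonVertex ∧
      ∀ β, D β = figureDiagram (fun k => g (X.polygonVertex k.val))
        (graySide (-u) (-v)) (graySide u v) red blue (F β)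

end Setup

end CoxeterDiagram

end

/-!
# Diagrams of almost positive roots

The proof replaces roots by combinatorial figures. Number the vertices of a polygon in the order of
a snake, so that the diagonals `d_p = {p, p + 1}` form the snake and the reflections `τ_ε` act by
swapping neighbors `q`, `q + 1` of a fixed parity (`swp`). Give a diagonal `F` the coordinates
`d_p(F) ∈ {-1, 0, 1}`, the signed numbers of its crossings with `d_p` (`dch`). These coordinates
transform under `τ_ε` as the coordinates of an almost positive root of type `A` do, and a diagonal
crosses `d_p` iff `d_p(F) > 0`. Thus the diagonals model type `A` (`baseA`), with compatibility
given by noncrossing; diagonals together with diameters in two colors model type `D` in the same way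
(`baseD`).

The other types are folded (`Folding`): the nodes of a simply laced diagram are mapped to those of
the given diagram, with positive weights for which adjacency is preserved in the weighted sense. The
path folds onto `B n` and, with weights `sin (p π / m)`, onto `I₂(m)`; the diagram of type `D₆`
folds onto `H₃` with weights `1` and the golden ratio. Adding up the weighted coordinates of a
figure over the fibers gives a vector that is a positive multiple of an almost positive root, and
all of them are obtained in this way. So an almost positive root becomes a class of figures
(`RootModel`), and two roots are compatible iff all figures in their classes are. Uniqueness of all
assignments comes from the fact that every almost positive root is reached from some `-α i` by the
`τ_ε`, since otherwise `c` would fix a sum of positive roots (`tau_induction`).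

To compare figures with segments, follow the orbit of a fundamental weight along the same snake. Its
consecutive elements differ by multiples of vectors `κ 1, κ 2, …` with nonnegative coordinates that
satisfy the recursion `κ (p + 1) + κ (p - 1) = 𝒜 κ p` and return to zero at `p = h` (`ZigZag`).
They are explicit in types `A` and `D` (`zigD`) and are folded otherwise. Hence `h`
is the order of `c`, the vector `∑ sin (π p / h) κ p` is a Perron–Frobenius eigenvector whose two
sign parts span the Coxeter plane, and the orbit consists of `h` elements in a single cycle of `c`
and, in type `D` and for `H₃`, of two more elements projected to the origin (`ZigZag.Orbit`). The
projections are the vertices of the regular `h`-gon in the order of the snake, and after the two new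
vertices are inserted the element number `p` lies at the vertex number `p` of the `(h + 2)`-gon
(`Setup.exists_place_y`); the two new vertices are the ends of the snake. Since the simple
reflection `s_i` exchanges the ends of exactly the steps of the snake lying over `i`, the diagram of
`-α i` consists of the diagonals `d_p` over `i`, which is the class of figures of `-α i`. As figures
and segments are moved by `τ_ε` in the same way, the diagram of every almost positive root is the
union of the segments of its figures. The criterion then reduces to the comparison of two figures,
that is, to crossings of chords of a regular polygon (`crosses_snakePt_iff`) and to the sides of the
gray zone on which halves of diameters lie (`segsD_iff`).

That an orbit of smallest size is the orbit of such a fundamental weight follows from counting: an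
orbit with at most as many elements has a single nontrivial cycle of `c`, so that one of its
elements is fixed by some `c_ε`, and at most one simple reflection moves each of the first elements
of its snake (`IsLeaf`, `IsTame`). This leaves only nodes from which another folding starts.
-/

open scoped Real

noncomputable section

namespace CoxeterDiagram

variable {n : ℕ} {V : Type*} [NormedAddCommGroup V] [InnerProductSpace ℝ V]

/-! ### Reflections, root systems and the involutions `τ` -/

section Roots

theorem refl_apply (v x : V) : refl v x = x - (2 * ⟪v, x⟫_ℝ / ⟪v, v⟫_ℝ) • v := by
  unfold refl
  rw [Submodule.reflection_orthogonal_apply, Submodule.reflection_singleton_apply,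
    real_inner_self_eq_norm_sq, two_smul]
  simp only [RCLike.ofReal_real_eq_id, id]
  rw [mul_div_assoc, two_mul, add_smul]
  abel

theorem refl_refl (v x : V) : refl v (refl v x) = x := by
  unfold refl; exact Submodule.reflection_reflection _ x

theorem refl_inv (v : V) : (refl v)⁻¹ = refl v := by
  rw [inv_eq_iff_mul_eq_one]
  ext x
  exact refl_refl v x

/-- The simple roots rescaled to squared length `2`. -/
def nroot (α : Module.Basis (Fin n) ℝ V) (i : Fin n) : V := (√2 / ‖α i‖) • α i

variable (α : Module.Basis (Fin n) ℝ V) (σ : Fin n → Bool)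

theorem nroot_scale_pos (i : Fin n) : 0 < √2 / ‖α i‖ :=
  div_pos (by positivity) (norm_pos_iff.2 (α.ne_zero i))

theorem nroot_self (i : Fin n) : ⟪nroot α i, nroot α i⟫_ℝ = 2 := by
  have h : ‖α i‖ ≠ 0 := norm_ne_zero_iff.2 (α.ne_zero i)
  unfold nroot
  rw [real_inner_smul_left, real_inner_smul_right, real_inner_self_eq_norm_sq]
  field_simp
  simp

theorem nroot_ne_zero (i : Fin n) : nroot α i ≠ 0 := by
  intro h
  have := nroot_self α i
  simp [h] at this

theorem eq_smul_nroot (i : Fin n) : α i = (‖α i‖ / √2) • nroot α i := by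
  have h : ‖α i‖ ≠ 0 := norm_ne_zero_iff.2 (α.ne_zero i)
  unfold nroot
  rw [smul_smul]
  have : ‖α i‖ / √2 * (√2 / ‖α i‖) = 1 := by field_simp
  rw [this, one_smul]

theorem refl_simple (i : Fin n) (x : V) :
    refl (α i) x = x - ⟪nroot α i, x⟫_ℝ • nroot α i := by
  have h : ‖α i‖ ≠ 0 := norm_ne_zero_iff.2 (α.ne_zero i)
  rw [refl_apply]
  unfold nroot
  rw [real_inner_smul_left, real_inner_self_eq_norm_sq, smul_smul]
  congr 2
  field_simp
  simp [mul_comm]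

theorem refl_simple_eq_self_iff (i : Fin n) (x : V) :
    refl (α i) x = x ↔ ⟪nroot α i, x⟫_ℝ = 0 := by
  rw [refl_simple, sub_eq_self, smul_eq_zero]
  simp [nroot_ne_zero]

theorem inner_simple_eq_zero_iff (i : Fin n) (x : V) :
    ⟪x, α i⟫_ℝ = 0 ↔ ⟪nroot α i, x⟫_ℝ = 0 := by
  unfold nroot
  rw [real_inner_smul_left, real_inner_comm]
  simp [(nroot_scale_pos α i).ne']

theorem repr_nroot (i j : Fin n) :
    α.repr (nroot α i) j = if j = i then √2 / ‖α i‖ else 0 := by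
  unfold nroot
  rw [map_smul, Module.Basis.repr_self, Finsupp.smul_apply, Finsupp.single_apply]
  by_cases h : i = j
  · subst h; simp
  · have : ¬ j = i := fun h' => h h'.symm
    simp [h, this]

theorem repr_sum_nroot (d : Fin n → ℝ) (j : Fin n) :
    α.repr (∑ i, d i • nroot α i) j = d j * (√2 / ‖α j‖) := by
  rw [map_sum, Finsupp.finsetSum_apply]
  simp only [map_smul, Finsupp.smul_apply, repr_nroot, smul_eq_mul, mul_ite, mul_zero]
  simp

theorem eq_zero_of_inner_nroot {v : V} (h : ∀ i, ⟪nroot α i, v⟫_ℝ = 0) : v = 0 := by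
  have h2 : ∀ w : V, ⟪w, v⟫_ℝ = 0 := by
    intro w
    rw [← α.sum_repr w, sum_inner]
    refine Finset.sum_eq_zero fun i _ => ?_
    rw [real_inner_smul_left, real_inner_comm, (inner_simple_eq_zero_iff α i v).2 (h i), mul_zero]
  exact inner_self_eq_zero.1 (h2 v)

theorem refl_mem_weylGroup (i : Fin n) : refl (α i) ∈ weylGroup α :=
  Subgroup.subset_closure ⟨i, rfl⟩

theorem cSign_mem_weylGroup (ε : Bool) : cSign α σ ε ∈ weylGroup α := by
  unfold cSign
  refine Subgroup.list_prod_mem _ ?_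
  intro x hx
  obtain ⟨i, -, rfl⟩ := List.mem_map.1 hx
  exact refl_mem_weylGroup α i

theorem orbitOf_closed {x y : V} (hy : y ∈ orbitOf α x) {w : V ≃ₗᵢ[ℝ] V} (hw : w ∈ weylGroup α) :
    w y ∈ orbitOf α x := by
  obtain ⟨w', hw', rfl⟩ := hy
  exact ⟨w * w', mul_mem hw hw', rfl⟩

theorem self_mem_orbitOf (x : V) : x ∈ orbitOf α x := ⟨1, one_mem _, rfl⟩

theorem orbitOf_eq_of_mem {x y : V} (hy : y ∈ orbitOf α x) : orbitOf α x = orbitOf α y := by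
  obtain ⟨w, hw, rfl⟩ := hy
  ext z
  constructor
  · rintro ⟨u, hu, rfl⟩
    refine ⟨u * w⁻¹, mul_mem hu (inv_mem hw), ?_⟩
    change u x = u (w⁻¹ (w x))
    rw [show w⁻¹ (w x) = (w⁻¹ * w) x from rfl, inv_mul_cancel]; rfl
  · rintro ⟨u, hu, rfl⟩
    exact ⟨u * w, mul_mem hu hw, rfl⟩

/-- A set containing `x` and stable under the simple reflections contains the orbit of `x`. -/
theorem orbitOf_subset {x : V} {S : Set V} (hx : x ∈ S) (hS : ∀ i, ∀ y ∈ S, refl (α i) y ∈ S) :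
    orbitOf α x ⊆ S := by
  have key : ∀ w ∈ weylGroup α, ∀ y ∈ S, w y ∈ S := by
    intro w hw
    unfold weylGroup at hw
    induction hw using Subgroup.closure_induction'' with
    | mem w hw => obtain ⟨i, rfl⟩ := hw; exact hS i
    | inv_mem w hw => obtain ⟨i, rfl⟩ := hw; rw [refl_inv]; exact hS i
    | one => exact fun y hy => hy
    | mul a b _ _ ha hb => exact fun y hy => ha _ (hb _ hy)
  rintro _ ⟨w, hw, rfl⟩
  exact key w hw x hx

/-- The product of the reflections in pairwise orthogonal vectors of squared length `2`. -/
theorem list_prod_refl_apply (l : List (Fin n)) (hl : l.Nodup)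
    (ho : ∀ i ∈ l, ∀ j ∈ l, i ≠ j → ⟪nroot α i, nroot α j⟫_ℝ = 0) (x : V) :
    (l.map fun i => refl (α i)).prod x = x - ∑ i ∈ l.toFinset, ⟪nroot α i, x⟫_ℝ • nroot α i := by
  induction l with
  | nil => simp
  | cons a l ih =>
    rw [List.nodup_cons] at hl
    have ih' := ih hl.2 (fun i hi j hj => ho i (by simp [hi]) j (by simp [hj]))
    rw [List.map_cons, List.prod_cons, List.toFinset_cons, Finset.sum_insert (by simpa using hl.1)]
    change refl (α a) ((l.map fun i => refl (α i)).prod x) = _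
    rw [ih', refl_simple, inner_sub_right, inner_sum]
    rw [Finset.sum_eq_zero (s := l.toFinset) (f := fun i => ⟪nroot α a, ⟪nroot α i, x⟫_ℝ • nroot α i⟫_ℝ)]
    · rw [sub_zero]; abel
    · intro i hi
      have hi' : i ∈ l := by simpa using hi
      rw [real_inner_smul_right, ho a (by simp) i (by simp [hi']), mul_zero]
      rintro rfl; exact hl.1 hi'

/-- Simple reflections of the same sign commute: the simple roots in them are orthogonal. -/
def SignOrtho : Prop := ∀ i j, i ≠ j → σ i = σ j → ⟪nroot α i, nroot α j⟫_ℝ = 0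

variable {α σ}

theorem cSign_apply (h : SignOrtho α σ) (ε : Bool) (x : V) :
    cSign α σ ε x = x - ∑ i with σ i = ε, ⟪nroot α i, x⟫_ℝ • nroot α i := by
  unfold cSign
  rw [list_prod_refl_apply]
  · congr 2
    ext i; simp
  · exact (List.nodup_finRange n).filter _
  · intro i hi j hj hij
    simp only [List.mem_filter, List.mem_finRange, true_and, decide_eq_true_eq] at hi hj
    exact h i j hij (hi.trans hj.symm)

theorem inner_nroot_sum (h : SignOrtho α σ) (ε : Bool) (d : Fin n → ℝ) (j : Fin n) (hj : σ j = ε) :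
    ⟪nroot α j, ∑ i with σ i = ε, d i • nroot α i⟫_ℝ = 2 * d j := by
  rw [inner_sum, Finset.sum_eq_single j]
  · rw [real_inner_smul_right, nroot_self, mul_comm]
  · intro i hi hij
    rw [real_inner_smul_right, h j i hij.symm (by simp at hi; rw [hi, hj]), mul_zero]
  · intro h; simp [hj] at h

theorem inner_cSign_same (h : SignOrtho α σ) (ε : Bool) (x : V) (j : Fin n) (hj : σ j = ε) :
    ⟪nroot α j, cSign α σ ε x⟫_ℝ = -⟪nroot α j, x⟫_ℝ := by
  rw [cSign_apply h, inner_sub_right, inner_nroot_sum h ε _ j hj]; ring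

theorem cSign_cSign (h : SignOrtho α σ) (ε : Bool) (x : V) :
    cSign α σ ε (cSign α σ ε x) = x := by
  rw [cSign_apply h ε (cSign α σ ε x)]
  rw [Finset.sum_congr rfl (g := fun i => -(⟪nroot α i, x⟫_ℝ • nroot α i))]
  · rw [Finset.sum_neg_distrib, sub_neg_eq_add, cSign_apply h]; abel
  · intro i hi
    simp only [Finset.mem_filter, Finset.mem_univ, true_and] at hi
    rw [inner_cSign_same h ε x i hi, neg_smul]

theorem cSign_inv (h : SignOrtho α σ) (ε : Bool) : (cSign α σ ε)⁻¹ = cSign α σ ε := by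
  rw [inv_eq_iff_mul_eq_one]
  ext x
  exact cSign_cSign h ε x

theorem cSign_eq_self_iff (h : SignOrtho α σ) (ε : Bool) (x : V) :
    cSign α σ ε x = x ↔ ∀ i, σ i = ε → ⟪nroot α i, x⟫_ℝ = 0 := by
  constructor
  · intro hx i hi
    have := inner_cSign_same h ε x i hi
    rw [hx] at this; linarith
  · intro hx
    rw [cSign_apply h, Finset.sum_eq_zero, sub_zero]
    intro i hi
    rw [hx i (by simpa using hi), zero_smul]

theorem repr_sum_filter (ε : Bool) (d : Fin n → ℝ) (j : Fin n) :
    α.repr (∑ i with σ i = ε, d i • nroot α i) j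
      = if σ j = ε then d j * (√2 / ‖α j‖) else 0 := by
  rw [Finset.sum_filter]
  have : (∑ i, if σ i = ε then d i • nroot α i else 0)
      = ∑ i, (if σ i = ε then d i else 0) • nroot α i := by
    refine Finset.sum_congr rfl fun i _ => ?_
    split_ifs <;> simp
  rw [this, repr_sum_nroot]
  split_ifs <;> simp

theorem repr_cSign_ne (h : SignOrtho α σ) (ε : Bool) (x : V) (j : Fin n) (hj : σ j ≠ ε) :
    α.repr (cSign α σ ε x) j = α.repr x j := by
  rw [cSign_apply h, map_sub, Finsupp.sub_apply, repr_sum_filter, if_neg hj, sub_zero]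

/-- The Coxeter element has no nonzero fixed vector. -/
theorem eq_zero_of_cSign_eq (h : SignOrtho α σ) {x : V}
    (hx : cSign α σ true x = cSign α σ false x) : x = 0 := by
  rw [cSign_apply h, cSign_apply h, sub_right_inj] at hx
  refine eq_zero_of_inner_nroot α fun i => ?_
  have h1 := congrArg (fun v => α.repr v i) hx
  simp only [repr_sum_filter] at h1
  have hp := (nroot_scale_pos α i).ne'
  cases hi : σ i <;> simp only [hi, if_true, if_false, Bool.false_eq_true, Bool.true_eq_false] at h1
  · rw [eq_comm, mul_eq_zero] at h1; exact h1.resolve_right hp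
  · rw [mul_eq_zero] at h1; exact h1.resolve_right hp

theorem cSign_simple (h : SignOrtho α σ) (ε : Bool) (i : Fin n) (hi : σ i = ε) :
    cSign α σ ε (α i) = -α i := by
  have hs : cSign α σ ε (nroot α i) = -nroot α i := by
    rw [cSign_apply h, Finset.sum_eq_single i]
    · rw [nroot_self, two_smul]; abel
    · intro j hj hji
      rw [h j i hji (by simp at hj; rw [hj, hi]), zero_smul]
    · intro h'; simp [hi] at h'
  rw [eq_smul_nroot α i, map_smul, hs, smul_neg]

variable {Φ : Set V}

theorem weylGroup_root (hΦ : IsRootSystemWithBase Φ α) {w : V ≃ₗᵢ[ℝ] V} (hw : w ∈ weylGroup α)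
    {β : V} (hβ : β ∈ Φ) : w β ∈ Φ :=
  orbitOf_subset α hβ (fun i y hy => hΦ.refl_mem _ (hΦ.simple_mem i) y hy) ⟨w, hw, rfl⟩

/-- A positive root with all its coefficients on one sign class is simple. -/
theorem root_eq_simple (hΦ : IsRootSystemWithBase Φ α) (h : SignOrtho α σ) (ε : Bool) {β : V}
    (hβ : β ∈ Φ) (hpos : ∀ i, 0 ≤ α.repr β i) (hz : ∀ i, σ i ≠ ε → α.repr β i = 0) :
    ∃ i, σ i = ε ∧ β = α i := by
  have hne : β ≠ 0 := fun h0 => hΦ.zero_notMem (h0 ▸ hβ)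
  obtain ⟨i, hi⟩ : ∃ i, α.repr β i ≠ 0 := by
    by_contra hc
    push Not at hc
    exact hne (α.repr.map_eq_zero_iff.1 (Finsupp.ext hc))
  have hσ : σ i = ε := by by_contra hc; exact hi (hz i hc)
  have hipos : 0 < α.repr β i := lt_of_le_of_ne (hpos i) (Ne.symm hi)
  have hb : β = ∑ k with σ k = ε, (α.repr β k * (‖α k‖ / √2)) • nroot α k := by
    conv_lhs => rw [← α.sum_repr β]
    rw [Finset.sum_filter]
    refine Finset.sum_congr rfl fun k _ => ?_
    split_ifs with hk
    · conv_lhs => rw [eq_smul_nroot α k, smul_smul]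
    · rw [hz k hk, zero_smul]
  have hn : ‖α i‖ ≠ 0 := norm_ne_zero_iff.2 (α.ne_zero i)
  -- reflecting in `α i` changes only the sign of the coefficient of `α i`
  have hr : ∀ k, α.repr (refl (α i) β) k = if k = i then -α.repr β i else α.repr β k := by
    intro k
    rw [refl_simple]
    have : ⟪nroot α i, β⟫_ℝ = 2 * (α.repr β i * (‖α i‖ / √2)) := by
      conv_lhs => rw [hb]
      exact inner_nroot_sum h ε _ i hσ
    rw [this, map_sub, map_smul, Finsupp.sub_apply, Finsupp.smul_apply, repr_nroot]
    split_ifs with hk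
    · subst hk; simp only [smul_eq_mul]; field_simp; ring
    · simp
  have hmem := hΦ.refl_mem _ (hΦ.simple_mem i) β hβ
  have hzero : ∀ k, k ≠ i → α.repr β k = 0 := by
    intro k hk
    rcases hΦ.pos_or_neg _ hmem with h1 | h1
    · have := h1 i; rw [hr, if_pos rfl] at this; linarith
    · have := h1 k; rw [hr, if_neg hk] at this; exact le_antisymm this (hpos k)
  have hβi : β = α.repr β i • α i := by
    conv_lhs => rw [← α.sum_repr β]
    rw [Finset.sum_eq_single i]
    · intro k _ hk; rw [hzero k hk, zero_smul]
    · simp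
  refine ⟨i, hσ, ?_⟩
  rcases hΦ.reduced _ (hΦ.simple_mem i) (α.repr β i) (hβi ▸ hβ) with h1 | h1
  · rw [h1, one_smul] at hβi; exact hβi
  · rw [h1] at hipos; norm_num at hipos

theorem neg_simple_mem (i : Fin n) : -α i ∈ almostPos α Φ := Or.inr ⟨i, rfl⟩

theorem repr_neg_simple (i j : Fin n) : α.repr (-α i) j = if j = i then -1 else 0 := by
  rw [map_neg, Module.Basis.repr_self, Finsupp.neg_apply, Finsupp.single_apply]
  by_cases h : i = j
  · subst h; simp
  · have : ¬ j = i := fun h' => h h'.symm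
    simp [h, this]

/-- An almost positive root with a negative coefficient is a negative simple root. -/
theorem almostPos_neg {β : V} (hβ : β ∈ almostPos α Φ) {i : Fin n} (hi : α.repr β i < 0) :
    β = -α i := by
  rcases hβ with ⟨-, h⟩ | ⟨j, rfl⟩
  · exact absurd (h i) (not_le.2 hi)
  · simp only [repr_neg_simple] at hi
    split_ifs at hi with hij
    · rw [hij]
    · exact absurd hi (lt_irrefl _)

theorem tau_fixed {ε : Bool} {i : Fin n} (hi : σ i ≠ ε) : tau α σ ε (-α i) = -α i := by
  unfold tau
  rw [if_pos ⟨i, hi, rfl⟩]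

theorem tau_eq_cSign {ε : Bool} {β : V} (h : ∀ i, σ i ≠ ε → β ≠ -α i) :
    tau α σ ε β = cSign α σ ε β := by
  unfold tau
  rw [if_neg]
  rintro ⟨i, hi, rfl⟩
  exact h i hi rfl

theorem tau_mem (hΦ : IsRootSystemWithBase Φ α) (h : SignOrtho α σ) (ε : Bool) {β : V}
    (hβ : β ∈ almostPos α Φ) : tau α σ ε β ∈ almostPos α Φ := by
  by_cases hf : ∃ i, σ i ≠ ε ∧ β = -α i
  · obtain ⟨i, hi, rfl⟩ := hf
    rw [tau_fixed hi]; exact hβ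
  push Not at hf
  rw [tau_eq_cSign hf]
  rcases hβ with ⟨hβ, hpos⟩ | ⟨i, rfl⟩
  · have hc := weylGroup_root hΦ (cSign_mem_weylGroup α σ ε) hβ
    by_cases hz : ∀ i, σ i ≠ ε → α.repr β i = 0
    · obtain ⟨i, hi, rfl⟩ := root_eq_simple hΦ h ε hβ hpos hz
      rw [cSign_simple h ε i hi]
      exact neg_simple_mem i
    · push Not at hz
      obtain ⟨i, hi, hne⟩ := hz
      refine Or.inl ⟨hc, ?_⟩
      rcases hΦ.pos_or_neg _ hc with h1 | h1
      · exact h1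
      · have := h1 i
        rw [repr_cSign_ne h ε β i hi] at this
        exact absurd (le_antisymm this (hpos i)) hne
  · have hi : σ i = ε := by by_contra hc; exact hf i hc rfl
    change cSign α σ ε (-α i) ∈ _
    rw [map_neg, cSign_simple h ε i hi, neg_neg]
    refine Or.inl ⟨hΦ.simple_mem i, fun j => ?_⟩
    rw [Module.Basis.repr_self, Finsupp.single_apply]
    split_ifs <;> norm_num

theorem tau_tau (h : SignOrtho α σ) (ε : Bool) {β : V}
    (hβ : β ∈ almostPos α Φ) : tau α σ ε (tau α σ ε β) = β := by
  by_cases hf : ∃ i, σ i ≠ ε ∧ β = -α i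
  · obtain ⟨i, hi, rfl⟩ := hf
    rw [tau_fixed hi, tau_fixed hi]
  push Not at hf
  rw [tau_eq_cSign hf, tau_eq_cSign, cSign_cSign h]
  intro i hi hc
  have h1 := repr_cSign_ne h ε β i hi
  rw [hc, repr_neg_simple, if_pos rfl] at h1
  exact hf i hi (almostPos_neg hβ (by rw [← h1]; norm_num))

/-- Every almost positive root is obtained from a negative simple root by the involutions `τ`:
otherwise its orbit under the Coxeter element would consist of positive roots, whose sum is a
nonzero vector fixed by the Coxeter element. -/
theorem tau_induction (hΦ : IsRootSystemWithBase Φ α) (h : SignOrtho α σ) {p : V → Prop}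
    (h0 : ∀ i, p (-α i)) (h1 : ∀ ε, ∀ β ∈ almostPos α Φ, p β → p (tau α σ ε β)) :
    ∀ β ∈ almostPos α Φ, p β := by
  by_contra hc
  push Not at hc
  obtain ⟨β, hβ, hpβ⟩ := hc
  let Bad : Set V := {γ | γ ∈ almostPos α Φ ∧ ¬ p γ}
  have hpos : ∀ γ ∈ Bad, γ ∈ Φ ∧ ∀ i, 0 ≤ α.repr γ i := by
    rintro γ ⟨hγ, hp⟩
    rcases hγ with h | ⟨i, rfl⟩
    · exact h
    · exact absurd (h0 i) hp
  have hstep : ∀ ε, ∀ γ ∈ Bad, cSign α σ ε γ ∈ Bad := by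
    rintro ε γ ⟨hγ, hp⟩
    have hne : ∀ i, σ i ≠ ε → γ ≠ -α i := by
      rintro i - rfl; exact hp (h0 i)
    rw [← tau_eq_cSign hne]
    refine ⟨tau_mem hΦ h ε hγ, fun hq => hp ?_⟩
    have := h1 ε _ (tau_mem hΦ h ε hγ) hq
    rwa [tau_tau h ε hγ] at this
  have hfin : Bad.Finite := hΦ.finite.subset fun γ hγ => (hpos γ hγ).1
  have hcstep : ∀ γ ∈ Bad, coxElt α σ γ ∈ Bad := fun γ hγ => hstep _ _ (hstep _ _ hγ)
  have hS : ∑ γ ∈ hfin.toFinset, γ = 0 := by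
    have hfix : coxElt α σ (∑ γ ∈ hfin.toFinset, γ) = ∑ γ ∈ hfin.toFinset, γ := by
      rw [map_sum]
      refine Finset.sum_bij (fun γ _ => coxElt α σ γ) ?_ ?_ ?_ ?_
      · intro γ hγ; simpa using hcstep γ (by simpa using hγ)
      · intro a _ b _ hab; exact (coxElt α σ).injective hab
      · intro γ hγ
        have hγ' : γ ∈ Bad := by simpa using hγ
        refine ⟨cSign α σ true (cSign α σ false γ), ?_, ?_⟩
        · simpa using hstep true _ (hstep false _ hγ')
        · change cSign α σ false (cSign α σ true (cSign α σ true (cSign α σ false γ))) = γ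
          rw [cSign_cSign h, cSign_cSign h]
      · intro a _; rfl
    apply eq_zero_of_cSign_eq h
    conv_rhs => rw [← hfix]
    change _ = cSign α σ false (cSign α σ false (cSign α σ true _))
    rw [cSign_cSign h]
  have hβB : β ∈ Bad := ⟨hβ, hpβ⟩
  have hzero : ∀ i, α.repr β i = 0 := by
    intro i
    have h2 := congrArg (fun v => α.repr v i) hS
    simp only [map_sum, Finsupp.finsetSum_apply, map_zero, Finsupp.coe_zero, Pi.zero_apply] at h2
    rw [Finset.sum_eq_zero_iff_of_nonneg] at h2
    · exact h2 β (by simpa using hβB)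
    · intro γ hγ; exact (hpos γ (by simpa using hγ)).2 i
  exact hΦ.zero_notMem ((α.repr.map_eq_zero_iff.1 (Finsupp.ext hzero)) ▸ (hpos β hβB).1)

end Roots

/-! ### The Gram matrix of the simple roots -/

section Gram

variable {α : Module.Basis (Fin n) ℝ V} {Φ : Set V}

/-- The coordinates of a linear combination of two normalized simple roots. -/
theorem repr_pair {i j : Fin n} (hij : i ≠ j) (x y : ℝ) :
    α.repr (x • nroot α i + y • nroot α j) i = x * (√2 / ‖α i‖) ∧
    α.repr (x • nroot α i + y • nroot α j) j = y * (√2 / ‖α j‖) := by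
  simp [repr_nroot, hij, hij.symm]

theorem refl_pair_left {i j : Fin n} {g : ℝ} (hg : ⟪nroot α i, nroot α j⟫_ℝ = -g) (x y : ℝ) :
    refl (α i) (x • nroot α i + y • nroot α j)
      = (g * y - x) • nroot α i + y • nroot α j := by
  rw [refl_simple, inner_add_right, real_inner_smul_right, real_inner_smul_right, nroot_self, hg]
  module

theorem refl_pair_right {i j : Fin n} {g : ℝ} (hg : ⟪nroot α i, nroot α j⟫_ℝ = -g) (x y : ℝ) :
    refl (α j) (x • nroot α i + y • nroot α j)
      = x • nroot α i + (g * x - y) • nroot α j := by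
  rw [refl_simple, inner_add_right, real_inner_smul_right, real_inner_smul_right, nroot_self,
    real_inner_comm, hg]
  module

/-- The vectors obtained from two simple roots at the angle `π - ψ` by alternating reflections. -/
def dihedralVec (α : Module.Basis (Fin n) ℝ V) (i j : Fin n) (ψ : ℝ) (q : ℕ) : V :=
  (Real.sin ((q + 1) * ψ) / Real.sin ψ) • nroot α i + (Real.sin (q * ψ) / Real.sin ψ) • nroot α j

theorem refl_refl_dihedralVec {i j : Fin n} {ψ : ℝ}
    (hg : ⟪nroot α i, nroot α j⟫_ℝ = -(2 * Real.cos ψ)) (q : ℕ) :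
    (refl (α i) * refl (α j)) (dihedralVec α i j ψ q) = dihedralVec α i j ψ (q + 2) := by
  change refl (α i) (refl (α j) _) = _
  unfold dihedralVec
  rw [refl_pair_right hg, refl_pair_left hg]
  have h2 : Real.sin (((q + 2 : ℕ) : ℝ) * ψ)
      = 2 * Real.cos ψ * Real.sin ((q + 1) * ψ) - Real.sin (q * ψ) := by
    have e1 : ((q + 2 : ℕ) : ℝ) * ψ = (q + 1) * ψ + ψ := by push_cast; ring
    have e2 : (q : ℝ) * ψ = (q + 1) * ψ - ψ := by ring
    rw [e1, e2, Real.sin_add, Real.sin_sub]; ring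
  have h3 : Real.sin ((((q + 2 : ℕ) : ℝ) + 1) * ψ)
      = 2 * Real.cos ψ * Real.sin (((q + 2 : ℕ) : ℝ) * ψ) - Real.sin ((q + 1) * ψ) := by
    have e1 : (((q + 2 : ℕ) : ℝ) + 1) * ψ = ((q + 2 : ℕ) : ℝ) * ψ + ψ := by push_cast; ring
    have e2 : ((q : ℝ) + 1) * ψ = ((q + 2 : ℕ) : ℝ) * ψ - ψ := by push_cast; ring
    rw [e1, e2, Real.sin_add, Real.sin_sub]; ring
  rw [h3, h2]
  congr 2 <;> ring

theorem pow_dihedralVec {i j : Fin n} {ψ : ℝ}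
    (hg : ⟪nroot α i, nroot α j⟫_ℝ = -(2 * Real.cos ψ)) (k q : ℕ) :
    ((refl (α i) * refl (α j)) ^ k) (dihedralVec α i j ψ q) = dihedralVec α i j ψ (q + 2 * k) := by
  induction k with
  | zero => simp
  | succ k ih =>
    rw [pow_succ']
    change (refl (α i) * refl (α j)) (((refl (α i) * refl (α j)) ^ k) _) = _
    rw [ih, refl_refl_dihedralVec hg]
    congr 1

/-- In a root system with base, the simple reflections `s_i`, `s_j` generate a dihedral group
whose order determines the angle between the simple roots. -/
theorem inner_nroot_of_orderOf (hΦ : IsRootSystemWithBase Φ α) {i j : Fin n} (hij : i ≠ j) {m : ℕ}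
    (ho : orderOf (refl (α i) * refl (α j)) = m) :
    ⟪nroot α i, nroot α j⟫_ℝ = -(2 * Real.cos (π / m)) := by
  set ψ := Real.arccos (-⟪nroot α i, nroot α j⟫_ℝ / 2) with hψ
  have hpi := Real.pi_pos
  -- directions of roots
  let Ψ : Set V := {v | ∃ r : ℝ, 0 < r ∧ r • v ∈ Φ}
  have hΨs : ∀ k v, v ∈ Ψ → refl (α k) v ∈ Ψ := by
    rintro k v ⟨r, hr, hv⟩
    refine ⟨r, hr, ?_⟩
    rw [← map_smul]; exact hΦ.refl_mem _ (hΦ.simple_mem k) _ hv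
  have hΨa : ∀ k, nroot α k ∈ Ψ := by
    intro k
    refine ⟨‖α k‖ / √2, div_pos (norm_pos_iff.2 (α.ne_zero k)) (by positivity), ?_⟩
    rw [← eq_smul_nroot]; exact hΦ.simple_mem k
  have hΨsign : ∀ x y : ℝ, x • nroot α i + y • nroot α j ∈ Ψ → 0 < y → 0 ≤ x := by
    rintro x y ⟨r, hr, hv⟩ hy
    obtain ⟨e1, e2⟩ := repr_pair (α := α) hij (r * x) (r * y)
    rw [mul_smul, mul_smul, ← smul_add] at e1 e2
    have hi := nroot_scale_pos α i
    have hj := nroot_scale_pos α j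
    rcases hΦ.pos_or_neg _ hv with h | h
    · have h1 := h i
      rw [e1] at h1
      by_contra hc
      push Not at hc
      have : r * x * (√2 / ‖α i‖) < 0 := mul_neg_of_neg_of_pos (mul_neg_of_pos_of_neg hr hc) hi
      linarith
    · have h1 := h j
      rw [e2] at h1
      have : 0 < r * y * (√2 / ‖α j‖) := by positivity
      linarith
  -- the angle between simple roots is obtuse, and smaller than `π`
  have hg0 : ⟪nroot α i, nroot α j⟫_ℝ ≤ 0 := by
    have h1 := hΨs i _ (hΨa j)
    have h2 := refl_pair_left (α := α) (i := i) (j := j) (g := -⟪nroot α i, nroot α j⟫_ℝ)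
      (by ring) 0 1
    rw [zero_smul, one_smul, zero_add] at h2
    rw [h2] at h1
    have h3 := hΨsign (-⟪nroot α i, nroot α j⟫_ℝ * 1 - 0) 1 (by rw [one_smul]; exact h1) one_pos
    linarith
  have hni : ‖nroot α i‖ ^ 2 = 2 := by rw [← real_inner_self_eq_norm_sq, nroot_self]
  have hnj : ‖nroot α j‖ ^ 2 = 2 := by rw [← real_inner_self_eq_norm_sq, nroot_self]
  have hg2 : -2 < ⟪nroot α i, nroot α j⟫_ℝ := by
    by_contra hc
    push Not at hc
    have h1 : ‖nroot α i + nroot α j‖ ^ 2 ≤ 0 := by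
      rw [norm_add_sq_real, hni, hnj]; linarith
    have h2 : nroot α i + nroot α j = 0 := by
      have := sq_nonneg ‖nroot α i + nroot α j‖
      exact norm_eq_zero.1 (pow_eq_zero_iff two_ne_zero |>.1 (le_antisymm h1 this))
    have h3 := (repr_pair (α := α) hij 1 1).1
    rw [one_smul, one_smul, h2] at h3
    have := nroot_scale_pos α i
    simp only [map_zero, Finsupp.coe_zero, Pi.zero_apply, one_mul] at h3
    linarith
  have hcos : Real.cos ψ = -⟪nroot α i, nroot α j⟫_ℝ / 2 :=
    Real.cos_arccos (by linarith) (by linarith)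
  have hg : ⟪nroot α i, nroot α j⟫_ℝ = -(2 * Real.cos ψ) := by rw [hcos]; ring
  have hψ0 : 0 < ψ := by rw [hψ, Real.arccos_pos]; linarith
  have hψ2 : ψ ≤ π / 2 := by rw [hψ, Real.arccos_le_pi_div_two]; linarith
  have hs : 0 < Real.sin ψ := Real.sin_pos_of_pos_of_lt_pi hψ0 (by linarith)
  have hai : dihedralVec α i j ψ 0 = nroot α i := by
    unfold dihedralVec; simp [hs.ne']
  have hroot : ∀ q, dihedralVec α i j ψ q ∈ Ψ := by
    have h1 : dihedralVec α i j ψ 1 = refl (α i) (nroot α j) := by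
      have h2 := refl_pair_left (α := α) (i := i) (j := j) hg 0 1
      rw [zero_smul, one_smul, zero_add] at h2
      rw [h2]
      unfold dihedralVec
      have : ((1 : ℕ) + 1 : ℝ) * ψ = 2 * ψ := by push_cast; ring
      rw [this, Real.sin_two_mul, Nat.cast_one, one_mul, div_self hs.ne', one_smul]
      congr 2
      field_simp
      ring
    have hstep : ∀ q, dihedralVec α i j ψ q ∈ Ψ → dihedralVec α i j ψ (q + 2) ∈ Ψ := by
      intro q hq
      rw [← refl_refl_dihedralVec hg]
      exact hΨs i _ (hΨs j _ hq)
    intro q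
    induction q using Nat.twoStepInduction with
    | zero => rw [hai]; exact hΨa i
    | one => rw [h1]; exact hΨs _ _ (hΨa j)
    | more q ih _ => exact hstep q ih
  -- `(q + 1) ψ = π` for the last `q` with `q ψ < π`, since root coefficients have one sign
  obtain ⟨r, hr1, hrψ⟩ : ∃ r : ℕ, 1 ≤ r ∧ (r : ℝ) * ψ = π := by
    have hex : ∃ q : ℕ, π ≤ (q : ℝ) * ψ := by
      obtain ⟨q, hq⟩ := exists_nat_ge (π / ψ)
      exact ⟨q, by rwa [div_le_iff₀ hψ0] at hq⟩
    classical
    have hspec := Nat.find_spec hex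
    have hmin := fun q => Nat.find_min hex (m := q)
    set r := Nat.find hex
    have hr0 : r ≠ 0 := by
      intro h0; rw [h0] at hspec; simp at hspec; linarith
    obtain ⟨q, hq⟩ := Nat.exists_eq_succ_of_ne_zero hr0
    refine ⟨r, Nat.one_le_iff_ne_zero.2 hr0, ?_⟩
    have hlt : (q : ℝ) * ψ < π := by
      have := hmin q (by omega); push Not at this; exact this
    have hrq : (r : ℝ) = q + 1 := by rw [hq]; push_cast; ring
    rw [hrq] at hspec ⊢
    refine le_antisymm ?_ hspec
    by_contra hc
    push Not at hc
    have hq0 : 0 < q := by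
      rcases Nat.eq_zero_or_pos q with h | h
      · rw [h] at hc; simp at hc; linarith
      · exact h
    have hq0' : (0 : ℝ) < q := by exact_mod_cast hq0
    have h1 : 0 < Real.sin (q * ψ) / Real.sin ψ :=
      div_pos (Real.sin_pos_of_pos_of_lt_pi (by positivity) hlt) hs
    have h2 : Real.sin ((q + 1) * ψ) < 0 := by
      have h3 : 0 < Real.sin ((q + 1) * ψ - π) :=
        Real.sin_pos_of_pos_of_lt_pi (by linarith) (by nlinarith)
      rw [Real.sin_sub_pi] at h3; linarith
    have h3 := hΨsign _ _ (hroot q) h1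
    have h4 : Real.sin ((q + 1) * ψ) / Real.sin ψ < 0 := div_neg_of_neg_of_pos h2 hs
    linarith
  -- hence `r` is the order of the product
  have hper : ∀ q, dihedralVec α i j ψ (q + 2 * r) = dihedralVec α i j ψ q := by
    intro q
    unfold dihedralVec
    have e1 : (((q + 2 * r : ℕ) : ℝ) + 1) * ψ = (q + 1) * ψ + 2 * π := by
      push_cast; rw [← hrψ]; ring
    have e2 : ((q + 2 * r : ℕ) : ℝ) * ψ = q * ψ + 2 * π := by
      push_cast; rw [← hrψ]; ring
    rw [e1, e2, Real.sin_add_two_pi, Real.sin_add_two_pi]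
  have hfix : ∀ q, ((refl (α i) * refl (α j)) ^ r) (dihedralVec α i j ψ q)
      = dihedralVec α i j ψ q := by
    intro q; rw [pow_dihedralVec hg, hper]
  have haj : dihedralVec α i j ψ (r - 1) = nroot α j := by
    unfold dihedralVec
    have e1 : (((r - 1 : ℕ) : ℝ) + 1) * ψ = π := by
      rw [Nat.cast_sub hr1]; push_cast; rw [← hrψ]; ring
    have e2 : ((r - 1 : ℕ) : ℝ) * ψ = π - ψ := by rw [← e1]; ring
    rw [e1, e2, Real.sin_pi, Real.sin_pi_sub, div_self hs.ne']; simp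
  have hone : (refl (α i) * refl (α j)) ^ r = 1 := by
    ext x
    let U : Submodule ℝ V := Submodule.span ℝ {nroot α i, nroot α j}
    have : FiniteDimensional ℝ U := FiniteDimensional.span_of_finite ℝ (by simp)
    obtain ⟨u, hu, w, hw, rfl⟩ := U.exists_add_mem_mem_orthogonal x
    have hw1 : ∀ k ∈ ({i, j} : Set (Fin n)), refl (α k) w = w := by
      intro k hk
      rw [refl_simple_eq_self_iff]
      refine (Submodule.mem_orthogonal _ _).1 hw _ (Submodule.subset_span ?_)
      rcases hk with rfl | hk
      · simp
      · rw [Set.mem_singleton_iff.1 hk]; simp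
    have hw2 : ∀ k : ℕ, ((refl (α i) * refl (α j)) ^ k) w = w := by
      intro k
      induction k with
      | zero => rfl
      | succ k ih =>
        rw [pow_succ']
        change refl (α i) (refl (α j) (((refl (α i) * refl (α j)) ^ k) w)) = w
        rw [ih, hw1 j (by simp), hw1 i (by simp)]
    obtain ⟨x, y, rfl⟩ := Submodule.mem_span_pair.1 hu
    rw [map_add, hw2, map_add, map_smul, map_smul]
    conv_lhs => rw [← hai, ← haj, hfix, hfix, hai, haj]
    rfl
  have hdvd : m ∣ r := ho ▸ orderOf_dvd_of_pow_eq_one hone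
  have hdvd2 : r ∣ m := by
    have h1 : dihedralVec α i j ψ (0 + 2 * m) = dihedralVec α i j ψ 0 := by
      rw [← pow_dihedralVec hg, ← ho, pow_orderOf_eq_one]; rfl
    unfold dihedralVec at h1
    have h2 : Real.sin ((2 * m : ℝ) * ψ) = 0 := by
      have := congrArg (fun v => α.repr v j) h1
      simp only [(repr_pair (α := α) hij _ _).2] at this
      simpa [hs.ne'] using mul_right_cancel₀ (nroot_scale_pos α j).ne' this
    have h5 : Real.sin ((2 * m + 1 : ℝ) * ψ) = Real.sin ψ := by
      have := congrArg (fun v => α.repr v i) h1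
      simp only [(repr_pair (α := α) hij _ _).1] at this
      simpa [div_left_inj' hs.ne'] using mul_right_cancel₀ (nroot_scale_pos α i).ne' this
    have h6 : Real.cos ((2 * m : ℝ) * ψ) = 1 := by
      rw [add_mul, one_mul, Real.sin_add, h2, zero_mul, zero_add] at h5
      exact mul_right_cancel₀ hs.ne' (by rw [h5, one_mul])
    obtain ⟨k, hk⟩ := (Real.cos_eq_one_iff _).1 h6
    have h7 : (m : ℝ) = k * r := by
      have h8 : (2 : ℝ) * ψ ≠ 0 := by positivity
      apply mul_right_cancel₀ h8
      calc (m : ℝ) * (2 * ψ) = 2 * m * ψ := by ring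
        _ = k * (2 * π) := hk.symm
        _ = _ := by rw [← hrψ]; ring
    have h8 : (m : ℤ) = k * r := by exact_mod_cast h7
    exact Int.natCast_dvd_natCast.1 ⟨k, by rw [h8]; ring⟩
  have hr0 : (r : ℝ) ≠ 0 := by positivity
  rw [hg, Nat.dvd_antisymm hdvd hdvd2, ← hrψ]
  congr 3
  field_simp

/-- The normalized simple roots have the Gram matrix prescribed by the Coxeter matrix `M`. -/
def HasGram (α : Module.Basis (Fin n) ℝ V) (M : CoxeterMatrix (Fin n)) : Prop :=
  ∀ i j, i ≠ j → ⟪nroot α i, nroot α j⟫_ℝ = -(2 * Real.cos (π / M i j))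

theorem hasGram (hΦ : IsRootSystemWithBase Φ α) {M : CoxeterMatrix (Fin n)}
    (h : HasCoxeterMatrix α M) : HasGram α M :=
  fun i j hij => inner_nroot_of_orderOf hΦ hij (h i j)

end Gram

/-! ### Figure models of the almost positive roots -/

section Models

/-- A combinatorial model of the almost positive roots.  The type `𝓕` consists of figures, and an
almost positive root is represented by a class of figures under the equivalence relation `Eqv`.
The coordinates `dv F` (in the normalized simple roots) of a figure `F` determine the root
represented by `F` up to a positive factor. -/
structure RootModel (α : Module.Basis (Fin n) ℝ V) (σ : Fin n → Bool) (𝓕 : Type*) where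
  /-- the action of `τ_ε` on figures -/
  T : Bool → 𝓕 → 𝓕
  T_T : ∀ ε F, T ε (T ε F) = F
  /-- the coordinates of a figure -/
  dv : 𝓕 → Fin n → ℝ
  /-- figures representing the same root -/
  Eqv : 𝓕 → 𝓕 → Prop
  eqv : Equivalence Eqv
  eqv_T : ∀ ε F G, Eqv F G → Eqv (T ε F) (T ε G)
  /-- a figure representing `-α i` -/
  b : Fin n → 𝓕
  eqv_b : ∀ F i, Eqv F (b i) → ∃ s : ℝ, 0 < s ∧ ∀ j, dv F j = if j = i then -s else 0
  neg_b : ∀ F i, dv F i < 0 → Eqv F (b i)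
  T_b : ∀ ε i, σ i ≠ ε → Eqv (T ε (b i)) (b i)
  rec_ne : ∀ ε F, (∀ i, σ i ≠ ε → ¬ Eqv F (b i)) → ∀ j, σ j ≠ ε → dv (T ε F) j = dv F j
  rec_eq : ∀ ε F, (∀ i, σ i ≠ ε → ¬ Eqv F (b i)) → ∀ j, σ j = ε →
    dv (T ε F) j = dv F j - ∑ k, ⟪nroot α j, nroot α k⟫_ℝ * dv F k

namespace RootModel

variable {α : Module.Basis (Fin n) ℝ V} {σ : Fin n → Bool} {𝓕 : Type*} (𝓜 : RootModel α σ 𝓕)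
  {Φ : Set V}

/-- The vector with the coordinates of a figure. -/
def vec (F : 𝓕) : V := ∑ i, 𝓜.dv F i • nroot α i

/-- The figure `F` represents `β`. -/
def Rel (β : V) (F : 𝓕) : Prop := ∃ s : ℝ, 0 < s ∧ 𝓜.vec F = s • β

theorem repr_vec (F : 𝓕) (i : Fin n) :
    α.repr (𝓜.vec F) i = 𝓜.dv F i * (√2 / ‖α i‖) := repr_sum_nroot α _ i

theorem Rel.repr_pos_iff {𝓜 : RootModel α σ 𝓕} {β : V} {F : 𝓕} (h : 𝓜.Rel β F) (i : Fin n) :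
    (α.repr β i < 0 ↔ 𝓜.dv F i < 0) ∧ (α.repr β i = 0 ↔ 𝓜.dv F i = 0) := by
  obtain ⟨s, hs, hv⟩ := h
  have h1 := 𝓜.repr_vec F i
  have hp := nroot_scale_pos α i
  rw [hv, map_smul, Finsupp.smul_apply, smul_eq_mul] at h1
  constructor
  · constructor <;> intro hh <;> by_contra hc <;> push Not at hc
    · linarith [mul_nonneg hc hp.le, mul_neg_of_pos_of_neg hs hh]
    · linarith [mul_nonneg hs.le hc, mul_neg_of_neg_of_pos hh hp]
  · constructor <;> intro hh <;> rw [hh] at h1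
    · rw [mul_zero, eq_comm, mul_eq_zero] at h1; exact h1.resolve_right hp.ne'
    · rw [zero_mul, mul_eq_zero] at h1; exact h1.resolve_left hs.ne'

theorem vec_T (h : SignOrtho α σ) {ε : Bool} {F : 𝓕} (hF : ∀ i, σ i ≠ ε → ¬ 𝓜.Eqv F (𝓜.b i)) :
    𝓜.vec (𝓜.T ε F) = cSign α σ ε (𝓜.vec F) := by
  refine α.repr.injective (Finsupp.ext fun j => ?_)
  rw [cSign_apply h, map_sub, Finsupp.sub_apply, repr_vec, repr_vec, repr_sum_filter]
  split_ifs with hj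
  · rw [𝓜.rec_eq ε F hF j hj]
    unfold vec
    rw [inner_sum]
    simp only [real_inner_smul_right]
    rw [Finset.sum_congr rfl fun k _ => mul_comm (𝓜.dv F k) _]
    ring
  · rw [𝓜.rec_ne ε F hF j hj, sub_zero]

theorem vec_of_eqv_b {F : 𝓕} {i : Fin n} (hF : 𝓜.Eqv F (𝓜.b i)) : 𝓜.Rel (-α i) F := by
  obtain ⟨s, hs, hd⟩ := 𝓜.eqv_b F i hF
  refine ⟨s * (√2 / ‖α i‖), mul_pos hs (nroot_scale_pos α i), ?_⟩
  unfold vec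
  rw [Finset.sum_eq_single i]
  · rw [hd, if_pos rfl, mul_smul, smul_neg, smul_neg, neg_smul]; rfl
  · intro j _ hj; rw [hd, if_neg hj, zero_smul]
  · simp

theorem rel_neg_iff {F : 𝓕} {i : Fin n} : 𝓜.Rel (-α i) F ↔ 𝓜.Eqv F (𝓜.b i) := by
  refine ⟨fun h => 𝓜.neg_b F i ?_, 𝓜.vec_of_eqv_b⟩
  rw [← (h.repr_pos_iff i).1, repr_neg_simple, if_pos rfl]
  norm_num

theorem rel_b (i : Fin n) : 𝓜.Rel (-α i) (𝓜.b i) := 𝓜.vec_of_eqv_b (𝓜.eqv.refl _)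

theorem rel_T (h : SignOrtho α σ) (ε : Bool) {β : V} (hβ : β ∈ almostPos α Φ) {F : 𝓕}
    (hF : 𝓜.Rel β F) : 𝓜.Rel (tau α σ ε β) (𝓜.T ε F) := by
  by_cases hf : ∃ i, σ i ≠ ε ∧ 𝓜.Eqv F (𝓜.b i)
  · obtain ⟨i, hi, hFi⟩ := hf
    have hb : β = -α i := by
      apply almostPos_neg hβ
      rw [(hF.repr_pos_iff i).1]
      obtain ⟨s, hs, hd⟩ := 𝓜.eqv_b F i hFi
      rw [hd, if_pos rfl]; linarith
    rw [hb, tau_fixed hi]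
    apply 𝓜.vec_of_eqv_b
    exact 𝓜.eqv.trans (𝓜.eqv_T ε _ _ hFi) (𝓜.T_b ε i hi)
  · push Not at hf
    rw [tau_eq_cSign]
    · obtain ⟨s, hs, hv⟩ := hF
      exact ⟨s, hs, by rw [𝓜.vec_T h hf, hv, map_smul]⟩
    · rintro i hi rfl
      exact hf i hi (𝓜.rel_neg_iff.1 hF)

theorem exists_rel (hΦ : IsRootSystemWithBase Φ α) (h : SignOrtho α σ) :
    ∀ β ∈ almostPos α Φ, ∃ F, 𝓜.Rel β F :=
  tau_induction hΦ h (fun i => ⟨_, 𝓜.rel_b i⟩)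
    (fun ε _ hβ ⟨F, hF⟩ => ⟨𝓜.T ε F, 𝓜.rel_T h ε hβ hF⟩)

theorem eqv_of_rel (hΦ : IsRootSystemWithBase Φ α) (h : SignOrtho α σ) :
    ∀ β ∈ almostPos α Φ, ∀ F G, 𝓜.Rel β F → 𝓜.Rel β G → 𝓜.Eqv F G := by
  refine tau_induction hΦ h ?_ ?_
  · intro i F G hF hG
    exact 𝓜.eqv.trans (𝓜.rel_neg_iff.1 hF) (𝓜.eqv.symm (𝓜.rel_neg_iff.1 hG))
  · intro ε β hβ ih F G hF hG
    have hF' := 𝓜.rel_T h ε (tau_mem hΦ h ε hβ) hF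
    have hG' := 𝓜.rel_T h ε (tau_mem hΦ h ε hβ) hG
    rw [tau_tau h ε hβ] at hF' hG'
    have := 𝓜.eqv_T ε _ _ (ih _ _ hF' hG')
    rwa [𝓜.T_T, 𝓜.T_T] at this

theorem rel_of_eqv (hΦ : IsRootSystemWithBase Φ α) (h : SignOrtho α σ) :
    ∀ β ∈ almostPos α Φ, ∀ F G, 𝓜.Rel β F → 𝓜.Eqv F G → 𝓜.Rel β G := by
  refine tau_induction hΦ h ?_ ?_
  · intro i F G hF hG
    exact 𝓜.vec_of_eqv_b (𝓜.eqv.trans (𝓜.eqv.symm hG) (𝓜.rel_neg_iff.1 hF))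
  · intro ε β hβ ih F G hF hG
    have hF' := 𝓜.rel_T h ε (tau_mem hΦ h ε hβ) hF
    rw [tau_tau h ε hβ] at hF'
    have := 𝓜.rel_T h ε hβ (ih _ _ hF' (𝓜.eqv_T ε _ _ hG))
    rwa [𝓜.T_T] at this

/-- Distinct almost positive roots are represented by inequivalent figures. -/
theorem not_eqv (hΦ : IsRootSystemWithBase Φ α) (h : SignOrtho α σ) {β γ : almostPos α Φ}
    (hne : β ≠ γ) {F G : 𝓕} (hF : 𝓜.Rel β F) (hG : 𝓜.Rel γ G) : ¬ 𝓜.Eqv F G := by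
  intro he
  have key : ∀ β ∈ almostPos α Φ, ∀ γ ∈ almostPos α Φ, ∀ F, 𝓜.Rel β F → 𝓜.Rel γ F → β = γ := by
    refine tau_induction hΦ h ?_ ?_
    · intro i γ hγ F hF hG
      refine (almostPos_neg hγ ?_).symm
      rw [(hG.repr_pos_iff i).1, ← (hF.repr_pos_iff i).1, repr_neg_simple, if_pos rfl]
      norm_num
    · intro ε β hβ ih γ hγ F hF hG
      have hF' := 𝓜.rel_T h ε (tau_mem hΦ h ε hβ) hF
      rw [tau_tau h ε hβ] at hF'
      rw [ih _ (tau_mem hΦ h ε hγ) _ hF' (𝓜.rel_T h ε hγ hG), tau_tau h ε hγ]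
  exact hne (Subtype.ext (key β β.2 γ γ.2 G (𝓜.rel_of_eqv hΦ h β β.2 F G hF he) hG))

/-- A function on figures that is invariant and equivariant descends to the almost positive
roots, and the result is determined by its values at the negative simple roots. -/
theorem existsUnique_assignment (hΦ : IsRootSystemWithBase Φ α) (h : SignOrtho α σ) {X : Type*}
    (m : 𝓕 → X) (t : Bool → X → X) (hm : ∀ F G, 𝓜.Eqv F G → m F = m G)
    (ht : ∀ ε F, m (𝓜.T ε F) = t ε (m F)) :
    ∃ D : almostPos α Φ → X,
      (∀ (β : almostPos α Φ) F, 𝓜.Rel (β : V) F → D β = m F) ∧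
      (∀ (i : Fin n) (β : almostPos α Φ), (β : V) = -α i → D β = m (𝓜.b i)) ∧
      (∀ (ε : Bool) (β γ : almostPos α Φ), (γ : V) = tau α σ ε β → D γ = t ε (D β)) ∧
      ∀ D' : almostPos α Φ → X,
        (∀ (i : Fin n) (β : almostPos α Φ), (β : V) = -α i → D' β = m (𝓜.b i)) →
        (∀ (ε : Bool) (β γ : almostPos α Φ), (γ : V) = tau α σ ε β → D' γ = t ε (D' β)) →
        D' = D := by
  choose φ hφ using 𝓜.exists_rel hΦ h
  have hD : ∀ β : almostPos α Φ, ∀ F, 𝓜.Rel (β : V) F → m (φ β β.2) = m F := fun β F hF =>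
    hm _ _ (𝓜.eqv_of_rel hΦ h β β.2 _ _ (hφ β β.2) hF)
  refine ⟨fun β => m (φ β β.2), hD, ?_, ?_, ?_⟩
  · intro i β hβ
    exact hD β _ (hβ ▸ 𝓜.rel_b i)
  · intro ε β γ hγ
    change _ = t ε (m (φ β β.2))
    rw [← ht]
    exact hD γ _ (hγ ▸ 𝓜.rel_T h ε β.2 (hφ β β.2))
  · intro D' h1 h2
    have key : ∀ β ∈ almostPos α Φ, ∀ hβ : β ∈ almostPos α Φ, D' ⟨β, hβ⟩ = m (φ β hβ) := by
      refine tau_induction hΦ h ?_ ?_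
      · intro i hβ
        rw [h1 i _ rfl]
        exact (hD ⟨-α i, hβ⟩ _ (𝓜.rel_b i)).symm
      · intro ε β hβ ih hβ'
        rw [h2 ε ⟨β, hβ⟩ _ rfl, ih hβ, ← ht]
        exact (hD ⟨_, hβ'⟩ _ (𝓜.rel_T h ε hβ (hφ β hβ))).symm
    exact funext fun β => key β β.2 β.2

/-- Compatibility is given by any invariant relation on figures with the right values at the
negative simple roots. -/
theorem compatibility (hΦ : IsRootSystemWithBase Φ α) (h : SignOrtho α σ) (FC : 𝓕 → 𝓕 → Prop)
    (hT : ∀ ε F G, FC (𝓜.T ε F) (𝓜.T ε G) ↔ FC F G)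
    (hb : ∀ i G, (∀ F' G', 𝓜.Eqv F' (𝓜.b i) → 𝓜.Eqv G' G → FC F' G') ↔ 𝓜.dv G i = 0) :
    (∃! R, IsCompatibility α σ Φ R) ∧
    ∀ R, IsCompatibility α σ Φ R → ∀ (β γ : almostPos α Φ) F G, 𝓜.Rel (β : V) F →
      𝓜.Rel (γ : V) G → (R β γ ↔ ∀ F' G', 𝓜.Eqv F' F → 𝓜.Eqv G' G → FC F' G') := by
  have hT' : ∀ ε F G, (∀ F' G', 𝓜.Eqv F' (𝓜.T ε F) → 𝓜.Eqv G' (𝓜.T ε G) → FC F' G') ↔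
      ∀ F' G', 𝓜.Eqv F' F → 𝓜.Eqv G' G → FC F' G' := by
    intro ε F G
    constructor
    · intro hc F' G' hF hG
      exact (hT ε _ _).1 (hc _ _ (𝓜.eqv_T ε _ _ hF) (𝓜.eqv_T ε _ _ hG))
    · intro hc F' G' hF hG
      rw [← hT ε]
      have h1 := 𝓜.eqv_T ε _ _ hF
      have h2 := 𝓜.eqv_T ε _ _ hG
      rw [𝓜.T_T] at h1 h2
      exact hc _ _ h1 h2
  have hmem := fun ε (β : almostPos α Φ) => tau_mem hΦ h ε β.2
  have key : ∀ R, IsCompatibility α σ Φ R → ∀ β ∈ almostPos α Φ, ∀ (hβ : β ∈ almostPos α Φ)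
      (γ : almostPos α Φ) F G, 𝓜.Rel (β : V) F → 𝓜.Rel (γ : V) G →
      (R ⟨β, hβ⟩ γ ↔ ∀ F' G', 𝓜.Eqv F' F → 𝓜.Eqv G' G → FC F' G') := by
    intro R hR
    refine tau_induction hΦ h ?_ ?_
    · intro i hβ γ F G hF hG
      rw [hR.negSimple i _ γ rfl, (hG.repr_pos_iff i).2, ← hb i G]
      have hFb := 𝓜.rel_neg_iff.1 hF
      constructor
      · intro hc F' G' hF' hG'
        exact hc F' G' (𝓜.eqv.trans hF' hFb) hG'
      · intro hc F' G' hF' hG'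
        exact hc F' G' (𝓜.eqv.trans hF' (𝓜.eqv.symm hFb)) hG'
    · intro ε β hβ ih hβ' γ F G hF hG
      have hF' := 𝓜.rel_T h ε hβ' hF
      rw [tau_tau h ε hβ] at hF'
      rw [hR.invariant ε ⟨_, hβ'⟩ γ ⟨β, hβ⟩ ⟨_, hmem ε γ⟩ (tau_tau h ε hβ).symm rfl,
        ih hβ ⟨_, hmem ε γ⟩ _ _ hF' (𝓜.rel_T h ε γ.2 hG), hT']
  refine ⟨?_, fun R hR β γ F G hF hG => key R hR β β.2 β.2 γ F G hF hG⟩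
  choose φ hφ using 𝓜.exists_rel hΦ h
  let R₀ : almostPos α Φ → almostPos α Φ → Prop := fun β γ =>
    ∀ F' G', 𝓜.Eqv F' (φ β β.2) → 𝓜.Eqv G' (φ γ γ.2) → FC F' G'
  have hR₀ : ∀ (β γ : almostPos α Φ) F G, 𝓜.Rel (β : V) F → 𝓜.Rel (γ : V) G →
      (R₀ β γ ↔ ∀ F' G', 𝓜.Eqv F' F → 𝓜.Eqv G' G → FC F' G') := by
    intro β γ F G hF hG
    have h1 := 𝓜.eqv_of_rel hΦ h β β.2 _ _ (hφ β β.2) hF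
    have h2 := 𝓜.eqv_of_rel hΦ h γ γ.2 _ _ (hφ γ γ.2) hG
    constructor
    · intro hc F' G' hF' hG'
      exact hc F' G' (𝓜.eqv.trans hF' (𝓜.eqv.symm h1)) (𝓜.eqv.trans hG' (𝓜.eqv.symm h2))
    · intro hc F' G' hF' hG'
      exact hc F' G' (𝓜.eqv.trans hF' h1) (𝓜.eqv.trans hG' h2)
  have hcomp : IsCompatibility α σ Φ R₀ := by
    constructor
    · intro ε β γ β' γ' hβ' hγ'
      rw [hR₀ β' γ' (𝓜.T ε (φ β β.2)) (𝓜.T ε (φ γ γ.2)) (hβ' ▸ 𝓜.rel_T h ε β.2 (hφ β β.2))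
        (hγ' ▸ 𝓜.rel_T h ε γ.2 (hφ γ γ.2)), hT']
    · intro i β γ hβ
      rw [hR₀ β γ (𝓜.b i) _ (hβ ▸ 𝓜.rel_b i) (hφ γ γ.2), hb,
        ((hφ γ γ.2).repr_pos_iff i).2]
  refine ⟨R₀, hcomp, fun R hR => ?_⟩
  funext β γ
  exact propext ((key R hR β β.2 β.2 γ _ _ (hφ β β.2) (hφ γ γ.2)))

end RootModel

end Models

/-! ### Folding -/

section Folding

/-- A simply laced combinatorial model that can be folded: figures `F` with integral coordinates
`D F k` indexed by the nodes `k` of a graph with adjacency matrix `adj` and bipartition `s`. -/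
structure BaseModel (K 𝓕 : Type*) [Fintype K] [DecidableEq K] where
  T : Bool → 𝓕 → 𝓕
  T_T : ∀ ε F, T ε (T ε F) = F
  D : 𝓕 → K → ℤ
  adj : K → K → ℤ
  s : K → Bool
  adj_sign : ∀ k l, adj k l ≠ 0 → s k ≠ s l
  /-- the figure represents the negative of the simple root `k` -/
  IsB : 𝓕 → K → Prop
  exists_isB : ∀ k, ∃ F, IsB F k
  D_isB : ∀ F k, IsB F k → ∀ l, D F l = if l = k then -1 else 0
  isB_of_neg : ∀ F k, D F k < 0 → IsB F k
  T_isB : ∀ ε F k, s k ≠ ε → IsB F k → IsB (T ε F) k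
  rec_ne : ∀ ε F, (∀ k, s k ≠ ε → ¬ IsB F k) → ∀ k, s k ≠ ε → D (T ε F) k = D F k
  rec_eq : ∀ ε F, (∀ k, s k ≠ ε → ¬ IsB F k) → ∀ k, s k = ε →
    D (T ε F) k = -D F k + ∑ l, adj k l * D F l
  /-- compatibility of figures -/
  FC : 𝓕 → 𝓕 → Prop
  FC_T : ∀ ε F G, FC (T ε F) (T ε G) ↔ FC F G
  FC_b : ∀ k G, (∀ F, IsB F k → FC F G) ↔ D G k = 0

/-- A folding of the graph of a base model onto the Coxeter diagram of the simple roots `α`, with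
positive weights `w`. -/
structure Folding {K 𝓕 : Type*} [Fintype K] [DecidableEq K] (B : BaseModel K 𝓕)
    (α : Module.Basis (Fin n) ℝ V) (σ : Fin n → Bool) where
  j : K → Fin n
  w : K → ℝ
  w_pos : ∀ k, 0 < w k
  j_surj : Function.Surjective j
  sign : ∀ k, σ (j k) = B.s k
  fold : ∀ i l, i ≠ j l →
    ∑ k, (if j k = i then (B.adj k l : ℝ) * w k else 0) = -⟪nroot α i, nroot α (j l)⟫_ℝ * w l

/-- A folding with an equivalence relation on figures, whose classes represent the roots. -/
structure FoldDatum {K 𝓕 : Type*} [Fintype K] [DecidableEq K] (B : BaseModel K 𝓕)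
    (α : Module.Basis (Fin n) ℝ V) (σ : Fin n → Bool) extends Folding B α σ where
  Eqv : 𝓕 → 𝓕 → Prop
  eqv : Equivalence Eqv
  eqv_T : ∀ ε F G, Eqv F G → Eqv (B.T ε F) (B.T ε G)
  eqv_isB : ∀ F k, B.IsB F k → ∀ G, Eqv G F ↔ ∃ k', j k' = j k ∧ B.IsB G k'
  eqv_zero : ∀ F G, Eqv F G → ∀ i, (∀ k, j k = i → B.D F k = 0) → ∀ k, j k = i → B.D G k = 0

namespace Folding

variable {K 𝓕 : Type*} [Fintype K] [DecidableEq K] {B : BaseModel K 𝓕}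
  {α : Module.Basis (Fin n) ℝ V} {σ : Fin n → Bool} (Q : Folding B α σ)

/-- The folded coordinates. -/
def foldVec (x : K → ℝ) (i : Fin n) : ℝ := ∑ k, if Q.j k = i then Q.w k * x k else 0

/-- Folding intertwines the adjacency operators. -/
theorem foldVec_adj (x : K → ℝ) (i : Fin n) :
    Q.foldVec (fun k => ∑ l, (B.adj k l : ℝ) * x l) i
      = 2 * Q.foldVec x i - ∑ i', ⟪nroot α i, nroot α i'⟫_ℝ * Q.foldVec x i' := by
  have h1 : ∑ i', ⟪nroot α i, nroot α i'⟫_ℝ * Q.foldVec x i'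
      = ∑ k, ⟪nroot α i, nroot α (Q.j k)⟫_ℝ * (Q.w k * x k) := by
    unfold foldVec
    simp only [Finset.mul_sum]
    rw [Finset.sum_comm]
    refine Finset.sum_congr rfl fun k _ => ?_
    simp only [mul_ite, mul_zero]
    rw [Finset.sum_ite_eq]
    simp
  have h2 : Q.foldVec (fun k => ∑ l, (B.adj k l : ℝ) * x l) i
      = ∑ l, (∑ k, (if Q.j k = i then (B.adj k l : ℝ) * Q.w k else 0)) * x l := by
    unfold foldVec
    simp only [Finset.sum_mul]
    rw [Finset.sum_comm]
    refine Finset.sum_congr rfl fun k _ => ?_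
    split_ifs with h
    · rw [Finset.mul_sum]
      refine Finset.sum_congr rfl fun l _ => ?_
      ring
    · simp
  rw [h1, h2]
  unfold foldVec
  rw [Finset.mul_sum, ← Finset.sum_sub_distrib]
  refine Finset.sum_congr rfl fun l _ => ?_
  by_cases hl : Q.j l = i
  · rw [if_pos hl, hl, nroot_self, Finset.sum_eq_zero, zero_mul, sub_self]
    intro k _
    split_ifs with hk
    · have : B.adj k l = 0 := by
        by_contra hc
        apply B.adj_sign k l hc
        rw [← Q.sign, ← Q.sign, hk, hl]
      rw [this]; simp
    · rfl
  · rw [if_neg hl, Q.fold i l (fun h => hl h.symm)]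
    ring

theorem foldVec_congr {x y : K → ℝ} {i : Fin n} (h : ∀ k, Q.j k = i → x k = y k) :
    Q.foldVec x i = Q.foldVec y i := by
  unfold foldVec
  refine Finset.sum_congr rfl fun k _ => ?_
  split_ifs with hk
  · rw [h k hk]
  · rfl

theorem foldVec_isB {F : 𝓕} {k : K} (hF : B.IsB F k) (i : Fin n) :
    Q.foldVec (fun k => (B.D F k : ℝ)) i = if i = Q.j k then -Q.w k else 0 := by
  unfold foldVec
  beta_reduce
  rw [Finset.sum_eq_single k]
  · rw [B.D_isB F k hF]
    by_cases h : Q.j k = i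
    · rw [if_pos h, if_pos h.symm]; simp
    · rw [if_neg h, if_neg (fun h' => h h'.symm)]
  · intro l _ hl
    rw [B.D_isB F k hF, if_neg hl]; simp
  · simp

theorem exists_neg {F : 𝓕} {i : Fin n} (h : Q.foldVec (fun k => (B.D F k : ℝ)) i < 0) :
    ∃ k, Q.j k = i ∧ B.IsB F k := by
  unfold foldVec at h
  obtain ⟨k, -, hk⟩ := Finset.exists_lt_of_sum_lt
    (s := Finset.univ) (f := fun k => if Q.j k = i then Q.w k * (B.D F k : ℝ) else 0)
    (g := fun _ => (0 : ℝ)) (by simpa using h)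
  split_ifs at hk with hj
  · refine ⟨k, hj, B.isB_of_neg F k ?_⟩
    have : (B.D F k : ℝ) < 0 := by
      by_contra hc
      push Not at hc
      linarith [mul_nonneg (Q.w_pos k).le hc]
    exact_mod_cast this
  · exact absurd hk (lt_irrefl _)

theorem foldVec_eq_zero_iff (F : 𝓕) (i : Fin n) :
    Q.foldVec (fun k => (B.D F k : ℝ)) i = 0 ↔ ∀ k, Q.j k = i → B.D F k = 0 := by
  constructor
  · intro h
    by_cases hn : ∃ k, B.IsB F k
    · obtain ⟨k, hk⟩ := hn
      rw [Q.foldVec_isB hk] at h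
      have hik : i ≠ Q.j k := by
        intro hc
        rw [if_pos hc] at h
        linarith [Q.w_pos k]
      intro l hl
      rw [B.D_isB F k hk, if_neg]
      rintro rfl; exact hik hl.symm
    · push Not at hn
      have hpos : ∀ k, 0 ≤ B.D F k := fun k => by
        by_contra hc
        exact hn k (B.isB_of_neg F k (not_le.1 hc))
      unfold foldVec at h
      beta_reduce at h
      rw [Finset.sum_eq_zero_iff_of_nonneg] at h
      · intro k hk
        have := h k (Finset.mem_univ _)
        rw [if_pos hk, mul_eq_zero] at this
        exact_mod_cast this.resolve_left (Q.w_pos k).ne'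
      · intro k _
        have : (0 : ℝ) ≤ B.D F k := by exact_mod_cast hpos k
        have := Q.w_pos k
        split_ifs <;> positivity
  · intro h
    unfold foldVec
    beta_reduce
    refine Finset.sum_eq_zero fun k _ => ?_
    split_ifs with hk
    · rw [h k hk]; simp
    · rfl

theorem foldVec_T_ne {ε : Bool} {F : 𝓕} (hF : ∀ k, B.s k ≠ ε → ¬ B.IsB F k) {i : Fin n}
    (hi : σ i ≠ ε) :
    Q.foldVec (fun k => (B.D (B.T ε F) k : ℝ)) i = Q.foldVec (fun k => (B.D F k : ℝ)) i :=
  Q.foldVec_congr fun k hk => by rw [B.rec_ne ε F hF k (by rwa [← Q.sign, hk])]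

theorem foldVec_T_eq {ε : Bool} {F : 𝓕} (hF : ∀ k, B.s k ≠ ε → ¬ B.IsB F k) {i : Fin n}
    (hi : σ i = ε) :
    Q.foldVec (fun k => (B.D (B.T ε F) k : ℝ)) i = Q.foldVec (fun k => (B.D F k : ℝ)) i
      - ∑ i', ⟪nroot α i, nroot α i'⟫_ℝ * Q.foldVec (fun k => (B.D F k : ℝ)) i' := by
  have h1 : Q.foldVec (fun k => (B.D (B.T ε F) k : ℝ)) i
      = -Q.foldVec (fun k => (B.D F k : ℝ)) i
        + Q.foldVec (fun k => ∑ l, (B.adj k l : ℝ) * (B.D F l : ℝ)) i := by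
    unfold foldVec
    beta_reduce
    rw [← Finset.sum_neg_distrib, ← Finset.sum_add_distrib]
    refine Finset.sum_congr rfl fun k _ => ?_
    split_ifs with hk
    · rw [B.rec_eq ε F hF k (by rw [← Q.sign, hk, hi])]
      push_cast; ring
    · simp
  rw [h1, foldVec_adj]
  ring

/-- Two figures are equivalent if their folded coordinate vectors are positively proportional. -/
def toFoldDatum : FoldDatum B α σ where
  toFolding := Q
  Eqv F G := ∃ c : ℝ, 0 < c ∧ ∀ i,
    Q.foldVec (fun k => (B.D G k : ℝ)) i = c * Q.foldVec (fun k => (B.D F k : ℝ)) i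
  eqv :=
    { refl := fun F => ⟨1, one_pos, fun i => (one_mul _).symm⟩
      symm := fun ⟨c, hc, h⟩ => ⟨c⁻¹, inv_pos.2 hc, fun i => by
        rw [h, inv_mul_cancel_left₀ hc.ne']⟩
      trans := fun ⟨c, hc, h⟩ ⟨d, hd, h'⟩ => ⟨d * c, mul_pos hd hc, fun i => by
        rw [h', h, mul_assoc]⟩ }
  eqv_T := by
    rintro ε F G ⟨c, hc, h⟩
    by_cases hF : ∃ k, B.s k ≠ ε ∧ B.IsB F k
    · obtain ⟨k, hk, hb⟩ := hF
      have hneg : Q.foldVec (fun k => (B.D G k : ℝ)) (Q.j k) < 0 := by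
        rw [h, Q.foldVec_isB hb, if_pos rfl]
        exact mul_neg_of_pos_of_neg hc (neg_neg_of_pos (Q.w_pos k))
      obtain ⟨k', hk', hb'⟩ := Q.exists_neg hneg
      have hs' : B.s k' ≠ ε := by rwa [← Q.sign, hk', Q.sign]
      refine ⟨Q.w k' / Q.w k, div_pos (Q.w_pos _) (Q.w_pos _), fun i => ?_⟩
      rw [Q.foldVec_isB (B.T_isB ε G k' hs' hb'), Q.foldVec_isB (B.T_isB ε F k hk hb), hk']
      have := (Q.w_pos k).ne'
      split_ifs
      · field_simp
      · simp
    · push Not at hF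
      have hG : ∀ k, B.s k ≠ ε → ¬ B.IsB G k := by
        intro k hk hb
        have hneg : Q.foldVec (fun k => (B.D F k : ℝ)) (Q.j k) < 0 := by
          have := h (Q.j k)
          rw [Q.foldVec_isB hb, if_pos rfl] at this
          have := Q.w_pos k
          exact neg_of_mul_neg_right (by linarith) hc.le
        obtain ⟨k', hk', hb'⟩ := Q.exists_neg hneg
        exact hF k' (by rwa [← Q.sign, hk', Q.sign]) hb'
      refine ⟨c, hc, fun i => ?_⟩
      by_cases hi : σ i = ε
      · rw [Q.foldVec_T_eq hG hi, Q.foldVec_T_eq hF hi]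
        simp only [h, mul_sub, Finset.mul_sum]
        congr 1
        exact Finset.sum_congr rfl fun _ _ => by ring
      · rw [Q.foldVec_T_ne hG hi, Q.foldVec_T_ne hF hi, h]
  eqv_isB F k hF G := by
    constructor
    · rintro ⟨c, hc, h⟩
      refine Q.exists_neg ?_
      have := h (Q.j k)
      rw [Q.foldVec_isB hF, if_pos rfl] at this
      have := Q.w_pos k
      exact neg_of_mul_neg_right (by linarith) hc.le
    · rintro ⟨k', hk', hb⟩
      refine ⟨Q.w k / Q.w k', div_pos (Q.w_pos _) (Q.w_pos _), fun i => ?_⟩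
      rw [Q.foldVec_isB hF, Q.foldVec_isB hb, hk']
      have := (Q.w_pos k').ne'
      split_ifs
      · field_simp
      · simp
  eqv_zero F G := by
    rintro ⟨c, hc, h⟩ i hF
    rw [← Q.foldVec_eq_zero_iff] at hF ⊢
    rw [h, hF, mul_zero]

end Folding

namespace FoldDatum

variable {K 𝓕 : Type*} [Fintype K] [DecidableEq K] {B : BaseModel K 𝓕}
  {α : Module.Basis (Fin n) ℝ V} {σ : Fin n → Bool} (Q : FoldDatum B α σ)

/-- A chosen figure representing `-α i`. -/
def bFig (i : Fin n) : 𝓕 := (B.exists_isB (Q.j_surj i).choose).choose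

theorem bFig_spec (i : Fin n) : ∃ k, Q.j k = i ∧ B.IsB (Q.bFig i) k :=
  ⟨_, (Q.j_surj i).choose_spec, (B.exists_isB _).choose_spec⟩

theorem eqv_bFig (F : 𝓕) (i : Fin n) : Q.Eqv F (Q.bFig i) ↔ ∃ k, Q.j k = i ∧ B.IsB F k := by
  obtain ⟨k, hk, hb⟩ := Q.bFig_spec i
  rw [Q.eqv_isB _ k hb, hk]

theorem not_isB {F : 𝓕} {ε : Bool} (h : ∀ i, σ i ≠ ε → ¬ Q.Eqv F (Q.bFig i)) :
    ∀ k, B.s k ≠ ε → ¬ B.IsB F k := fun k hk hF =>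
  h (Q.j k) (by rwa [Q.sign]) ((Q.eqv_bFig F _).2 ⟨k, rfl, hF⟩)

/-- The model of the almost positive roots obtained by folding. -/
def toRootModel : RootModel α σ 𝓕 where
  T := B.T
  T_T := B.T_T
  dv F := Q.foldVec fun k => (B.D F k : ℝ)
  Eqv := Q.Eqv
  eqv := Q.eqv
  eqv_T := Q.eqv_T
  b := Q.bFig
  eqv_b := by
    intro F i hF
    obtain ⟨k, hk, hb⟩ := (Q.eqv_bFig F i).1 hF
    exact ⟨Q.w k, Q.w_pos k, fun l => by rw [Q.foldVec_isB hb, hk]⟩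
  neg_b := fun F i h => (Q.eqv_bFig F i).2 (Q.exists_neg h)
  T_b := by
    intro ε i hi
    obtain ⟨k, hk, hb⟩ := Q.bFig_spec i
    refine (Q.eqv_bFig _ i).2 ⟨k, hk, B.T_isB ε _ k ?_ hb⟩
    rwa [← Q.sign, hk]
  rec_ne := fun ε F hF i hi => Q.foldVec_T_ne (Q.not_isB hF) hi
  rec_eq := fun ε F hF i hi => Q.foldVec_T_eq (Q.not_isB hF) hi

theorem FC_bFig (i : Fin n) (G : 𝓕) :
    (∀ F' G', Q.Eqv F' (Q.bFig i) → Q.Eqv G' G → B.FC F' G') ↔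
      Q.foldVec (fun k => (B.D G k : ℝ)) i = 0 := by
  rw [Q.foldVec_eq_zero_iff]
  constructor
  · intro h k hk
    rw [← B.FC_b]
    intro F hF
    exact h F G ((Q.eqv_bFig F i).2 ⟨k, hk, hF⟩) (Q.eqv.refl G)
  · intro h F' G' hF hG
    obtain ⟨k, hk, hb⟩ := (Q.eqv_bFig F' i).1 hF
    exact (B.FC_b k G').2 (Q.eqv_zero G G' (Q.eqv.symm hG) i h k hk) F' hb

end FoldDatum

end Folding

/-! ### Chords of a polygon in snake order -/

section Chords

/-- The reflections of a polygon whose vertices are numbered `0, …, H` in the order of a snake: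
adjacent numbers `q`, `q + 1` with `q ≡ e` modulo `2` are swapped. -/
def swp (H e q : ℕ) : ℕ := if q % 2 = e then (if q < H then q + 1 else q) else q - 1

/-- The chord `{q, q'}` with `q < q' ≤ H` is a diagonal, i.e. not an edge of the polygon. -/
def IsDiag (H q q' : ℕ) : Prop :=
  q < q' ∧ q' ≤ H ∧ q' ≠ q + 2 ∧ ¬(q = 0 ∧ q' = 1) ∧ ¬(q + 1 = H ∧ q' = H)

/-- The coordinates of a diagonal of type `A`: the signed number of crossings with the diagonals
`{p, p + 1}` of the snake. -/
def dch (q q' p : ℕ) : ℤ := if q = p ∧ q' = p + 1 then -1 else if q < p ∧ p + 1 < q' then 1 else 0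

theorem swp_le {H e q : ℕ} (h : q ≤ H) : swp H e q ≤ H := by
  unfold swp; split_ifs <;> omega

theorem swp_swp {H e q : ℕ} (he : e < 2) (h : q ≤ H) : swp H e (swp H e q) = q := by
  unfold swp; split_ifs <;> omega

theorem swp_spec {H e q : ℕ} (h : q ≤ H) :
    (q % 2 = e ∧ q < H ∧ swp H e q = q + 1) ∨ (q % 2 = e ∧ q = H ∧ swp H e q = q) ∨
    (q % 2 ≠ e ∧ q = 0 ∧ swp H e q = 0) ∨ (q % 2 ≠ e ∧ 0 < q ∧ swp H e q + 1 = q) := by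
  unfold swp; split_ifs <;> omega

theorem swp_inj {H e q q' : ℕ} (he : e < 2) (h : q ≤ H) (h' : q' ≤ H)
    (heq : swp H e q = swp H e q') : q = q' := by
  rw [← swp_swp he h, heq, swp_swp he h']

theorem isDiag_swp {H e q q' : ℕ} (he : e < 2) (h : IsDiag H q q') :
    IsDiag H (min (swp H e q) (swp H e q')) (max (swp H e q) (swp H e q')) := by
  obtain ⟨h1, h2, h3, h4, h5⟩ := h
  have a := swp_spec (H := H) (e := e) (q := q) (by omega)
  have b := swp_spec (H := H) (e := e) (q := q') h2
  unfold IsDiag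
  generalize swp H e q = x at *
  generalize swp H e q' = y at *
  rcases le_total x y with hxy | hxy
  · rw [min_eq_left hxy, max_eq_right hxy]
    omega
  · rw [min_eq_right hxy, max_eq_left hxy]
    omega

/-- Order is only changed by the swap of `q` and `q'` themselves. -/
theorem swp_lt {H e q q' : ℕ} (he : e < 2) (h : q < q') (h' : q' ≤ H)
    (hn : ¬(q % 2 = e ∧ q' = q + 1)) : swp H e q < swp H e q' := by
  have a := swp_spec (H := H) (e := e) (q := q) (by omega)
  have b := swp_spec (H := H) (e := e) (q := q') h'
  omega

theorem dch_swp_ne {H e q q' p : ℕ} (he : e < 2) (h : IsDiag H q q') (hp : p + 1 ≤ H)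
    (hpe : p % 2 = e) :
    dch (min (swp H e q) (swp H e q')) (max (swp H e q) (swp H e q')) p = dch q q' p := by
  obtain ⟨h1, h2, h3, h4, h5⟩ := h
  have a := swp_spec (H := H) (e := e) (q := q) (by omega)
  have b := swp_spec (H := H) (e := e) (q := q') h2
  generalize swp H e q = x at *
  generalize swp H e q' = y at *
  unfold dch
  rcases le_total x y with hxy | hxy
  · rw [min_eq_left hxy, max_eq_right hxy]
    congr 1
    · rw [eq_iff_iff]; omega
    · congr 1; rw [eq_iff_iff]; omega
  · rw [min_eq_right hxy, max_eq_left hxy]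
    congr 1
    · rw [eq_iff_iff]; omega
    · congr 1; rw [eq_iff_iff]; omega

theorem dch_spec (q q' p : ℕ) :
    (q = p ∧ q' = p + 1 ∧ dch q q' p = -1) ∨ (q < p ∧ p + 1 < q' ∧ dch q q' p = 1) ∨
    (¬(q = p ∧ q' = p + 1) ∧ ¬(q < p ∧ p + 1 < q') ∧ dch q q' p = 0) := by
  unfold dch
  split_ifs <;> omega

/-- The recursion for the coordinates of a diagonal: under the reflection that does not fix `{p, p +
1}`, they change like the coordinates of a root of type `A` under a product of simple reflections.
-/
theorem dch_swp_eq {H e q q' p : ℕ} (he : e < 2) (h : IsDiag H q q') (hp0 : 1 ≤ p)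
    (hp : p + 2 ≤ H) (hpe : p % 2 ≠ e) (hn : ¬(q % 2 = e ∧ q' = q + 1)) :
    dch (min (swp H e q) (swp H e q')) (max (swp H e q) (swp H e q')) p
      = -dch q q' p + dch q q' (p - 1) + dch q q' (p + 1) := by
  obtain ⟨h1, h2, h3, h4, h5⟩ := h
  have hlt := swp_lt he h1 h2 hn
  rw [min_eq_left hlt.le, max_eq_right hlt.le]
  have a := swp_spec (H := H) (e := e) (q := q) (by omega)
  have b := swp_spec (H := H) (e := e) (q := q') h2
  generalize swp H e q = x at *
  generalize swp H e q' = y at *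
  have e1 : x < p ↔ q + 1 < p ∨ q = p := by clear b; rcases a with a | a | a | a <;> omega
  have e2 : p + 1 < y ↔ p + 2 < q' ∨ q' = p + 1 := by
    clear a; rcases b with b | b | b | b <;> omega
  have e3 : x = p ↔ q + 1 = p := by clear b; rcases a with a | a | a | a <;> omega
  have e4 : y = p + 1 ↔ q' = p + 2 := by clear a; rcases b with b | b | b | b <;> omega
  have e5 : ¬(q + 1 = p ∧ q' = p) := by omega
  have e6 : ¬(q = p + 1 ∧ q' = p + 2) := by omega
  clear a b hlt hn hpe he h4 h5
  unfold dch
  simp only [e1, e2, e3, e4]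
  clear e1 e2 e3 e4
  rcases lt_trichotomy (q + 1) p with g1 | g1 | g1
  · have n1 : q ≠ p := by omega
    have n2 : q ≠ p - 1 := by omega
    have n3 : q ≠ p + 1 := by omega
    have n4 : q < p := by omega
    have n5 : q < p - 1 := by omega
    have n6 : q < p + 1 := by omega
    simp only [n1, n2, n3, n4, n5, n6, g1, g1.ne, false_and, true_and, true_or, if_false]
    split_ifs <;> omega
  · have n1 : q ≠ p := by omega
    have n2 : q = p - 1 := by omega
    have n3 : q ≠ p + 1 := by omega
    have n4 : q < p := by omega
    have n5 : ¬ q < p - 1 := by omega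
    have n6 : q < p + 1 := by omega
    have n7 : ¬ q + 1 < p := by omega
    simp only [n1, n3, n4, n5, n6, g1, false_and, true_and, or_false, if_false]
    split_ifs <;> omega
  · have n2 : q ≠ p - 1 := by omega
    have n4 : ¬ q < p := by omega
    have n5 : ¬ q < p - 1 := by omega
    have n7 : ¬ q + 1 < p := by omega
    have n8 : q + 1 ≠ p := by omega
    simp only [n2, n4, n5, n7, n8, false_and, false_or, if_false]
    split_ifs <;> omega

end Chords

/-! ### Crossing chords of a regular polygon -/

section Geometry

open Complex

theorem crosses_map (L : ℂ →ₗ[ℝ] ℂ) (hL : Function.Injective L) (a b c d : ℂ) :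
    Crosses (L a) (L b) (L c) (L d) ↔ Crosses a b c d := by
  unfold Crosses
  have h := fun x y => image_openSegment ℝ L.toAffineMap x y
  simp only [LinearMap.coe_toAffineMap] at h
  rw [← h, ← h, ← Set.image_inter hL, Set.image_nonempty]

theorem crosses_swap_left (a b c d : ℂ) : Crosses a b c d ↔ Crosses b a c d := by
  unfold Crosses; rw [openSegment_symm]

theorem crosses_swap_right (a b c d : ℂ) : Crosses a b c d ↔ Crosses a b d c := by
  unfold Crosses; rw [openSegment_symm ℝ c d]

theorem crosses_comm (a b c d : ℂ) : Crosses a b c d ↔ Crosses c d a b := by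
  unfold Crosses; rw [Set.inter_comm]

theorem crosses_sym2 {a b c d a' b' : ℂ} (h : s(a, b) = s(a', b')) :
    Crosses a b c d ↔ Crosses a' b' c d := by
  rw [Sym2.eq_iff] at h
  rcases h with ⟨rfl, rfl⟩ | ⟨rfl, rfl⟩
  · rfl
  · exact crosses_swap_left _ _ _ _

theorem not_crosses_of_re {a b c d : ℂ} {x : ℝ} (ha : a.re = x) (hb : b.re = x)
    (h : (c.re < x ∧ d.re ≤ x) ∨ (c.re ≤ x ∧ d.re < x) ∨ (x < c.re ∧ x ≤ d.re) ∨
      (x ≤ c.re ∧ x < d.re)) : ¬ Crosses a b c d := by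
  rintro ⟨w, ⟨s, t, hs, ht, hst, rfl⟩, ⟨s', t', hs', ht', hst', h2⟩⟩
  have h3 := congrArg Complex.re h2
  simp only [Complex.add_re, Complex.real_smul, Complex.mul_re, Complex.ofReal_re,
    Complex.ofReal_im, zero_mul, sub_zero, ha, hb] at h3
  rw [← add_mul, hst, one_mul] at h3
  have h4 : s' * (c.re - x) + t' * (d.re - x) = 0 := by
    have : x = (s' + t') * x := by rw [hst', one_mul]
    nlinarith
  rcases h with ⟨h5, h6⟩ | ⟨h5, h6⟩ | ⟨h5, h6⟩ | ⟨h5, h6⟩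
  · nlinarith [mul_pos hs' (sub_pos.2 h5), mul_nonneg ht'.le (sub_nonneg.2 h6)]
  · nlinarith [mul_nonneg hs'.le (sub_nonneg.2 h5), mul_pos ht' (sub_pos.2 h6)]
  · nlinarith [mul_pos hs' (sub_pos.2 h5), mul_nonneg ht'.le (sub_nonneg.2 h6)]
  · nlinarith [mul_nonneg hs'.le (sub_nonneg.2 h5), mul_pos ht' (sub_pos.2 h6)]

/-- A vertical chord of the unit circle meets every chord with endpoints on its two sides. -/
theorem crosses_of_re {a b c d : ℂ} {x y : ℝ} (hy : 0 < y) (ha : a = ⟨x, y⟩) (hb : b = ⟨x, -y⟩)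
    (hxy : x ^ 2 + y ^ 2 = 1) (hc : c.re ^ 2 + c.im ^ 2 = 1) (hd : d.re ^ 2 + d.im ^ 2 = 1)
    (hcx : x < c.re) (hdx : d.re < x) : Crosses a b c d := by
  set t := (c.re - x) / (c.re - d.re) with ht
  have hcd : 0 < c.re - d.re := by linarith
  have ht0 : 0 < t := div_pos (by linarith) hcd
  have ht1 : t < 1 := by rw [ht, div_lt_one hcd]; linarith
  have htx : (1 - t) * c.re + t * d.re = x := by
    rw [ht]; field_simp; ring
  set v := (1 - t) * c.im + t * d.im with hv
  -- the intersection point lies in the open disc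
  have hvy : v ^ 2 < y ^ 2 := by
    have h1 : x ^ 2 + v ^ 2 < 1 := by
      have e : x ^ 2 + v ^ 2 = (1 - t) * (c.re ^ 2 + c.im ^ 2) + t * (d.re ^ 2 + d.im ^ 2)
          - t * (1 - t) * ((c.re - d.re) ^ 2 + (c.im - d.im) ^ 2) := by
        rw [← htx, hv]; ring
      rw [e, hc, hd]
      have : 0 < t * (1 - t) * ((c.re - d.re) ^ 2 + (c.im - d.im) ^ 2) := by
        have h1t : 0 < 1 - t := by linarith
        positivity
      linarith
    linarith
  have hv1 : -y < v := by nlinarith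
  have hv2 : v < y := by nlinarith
  refine ⟨⟨x, v⟩, ?_, ?_⟩
  · refine ⟨(y + v) / (2 * y), (y - v) / (2 * y), div_pos (by linarith) (by linarith),
      div_pos (by linarith) (by linarith), by field_simp; ring, ?_⟩
    rw [ha, hb]
    apply Complex.ext
    · simp only [Complex.add_re, Complex.smul_re, smul_eq_mul]; field_simp; ring
    · simp only [Complex.add_im, Complex.smul_im, smul_eq_mul]; field_simp; ring
  · refine ⟨1 - t, t, by linarith, ht0, by ring, ?_⟩
    apply Complex.ext
    · simp; linarith
    · simp [hv]

/-- The cyclic position of the vertex number `q` of the snake. -/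
def sv (q : ℕ) : ℤ := if q % 2 = 0 then ((q / 2 : ℕ) : ℤ) else -((q + 1) / 2 : ℕ)

/-- The vertices of the regular `N`-gon inscribed in the unit circle, in cyclic order. -/
def rootPt (N : ℕ) (a : ℤ) : ℂ := exp (2 * π * I * a / N)

/-- The distance from the axis of the reflection `swp H e`, in half-steps along the circle. -/
def lev (e q : ℕ) : ℕ := if q % 2 = e then q + 1 else q

/-- The position of the axis of the reflection `swp H e`. -/
def axisShift (e : ℕ) : ℤ := if e = 1 then 0 else -1

/-- The vertices of the polygon in snake order, rotated so that the axis of the reflection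
`swp H e` is the real line. -/
def frm (N e q : ℕ) : ℂ :=
  ⟨Real.cos (π * lev e q / N), (-1) ^ q * Real.sin (π * lev e q / N)⟩

theorem rootPt_add_mul (N : ℕ) (hN : N ≠ 0) (a k : ℤ) : rootPt N (a + N * k) = rootPt N a := by
  unfold rootPt
  have hN' : (N : ℂ) ≠ 0 := by exact_mod_cast hN
  rw [Complex.exp_eq_exp_iff_exists_int]
  refine ⟨k, ?_⟩
  push_cast
  field_simp

theorem rootPt_eq_iff (N : ℕ) (hN : N ≠ 0) (a b : ℤ) :
    rootPt N a = rootPt N b ↔ (N : ℤ) ∣ a - b := by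
  constructor
  · intro h
    unfold rootPt at h
    rw [Complex.exp_eq_exp_iff_exists_int] at h
    obtain ⟨k, hk⟩ := h
    refine ⟨k, ?_⟩
    have hN' : (N : ℂ) ≠ 0 := by exact_mod_cast hN
    have h2 : (2 * π * I : ℂ) ≠ 0 := Complex.two_pi_I_ne_zero
    have : ((a - b : ℤ) : ℂ) = ((N * k : ℤ) : ℂ) := by
      apply mul_left_cancel₀ h2
      push_cast
      field_simp at hk
      linear_combination (2 * π * I : ℂ) * hk
    exact_mod_cast this
  · rintro ⟨k, hk⟩
    rw [show a = b + N * k by linarith, rootPt_add_mul N hN]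

theorem two_sv (e q : ℕ) (he : e < 2) :
    2 * sv q - axisShift e = if q % 2 = 0 then (lev e q : ℤ) else -(lev e q : ℤ) := by
  unfold sv axisShift lev
  rcases (by omega : e = 0 ∨ e = 1) with rfl | rfl
  · simp only [Nat.zero_ne_one, if_false]; split_ifs <;> omega
  · simp only [if_true]; split_ifs <;> omega

theorem rootPt_sv (N e q : ℕ) (he : e < 2) :
    rootPt N (sv q) = exp (π * I * axisShift e / N) * frm N e q := by
  have h1 : frm N e q = exp ((((if q % 2 = 0 then (lev e q : ℤ) else -(lev e q : ℤ)) : ℤ) : ℂ)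
      * π / N * I) := by
    have h3 : ∀ x : ℤ, exp ((x : ℂ) * π / N * I) =
        ⟨Real.cos (π * x / N), Real.sin (π * x / N)⟩ := by
      intro x
      have : ((x : ℂ) * π / N) = ((π * x / N : ℝ) : ℂ) := by push_cast; ring
      rw [this]
      apply Complex.ext
      · exact Complex.exp_ofReal_mul_I_re _
      · exact Complex.exp_ofReal_mul_I_im _
    rw [h3]
    unfold frm
    split_ifs with hq
    · rw [(Nat.even_iff.2 hq).neg_one_pow]; push_cast; rw [one_mul]
    · rw [(Nat.odd_iff.2 (by omega)).neg_one_pow]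
      push_cast
      rw [mul_neg, neg_div, Real.cos_neg, Real.sin_neg]; simp
  rw [h1, ← two_sv e q he, ← Complex.exp_add]
  unfold rootPt
  congr 1
  push_cast
  ring

theorem frm_norm (N e q : ℕ) : (frm N e q).re ^ 2 + (frm N e q).im ^ 2 = 1 := by
  unfold frm
  simp only
  rw [mul_pow, ← pow_mul, mul_comm q 2, pow_mul]
  simp

theorem lev_le {H e q : ℕ} (h : q ≤ H) : lev e q ≤ H + 1 := by
  unfold lev; split_ifs <;> omega

theorem cos_lev_lt {N a b : ℕ} (hab : a < b) (hb : b ≤ N) :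
    Real.cos (π * b / N) < Real.cos (π * a / N) := by
  have hN : (0 : ℝ) < N := by exact_mod_cast (by omega : 0 < N)
  have hp := Real.pi_pos
  apply Real.cos_lt_cos_of_nonneg_of_le_pi
  · positivity
  · rw [div_le_iff₀ hN]
    have : (b : ℝ) ≤ N := by exact_mod_cast hb
    nlinarith
  · have : (a : ℝ) < b := by exact_mod_cast hab
    gcongr

/-- In snake order, `swp H e` is the reflection of the regular polygon in its axis. -/
theorem frm_swp {H e q : ℕ} (he : e < 2) (h : q ≤ H) :
    frm (H + 1) e (swp H e q) = (starRingEnd ℂ) (frm (H + 1) e q) := by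
  have hs := swp_spec (e := e) h
  have hlev : lev e (swp H e q) = lev e q := by
    unfold lev
    rcases hs with ⟨h1, h2, h3⟩ | ⟨h1, h2, h3⟩ | ⟨h1, h2, h3⟩ | ⟨h1, h2, h3⟩
    · rw [h3, if_pos h1, if_neg (by omega)]
    · rw [h3]
    · rw [h3, h2]
    · rw [if_pos (by omega), if_neg h1, h3]
  have hH : ((H + 1 : ℕ) : ℝ) ≠ 0 := by positivity
  unfold frm
  rw [hlev]
  apply Complex.ext
  · simp
  · simp only [Complex.conj_im]
    rcases hs with ⟨h1, h2, h3⟩ | ⟨h1, h2, h3⟩ | ⟨h1, h2, h3⟩ | ⟨h1, h2, h3⟩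
    · rw [h3, pow_succ]; ring
    · rw [h3]
      have : lev e q = H + 1 := by unfold lev; rw [if_pos h1, h2]
      rw [this, mul_div_assoc, div_self hH, mul_one, Real.sin_pi]; simp
    · have : lev e q = 0 := by unfold lev; rw [if_neg h1, h2]
      rw [this]; simp
    · have : (-1 : ℝ) ^ q = -(-1) ^ (swp H e q) := by
        conv_lhs => rw [← h3, pow_succ]
        ring
      rw [this]; ring

/-- In snake order the chord `{p, p + 1}` crosses the chord `{q, q'}` exactly when `p`, `p + 1` lie
between `q` and `q'`, or when the chords coincide. -/
theorem crosses_frm_iff {H p q q' : ℕ} (hp : p + 1 ≤ H) (hq : q < q') (hq' : q' ≤ H) :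
    Crosses (frm (H + 1) (p % 2) p) (frm (H + 1) (p % 2) (p + 1)) (frm (H + 1) (p % 2) q)
      (frm (H + 1) (p % 2) q') ↔ dch q q' p ≠ 0 := by
  have hlp : lev (p % 2) p = p + 1 := by unfold lev; simp
  have hlp1 : lev (p % 2) (p + 1) = p + 1 := by unfold lev; rw [if_neg (by omega)]
  have hH : (0 : ℝ) < ((H + 1 : ℕ) : ℝ) := by positivity
  have hpi := Real.pi_pos
  have hlq := lev_le (e := p % 2) (q := q) (H := H) (by omega)
  have hlq' := lev_le (e := p % 2) hq'
  have hge : ∀ a, p < a → p + 1 ≤ lev (p % 2) a := by intro a ha; unfold lev; split_ifs <;> omega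
  have hge2 : ∀ a, p + 1 < a → p + 1 < lev (p % 2) a := by
    intro a ha; unfold lev; split_ifs <;> omega
  have hle : ∀ a, a ≤ p + 1 → lev (p % 2) a ≤ p + 1 := by
    intro a ha; unfold lev; split_ifs <;> omega
  have hle2 : ∀ a, a < p → lev (p % 2) a < p + 1 := by
    intro a ha; unfold lev; split_ifs <;> omega
  rcases dch_spec q q' p with ⟨h1, h2, h3⟩ | ⟨h1, h2, h3⟩ | ⟨h1, h2, h3⟩
  · rw [h3, h1, h2]
    simp only [ne_eq, Int.reduceNeg, neg_eq_zero, one_ne_zero, not_false_eq_true, iff_true]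
    unfold Crosses
    rw [Set.inter_self]
    exact ⟨_, ⟨1 / 2, 1 / 2, by norm_num, by norm_num, by norm_num, rfl⟩⟩
  · rw [h3]
    simp only [ne_eq, one_ne_zero, not_false_eq_true, iff_true]
    have hr1 := cos_lev_lt (N := H + 1) (hle2 q h1) (by omega)
    have hr2 := cos_lev_lt (N := H + 1) (hge2 q' h2) hlq'
    have hy : 0 < Real.sin (π * ((p + 1 : ℕ) : ℝ) / ((H + 1 : ℕ) : ℝ)) := by
      apply Real.sin_pos_of_pos_of_lt_pi
      · positivity
      · rw [div_lt_iff₀ hH]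
        have : ((p + 1 : ℕ) : ℝ) < ((H + 1 : ℕ) : ℝ) := by exact_mod_cast (by omega)
        nlinarith
    have hcs := Real.cos_sq_add_sin_sq (π * ((p + 1 : ℕ) : ℝ) / ((H + 1 : ℕ) : ℝ))
    rcases Nat.even_or_odd p with hev | hodd
    · exact crosses_of_re hy (by unfold frm; rw [hlp, hev.neg_one_pow, one_mul])
        (by unfold frm; rw [hlp1, pow_succ, hev.neg_one_pow]; simp) hcs (frm_norm _ _ _)
        (frm_norm _ _ _) hr1 hr2
    · rw [crosses_swap_left]
      exact crosses_of_re hy (by unfold frm; rw [hlp1, pow_succ, hodd.neg_one_pow]; simp)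
        (by unfold frm; rw [hlp, hodd.neg_one_pow, neg_one_mul]) hcs (frm_norm _ _ _)
        (frm_norm _ _ _) hr1 hr2
  · rw [h3]
    simp only [ne_eq, not_true_eq_false, iff_false]
    apply not_crosses_of_re (x := Real.cos (π * ((p + 1 : ℕ) : ℝ) / ((H + 1 : ℕ) : ℝ)))
    · unfold frm; rw [hlp]
    · unfold frm; rw [hlp1]
    have hmono : ∀ a b : ℕ, a ≤ b → b ≤ H + 1 →
        Real.cos (π * b / ((H + 1 : ℕ) : ℝ)) ≤ Real.cos (π * a / ((H + 1 : ℕ) : ℝ)) := by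
      intro a b hab hb
      rcases hab.lt_or_eq with h | h
      · exact (cos_lev_lt h hb).le
      · rw [h]
    by_cases hqp : q < p
    · exact Or.inr (Or.inr (Or.inl ⟨cos_lev_lt (hle2 q hqp) (by omega),
        hmono _ _ (hle q' (by omega)) (by omega)⟩))
    · by_cases hq1 : q' ≤ p + 1
      · omega
      · have hq2 : p + 1 ≤ lev (p % 2) q := by
          rcases Nat.lt_or_ge p q with h | h
          · exact hge q h
          · rw [show q = p by omega, hlp]
        exact Or.inr (Or.inl ⟨hmono _ _ hq2 hlq, cos_lev_lt (hge2 q' (by omega)) hlq'⟩)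

/-- The vertex number `q` of the snake in the regular polygon with vertices `0, …, H`. -/
def snakePt (H q : ℕ) : ℂ := rootPt (H + 1) (sv q)

theorem snakePt_eq (H e q : ℕ) (he : e < 2) :
    snakePt H q = exp (π * I * axisShift e / (H + 1 : ℕ)) * frm (H + 1) e q :=
  rootPt_sv (H + 1) e q he

theorem crosses_mul {z : ℂ} (hz : z ≠ 0) (a b c d : ℂ) :
    Crosses (z * a) (z * b) (z * c) (z * d) ↔ Crosses a b c d :=
  crosses_map (LinearMap.mulLeft ℝ z) (mul_right_injective₀ hz) a b c d

theorem crosses_conj (a b c d : ℂ) :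
    Crosses ((starRingEnd ℂ) a) ((starRingEnd ℂ) b) ((starRingEnd ℂ) c) ((starRingEnd ℂ) d) ↔
      Crosses a b c d :=
  crosses_map Complex.conjLIE.toLinearEquiv.toLinearMap Complex.conjLIE.injective a b c d

theorem crosses_snakePt_frm (H e a b c d : ℕ) (he : e < 2) :
    Crosses (snakePt H a) (snakePt H b) (snakePt H c) (snakePt H d) ↔
      Crosses (frm (H + 1) e a) (frm (H + 1) e b) (frm (H + 1) e c) (frm (H + 1) e d) := by
  simp only [snakePt_eq H e _ he]
  exact crosses_mul (exp_ne_zero _) _ _ _ _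

theorem crosses_snakePt_iff {H p q q' : ℕ} (hp : p + 1 ≤ H) (hq : q < q') (hq' : q' ≤ H) :
    Crosses (snakePt H p) (snakePt H (p + 1)) (snakePt H q) (snakePt H q') ↔ dch q q' p ≠ 0 := by
  rw [crosses_snakePt_frm H (p % 2) _ _ _ _ (by omega), crosses_frm_iff hp hq hq']

theorem crosses_snakePt_swp {H e a b c d : ℕ} (he : e < 2) (ha : a ≤ H) (hb : b ≤ H) (hc : c ≤ H)
    (hd : d ≤ H) :
    Crosses (snakePt H (swp H e a)) (snakePt H (swp H e b)) (snakePt H (swp H e c))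
      (snakePt H (swp H e d)) ↔
      Crosses (snakePt H a) (snakePt H b) (snakePt H c) (snakePt H d) := by
  rw [crosses_snakePt_frm H e _ _ _ _ he, crosses_snakePt_frm H e _ _ _ _ he,
    frm_swp he ha, frm_swp he hb, frm_swp he hc, frm_swp he hd, crosses_conj]

theorem crosses_minmax (H : ℕ) (x y x' y' : ℕ) :
    Crosses (snakePt H (min x y)) (snakePt H (max x y)) (snakePt H (min x' y'))
      (snakePt H (max x' y')) ↔
      Crosses (snakePt H x) (snakePt H y) (snakePt H x') (snakePt H y') := by
  rcases le_total x y with h | h <;> rcases le_total x' y' with h' | h' <;>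
    simp only [min_eq_left h, min_eq_left h', max_eq_right h, max_eq_right h', min_eq_right h,
      min_eq_right h', max_eq_left h, max_eq_left h']
  · exact crosses_swap_right _ _ _ _
  · exact crosses_swap_left _ _ _ _
  · rw [crosses_swap_left, crosses_swap_right]

theorem snakePt_injOn {H a b : ℕ} (ha : a ≤ H) (hb : b ≤ H) (h : snakePt H a = snakePt H b) :
    a = b := by
  unfold snakePt at h
  rw [rootPt_eq_iff _ (by omega)] at h
  obtain ⟨k, hk⟩ := h
  have h1 : |sv a - sv b| < H + 1 := by
    rw [abs_lt]; unfold sv; split_ifs <;> omega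
  have hk0 : k = 0 := by
    rw [hk, abs_mul, Nat.abs_cast] at h1
    by_contra hc
    have := Int.one_le_abs hc
    push_cast at h1
    nlinarith
  rw [hk0, mul_zero] at hk
  unfold sv at hk
  split_ifs at hk <;> omega

/-- For odd `H` the antipode of the vertex `q` is the vertex `H - q`. -/
theorem snakePt_antipode {H q : ℕ} (hH : H % 2 = 1) (h : q ≤ H) :
    snakePt H (H - q) = -snakePt H q := by
  rw [snakePt_eq H 0 _ (by omega), snakePt_eq H 0 _ (by omega), ← mul_neg]
  congr 1
  have hl : (lev 0 (H - q) : ℝ) = (H + 1 : ℕ) - lev 0 q := by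
    rw [eq_sub_iff_add_eq]
    norm_cast
    unfold lev
    split_ifs <;> omega
  have hH : ((H + 1 : ℕ) : ℝ) ≠ 0 := by positivity
  have ha : π * (lev 0 (H - q) : ℝ) / ((H + 1 : ℕ) : ℝ)
      = π - π * lev 0 q / ((H + 1 : ℕ) : ℝ) := by
    rw [hl]; field_simp
  have hs : (-1 : ℝ) ^ (H - q) = -(-1) ^ q := by
    rcases Nat.even_or_odd q with hq | hq
    · rw [hq.neg_one_pow, Odd.neg_one_pow (by rw [Nat.odd_iff] at *; rw [Nat.even_iff] at hq; omega)]
    · rw [hq.neg_one_pow, Even.neg_one_pow (by rw [Nat.even_iff]; rw [Nat.odd_iff] at hq; omega)]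
      norm_num
  unfold frm
  rw [ha, Real.cos_pi_sub, Real.sin_pi_sub, hs]
  apply Complex.ext <;> simp

theorem snakePt_norm (H q : ℕ) : ‖snakePt H q‖ = 1 := by
  unfold snakePt rootPt
  rw [show (2 * π * I * (sv q : ℂ) / ((H + 1 : ℕ) : ℂ))
    = ((2 * π * sv q / ((H + 1 : ℕ) : ℝ) : ℝ) : ℂ) * I by push_cast; ring]
  exact Complex.norm_exp_ofReal_mul_I _

theorem zero_notMem_openSegment {a b : ℂ} (ha : ‖a‖ = 1) (hb : ‖b‖ = 1) (hab : b ≠ -a) :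
    (0 : ℂ) ∉ openSegment ℝ a b := by
  rintro ⟨s, t, hs, ht, hst, h⟩
  have h1 : s • a = -(t • b) := by rw [eq_neg_iff_add_eq_zero]; exact h
  have h2 := congrArg norm h1
  rw [norm_neg, norm_smul, norm_smul, ha, hb, mul_one, mul_one, Real.norm_of_nonneg hs.le,
    Real.norm_of_nonneg ht.le] at h2
  rw [← h2, ← smul_neg] at h1
  have h3 := smul_right_injective ℂ hs.ne' h1
  exact hab (by rw [h3, neg_neg])

/-- A chord that misses the center crosses a diameter if and only if it crosses one of its
two halves. -/
theorem crosses_diameter {a b u : ℂ} (h0 : (0 : ℂ) ∉ openSegment ℝ a b) :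
    Crosses a b u (-u) ↔ Crosses a b 0 u ∨ Crosses a b 0 (-u) := by
  constructor
  · rintro ⟨w, hw, s, t, hs, ht, hst, rfl⟩
    rcases lt_trichotomy t s with h | h | h
    · refine Or.inl ⟨_, hw, 1 - (s - t), s - t, by linarith, by linarith, by ring, ?_⟩
      module
    · exfalso
      apply h0
      rw [h] at hw
      simpa using hw
    · refine Or.inr ⟨_, hw, 1 - (t - s), t - s, by linarith, by linarith, by ring, ?_⟩
      module
  · rintro (⟨w, hw, s, t, hs, ht, hst, rfl⟩ | ⟨w, hw, s, t, hs, ht, hst, rfl⟩)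
    · refine ⟨_, hw, (1 + t) / 2, (1 - t) / 2, by linarith, by linarith, by ring, ?_⟩
      module
    · refine ⟨_, hw, (1 - t) / 2, (1 + t) / 2, by linarith, by linarith, by ring, ?_⟩
      module

theorem eq_of_crosses_half {u v : ℂ} (hu : ‖u‖ = ‖v‖) (hv : v ≠ 0) (h : Crosses 0 u 0 v) : u = v := by
  obtain ⟨w, ⟨s, t, hs, ht, hst, rfl⟩, s', t', hs', ht', hst', h⟩ := h
  rw [smul_zero, smul_zero, zero_add, zero_add] at h
  have h2 := congrArg norm h
  rw [norm_smul, norm_smul, hu, Real.norm_of_nonneg ht'.le, Real.norm_of_nonneg ht.le] at h2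
  have h3 := mul_right_cancel₀ (norm_ne_zero_iff.2 hv) h2
  rw [h3] at h
  exact (smul_right_injective ℂ ht.ne' h).symm

end Geometry

/-! ### The models of types `A` and `D` -/

section BaseModels

/-- The parity of the snake diagonals that are fixed by `τ_ε`, if the first one has sign `η`. -/
def parOf (η ε : Bool) : ℕ := if ε = η then 0 else 1

/-- The sign of the snake diagonal `{p, p + 1}`, if the first one has sign `η`. -/
def sgnOf (η : Bool) (p : ℕ) : Bool := if p % 2 = 1 then η else !η

theorem parOf_lt (η ε : Bool) : parOf η ε < 2 := by unfold parOf; split_ifs <;> omega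

theorem sgnOf_ne_iff (η ε : Bool) (p : ℕ) : sgnOf η p ≠ ε ↔ p % 2 = parOf η ε := by
  unfold sgnOf parOf
  rcases Nat.mod_two_eq_zero_or_one p with h | h <;> cases η <;> cases ε <;> simp [h]

theorem sgnOf_eq_iff (η ε : Bool) (p : ℕ) : sgnOf η p = ε ↔ p % 2 ≠ parOf η ε := by
  rw [← not_iff_not, ← ne_eq, sgnOf_ne_iff]; simp

/-- Diagonals of the polygon with vertices `0, …, r + 2`. -/
abbrev ChordFig (r : ℕ) := {F : ℕ × ℕ // IsDiag (r + 2) F.1 F.2}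

/-- The image of a diagonal under a reflection of the polygon. -/
def swpFig (r e : ℕ) (he : e < 2) (F : ChordFig r) : ChordFig r :=
  ⟨(min (swp (r + 2) e F.1.1) (swp (r + 2) e F.1.2),
    max (swp (r + 2) e F.1.1) (swp (r + 2) e F.1.2)), isDiag_swp he F.2⟩

theorem min_max_swp {H e q q' : ℕ} (he : e < 2) (h : q < q') (h' : q' ≤ H) :
    min (swp H e (min (swp H e q) (swp H e q'))) (swp H e (max (swp H e q) (swp H e q'))) = q ∧
    max (swp H e (min (swp H e q) (swp H e q'))) (swp H e (max (swp H e q) (swp H e q'))) = q' := by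
  have h1 := swp_swp he (show q ≤ H by omega)
  have h2 := swp_swp he h'
  rcases le_total (swp H e q) (swp H e q') with h3 | h3
  · rw [min_eq_left h3, max_eq_right h3, h1, h2]
    exact ⟨min_eq_left h.le, max_eq_right h.le⟩
  · rw [min_eq_right h3, max_eq_left h3, h1, h2]
    exact ⟨min_eq_right h.le, max_eq_left h.le⟩

theorem swp_fixed {H e p : ℕ} (hp : p + 1 ≤ H) (hpe : p % 2 = e) :
    swp H e p = p + 1 ∧ swp H e (p + 1) = p := by
  unfold swp
  rw [if_pos hpe, if_pos (by omega), if_neg (by omega)]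
  exact ⟨rfl, rfl⟩

theorem sum_fin_delta {r : ℕ} (g : ℕ → ℤ) (a : ℕ) :
    ∑ l : Fin r, (if (l : ℕ) = a then 1 else 0) * g l = if a < r then g a else 0 := by
  rw [Fin.sum_univ_eq_sum_range (fun l => (if l = a then 1 else 0) * g l) r]
  simp only [ite_mul, one_mul, zero_mul]
  rw [Finset.sum_ite_eq' (Finset.range r) a g]
  simp

/-- The path with `r` nodes. -/
def adjPath (r : ℕ) (k l : Fin r) : ℤ := if (k : ℕ) + 1 = l ∨ (l : ℕ) + 1 = k then 1 else 0

theorem sum_adjPath {r : ℕ} (g : ℕ → ℤ) (h0 : g 0 = 0) (hr : g (r + 1) = 0) (k : Fin r) :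
    ∑ l : Fin r, adjPath r k l * g (l + 1) = g k + g (k + 2) := by
  have h1 : ∀ l : Fin r, adjPath r k l * g (l + 1)
      = (if (l : ℕ) = k + 1 then 1 else 0) * g (l + 1)
        + (if (k : ℕ) = 0 then 0 else (if (l : ℕ) = k - 1 then 1 else 0) * g (l + 1)) := by
    intro l
    unfold adjPath
    split_ifs <;> omega
  rw [Finset.sum_congr rfl fun l _ => h1 l, Finset.sum_add_distrib,
    sum_fin_delta (fun l => g (l + 1))]
  have hk := k.2
  have h2 : (if (k : ℕ) + 1 < r then g (k + 1 + 1) else 0) = g (k + 2) := by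
    split_ifs with h
    · rfl
    · rw [show (k : ℕ) + 2 = r + 1 by omega, hr]
  rw [h2]
  split_ifs with h
  · rw [Finset.sum_const_zero, h, h0]; ring
  · rw [sum_fin_delta (fun l => g (l + 1)), if_pos (by omega), show (k : ℕ) - 1 + 1 = k by omega]
    ring

theorem dch_zero {H q q' : ℕ} (h : IsDiag H q q') : dch q q' 0 = 0 := by
  obtain ⟨h1, h2, h3, h4, h5⟩ := h
  unfold dch
  rw [if_neg (by omega), if_neg (by omega)]

theorem dch_last {H q q' : ℕ} (h : IsDiag (H + 1) q q') : dch q q' H = 0 := by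
  obtain ⟨h1, h2, h3, h4, h5⟩ := h
  unfold dch
  rw [if_neg (by omega), if_neg (by omega)]

/-- The model of type `A r` by diagonals of an `(r + 3)`-gon. -/
def baseA (r : ℕ) (η : Bool) : BaseModel (Fin r) (ChordFig r) where
  T ε := swpFig r (parOf η ε) (parOf_lt η ε)
  T_T ε F := by
    obtain ⟨h1, h2⟩ := min_max_swp (parOf_lt η ε) F.2.1 F.2.2.1
    exact Subtype.ext (Prod.ext h1 h2)
  D F k := dch F.1.1 F.1.2 (k + 1)
  adj := adjPath r
  s k := sgnOf η (k + 1)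
  adj_sign k l h := by
    unfold adjPath at h
    have h' : (k : ℕ) + 1 = l ∨ (l : ℕ) + 1 = k := by by_contra hc; rw [if_neg hc] at h; exact h rfl
    unfold sgnOf
    rcases h' with h' | h' <;> split_ifs <;> first | omega | (cases η <;> simp)
  IsB F k := F.1.1 = k + 1 ∧ F.1.2 = k + 2
  exists_isB k := ⟨⟨(k + 1, k + 2), by unfold IsDiag; have := k.2; dsimp only; omega⟩, rfl, rfl⟩
  D_isB F k h l := by
    rw [h.1, h.2]
    have e : l = k ↔ (l : ℕ) = k := Fin.ext_iff
    simp only [e]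
    unfold dch
    split_ifs <;> omega
  isB_of_neg F k h := by
    rcases dch_spec F.1.1 F.1.2 (k + 1) with ⟨h1, h2, h3⟩ | ⟨h1, h2, h3⟩ | ⟨h1, h2, h3⟩
    · exact ⟨h1, h2⟩
    · omega
    · omega
  T_isB ε F k hk h := by
    rw [sgnOf_ne_iff] at hk
    have hk2 := k.2
    obtain ⟨h1, h2⟩ := swp_fixed (H := r + 2) (by omega) hk
    unfold swpFig
    dsimp only
    rw [h.1, h.2, show (k : ℕ) + 2 = k + 1 + 1 by ring, h1, h2]
    constructor
    · rw [min_eq_right]; omega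
    · rw [max_eq_left]; omega
  rec_ne ε F hF k hk := by
    rw [sgnOf_ne_iff] at hk
    exact dch_swp_ne (parOf_lt η ε) F.2 (by have := k.2; omega) hk
  rec_eq ε F hF k hk := by
    rw [sgnOf_eq_iff] at hk
    have hk2 := k.2
    have hn : ¬(F.1.1 % 2 = parOf η ε ∧ F.1.2 = F.1.1 + 1) := by
      rintro ⟨h1, h2⟩
      obtain ⟨g1, g2, g3, g4, g5⟩ := F.2
      refine hF ⟨F.1.1 - 1, by omega⟩ ?_ ⟨?_, ?_⟩
      · rw [sgnOf_ne_iff]; dsimp only; rw [Nat.sub_add_cancel (by omega)]; exact h1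
      · dsimp only; omega
      · dsimp only; omega
    rw [sum_adjPath (fun p => dch F.1.1 F.1.2 p) (dch_zero F.2) (dch_last F.2)]
    have := dch_swp_eq (parOf_lt η ε) F.2 (p := k + 1) (by omega) (by omega) hk hn
    rw [add_assoc] at this
    exact this
  FC F G := ¬ Crosses (snakePt (r + 2) F.1.1) (snakePt (r + 2) F.1.2) (snakePt (r + 2) G.1.1)
    (snakePt (r + 2) G.1.2)
  FC_T ε F G := by
    obtain ⟨f1, f2, -⟩ := F.2
    obtain ⟨g1, g2, -⟩ := G.2
    unfold swpFig
    dsimp only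
    rw [crosses_minmax, crosses_snakePt_swp (parOf_lt η ε) (by omega) (by omega) (by omega)
      (by omega)]
  FC_b k G := by
    obtain ⟨g1, g2, -⟩ := G.2
    have hk := k.2
    have key := crosses_snakePt_iff (H := r + 2) (p := k + 1) (by omega) g1 g2
    constructor
    · intro h
      have := h ⟨(k + 1, k + 2), by unfold IsDiag; dsimp only; omega⟩ ⟨rfl, rfl⟩
      dsimp only at this
      rw [key] at this
      simpa using this
    · rintro h F ⟨h1, h2⟩
      rw [h1, h2, key]
      simpa using h

/-- Figures of type `D (m + 1)`: diagonals of the `(2 m + 2)`-gon, where diameters are colored. -/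
abbrev DFig (m : ℕ) :=
  {F : ℕ × ℕ × Bool // IsDiag (2 * m + 1) F.1 F.2.1 ∧ (F.1 + F.2.1 ≠ 2 * m + 1 → F.2.2 = false)}

/-- The figure is a colored diameter. -/
def DFig.IsDiam {m : ℕ} (F : DFig m) : Prop := F.1.1 + F.1.2.1 = 2 * m + 1

instance {m : ℕ} (F : DFig m) : Decidable F.IsDiam := by unfold DFig.IsDiam; infer_instance

theorem swp_add {m e q q' : ℕ} (he : e < 2) (h : q ≤ 2 * m + 1) (h' : q' ≤ 2 * m + 1) :
    swp (2 * m + 1) e q + swp (2 * m + 1) e q' = 2 * m + 1 ↔ q + q' = 2 * m + 1 := by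
  have a := swp_spec (e := e) h
  have b := swp_spec (e := e) h'
  rcases a with a | a | a | a <;> rcases b with b | b | b | b <;> omega

/-- The image of a figure of type `D` under a reflection of the polygon, which changes the color
of diameters unless it fixes the snake diameter. -/
def swpFigD (m e : ℕ) (he : e < 2) (F : DFig m) : DFig m :=
  ⟨(min (swp (2 * m + 1) e F.1.1) (swp (2 * m + 1) e F.1.2.1),
    max (swp (2 * m + 1) e F.1.1) (swp (2 * m + 1) e F.1.2.1),
    if F.1.1 + F.1.2.1 = 2 * m + 1 ∧ m % 2 ≠ e then !F.1.2.2 else F.1.2.2), by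
    refine ⟨isDiag_swp he F.2.1, fun h => ?_⟩
    obtain ⟨f1, f2, -⟩ := F.2.1
    dsimp only at h
    rw [min_add_max, ne_eq, swp_add he (by omega) f2] at h
    dsimp only
    rw [if_neg (fun h' => h h'.1)]
    exact F.2.2 h⟩

/-- The graph of type `D (m + 1)`: the nodes `0, …, m - 1` form a path and `m` is joined to
`m - 2`. -/
def adjD (m : ℕ) (k l : Fin (m + 1)) : ℤ :=
  if ((k : ℕ) + 1 = l ∧ (l : ℕ) < m) ∨ ((l : ℕ) + 1 = k ∧ (k : ℕ) < m) ∨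
    ((k : ℕ) + 2 = m ∧ (l : ℕ) = m) ∨ ((l : ℕ) + 2 = m ∧ (k : ℕ) = m) then 1 else 0

theorem sum_adjD {m : ℕ} (hm : 3 ≤ m) (g : ℕ → ℤ) (k : Fin (m + 1)) :
    ∑ l : Fin (m + 1), adjD m k l * g l =
      if (k : ℕ) + 2 < m then (if (k : ℕ) = 0 then 0 else g (k - 1)) + g (k + 1)
      else if (k : ℕ) + 2 = m then g (k - 1) + g (m - 1) + g m else g (m - 2) := by
  have hk := k.2
  have key : ∀ f : ℕ → ℤ, (∀ l : Fin (m + 1), adjD m k l = f l) →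
      ∑ l : Fin (m + 1), adjD m k l * g l = ∑ l : Fin (m + 1), f l * g l := by
    intro f hf
    exact Finset.sum_congr rfl fun l _ => by rw [hf]
  split_ifs with h1 h2 h3
  · rw [key (fun l => if l = k + 1 then 1 else 0), sum_fin_delta, if_pos (by omega)]
    · ring
    · intro l; unfold adjD; have := l.2; split_ifs <;> omega
  · rw [key (fun l => (if l = k - 1 then 1 else 0) + (if l = k + 1 then 1 else 0))]
    · simp only [add_mul]
      rw [Finset.sum_add_distrib, sum_fin_delta, sum_fin_delta, if_pos (by omega),
        if_pos (by omega)]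
    · intro l; unfold adjD; have := l.2; split_ifs <;> omega
  · rw [key (fun l => (if l = k - 1 then 1 else 0) + (if l = m - 1 then 1 else 0)
      + (if l = m then 1 else 0))]
    · simp only [add_mul]
      rw [Finset.sum_add_distrib, Finset.sum_add_distrib, sum_fin_delta, sum_fin_delta,
        sum_fin_delta, if_pos (by omega), if_pos (by omega), if_pos (by omega)]
    · intro l; unfold adjD; have := l.2; split_ifs <;> omega
  · rw [key (fun l => if l = m - 2 then 1 else 0), sum_fin_delta, if_pos (by omega)]
    · intro l; unfold adjD; have := l.2; split_ifs <;> omega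

/-- The coordinates of a figure of type `D (m + 1)`. -/
def dD (m q q' : ℕ) (c : Bool) (k : ℕ) : ℤ :=
  if q + q' = 2 * m + 1 then
    if k + 1 < m then dch q q' (k + 1)
    else if q = m then (if c = decide (k = m) then -1 else 0)
    else (if c = decide (k = m) then 0 else 1)
  else if k + 1 < m then dch q q' (k + 1) + dch q q' (2 * m - (k + 1)) else dch q q' m

/-- The snake diagonal corresponding to the node `k`. -/
def nodeD (m k : ℕ) : ℕ := if k < m then k + 1 else m

/-- The figures of `-α k`: a diagonal of the snake or its antipode, respectively the snake diameter
in one of the two colors. -/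
def IsBD (m : ℕ) (F : DFig m) (k : ℕ) : Prop :=
  if k + 1 < m then (F.1.1 = k + 1 ∧ F.1.2.1 = k + 2) ∨ (F.1.1 + k + 1 = 2 * m ∧ F.1.2.1 + k = 2 * m)
  else F.1.1 = m ∧ F.1.2.1 = m + 1 ∧ F.1.2.2 = decide (k = m)

/-- Compatibility of figures of type `D`. -/
def fcD {m : ℕ} (F G : DFig m) : Prop :=
  if F.IsDiam ∧ G.IsDiam then (F.1.2.2 = G.1.2.2 ↔ F.1.1 ≠ G.1.1)
  else ¬ Crosses (snakePt (2 * m + 1) F.1.1) (snakePt (2 * m + 1) F.1.2.1)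
    (snakePt (2 * m + 1) G.1.1) (snakePt (2 * m + 1) G.1.2.1)

theorem dD_diam {m q q' : ℕ} (h : q + q' = 2 * m + 1) (c : Bool) (k : ℕ) :
    dD m q q' c k = if k + 1 < m then dch q q' (k + 1)
      else if q = m then (if c = decide (k = m) then -1 else 0)
      else (if c = decide (k = m) then 0 else 1) := if_pos h

theorem dD_not_diam {m q q' : ℕ} (h : q + q' ≠ 2 * m + 1) (c : Bool) (k : ℕ) :
    dD m q q' c k = if k + 1 < m then dch q q' (k + 1) + dch q q' (2 * m - (k + 1))
      else dch q q' m := if_neg h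

theorem nodeD_mod {m k : ℕ} (hk : k ≤ m) :
    (k + 1 < m ∧ nodeD m k = k + 1) ∨ (m ≤ k + 1 ∧ nodeD m k = m) := by
  unfold nodeD; split_ifs <;> omega

theorem dD_of_isBD {m k : ℕ} (hm : 3 ≤ m) (hk : k ≤ m) {F : DFig m} (h : IsBD m F k) {l : ℕ}
    (hl : l ≤ m) : dD m F.1.1 F.1.2.1 F.1.2.2 l = if l = k then -1 else 0 := by
  unfold IsBD at h
  split_ifs at h with h1
  · rcases h with ⟨e1, e2⟩ | ⟨e1, e2⟩
    all_goals
      rw [dD_not_diam (by omega)]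
      have a := dch_spec F.1.1 F.1.2.1 (l + 1)
      have b := dch_spec F.1.1 F.1.2.1 (2 * m - (l + 1))
      have c := dch_spec F.1.1 F.1.2.1 m
      split_ifs <;> omega
  · obtain ⟨e1, e2, e3⟩ := h
    rw [dD_diam (by omega), e3]
    have a := dch_spec F.1.1 F.1.2.1 (l + 1)
    by_cases h2 : l = m <;> by_cases h3 : k = m <;> simp only [h2, h3, decide_true, decide_false]
    all_goals split_ifs <;> first | omega | simp_all

theorem isBD_of_neg {m k : ℕ} {F : DFig m}
    (h : dD m F.1.1 F.1.2.1 F.1.2.2 k < 0) : IsBD m F k := by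
  have a := dch_spec F.1.1 F.1.2.1 (k + 1)
  have b := dch_spec F.1.1 F.1.2.1 (2 * m - (k + 1))
  have c := dch_spec F.1.1 F.1.2.1 m
  unfold IsBD
  by_cases hd : F.1.1 + F.1.2.1 = 2 * m + 1
  · rw [dD_diam hd] at h
    split_ifs at h with h1 h2 h3
    · omega
    · rw [if_neg h1]
      exact ⟨h2, by omega, h3⟩
    all_goals omega
  · rw [dD_not_diam hd] at h
    split_ifs at h with h1
    · rw [if_pos h1]
      clear c
      rcases a with a | a | a <;> rcases b with b | b | b <;> omega
    · omega

/-- A figure that is a snake diagonal `{q, q + 1}` represents the negative of a simple root. -/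
theorem isBD_of_snake {m : ℕ} {F : DFig m} (h : F.1.2.1 = F.1.1 + 1) :
    ∃ k ≤ m, nodeD m k % 2 = F.1.1 % 2 ∧ IsBD m F k := by
  obtain ⟨g1, g2, g3, g4, g5⟩ := F.2.1
  unfold IsBD
  rcases lt_trichotomy F.1.1 m with h1 | h1 | h1
  · refine ⟨F.1.1 - 1, by omega, ?_, ?_⟩
    · have := nodeD_mod (m := m) (k := F.1.1 - 1) (by omega)
      omega
    · rw [if_pos (by omega)]; omega
  · by_cases hc : F.1.2.2 = true
    · refine ⟨m, le_rfl, ?_, ?_⟩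
      · have := nodeD_mod (m := m) (k := m) le_rfl
        omega
      · rw [if_neg (by omega), hc]
        exact ⟨h1, by omega, by simp⟩
    · refine ⟨m - 1, by omega, ?_, ?_⟩
      · have := nodeD_mod (m := m) (k := m - 1) (by omega)
        omega
      · rw [if_neg (by omega)]
        refine ⟨h1, by omega, ?_⟩
        rw [Bool.eq_false_of_not_eq_true hc]
        symm
        rw [decide_eq_false_iff_not]
        omega
  · refine ⟨2 * m - 1 - F.1.1, by omega, ?_, ?_⟩
    · have := nodeD_mod (m := m) (k := 2 * m - 1 - F.1.1) (by omega)
      omega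
    · rw [if_pos (by omega)]; omega

theorem isBD_swpFigD {m e k : ℕ} (he : e < 2) (hk : k ≤ m) (hke : nodeD m k % 2 = e)
    {F : DFig m} (h : IsBD m F k) : IsBD m (swpFigD m e he F) k := by
  obtain ⟨g1, g2, -⟩ := F.2.1
  have key : F.1.2.1 = F.1.1 + 1 ∧ F.1.1 % 2 = e := by
    have := nodeD_mod hk
    unfold IsBD at h
    split_ifs at h with h1 <;> omega
  obtain ⟨h1, h2⟩ := swp_fixed (H := 2 * m + 1) (p := F.1.1) (by omega) key.2
  have e1 : (swpFigD m e he F).1.1 = F.1.1 := by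
    unfold swpFigD
    dsimp only
    rw [key.1, h1, h2, min_eq_right (by omega)]
  have e2 : (swpFigD m e he F).1.2.1 = F.1.2.1 := by
    unfold swpFigD
    dsimp only
    rw [key.1, h1, h2, max_eq_left (by omega)]
  have e3 : (swpFigD m e he F).1.2.2 = F.1.2.2 := by
    unfold swpFigD
    dsimp only
    rw [if_neg (by omega)]
  unfold IsBD at h ⊢
  rw [e1, e2, e3]
  exact h

theorem dD_swp_ne {m e k : ℕ} (he : e < 2) (hk : k ≤ m) (hke : nodeD m k % 2 = e)
    {F : DFig m} (hF : F.1.2.1 = F.1.1 + 1 → F.1.1 % 2 ≠ e) :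
    dD m (swpFigD m e he F).1.1 (swpFigD m e he F).1.2.1 (swpFigD m e he F).1.2.2 k
      = dD m F.1.1 F.1.2.1 F.1.2.2 k := by
  obtain ⟨g1, g2, -⟩ := F.2.1
  have hn := nodeD_mod hk
  have hsum := swp_add (m := m) (q := F.1.1) (q' := F.1.2.1) he (by omega) g2
  unfold swpFigD
  dsimp only
  by_cases hd : F.1.1 + F.1.2.1 = 2 * m + 1
  · rw [dD_diam (by rw [min_add_max]; exact hsum.2 hd), dD_diam hd]
    by_cases h1 : k + 1 < m
    · rw [if_pos h1, if_pos h1, dch_swp_ne he F.2.1 (by omega) (by omega)]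
    · have hlt := swp_lt he g1 g2 (fun h => hF h.2 h.1)
      have := swp_spec (H := 2 * m + 1) (e := e) (q := F.1.1) (by omega)
      have hq : F.1.1 ≠ m := fun h => hF (by omega) (by omega)
      rw [if_neg h1, if_neg h1, min_eq_left hlt.le, if_neg hq,
        if_neg (show ¬ swp (2 * m + 1) e F.1.1 = m by omega),
        if_neg (show ¬ (F.1.1 + F.1.2.1 = 2 * m + 1 ∧ m % 2 ≠ e) by omega)]
  · rw [dD_not_diam (by rw [min_add_max, ne_eq, hsum]; exact hd), dD_not_diam hd]
    by_cases h1 : k + 1 < m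
    · rw [if_pos h1, if_pos h1, dch_swp_ne he F.2.1 (by omega) (by omega),
        dch_swp_ne he F.2.1 (by omega) (by omega)]
    · rw [if_neg h1, if_neg h1, dch_swp_ne he F.2.1 (by omega) (by omega)]

/-- The analogue of `dch_swp_eq` in type `D`. At the fork, the coordinates of a colored diameter
record whether its color agrees with that of the snake diameter. -/
theorem dD_swp_eq {m e : ℕ} (hm : 3 ≤ m) {k : Fin (m + 1)} (he : e < 2)
    (hke : nodeD m k % 2 ≠ e) {F : DFig m} (hF : F.1.2.1 = F.1.1 + 1 → F.1.1 % 2 ≠ e) :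
    dD m (swpFigD m e he F).1.1 (swpFigD m e he F).1.2.1 (swpFigD m e he F).1.2.2 k
      = -dD m F.1.1 F.1.2.1 F.1.2.2 k
        + ∑ l : Fin (m + 1), adjD m k l * dD m F.1.1 F.1.2.1 F.1.2.2 l := by
  obtain ⟨g1, g2, -⟩ := F.2.1
  have hkm := k.2
  have hn := nodeD_mod (m := m) (k := k) (by omega)
  have hsum := swp_add (m := m) (q := F.1.1) (q' := F.1.2.1) he (by omega) g2
  have hn' : ¬(F.1.1 % 2 = e ∧ F.1.2.1 = F.1.1 + 1) := fun h => hF h.2 h.1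
  have hlt := swp_lt he g1 g2 hn'
  rw [sum_adjD hm fun l => dD m F.1.1 F.1.2.1 F.1.2.2 l]
  have key := fun p h1 h2 h3 => dch_swp_eq he F.2.1 (p := p) h1 h2 h3 hn'
  have z0 := dch_zero F.2.1
  have z1 : dch F.1.1 F.1.2.1 (2 * m) = 0 := dch_last F.2.1
  unfold swpFigD
  dsimp only
  by_cases hd : F.1.1 + F.1.2.1 = 2 * m + 1
  · rw [dD_diam (by rw [min_add_max]; exact hsum.2 hd)]
    simp only [dD_diam hd]
    by_cases h1 : (k : ℕ) + 1 < m
    · rw [if_pos h1, if_pos h1, key (k + 1) (by omega) (by omega) (by omega)]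
      rw [Nat.add_sub_cancel, add_assoc (-_ : ℤ) _ _]
      congr 1
      by_cases h2 : (k : ℕ) + 2 < m
      · rw [if_pos h2, if_pos (show (k : ℕ) + 1 + 1 < m by omega)]
        by_cases h3 : (k : ℕ) = 0
        · rw [if_pos h3, h3, z0]
        · rw [if_neg h3, if_pos (by omega), Nat.sub_add_cancel (by omega)]
      · rw [if_neg h2, if_pos (show (k : ℕ) + 2 = m by omega), if_pos (by omega),
          Nat.sub_add_cancel (by omega), if_neg (show ¬ (m - 1 + 1 < m) by omega),
          if_neg (show ¬ (m + 1 < m) by omega), add_assoc (dch _ _ _) _ _]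
        congr 1
        rw [decide_eq_false (show m - 1 ≠ m by omega)]
        simp only [decide_true]
        have := dch_spec F.1.1 F.1.2.1 (k + 1 + 1)
        cases F.1.2.2 <;> simp <;> split_ifs <;> omega
    · rw [if_neg h1, if_neg h1, if_neg (show ¬ (k : ℕ) + 2 < m by omega),
        if_neg (show ¬ (k : ℕ) + 2 = m by omega), if_pos (show m - 2 + 1 < m by omega),
        if_pos (show F.1.1 + F.1.2.1 = 2 * m + 1 ∧ m % 2 ≠ e from ⟨hd, by omega⟩),
        min_eq_left hlt.le]
      have h2 := swp_spec (H := 2 * m + 1) (e := e) (q := F.1.1) (by omega)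
      have h3 := dch_spec F.1.1 F.1.2.1 (m - 2 + 1)
      generalize decide ((k : ℕ) = m) = d
      generalize swp (2 * m + 1) e F.1.1 = x at *
      clear key hsum
      cases F.1.2.2 <;> cases d <;> simp <;> split_ifs <;> omega
  · rw [dD_not_diam (by rw [min_add_max, ne_eq, hsum]; exact hd)]
    simp only [dD_not_diam hd]
    by_cases h1 : (k : ℕ) + 1 < m
    · rw [if_pos h1, if_pos h1, key (k + 1) (by omega) (by omega) (by omega),
        key (2 * m - (k + 1)) (by omega) (by omega) (by omega)]
      rw [Nat.add_sub_cancel]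
      by_cases h2 : (k : ℕ) + 2 < m
      · rw [if_pos h2, if_pos (show (k : ℕ) + 1 + 1 < m by omega),
          show 2 * m - ((k : ℕ) + 1) - 1 = 2 * m - (k + 1 + 1) by omega]
        by_cases h3 : (k : ℕ) = 0
        · rw [if_pos h3, h3, z0, show 2 * m - (0 + 1) + 1 = 2 * m by omega, z1]
          ring
        · rw [if_neg h3, if_pos (by omega), Nat.sub_add_cancel (by omega),
            show 2 * m - ((k : ℕ) + 1) + 1 = 2 * m - k by omega]
          ring
      · rw [if_neg h2, if_pos (show (k : ℕ) + 2 = m by omega), if_pos (by omega),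
          Nat.sub_add_cancel (by omega), if_neg (show ¬ (m - 1 + 1 < m) by omega),
          if_neg (show ¬ (m + 1 < m) by omega), show (k : ℕ) + 1 + 1 = m by omega,
          show 2 * m - ((k : ℕ) + 1) - 1 = m by omega,
          show 2 * m - ((k : ℕ) + 1) + 1 = 2 * m - k by omega]
        ring
    · rw [if_neg h1, if_neg h1, if_neg (show ¬ (k : ℕ) + 2 < m by omega),
        if_neg (show ¬ (k : ℕ) + 2 = m by omega), if_pos (show m - 2 + 1 < m by omega),
        key m (by omega) (by omega) (by omega), show m - 2 + 1 = m - 1 by omega,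
        show 2 * m - (m - 1) = m + 1 by omega]
      ring

theorem fcD_swpFigD {m e : ℕ} (he : e < 2) (F G : DFig m) :
    fcD (swpFigD m e he F) (swpFigD m e he G) ↔ fcD F G := by
  obtain ⟨f1, f2, -⟩ := F.2.1
  obtain ⟨g1, g2, -⟩ := G.2.1
  have hF : (swpFigD m e he F).IsDiam ↔ F.IsDiam := by
    unfold DFig.IsDiam swpFigD
    dsimp only
    rw [min_add_max, swp_add he (by omega) f2]
  have hG : (swpFigD m e he G).IsDiam ↔ G.IsDiam := by
    unfold DFig.IsDiam swpFigD
    dsimp only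
    rw [min_add_max, swp_add he (by omega) g2]
  unfold fcD
  simp only [hF, hG]
  by_cases hd : F.IsDiam ∧ G.IsDiam
  · rw [if_pos hd, if_pos hd]
    have hs := swp_add (m := m) (q := F.1.1) (q' := F.1.2.1) he (by omega) f2
    have hs' := swp_add (m := m) (q := G.1.1) (q' := G.1.2.1) he (by omega) g2
    have h1 : (swpFigD m e he F).1.1 = (swpFigD m e he G).1.1 ↔ F.1.1 = G.1.1 := by
      unfold swpFigD
      dsimp only
      unfold DFig.IsDiam at hd
      constructor
      · intro h
        have i1 := fun h => swp_inj (H := 2 * m + 1) (e := e) (q := F.1.1) (q' := G.1.1) he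
          (by omega) (by omega) h
        have i2 := fun h => swp_inj (H := 2 * m + 1) (e := e) (q := F.1.1) (q' := G.1.2.1) he
          (by omega) (by omega) h
        have : swp (2 * m + 1) e F.1.1 = swp (2 * m + 1) e G.1.1 ∨
            swp (2 * m + 1) e F.1.1 = swp (2 * m + 1) e G.1.2.1 := by omega
        rcases this with h | h
        · exact i1 h
        · have := i2 h; omega
      · intro h
        rw [h, show F.1.2.1 = G.1.2.1 by omega]
    have h2 : (swpFigD m e he F).1.2.2 = (swpFigD m e he G).1.2.2 ↔ F.1.2.2 = G.1.2.2 := by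
      have hd1 := hd.1
      have hd2 := hd.2
      unfold DFig.IsDiam at hd1 hd2
      unfold swpFigD
      dsimp only
      simp only [hd1, hd2, true_and]
      split_ifs <;> simp
    rw [ne_eq, ne_eq, h1, h2]
  · rw [if_neg hd, if_neg hd]
    unfold swpFigD
    dsimp only
    rw [crosses_minmax, crosses_snakePt_swp he (by omega) (by omega) (by omega) (by omega)]

theorem fcD_isBD_iff {m k : ℕ} (hm : 3 ≤ m) (G : DFig m) :
    (∀ F, IsBD m F k → fcD F G) ↔ dD m G.1.1 G.1.2.1 G.1.2.2 k = 0 := by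
  obtain ⟨g1, g2, -⟩ := G.2.1
  have hx := fun p (hp : p + 1 ≤ 2 * m + 1) => crosses_snakePt_iff hp g1 g2
  by_cases h1 : k + 1 < m
  · have key : (∀ F, IsBD m F k → fcD F G) ↔ dch G.1.1 G.1.2.1 (k + 1) = 0 ∧
        dch G.1.1 G.1.2.1 (2 * m - (k + 1)) = 0 := by
      have e1 := hx (k + 1) (by omega)
      have e2 := hx (2 * m - (k + 1)) (by omega)
      constructor
      · intro h
        have t1 := h ⟨(k + 1, k + 2, false), by unfold IsDiag; dsimp only; omega, fun _ => rfl⟩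
          (by unfold IsBD; rw [if_pos h1]; exact Or.inl ⟨rfl, rfl⟩)
        have t2 := h ⟨(2 * m - (k + 1), 2 * m - (k + 1) + 1, false),
            by unfold IsDiag; dsimp only; omega, fun _ => rfl⟩
          (by unfold IsBD; rw [if_pos h1]; dsimp only; omega)
        unfold fcD DFig.IsDiam at t1 t2
        dsimp only at t1 t2
        rw [if_neg (by omega)] at t1 t2
        rw [e1] at t1
        rw [e2] at t2
        exact ⟨not_not.1 t1, not_not.1 t2⟩
      · rintro ⟨t1, t2⟩ F hF
        unfold IsBD at hF
        rw [if_pos h1] at hF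
        unfold fcD DFig.IsDiam
        rw [if_neg (by omega)]
        rcases hF with ⟨h2, h3⟩ | ⟨h2, h3⟩
        · rw [h2, h3, e1]
          exact not_not.2 t1
        · rw [show F.1.1 = 2 * m - (k + 1) by omega, show F.1.2.1 = 2 * m - (k + 1) + 1 by omega,
            e2]
          exact not_not.2 t2
    rw [key]
    have a := dch_spec G.1.1 G.1.2.1 (k + 1)
    have b := dch_spec G.1.1 G.1.2.1 (2 * m - (k + 1))
    by_cases hd : G.1.1 + G.1.2.1 = 2 * m + 1
    · rw [dD_diam hd, if_pos h1]; omega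
    · rw [dD_not_diam hd, if_pos h1]; omega
  · have key : (∀ F, IsBD m F k → fcD F G) ↔
        fcD ⟨(m, m + 1, decide (k = m)), by unfold IsDiag; dsimp only; omega,
          fun h => absurd (by dsimp only; ring) h⟩ G := by
      constructor
      · intro h
        refine h _ ?_
        unfold IsBD
        rw [if_neg h1]
        exact ⟨rfl, rfl, rfl⟩
      · intro h F hF
        unfold IsBD at hF
        rw [if_neg h1] at hF
        have e : F.1 = (m, m + 1, decide (k = m)) := Prod.ext hF.1 (Prod.ext hF.2.1 hF.2.2)
        obtain ⟨F, hF'⟩ := F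
        dsimp only at e
        subst e
        exact h
    rw [key]
    unfold fcD DFig.IsDiam
    dsimp only
    by_cases hd : G.1.1 + G.1.2.1 = 2 * m + 1
    · rw [if_pos ⟨by ring, hd⟩, dD_diam hd, if_neg h1]
      generalize decide (k = m) = d
      by_cases h2 : G.1.1 = m
      · rw [if_pos h2, h2]; cases G.1.2.2 <;> cases d <;> simp
      · rw [if_neg h2]
        have h3 : m ≠ G.1.1 := fun h => h2 h.symm
        cases G.1.2.2 <;> cases d <;> simp [h3]
    · rw [if_neg (fun h => hd h.2), dD_not_diam hd, if_neg h1, hx m (by omega)]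
      exact not_not

/-- The model of type `D (m + 1)` by diagonals and colored diameters of a `(2 m + 2)`-gon. -/
def baseD (m : ℕ) (hm : 3 ≤ m) (η : Bool) : BaseModel (Fin (m + 1)) (DFig m) where
  T ε := swpFigD m (parOf η ε) (parOf_lt η ε)
  T_T ε F := by
    obtain ⟨f1, f2, -⟩ := F.2.1
    obtain ⟨h1, h2⟩ := min_max_swp (parOf_lt η ε) f1 f2
    have h3 := swp_add (m := m) (q := F.1.1) (q' := F.1.2.1) (parOf_lt η ε) (by omega) f2
    refine Subtype.ext (Prod.ext h1 (Prod.ext h2 ?_))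
    unfold swpFigD
    dsimp only
    simp only [min_add_max, h3]
    split_ifs <;> simp
  D F k := dD m F.1.1 F.1.2.1 F.1.2.2 k
  adj := adjD m
  s k := sgnOf η (nodeD m k)
  adj_sign k l h := by
    unfold adjD at h
    have hk := k.2
    have hl := l.2
    have h1 := nodeD_mod (m := m) (k := k) (by omega)
    have h2 := nodeD_mod (m := m) (k := l) (by omega)
    have h3 : ¬(nodeD m k % 2 = nodeD m l % 2) := by split_ifs at h <;> omega
    intro h4
    have h5 := sgnOf_ne_iff η (sgnOf η (nodeD m l)) (nodeD m k)
    have h6 := sgnOf_ne_iff η (sgnOf η (nodeD m l)) (nodeD m l)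
    have h7 := parOf_lt η (sgnOf η (nodeD m l))
    simp only [h4, ne_eq, not_true_eq_false, false_iff] at h5 h6
    omega
  IsB F k := IsBD m F k
  exists_isB k := by
    have hk := k.2
    by_cases h : (k : ℕ) + 1 < m
    · refine ⟨⟨(k + 1, k + 2, false), by unfold IsDiag; dsimp only; omega, fun _ => rfl⟩, ?_⟩
      unfold IsBD
      rw [if_pos h]
      exact Or.inl ⟨rfl, rfl⟩
    · refine ⟨⟨(m, m + 1, decide ((k : ℕ) = m)), by unfold IsDiag; dsimp only; omega,
        fun h => absurd (by dsimp only; ring) h⟩, ?_⟩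
      unfold IsBD
      rw [if_neg h]
      exact ⟨rfl, rfl, rfl⟩
  D_isB F k h l := by
    rw [dD_of_isBD hm (by have := k.2; omega) h (by have := l.2; omega)]
    simp only [Fin.ext_iff]
  isB_of_neg F k h := isBD_of_neg h
  T_isB ε F k hk h :=
    isBD_swpFigD _ (by have := k.2; omega) ((sgnOf_ne_iff η ε _).1 hk) h
  rec_ne ε F hF k hk := by
    refine dD_swp_ne _ (by have := k.2; omega) ((sgnOf_ne_iff η ε _).1 hk) fun h h' => ?_
    obtain ⟨l, h1, h2, h3⟩ := isBD_of_snake h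
    exact hF ⟨l, by omega⟩ ((sgnOf_ne_iff η ε _).2 (h2.trans h')) h3
  rec_eq ε F hF k hk := by
    refine dD_swp_eq hm _ ((sgnOf_eq_iff η ε _).1 hk) fun h h' => ?_
    obtain ⟨l, h1, h2, h3⟩ := isBD_of_snake h
    exact hF ⟨l, by omega⟩ ((sgnOf_ne_iff η ε _).2 (h2.trans h')) h3
  FC := fcD
  FC_T ε F G := fcD_swpFigD _ F G
  FC_b k G := fcD_isBD_iff hm G

end BaseModels

/-! ### Zigzags in an orbit and the Coxeter plane -/

section ZigZags

/-- Coefficients `κ p i` of a sequence of vectors `∑ i, κ p i • a i` that is generated from the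
simple root `i₀` by the recursion `κ (p + 1) + κ (p - 1) = 𝒜 κ p` for the weighted adjacency
matrix `𝒜` of the Coxeter diagram, and that stays nonnegative until it vanishes at `p = h`.
They are the differences of consecutive elements in the orbit of a fundamental weight under
alternating application of `c₊` and `c₋`. -/
structure ZigZag (α : Module.Basis (Fin n) ℝ V) (σ : Fin n → Bool) where
  h : ℕ
  three_le : 3 ≤ h
  i₀ : Fin n
  κ : ℕ → Fin n → ℝ
  nonneg : ∀ p i, 0 ≤ κ p i
  zero : ∀ i, κ 0 i = 0
  one : ∀ i, κ 1 i = if i = i₀ then 1 else 0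
  last : ∀ i, κ h i = 0
  supp : ∀ p i, κ p i ≠ 0 → σ i = sgnOf (σ i₀) p
  recur : ∀ p, 1 ≤ p → p < h → ∀ i, κ (p + 1) i + κ (p - 1) i
    = 2 * κ p i - ∑ i', ⟪nroot α i, nroot α i'⟫_ℝ * κ p i'
  exists_pos : ∀ p, 1 ≤ p → p < h → ∃ i, 0 < κ p i
  cover : ∀ i, ∃ p, 1 ≤ p ∧ p < h ∧ 0 < κ p i

theorem sgnOf_succ (η : Bool) (p : ℕ) : sgnOf η (p + 1) = !sgnOf η p := by
  unfold sgnOf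
  split_ifs <;> first | omega | simp

namespace ZigZag

variable {α : Module.Basis (Fin n) ℝ V} {σ : Fin n → Bool} (Z : ZigZag α σ)

/-- The difference vectors of the zigzag. -/
def v (p : ℕ) : V := ∑ i, Z.κ p i • nroot α i

/-- The sign of the simple root where the zigzag starts. -/
def η : Bool := σ Z.i₀

theorem κ_eq_zero {p : ℕ} {i : Fin n} (h : σ i ≠ sgnOf Z.η p) : Z.κ p i = 0 := by
  by_contra hc
  exact h (Z.supp p i hc)

theorem v_eq (p : ℕ) : Z.v p = ∑ i with σ i = sgnOf Z.η p, Z.κ p i • nroot α i := by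
  unfold v
  rw [Finset.sum_filter]
  refine Finset.sum_congr rfl fun i _ => ?_
  split_ifs with h
  · rfl
  · rw [Z.κ_eq_zero h, zero_smul]

theorem v_zero : Z.v 0 = 0 := by simp [v, Z.zero]

theorem v_last : Z.v Z.h = 0 := by simp [v, Z.last]

theorem inner_v {p : ℕ} (hp : 1 ≤ p) (hp' : p < Z.h) (i : Fin n) :
    ⟪nroot α i, Z.v p⟫_ℝ = 2 * Z.κ p i - Z.κ (p + 1) i - Z.κ (p - 1) i := by
  have h := Z.recur p hp hp' i
  unfold v
  rw [inner_sum]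
  simp only [real_inner_smul_right]
  rw [sub_sub, h, sub_sub_cancel]
  exact Finset.sum_congr rfl fun _ _ => mul_comm _ _

variable (x₀ : V) (t : ℝ)

/-- The elements of the zigzag starting at `x₀`. -/
def y (p : ℕ) : V := x₀ - t • ∑ q ∈ Finset.range p, Z.v q

theorem y_succ (p : ℕ) : Z.y x₀ t (p + 1) = Z.y x₀ t p - t • Z.v p := by
  unfold y
  rw [Finset.sum_range_succ, smul_add]; abel

theorem y_one : Z.y x₀ t 1 = x₀ := by simp [y, v_zero]

variable {x₀ t}

theorem inner_y (hx : ∀ j, ⟪nroot α j, x₀⟫_ℝ = if j = Z.i₀ then t else 0) {p : ℕ} (hp : 1 ≤ p)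
    (hp' : p ≤ Z.h) (i : Fin n) :
    ⟪nroot α i, Z.y x₀ t p⟫_ℝ = t * (Z.κ p i - Z.κ (p - 1) i) := by
  induction p, hp using Nat.le_induction with
  | base =>
    rw [y_one, hx, Z.one, Z.zero]
    split_ifs <;> ring
  | succ p hp ih =>
    rw [y_succ, inner_sub_right, ih (by omega), real_inner_smul_right, Z.inner_v hp (by omega),
      Nat.add_sub_cancel]
    ring

theorem cSign_y (hs : SignOrtho α σ)
    (hx : ∀ j, ⟪nroot α j, x₀⟫_ℝ = if j = Z.i₀ then t else 0) {p : ℕ} (hp : 1 ≤ p)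
    (hp' : p ≤ Z.h) : cSign α σ (sgnOf Z.η p) (Z.y x₀ t p) = Z.y x₀ t (p + 1) := by
  rw [cSign_apply hs, y_succ, v_eq, Finset.smul_sum]
  congr 1
  refine Finset.sum_congr rfl fun i hi => ?_
  simp only [Finset.mem_filter, Finset.mem_univ, true_and] at hi
  rw [Z.inner_y hx hp hp', smul_smul]
  have : Z.κ (p - 1) i = 0 := by
    refine Z.κ_eq_zero ?_
    rw [hi]
    obtain ⟨q, rfl⟩ : ∃ q, p = q + 1 := ⟨p - 1, by omega⟩
    rw [Nat.add_sub_cancel, sgnOf_succ]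
    simp
  rw [this, sub_zero]

theorem cSign_x₀ (hs : SignOrtho α σ)
    (hx : ∀ j, ⟪nroot α j, x₀⟫_ℝ = if j = Z.i₀ then t else 0) : cSign α σ (!Z.η) x₀ = x₀ := by
  rw [cSign_eq_self_iff hs]
  intro i hi
  rw [hx, if_neg]
  rintro rfl
  simp [η] at hi

theorem y_h_succ : Z.y x₀ t (Z.h + 1) = Z.y x₀ t Z.h := by
  rw [y_succ, v_last, smul_zero, sub_zero]

theorem y_injOn (ht : t ≠ 0) {p p' : ℕ} (hp : 1 ≤ p) (hp' : p' ≤ Z.h) (hlt : p < p') :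
    Z.y x₀ t p ≠ Z.y x₀ t p' := by
  intro h
  unfold y at h
  have h2 := smul_right_injective V ht (sub_right_injective h)
  rw [← Finset.sum_range_add_sum_Ico _ hlt.le, left_eq_add] at h2
  unfold v at h2
  rw [Finset.sum_comm] at h2
  simp only [← Finset.sum_smul] at h2
  obtain ⟨i, hi⟩ := Z.exists_pos p hp (by omega)
  have h3 := congrArg (fun v => α.repr v i) h2
  simp only [repr_sum_nroot] at h3
  have h4 : 0 < ∑ q ∈ Finset.Ico p p', Z.κ q i :=
    Finset.sum_pos' (fun q _ => Z.nonneg q i) ⟨p, Finset.mem_Ico.2 ⟨le_rfl, hlt⟩, hi⟩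
  have h5 := mul_pos h4 (nroot_scale_pos α i)
  rw [h3] at h5
  simp at h5

/-- The bipartite Coxeter element that moves along the zigzag. -/
def G : V ≃ₗᵢ[ℝ] V := cSign α σ Z.η * cSign α σ (!Z.η)

theorem coxElt_eq (hs : SignOrtho α σ) : coxElt α σ = Z.G ∨ coxElt α σ = Z.G⁻¹ := by
  unfold G coxElt
  rw [mul_inv_rev, cSign_inv hs, cSign_inv hs]
  cases Z.η <;> simp

theorem coxNum_eq (hs : SignOrtho α σ) : coxNum α σ = orderOf Z.G := by
  unfold coxNum
  rcases Z.coxElt_eq hs with h | h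
  · rw [h]
  · rw [h, orderOf_inv]

theorem cSign_G_zpow (hs : SignOrtho α σ) (ℓ : ℤ) (x : V) :
    cSign α σ (!Z.η) ((Z.G ^ ℓ) x) = (Z.G ^ (-ℓ)) (cSign α σ (!Z.η) x) := by
  have h : SemiconjBy (cSign α σ (!Z.η)) Z.G Z.G⁻¹ := by
    unfold SemiconjBy G
    rw [mul_inv_rev, cSign_inv hs, cSign_inv hs, mul_assoc]
  have h2 := (h.zpow_right ℓ).eq
  rw [inv_zpow'] at h2
  exact congrArg (fun g : V ≃ₗᵢ[ℝ] V => g x) h2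

theorem cSign_η (hs : SignOrtho α σ) (x : V) :
    cSign α σ Z.η x = Z.G (cSign α σ (!Z.η) x) := by
  change _ = cSign α σ Z.η (cSign α σ (!Z.η) (cSign α σ (!Z.η) x))
  rw [cSign_cSign hs]

theorem cSign_η_G_zpow (hs : SignOrtho α σ) (ℓ : ℤ) (x : V) :
    cSign α σ Z.η ((Z.G ^ ℓ) x) = (Z.G ^ (1 - ℓ)) (cSign α σ (!Z.η) x) := by
  rw [Z.cSign_η hs, Z.cSign_G_zpow hs, sub_eq_add_neg, zpow_add, zpow_one]
  rfl

/-- The position of the `p`-th element of the zigzag in the cycle of the Coxeter element. -/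
def cyc (p : ℕ) : ℤ := if p % 2 = 0 then ((p / 2 : ℕ) : ℤ) else 1 - ((p + 1) / 2 : ℕ)

theorem y_eq (hs : SignOrtho α σ) (hx : ∀ j, ⟪nroot α j, x₀⟫_ℝ = if j = Z.i₀ then t else 0)
    {p : ℕ} (hp : 1 ≤ p) (hp' : p ≤ Z.h + 1) : Z.y x₀ t p = (Z.G ^ cyc p) x₀ := by
  induction p, hp using Nat.le_induction with
  | base => rw [y_one]; simp [cyc]
  | succ p hp ih =>
    rw [← Z.cSign_y hs hx hp (by omega), ih (by omega)]
    rcases Nat.mod_two_eq_zero_or_one p with h | h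
    · rw [show sgnOf Z.η p = !Z.η by simp [sgnOf, h], Z.cSign_G_zpow hs, Z.cSign_x₀ hs hx,
        show -cyc p = cyc (p + 1) by unfold cyc; split_ifs <;> omega]
    · rw [show sgnOf Z.η p = Z.η by simp [sgnOf, h], Z.cSign_η_G_zpow hs, Z.cSign_x₀ hs hx,
        show 1 - cyc p = cyc (p + 1) by unfold cyc; split_ifs <;> omega]

theorem G_zpow_add_h (hs : SignOrtho α σ)
    (hx : ∀ j, ⟪nroot α j, x₀⟫_ℝ = if j = Z.i₀ then t else 0) (ℓ : ℤ) :
    (Z.G ^ (ℓ + Z.h)) x₀ = (Z.G ^ ℓ) x₀ := by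
  have h3 := Z.three_le
  have h1 : (Z.G ^ cyc (Z.h + 1)) x₀ = (Z.G ^ cyc Z.h) x₀ := by
    rw [← Z.y_eq hs hx (by omega) le_rfl, ← Z.y_eq hs hx (by omega) (by omega), y_h_succ]
  have h2 : (Z.G ^ (Z.h : ℤ)) x₀ = x₀ := by
    have key : ∀ a b : ℤ, (Z.G ^ a) x₀ = (Z.G ^ b) x₀ → (Z.G ^ (a - b)) x₀ = x₀ := by
      intro a b hab
      rw [sub_eq_neg_add, zpow_add]
      change (Z.G ^ (-b)) ((Z.G ^ a) x₀) = x₀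
      rw [hab, zpow_neg]
      exact (Z.G ^ b).symm_apply_apply x₀
    rcases Nat.mod_two_eq_zero_or_one Z.h with h | h
    · have := key _ _ h1.symm
      rwa [show cyc Z.h - cyc (Z.h + 1) = Z.h by unfold cyc; split_ifs <;> omega] at this
    · have := key _ _ h1
      rwa [show cyc (Z.h + 1) - cyc Z.h = Z.h by unfold cyc; split_ifs <;> omega] at this
  rw [zpow_add]
  change (Z.G ^ ℓ) ((Z.G ^ (Z.h : ℤ)) x₀) = _
  rw [h2]

theorem G_zpow_add_mul_h (hs : SignOrtho α σ)
    (hx : ∀ j, ⟪nroot α j, x₀⟫_ℝ = if j = Z.i₀ then t else 0) (ℓ k : ℤ) :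
    (Z.G ^ (ℓ + k * Z.h)) x₀ = (Z.G ^ ℓ) x₀ := by
  induction k using Int.induction_on with
  | zero => simp
  | succ k ih => rw [← ih, ← Z.G_zpow_add_h hs hx (ℓ + k * Z.h)]; congr 2; ring
  | pred k ih => rw [← ih, ← Z.G_zpow_add_h hs hx (ℓ + (-k - 1) * Z.h)]; congr 2; ring

/-- Every residue class is the position of an element of the zigzag. -/
theorem exists_cyc (ℓ : ℤ) : ∃ p, 1 ≤ p ∧ p ≤ Z.h ∧ ∃ k : ℤ, cyc p = ℓ + k * Z.h := by
  have h3 := Z.three_le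
  have h0 : (0 : ℤ) < Z.h := by omega
  have e := Int.emod_add_mul_ediv ℓ Z.h
  have h1 := Int.emod_nonneg ℓ h0.ne'
  have h2 := Int.emod_lt_of_pos ℓ h0
  generalize ℓ % (Z.h : ℤ) = r at *
  generalize ℓ / (Z.h : ℤ) = d at *
  lift r to ℕ using h1
  by_cases hr0 : r = 0
  · refine ⟨1, le_rfl, by omega, -d, ?_⟩
    rw [← e, hr0]
    simp [cyc]; ring
  · by_cases hr : 2 * r ≤ Z.h
    · refine ⟨2 * r, by omega, hr, -d, ?_⟩
      rw [← e, show cyc (2 * r) = r by unfold cyc; split_ifs <;> omega]; ring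
    · refine ⟨2 * (Z.h - r) + 1, by omega, by omega, -d - 1, ?_⟩
      rw [← e, show cyc (2 * (Z.h - r) + 1) = r - Z.h by unfold cyc; split_ifs <;> omega]; ring

/-- A stable set consisting of the zigzag that starts at a multiple `x₀` of a fundamental weight,
and possibly of elements on which the square of the Coxeter element is trivial. -/
structure Orbit (o : Set V) where
  x₀ : V
  t : ℝ
  t_ne : t ≠ 0
  weight : ∀ j, ⟪nroot α j, x₀⟫_ℝ = if j = Z.i₀ then t else 0
  mem : x₀ ∈ o
  closed : ∀ i, ∀ x ∈ o, refl (α i) x ∈ o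
  shape : ∀ x ∈ o, (∃ p, 1 ≤ p ∧ p ≤ Z.h ∧ x = Z.y x₀ t p) ∨ (Z.G (Z.G x) = x ∧ Even Z.h)

namespace Orbit

variable {Z} {o : Set V} (O : Z.Orbit o)
include O

theorem cSign_mem (ε : Bool) {x : V} (hx : x ∈ o) : cSign α σ ε x ∈ o :=
  orbitOf_subset α hx O.closed ⟨_, cSign_mem_weylGroup α σ ε, rfl⟩

theorem y_mem (hs : SignOrtho α σ) {p : ℕ} (hp : 1 ≤ p) (hp' : p ≤ Z.h) : Z.y O.x₀ O.t p ∈ o := by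
  induction p, hp using Nat.le_induction with
  | base => rw [y_one]; exact O.mem
  | succ p hp ih =>
    rw [← Z.cSign_y hs O.weight hp (by omega)]
    exact O.cSign_mem _ (ih (by omega))

theorem eq_zero_of_inner (hs : SignOrtho α σ) {u : V} (hu : ∀ x ∈ o, ⟪x, u⟫_ℝ = 0) : u = 0 := by
  refine eq_zero_of_inner_nroot α fun i => ?_
  obtain ⟨p, hp, hp', hpos⟩ := Z.cover i
  have h1 := hu _ (O.y_mem hs hp hp'.le)
  have h2 := hu _ (O.closed i _ (O.y_mem hs hp hp'.le))
  rw [refl_simple, inner_sub_left, h1, zero_sub, neg_eq_zero, real_inner_smul_left, mul_eq_zero,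
    Z.inner_y O.weight hp hp'.le] at h2
  refine h2.resolve_left (mul_ne_zero O.t_ne ?_)
  have : Z.κ (p - 1) i = 0 := by
    refine Z.κ_eq_zero ?_
    rw [Z.supp p i hpos.ne']
    obtain ⟨q, rfl⟩ : ∃ q, p = q + 1 := ⟨p - 1, by omega⟩
    rw [Nat.add_sub_cancel, sgnOf_succ]
    simp [η]
  rw [this, sub_zero]
  exact hpos.ne'

theorem G_pow_h (hs : SignOrtho α σ) : Z.G ^ Z.h = 1 := by
  have h1 : ∀ x ∈ o, (Z.G ^ Z.h) x = x := by
    intro x hx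
    rcases O.shape x hx with ⟨p, hp, hp', rfl⟩ | ⟨h, k, hk⟩
    · have h := Z.G_zpow_add_h hs O.weight (cyc p)
      rw [← Z.y_eq hs O.weight hp (by omega), add_comm, zpow_add, zpow_natCast] at h
      rw [Z.y_eq hs O.weight hp (by omega)]
      exact h.trans (by rw [Z.y_eq hs O.weight hp (by omega)])
    · rw [hk, ← two_mul, pow_mul]
      have h' : (Z.G ^ 2) x = x := by rw [pow_two]; exact h
      clear hk
      induction k with
      | zero => rfl
      | succ k ih =>
        rw [pow_succ]
        change ((Z.G ^ 2) ^ k) ((Z.G ^ 2) x) = x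
        rw [h', ih]
  ext u
  rw [← sub_eq_zero]
  refine O.eq_zero_of_inner hs fun x hx => ?_
  rw [inner_sub_right, sub_eq_zero]
  nth_rewrite 1 [← h1 x hx]
  exact (Z.G ^ Z.h).inner_map_map x u

theorem coxNum_eq (hs : SignOrtho α σ) : coxNum α σ = Z.h := by
  rw [Z.coxNum_eq hs, orderOf_eq_iff (by have := Z.three_le; omega)]
  refine ⟨O.G_pow_h hs, fun m hm hm0 h => ?_⟩
  have h1 : (Z.G ^ (m : ℤ)) O.x₀ = O.x₀ := by rw [zpow_natCast, h]; rfl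
  obtain ⟨p, hp, hp', k, hk⟩ := Z.exists_cyc m
  have h2 := Z.y_eq hs O.weight hp (by omega)
  rw [hk, Z.G_zpow_add_mul_h hs O.weight, h1] at h2
  by_cases h3 : p = 1
  · subst h3
    have h4 : (m : ℤ) = -k * Z.h := by
      rw [show cyc 1 = 0 by simp [cyc]] at hk
      linarith
    have h5 : (Z.h : ℤ) ∣ m := ⟨-k, by rw [h4]; ring⟩
    have := Nat.le_of_dvd hm0 (by exact_mod_cast h5)
    omega
  · refine Z.y_injOn (x₀ := O.x₀) O.t_ne le_rfl hp' (by omega) ?_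
    rw [h2, y_one]

end Orbit

/-- The components of the Perron–Frobenius eigenvector of the Coxeter diagram. -/
def Φ (i : Fin n) : ℝ := ∑ p ∈ Finset.range Z.h, Real.sin (π * p / Z.h) * Z.κ p i

theorem Φ_pos (i : Fin n) : 0 < Z.Φ i := by
  have h3 := Z.three_le
  have hh : (0 : ℝ) < Z.h := by exact_mod_cast (by omega : 0 < Z.h)
  have hpi := Real.pi_pos
  obtain ⟨p, hp, hp', hpos⟩ := Z.cover i
  refine Finset.sum_pos' (fun q hq => mul_nonneg ?_ (Z.nonneg q i))
    ⟨p, Finset.mem_range.2 hp', mul_pos ?_ hpos⟩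
  · have hq' : (q : ℝ) ≤ Z.h := by exact_mod_cast (Finset.mem_range.1 hq).le
    refine Real.sin_nonneg_of_nonneg_of_le_pi (by positivity) ?_
    rw [div_le_iff₀ hh]
    exact mul_le_mul_of_nonneg_left hq' hpi.le
  · have hq : (0 : ℝ) < p := by exact_mod_cast hp
    have hq' : (p : ℝ) < Z.h := by exact_mod_cast hp'
    refine Real.sin_pos_of_pos_of_lt_pi (by positivity) ?_
    rw [div_lt_iff₀ hh]
    exact mul_lt_mul_of_pos_left hq' hpi

theorem gram_Φ (i : Fin n) : ∑ i', ⟪nroot α i, nroot α i'⟫_ℝ * Z.Φ i'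
    = 2 * Z.Φ i - 2 * Real.cos (π / Z.h) * Z.Φ i := by
  have h3 := Z.three_le
  have hh : (Z.h : ℝ) ≠ 0 := by exact_mod_cast (by omega : Z.h ≠ 0)
  set φ : ℕ → ℝ := fun p => Real.sin (π * p / Z.h) with hφ
  have φ0 : φ 0 = 0 := by simp [hφ]
  have φh : φ Z.h = 0 := by simp [hφ, mul_div_assoc, div_self hh]
  have hrec : ∀ p, 1 ≤ p → φ (p - 1) + φ (p + 1) = 2 * Real.cos (π / Z.h) * φ p := by
    intro p hp
    simp only [hφ]
    rw [Nat.cast_sub hp, Nat.cast_add, Nat.cast_one,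
      show π * ((p : ℝ) - 1) / Z.h = π * p / Z.h - π / Z.h by ring,
      show π * ((p : ℝ) + 1) / Z.h = π * p / Z.h + π / Z.h by ring,
      Real.sin_sub, Real.sin_add]
    ring
  have h1 : ∑ i', ⟪nroot α i, nroot α i'⟫_ℝ * Z.Φ i' = ∑ p ∈ Finset.range Z.h,
      φ p * ∑ i', ⟪nroot α i, nroot α i'⟫_ℝ * Z.κ p i' := by
    unfold Φ
    simp only [Finset.mul_sum]
    rw [Finset.sum_comm]
    refine Finset.sum_congr rfl fun p _ => Finset.sum_congr rfl fun i' _ => ?_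
    simp only [hφ]; ring
  have h2 : ∀ p ∈ Finset.range Z.h, φ p * ∑ i', ⟪nroot α i, nroot α i'⟫_ℝ * Z.κ p i'
      = 2 * (φ p * Z.κ p i) - (φ p * Z.κ (p + 1) i + φ p * Z.κ (p - 1) i) := by
    intro p hp
    rcases Nat.eq_zero_or_pos p with rfl | hp0
    · simp [φ0]
    · have := Z.recur p hp0 (Finset.mem_range.1 hp) i
      rw [← mul_add, this]; ring
  obtain ⟨h', hh'⟩ : ∃ h', Z.h = h' + 1 := ⟨Z.h - 1, by omega⟩
  have h4 : ∑ p ∈ Finset.range Z.h, φ p * Z.κ (p + 1) i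
      = ∑ p ∈ Finset.range Z.h, φ (p - 1) * Z.κ p i := by
    rw [hh', Finset.sum_range_succ, Finset.sum_range_succ', ← hh', Z.last, Z.zero]
    simp
  have h5 : ∑ p ∈ Finset.range Z.h, φ p * Z.κ (p - 1) i
      = ∑ p ∈ Finset.range Z.h, φ (p + 1) * Z.κ p i := by
    rw [hh', Finset.sum_range_succ', Finset.sum_range_succ (fun p => φ (p + 1) * Z.κ p i), ← hh',
      φ0, φh]
    simp
  rw [h1, Finset.sum_congr rfl h2, Finset.sum_sub_distrib, Finset.sum_add_distrib, h4, h5,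
    ← Finset.mul_sum, ← Finset.sum_add_distrib]
  unfold Φ
  rw [Finset.mul_sum _ _ (2 * Real.cos (π / Z.h))]
  congr 1
  refine Finset.sum_congr rfl fun p _ => ?_
  rcases Nat.eq_zero_or_pos p with rfl | hp0
  · simp [Z.zero]
  · rw [← add_mul, hrec p hp0]
    simp only [hφ]; ring

/-- The two vectors that span the Coxeter plane. -/
def u (ε : Bool) : V := ∑ i with σ i = ε, Z.Φ i • nroot α i

theorem inner_u_same (hs : SignOrtho α σ) {ε : Bool} {i : Fin n} (hi : σ i = ε) :
    ⟪nroot α i, Z.u ε⟫_ℝ = 2 * Z.Φ i := inner_nroot_sum hs ε _ i hi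

theorem inner_u_ne (hs : SignOrtho α σ) {ε : Bool} {i : Fin n} (hi : σ i ≠ ε) :
    ⟪nroot α i, Z.u ε⟫_ℝ = -(2 * Real.cos (π / Z.h) * Z.Φ i) := by
  have h1 : Z.u ε + Z.u (!ε) = ∑ j, Z.Φ j • nroot α j := by
    unfold u
    rw [Finset.sum_filter, Finset.sum_filter, ← Finset.sum_add_distrib]
    refine Finset.sum_congr rfl fun j _ => ?_
    cases σ j <;> cases ε <;> simp
  have h2 : ⟪nroot α i, ∑ j, Z.Φ j • nroot α j⟫_ℝ
      = 2 * Z.Φ i - 2 * Real.cos (π / Z.h) * Z.Φ i := by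
    rw [← Z.gram_Φ, inner_sum]
    refine Finset.sum_congr rfl fun j _ => ?_
    rw [real_inner_smul_right, mul_comm]
  have h3 := Z.inner_u_same hs (ε := !ε) (i := i) (Bool.eq_not_of_ne hi)
  rw [← h1, inner_add_right, h3] at h2
  linarith

theorem cSign_u_same (hs : SignOrtho α σ) (ε : Bool) : cSign α σ ε (Z.u ε) = -Z.u ε := by
  rw [cSign_apply hs]
  have : ∑ i with σ i = ε, ⟪nroot α i, Z.u ε⟫_ℝ • nroot α i = (2 : ℝ) • Z.u ε := by
    rw [u, Finset.smul_sum]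
    refine Finset.sum_congr rfl fun i hi => ?_
    rw [← u, Z.inner_u_same hs (by simpa using hi), mul_smul]
  rw [this, two_smul]; abel

theorem cSign_u_ne (hs : SignOrtho α σ) (ε : Bool) :
    cSign α σ (!ε) (Z.u ε) = Z.u ε + (2 * Real.cos (π / Z.h)) • Z.u (!ε) := by
  rw [cSign_apply hs, sub_eq_add_neg]
  congr 1
  unfold u
  rw [Finset.smul_sum, ← Finset.sum_neg_distrib]
  refine Finset.sum_congr rfl fun i hi => ?_
  have hi' : σ i ≠ ε := by
    simp only [Finset.mem_filter, Finset.mem_univ, true_and] at hi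
    rw [hi]; simp
  have := Z.inner_u_ne hs hi'
  unfold u at this
  rw [this, neg_smul, neg_neg, mul_smul]

theorem u_mem_coxPlane (hs : SignOrtho α σ) (hc : coxNum α σ = Z.h) (ε : Bool) :
    Z.u ε ∈ coxPlane α σ := by
  have key : ∀ ε, cSign α σ ε (cSign α σ (!ε) (Z.u ε)) + cSign α σ (!ε) (cSign α σ ε (Z.u ε))
      = (2 * Real.cos (2 * π / Z.h)) • Z.u ε := by
    intro ε
    have h2 := Z.cSign_u_ne hs (!ε)
    rw [Bool.not_not] at h2
    rw [Z.cSign_u_ne hs, Z.cSign_u_same hs, map_add, Z.cSign_u_same hs, map_smul, h2, map_neg,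
      Z.cSign_u_ne hs, mul_div_assoc, Real.cos_two_mul]
    module
  change coxElt α σ (Z.u ε) + (coxElt α σ)⁻¹ (Z.u ε) = _
  rw [hc]
  unfold coxElt
  rw [mul_inv_rev, cSign_inv hs, cSign_inv hs]
  change cSign α σ false (cSign α σ true (Z.u ε)) + cSign α σ true (cSign α σ false (Z.u ε)) = _
  cases ε
  · exact key false
  · rw [add_comm]; exact key true

include Z in
theorem exists_sign (ε : Bool) : ∃ i, σ i = ε := by
  have h3 := Z.three_le
  obtain ⟨i, hi⟩ := Z.exists_pos 2 (by omega) (by omega)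
  have h1 := Z.supp 2 i hi.ne'
  by_cases h : σ Z.i₀ = ε
  · exact ⟨_, h⟩
  · refine ⟨i, ?_⟩
    rw [h1]
    revert h
    cases ε <;> cases σ Z.i₀ <;> simp [sgnOf]

theorem linearIndependent_u :
    LinearIndependent ℝ ![Z.u true, Z.u false] := by
  rw [LinearIndependent.pair_iff]
  intro a b hab
  have h := fun i => congrArg (fun v => α.repr v i) hab
  simp only [u, map_add, map_smul, Finsupp.add_apply, Finsupp.smul_apply, repr_sum_filter,
    smul_eq_mul, map_zero, Finsupp.zero_apply] at h
  obtain ⟨i, hi⟩ := Z.exists_sign true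
  obtain ⟨j, hj⟩ := Z.exists_sign false
  have h1 := h i
  have h2 := h j
  simp only [hi, hj, if_true, if_false, Bool.true_eq_false, Bool.false_eq_true, mul_zero, add_zero,
    zero_add, mul_eq_zero, (Z.Φ_pos _).ne', (nroot_scale_pos α _).ne', or_false] at h1 h2
  exact ⟨h1, h2⟩

theorem mem_coxPlane_iff (hs : SignOrtho α σ) (hc : coxNum α σ = Z.h) (v : V) :
    v ∈ coxPlane α σ ↔ Z.G v + Z.G⁻¹ v = (2 * Real.cos (2 * π / Z.h)) • v := by
  change coxElt α σ v + (coxElt α σ)⁻¹ v = _ ↔ _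
  rw [hc]
  rcases Z.coxElt_eq hs with h | h
  · rw [h]
  · rw [h, inv_inv, add_comm]

theorem cos_two_pi_div_lt : Real.cos (2 * π / Z.h) ≠ 1 ∧ Real.cos (2 * π / Z.h) ≠ -1 := by
  have h3 : (3 : ℝ) ≤ Z.h := by exact_mod_cast Z.three_le
  have hpi := Real.pi_pos
  have h1 : 0 < 2 * π / Z.h := by positivity
  have h2 : 2 * π / Z.h < π := by rw [div_lt_iff₀ (by linarith)]; nlinarith
  constructor
  · intro h
    have := (Real.cos_eq_one_iff_of_lt_of_lt (by linarith) (by linarith)).1 h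
    linarith
  · intro h
    have h4 := Real.strictAntiOn_cos ⟨h1.le, h2.le⟩ ⟨hpi.le, le_rfl⟩ h2
    rw [Real.cos_pi] at h4
    linarith

/-- A vector on which the square of the Coxeter element is trivial projects to the origin. -/
theorem inner_eq_zero_of_G_G (hs : SignOrtho α σ) (hc : coxNum α σ = Z.h) {x v : V}
    (hx : Z.G (Z.G x) = x) (hv : v ∈ coxPlane α σ) : ⟪x, v⟫_ℝ = 0 := by
  rw [Z.mem_coxPlane_iff hs hc] at hv
  set C := Real.cos (2 * π / Z.h)
  have h1 : Z.G⁻¹ x = Z.G x := by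
    nth_rewrite 1 [← hx]
    exact Z.G.symm_apply_apply _
  have e1 : ∀ w, ⟪w, Z.G v⟫_ℝ = ⟪Z.G⁻¹ w, v⟫_ℝ := fun w => by
    rw [← Z.G.inner_map_map (Z.G⁻¹ w)]
    congr 1
    exact (Z.G.apply_symm_apply w).symm
  have e2 : ∀ w, ⟪w, Z.G⁻¹ v⟫_ℝ = ⟪Z.G w, v⟫_ℝ := fun w => by
    rw [← Z.G.inner_map_map w]
    congr 1
    exact (Z.G.apply_symm_apply v)
  have k1 := congrArg (fun u => ⟪x, u⟫_ℝ) hv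
  have k2 := congrArg (fun u => ⟪Z.G x, u⟫_ℝ) hv
  have h5 : Z.G⁻¹ (Z.G x) = x := Z.G.symm_apply_apply _
  simp only [inner_add_right, real_inner_smul_right, e1, e2, h1, hx, h5] at k1 k2
  obtain ⟨c1, c2⟩ := Z.cos_two_pi_div_lt
  have k3 : (C - 1) * (C + 1) * ⟪x, v⟫_ℝ = 0 := by
    have a1 : ⟪Z.G x, v⟫_ℝ = C * ⟪x, v⟫_ℝ := by linarith
    rw [a1] at k2
    linear_combination (-1 / 2 : ℝ) * k2
  rw [mul_eq_zero, mul_eq_zero, sub_eq_zero, ← eq_neg_iff_add_eq_zero] at k3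
  rcases k3 with (h | h) | h
  · exact absurd h c1
  · exact absurd h c2
  · exact h

namespace Orbit

variable {Z} {o : Set V} (O : Z.Orbit o)
include O

/-- A vector of the plane is determined by its inner products with `x₀` and `G x₀`, since those with
the other elements of the zigzag follow by a recursion of order two. Conversely, the two sign parts
of the Perron–Frobenius eigenvector are independent elements of the plane. -/
theorem finrank_coxPlane [FiniteDimensional ℝ V] (hs : SignOrtho α σ) :
    Module.finrank ℝ (coxPlane α σ) = 2 := by
  have hc := O.coxNum_eq hs
  apply le_antisymm
  · let L : coxPlane α σ →ₗ[ℝ] ℝ × ℝ :=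
      ((innerₛₗ ℝ O.x₀).comp (coxPlane α σ).subtype).prod
        ((innerₛₗ ℝ (Z.G O.x₀)).comp (coxPlane α σ).subtype)
    have hL : Function.Injective L := by
      rw [← LinearMap.ker_eq_bot, LinearMap.ker_eq_bot']
      rintro ⟨v, hv⟩ h0
      have h1 : ⟪O.x₀, v⟫_ℝ = 0 := congrArg Prod.fst h0
      have h2 : ⟪Z.G O.x₀, v⟫_ℝ = 0 := congrArg Prod.snd h0
      have hv' := (Z.mem_coxPlane_iff hs hc v).1 hv
      have e1 : ∀ w, ⟪w, Z.G⁻¹ v⟫_ℝ = ⟪Z.G w, v⟫_ℝ := fun w => by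
        rw [← Z.G.inner_map_map w]
        congr 1
        exact (Z.G.apply_symm_apply v)
      have e2 : ∀ w, ⟪Z.G w, Z.G v⟫_ℝ = ⟪w, v⟫_ℝ := fun w => Z.G.inner_map_map w v
      have key : ∀ k : ℕ, ⟪(Z.G ^ k) O.x₀, v⟫_ℝ = 0 ∧ ⟪(Z.G ^ (k + 1)) O.x₀, v⟫_ℝ = 0 := by
        intro k
        induction k with
        | zero => exact ⟨h1, by simpa using h2⟩
        | succ k ih =>
          refine ⟨ih.2, ?_⟩
          have h3 := congrArg (fun u => ⟪(Z.G ^ (k + 1)) O.x₀, u⟫_ℝ) hv'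
          simp only [inner_add_right, real_inner_smul_right, ih.2, mul_zero, e1] at h3
          have h4 : (Z.G ^ (k + 1)) O.x₀ = Z.G ((Z.G ^ k) O.x₀) := by rw [pow_succ']; rfl
          rw [h4, e2, ih.1, zero_add, ← h4] at h3
          rw [pow_succ']
          exact h3
      have : v = 0 := by
        refine O.eq_zero_of_inner hs fun x hx => ?_
        rcases O.shape x hx with ⟨p, hp, hp', rfl⟩ | ⟨h, -⟩
        · rw [Z.y_eq hs O.weight hp (by omega)]
          have h5 : (Z.G ^ cyc p) O.x₀ = (Z.G ^ (cyc p % (Z.h : ℤ))) O.x₀ := by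
            rw [← Z.G_zpow_add_mul_h hs O.weight (cyc p % (Z.h : ℤ)) (cyc p / (Z.h : ℤ)),
              mul_comm, Int.emod_add_mul_ediv]
          have h6 := Int.emod_nonneg (cyc p) (show (Z.h : ℤ) ≠ 0 by have := Z.three_le; omega)
          rw [h5]
          lift cyc p % (Z.h : ℤ) to ℕ using h6 with k
          rw [zpow_natCast]
          exact (key k).1
        · exact Z.inner_eq_zero_of_G_G hs hc h hv
      exact Subtype.ext this
    have := LinearMap.finrank_le_finrank_of_injective hL
    simpa using this
  · have h1 := Z.linearIndependent_u
    let b : Fin 2 → coxPlane α σ :=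
      ![⟨Z.u true, Z.u_mem_coxPlane hs hc true⟩, ⟨Z.u false, Z.u_mem_coxPlane hs hc false⟩]
    have h2 : LinearIndependent ℝ b := by
      refine LinearIndependent.of_comp (coxPlane α σ).subtype ?_
      convert h1 using 1
      ext k
      fin_cases k <;> rfl
    simpa using h2.fintype_card_le_finrank

end Orbit

end ZigZag

end ZigZags

/-! ### The projection of the orbit to the Coxeter plane -/

section Projection

/-- The points `exp (k π i / h)`. -/
def hst (h : ℕ) (k : ℤ) : ℂ := Complex.exp (((π * k / h : ℝ) : ℂ) * Complex.I)

theorem hst_add (h : ℕ) (k l : ℤ) : hst h (k + l) = hst h k * hst h l := by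
  unfold hst
  rw [← Complex.exp_add]
  congr 1
  push_cast
  ring

theorem hst_zero (h : ℕ) : hst h 0 = 1 := by simp [hst]

theorem hst_ne_zero (h : ℕ) (k : ℤ) : hst h k ≠ 0 := Complex.exp_ne_zero _

theorem hst_norm (h : ℕ) (k : ℤ) : ‖hst h k‖ = 1 := Complex.norm_exp_ofReal_mul_I _

theorem hst_re (h : ℕ) (k : ℤ) : (hst h k).re = Real.cos (π * k / h) :=
  Complex.exp_ofReal_mul_I_re _

theorem hst_im (h : ℕ) (k : ℤ) : (hst h k).im = Real.sin (π * k / h) :=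
  Complex.exp_ofReal_mul_I_im _

theorem hst_conj (h : ℕ) (k : ℤ) : (starRingEnd ℂ) (hst h k) = hst h (-k) := by
  apply Complex.ext
  · rw [Complex.conj_re, hst_re, hst_re, ← Real.cos_neg]
    congr 1; push_cast; ring
  · rw [Complex.conj_im, hst_im, hst_im, ← Real.sin_neg]
    congr 1; push_cast; ring

theorem hst_im_eq_zero_iff {h : ℕ} (hh : h ≠ 0) (k : ℤ) : (hst h k).im = 0 ↔ (h : ℤ) ∣ k := by
  have hh' : (h : ℝ) ≠ 0 := by exact_mod_cast hh
  rw [hst_im, Real.sin_eq_zero_iff]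
  constructor
  · rintro ⟨m, hm⟩
    refine ⟨m, ?_⟩
    rw [eq_div_iff hh'] at hm
    have h2 : π * ((k : ℝ) - h * m) = 0 := by linear_combination -hm
    rcases mul_eq_zero.1 h2 with h3 | h3
    · exact absurd h3 Real.pi_ne_zero
    · have : (k : ℝ) = ((h * m : ℤ) : ℝ) := by push_cast; linarith
      exact_mod_cast this
  · rintro ⟨m, rfl⟩
    refine ⟨m, ?_⟩
    push_cast
    field_simp

/-- The points `Q k = r exp (i t k)` of an increasing sequence of angles that turns once around
the circle in `N` steps are ordered by their arguments as by their indices, up to a rotation. -/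
theorem exists_ncard_arg_lt {N : ℕ} (hN : 0 < N) {t : ℤ → ℝ} (ht : StrictMono t)
    (htN : ∀ k, t (k + N) = t k + 2 * π) {r : ℝ} (hr : 0 < r) :
    ∃ K : ℤ, ∀ k : ℤ, ∃ j : ℤ,
      (({b ∈ Set.range fun k => (r : ℂ) * Complex.exp (t k * Complex.I) |
        b.arg < ((r : ℂ) * Complex.exp (t k * Complex.I)).arg}.ncard : ℕ) : ℤ) = k + K + N * j := by
  have hpi := Real.pi_pos
  have hper : ∀ k j : ℤ, t (k + N * j) = t k + 2 * π * j := by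
    intro k j
    induction j using Int.induction_on with
    | zero => simp
    | succ j ih =>
      rw [show k + (N : ℤ) * (j + 1) = k + N * j + N by ring, htN, ih]; push_cast; ring
    | pred j ih =>
      have := htN (k + N * (-j - 1))
      rw [show k + (N : ℤ) * (-j - 1) + N = k + N * -j by ring, ih] at this
      push_cast at this ⊢; linarith
  obtain ⟨K, hK, hKmin⟩ := Int.exists_least_of_bdd (P := fun k => -π < t k) (by
      obtain ⟨j, hj⟩ := exists_nat_gt ((t 0 + π) / (2 * π))
      rw [div_lt_iff₀ (by positivity)] at hj
      refine ⟨0 + N * (-j : ℤ), fun z hz => ?_⟩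
      have h1 : t (0 + N * (-j : ℤ)) < t z := by
        rw [hper]; push_cast; linarith
      exact (ht.lt_iff_lt.1 h1).le) (by
      obtain ⟨j, hj⟩ := exists_nat_gt ((-t 0 - π) / (2 * π))
      rw [div_lt_iff₀ (by positivity)] at hj
      refine ⟨0 + N * (j : ℤ), ?_⟩
      rw [hper]; push_cast; linarith)
  set Q : ℤ → ℂ := fun k => (r : ℂ) * Complex.exp (t k * Complex.I) with hQ
  have hlast : ∀ k < K + N, t k ≤ π := by
    intro k hk
    have h1 : ¬ -π < t (k - N) := fun h => by have := hKmin _ h; omega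
    have h2 := htN (k - N)
    rw [sub_add_cancel] at h2
    linarith
  have harg : ∀ k, K ≤ k → k < K + N → (Q k).arg = t k := by
    intro k h1 h2
    have h3 := ht.monotone h1
    simp only [hQ]
    rw [Complex.arg_real_mul _ hr, Complex.arg_exp_mul_I, toIocMod_eq_self]
    refine ⟨by linarith, ?_⟩
    have := hlast k h2
    linarith
  have hQper : ∀ k j : ℤ, Q (k + N * j) = Q k := by
    intro k j
    simp only [hQ, hper]
    congr 1
    rw [Complex.exp_eq_exp_iff_exists_int]
    exact ⟨j, by push_cast; ring⟩
  have hrep : ∀ k : ℤ, ∃ k' j, K ≤ k' ∧ k' < K + N ∧ k' = k + N * j := by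
    intro k
    have h0 : (N : ℤ) ≠ 0 := by omega
    have e := Int.emod_add_mul_ediv (k - K) N
    have h1 := Int.emod_nonneg (k - K) h0
    have h2 := Int.emod_lt_of_pos (k - K) (show (0 : ℤ) < N by omega)
    refine ⟨K + (k - K) % N, -((k - K) / N), by omega, by omega, ?_⟩
    rw [mul_neg]
    omega
  refine ⟨-K, fun k => ?_⟩
  obtain ⟨k', j, h1, h2, h3⟩ := hrep k
  refine ⟨j, ?_⟩
  have hQk : (r : ℂ) * Complex.exp (t k * Complex.I) = Q k' := by
    rw [h3, hQper]
  have hset : {b ∈ Set.range Q | b.arg < (Q k').arg} = Q '' (Finset.Ico K k' : Finset ℤ) := by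
    ext b
    simp only [Set.mem_ofPred_eq, Set.mem_range, Set.mem_image, Finset.coe_Ico, Set.mem_Ico]
    constructor
    · rintro ⟨⟨l, rfl⟩, hl⟩
      obtain ⟨l', j', g1, g2, g3⟩ := hrep l
      have : Q l = Q l' := by rw [g3, hQper]
      rw [this, harg l' g1 g2, harg k' h1 h2] at hl
      exact ⟨l', ⟨g1, ht.lt_iff_lt.1 hl⟩, this.symm⟩
    · rintro ⟨l, ⟨g1, g2⟩, rfl⟩
      refine ⟨⟨l, rfl⟩, ?_⟩
      rw [harg l g1 (by omega), harg k' h1 h2]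
      exact ht g2
  have hinj : Set.InjOn Q (Finset.Ico K k' : Finset ℤ) := by
    intro a ha b hb hab
    simp only [Finset.coe_Ico, Set.mem_Ico] at ha hb
    have := congrArg Complex.arg hab
    rw [harg a ha.1 (by omega), harg b hb.1 (by omega)] at this
    exact ht.injective this
  rw [hQk, hset, hinj.ncard_image, Set.ncard_coe_finset, Int.card_Ico]
  omega

end Projection

namespace Setup

variable [FiniteDimensional ℝ V] (X : Setup n V)

theorem proj_add (x y : V) : X.proj (x + y) = X.proj x + X.proj y := by simp [proj]

theorem proj_smul (r : ℝ) (x : V) : X.proj (r • x) = r • X.proj x := by simp [proj]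

theorem proj_coe (v : coxPlane X.α X.σ) : X.proj v = X.f v := by
  unfold proj
  rw [Submodule.orthogonalProjectionOnto_mem_subspace_eq_self]

theorem inner_proj (x : V) (v : coxPlane X.α X.σ) : ⟪X.proj x, X.f v⟫_ℝ = ⟪x, (v : V)⟫_ℝ := by
  unfold proj
  rw [X.f.inner_map_map, Submodule.inner_orthogonalProjectionOnto_eq_of_mem_right]

theorem proj_eq_zero_iff (x : V) :
    X.proj x = 0 ↔ ∀ v ∈ coxPlane X.α X.σ, ⟪x, v⟫_ℝ = 0 := by
  constructor
  · intro h v hv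
    rw [← X.inner_proj x ⟨v, hv⟩, h, inner_zero_left]
  · intro h
    rw [← inner_self_eq_zero (𝕜 := ℝ)]
    obtain ⟨v, hv⟩ := X.f.surjective (X.proj x)
    have h2 := X.inner_proj x v
    rw [hv] at h2
    rw [h2]
    exact h _ v.2

/-- An isometry that preserves the Coxeter plane induces an isometry of the complex plane. -/
theorem exists_isometry {g : V ≃ₗᵢ[ℝ] V} (hg : ∀ v ∈ coxPlane X.α X.σ, g v ∈ coxPlane X.α X.σ) :
    ∃ C : ℂ ≃ₗᵢ[ℝ] ℂ, ∀ x, X.proj (g x) = C (X.proj x) := by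
  let C₀ : ℂ →ₗᵢ[ℝ] ℂ :=
    { toFun := fun w => X.f ⟨g (X.f.symm w), hg _ (X.f.symm w).2⟩
      map_add' := fun a b => by
        rw [← map_add]; congr 1; ext; simp
      map_smul' := fun r a => by
        rw [RingHom.id_apply, ← map_smul]; congr 1; ext
        change g (X.f.symm (r • a) : V) = r • g (X.f.symm a : V)
        rw [map_smul, Submodule.coe_smul, map_smul]
      norm_map' := fun w => by
        change ‖X.f _‖ = _
        rw [X.f.norm_map]
        change ‖g (X.f.symm w : V)‖ = _
        rw [g.norm_map, Submodule.norm_coe, X.f.symm.norm_map] }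
  let C := C₀.toLinearIsometryEquiv rfl
  have hC : ∀ v : coxPlane X.α X.σ, C (X.f v) = X.f ⟨g v, hg _ v.2⟩ := by
    intro v
    change X.f ⟨g (X.f.symm (X.f v)), _⟩ = _
    congr 1
    ext
    simp
  refine ⟨C, fun x => ?_⟩
  refine ext_inner_right ℝ fun w => ?_
  obtain ⟨w', rfl⟩ := C.surjective w
  obtain ⟨v, rfl⟩ := X.f.surjective w'
  rw [C.inner_map_map, hC, X.inner_proj, X.inner_proj]
  exact g.inner_map_map x v

variable {X} {Z : ZigZag X.α X.σ} (O : Z.Orbit X.o)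

omit [FiniteDimensional ℝ V] in
theorem G_mem_coxPlane (hs : SignOrtho X.α X.σ) (hc : coxNum X.α X.σ = Z.h) {v : V}
    (hv : v ∈ coxPlane X.α X.σ) : Z.G v ∈ coxPlane X.α X.σ := by
  rw [Z.mem_coxPlane_iff hs hc] at hv ⊢
  rw [← map_smul, ← hv, map_add]
  congr 1
  exact (Z.G.symm_apply_apply v).trans (Z.G.apply_symm_apply v).symm

omit [FiniteDimensional ℝ V] in
theorem cSign_mem_coxPlane (hs : SignOrtho X.α X.σ) (hc : coxNum X.α X.σ = Z.h) {v : V}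
    (hv : v ∈ coxPlane X.α X.σ) : cSign X.α X.σ (!Z.η) v ∈ coxPlane X.α X.σ := by
  rw [Z.mem_coxPlane_iff hs hc] at hv ⊢
  have h1 := Z.cSign_G_zpow hs 1 v
  have h2 := Z.cSign_G_zpow hs (-1) v
  rw [neg_neg, zpow_one, zpow_neg_one] at h2
  rw [zpow_one, zpow_neg_one] at h1
  rw [← h1, ← h2, ← map_add, add_comm, hv, map_smul]

/-- The Coxeter element acts on the plane as a rotation. -/
theorem exists_rotation (hs : SignOrtho X.α X.σ) (hc : coxNum X.α X.σ = Z.h) :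
    ∃ s : ℤ, (s = 1 ∨ s = -1) ∧ ∀ x, X.proj (Z.G x) = hst Z.h (2 * s) * X.proj x := by
  obtain ⟨C, hC⟩ := X.exists_isometry fun v hv => G_mem_coxPlane (Z := Z) hs hc hv
  set c := Real.cos (2 * π / Z.h) with hcdef
  have key : ∀ w : ℂ, C (C w) + w = (2 * c : ℝ) * C w := by
    intro w
    obtain ⟨v, rfl⟩ := X.f.surjective w
    have h1 := (Z.mem_coxPlane_iff hs hc v).1 v.2
    have h2 := congrArg (fun x => X.proj (Z.G x)) h1
    simp only [map_add, X.proj_add, map_smul, X.proj_smul] at h2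
    rw [show Z.G (Z.G⁻¹ (v : V)) = v from Z.G.apply_symm_apply v, hC, hC, X.proj_coe] at h2
    rw [h2, Complex.real_smul]
  obtain ⟨a, ha⟩ := linear_isometry_complex C
  rcases ha with rfl | rfl
  · have h1 := key 1
    simp only [rotation_apply, mul_one] at h1
    set b : ℂ := (a : ℂ) with hb
    have h3 : hst Z.h 2 * hst Z.h (-2) = 1 := by rw [← hst_add]; exact hst_zero _
    have h4 : hst Z.h 2 + hst Z.h (-2) = (2 * c : ℝ) := by
      rw [← hst_conj, Complex.add_conj, hst_re]
      rw [hcdef]; congr 3; push_cast; ring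
    have h5 : (b - hst Z.h 2) * (b - hst Z.h (-2)) = 0 := by
      rw [← h4] at h1
      linear_combination h1 + h3
    rcases mul_eq_zero.1 h5 with h6 | h6
    · refine ⟨1, Or.inl rfl, fun x => ?_⟩
      rw [hC, rotation_apply, ← hb, sub_eq_zero.1 h6]; rfl
    · refine ⟨-1, Or.inr rfl, fun x => ?_⟩
      rw [hC, rotation_apply, ← hb, sub_eq_zero.1 h6]; rfl
  · exfalso
    have h1 := key 1
    have h2 := key Complex.I
    have h3 : (a : ℂ) * (starRingEnd ℂ) (a : ℂ) = 1 := by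
      rw [Complex.mul_conj, Complex.normSq_eq_norm_sq, Circle.norm_coe]; simp
    simp only [LinearIsometryEquiv.trans_apply, rotation_apply, Complex.conjLIE_apply, map_one,
      mul_one, Complex.conj_I, map_mul, map_neg] at h1 h2
    rw [h3] at h1
    rw [← mul_assoc, h3, one_mul] at h2
    have h4 : (2 : ℂ) * Complex.I = 0 := by
      linear_combination (1 / 2 * Complex.I) * h1 + (1 / 2) * h2
    simp at h4

theorem proj_x₀_ne_zero (hs : SignOrtho X.α X.σ) (hc : coxNum X.α X.σ = Z.h) :
    X.proj O.x₀ ≠ 0 := by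
  intro h
  have h1 := (X.proj_eq_zero_iff _).1 h _ (Z.u_mem_coxPlane hs hc Z.η)
  unfold ZigZag.u at h1
  rw [inner_sum, Finset.sum_eq_single Z.i₀] at h1
  · rw [real_inner_smul_right, real_inner_comm, O.weight, if_pos rfl] at h1
    exact (mul_ne_zero (Z.Φ_pos _).ne' O.t_ne) h1
  · intro i _ hi
    rw [real_inner_smul_right, real_inner_comm, O.weight, if_neg hi, mul_zero]
  · intro hi
    exact absurd (Finset.mem_filter.2 ⟨Finset.mem_univ Z.i₀, (rfl : X.σ Z.i₀ = Z.η)⟩) hi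

theorem proj_G_zpow {s : ℤ} (hG : ∀ x, X.proj (Z.G x) = hst Z.h (2 * s) * X.proj x) (ℓ : ℤ)
    (x : V) : X.proj ((Z.G ^ ℓ) x) = hst Z.h (2 * s * ℓ) * X.proj x := by
  induction ℓ using Int.induction_on with
  | zero => simp [hst_zero]
  | succ k ih =>
    rw [add_comm, zpow_add, zpow_one]
    change X.proj (Z.G ((Z.G ^ (k : ℤ)) x)) = _
    rw [hG, ih, ← mul_assoc, ← hst_add]
    congr 2; ring
  | pred k ih =>
    have h1 : (Z.G ^ (-(k : ℤ))) x = Z.G ((Z.G ^ (-(k : ℤ) - 1)) x) := by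
      conv_lhs => rw [show -(k : ℤ) = 1 + (-k - 1) by ring, zpow_add, zpow_one]
      rfl
    rw [h1, hG] at ih
    rw [← mul_right_inj' (hst_ne_zero Z.h (2 * s)), ih, ← mul_assoc, ← hst_add]
    congr 2; ring

theorem hst_two_ne {h : ℕ} (h3 : 3 ≤ h) {s : ℤ} (hs1 : s = 1 ∨ s = -1) :
    hst h (2 * s) ≠ hst h (-(2 * s)) := by
  intro hc
  have h1 := congrArg Complex.im hc
  rw [← hst_conj, Complex.conj_im] at h1
  have h2 : (hst h (2 * s)).im = 0 := by linarith
  rw [hst_im_eq_zero_iff (by omega)] at h2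
  have h5 : (h : ℤ) ∣ 2 := by
    rcases hs1 with rfl | rfl
    · simpa using h2
    · simpa using h2
  have := Int.le_of_dvd (by norm_num) h5
  omega

/-- The sign class fixing `x₀` acts as the reflection in the line through the projection of `x₀`. -/
theorem proj_cSign (hs : SignOrtho X.α X.σ) (hc : coxNum X.α X.σ = Z.h) {s : ℤ}
    (hs1 : s = 1 ∨ s = -1)
    (hG : ∀ x, X.proj (Z.G x) = hst Z.h (2 * s) * X.proj x) (x : V) (w : ℂ)
    (hx : X.proj x = X.proj O.x₀ * w) :
    X.proj (cSign X.α X.σ (!Z.η) x) = X.proj O.x₀ * (starRingEnd ℂ) w := by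
  obtain ⟨C, hC⟩ := X.exists_isometry fun v hv => cSign_mem_coxPlane (Z := Z) hs hc hv
  set p := X.proj O.x₀ with hp
  have hp0 : p ≠ 0 := proj_x₀_ne_zero O hs hc
  have h1 : C p = p := by rw [hp, ← hC, Z.cSign_x₀ hs O.weight]
  have h2 : C (hst Z.h (2 * s) * p) = hst Z.h (-(2 * s)) * p := by
    have e1 := proj_G_zpow hG 1 O.x₀
    have e2 := proj_G_zpow hG (-1) O.x₀
    rw [mul_one, ← hp] at e1
    rw [← e1, ← hC, Z.cSign_G_zpow hs, Z.cSign_x₀ hs O.weight, e2, ← hp]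
    congr 2; ring
  rw [hC, hx]
  obtain ⟨a, ha⟩ := linear_isometry_complex C
  rcases ha with rfl | rfl
  · exfalso
    rw [rotation_apply] at h1 h2
    have h3 : (a : ℂ) = 1 := mul_right_cancel₀ hp0 (h1.trans (one_mul p).symm)
    rw [h3, one_mul] at h2
    exact hst_two_ne Z.three_le hs1 (mul_right_cancel₀ hp0 h2)
  · simp only [LinearIsometryEquiv.trans_apply, rotation_apply, Complex.conjLIE_apply, map_mul]
      at h1 ⊢
    rw [← mul_assoc, h1]

theorem proj_cSign_η (hs : SignOrtho X.α X.σ) (hc : coxNum X.α X.σ = Z.h) {s : ℤ}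
    (hs1 : s = 1 ∨ s = -1)
    (hG : ∀ x, X.proj (Z.G x) = hst Z.h (2 * s) * X.proj x) (x : V) (w : ℂ)
    (hx : X.proj x = X.proj O.x₀ * w) :
    X.proj (cSign X.α X.σ Z.η x) = X.proj O.x₀ * (hst Z.h (2 * s) * (starRingEnd ℂ) w) := by
  rw [Z.cSign_η hs, hG, proj_cSign O hs hc hs1 hG x w hx]
  ring

end Setup

/-! ### The regular polygon -/

section Angles

/-- The angles of the vertices of the expanded polygon, in units of `π / h`, relative to one of the
new vertices; the index `0` and the middle index belong to the two new vertices. -/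
def ang (h : ℕ) (k : ℤ) : ℤ :=
  2 * (h * (k / (h + 2))) + (if k % (h + 2) = 0 then 0
    else if k % (h + 2) < (h + 2) / 2 then 2 * (k % (h + 2)) - 1
    else if k % (h + 2) = (h + 2) / 2 then 2 * (k % (h + 2)) - 2 else 2 * (k % (h + 2)) - 3)

theorem ang_eq (h : ℕ) (d r : ℤ) (hr : 0 ≤ r) (hr' : r < h + 2) :
    ang h ((h + 2) * d + r) = 2 * (h * d) + (if r = 0 then 0
      else if r < (h + 2) / 2 then 2 * r - 1 else if r = (h + 2) / 2 then 2 * r - 2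
      else 2 * r - 3) := by
  have h0 : (0 : ℤ) < h + 2 := by omega
  have h1 : ((h + 2) * d + r) / ((h : ℤ) + 2) = d := by
    rw [Int.mul_add_ediv_left _ _ h0.ne', Int.ediv_eq_zero_of_lt hr hr', add_zero]
  have h2 : ((h + 2) * d + r) % ((h : ℤ) + 2) = r := by
    rw [Int.mul_add_emod_self_left, Int.emod_eq_of_lt hr hr']
  unfold ang
  rw [h1, h2]

theorem exists_quot_rem (h : ℕ) (k : ℤ) : ∃ d r : ℤ, 0 ≤ r ∧ r < h + 2 ∧ k = (h + 2) * d + r :=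
  ⟨k / (h + 2), k % (h + 2), Int.emod_nonneg _ (by omega), Int.emod_lt_of_pos _ (by omega),
    by rw [add_comm]; exact (Int.emod_add_mul_ediv k (h + 2)).symm⟩

theorem ang_add (h : ℕ) (k : ℤ) : ang h (k + (h + 2 : ℕ)) = ang h k + 2 * h := by
  obtain ⟨d, r, h1, h2, rfl⟩ := exists_quot_rem h k
  rw [show ((h : ℤ) + 2) * d + r + ((h + 2 : ℕ) : ℤ) = (h + 2) * (d + 1) + r by push_cast; ring,
    ang_eq h _ r h1 h2, ang_eq h _ r h1 h2]
  ring

theorem ang_strictMono {h : ℕ} (h3 : 3 ≤ h) : StrictMono (ang h) := by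
  refine strictMono_int_of_lt_succ fun k => ?_
  obtain ⟨d, r, h1, h2, rfl⟩ := exists_quot_rem h k
  rw [ang_eq h _ r h1 h2]
  by_cases hr : r + 1 < h + 2
  · rw [add_assoc, ang_eq h _ (r + 1) (by omega) hr]
    generalize (h : ℤ) * d = D
    split_ifs <;> omega
  · rw [show ((h : ℤ) + 2) * d + r + 1 = (h + 2) * (d + 1) + 0 by linarith,
      ang_eq h _ 0 le_rfl (by omega), if_pos rfl, mul_add]
    generalize (h : ℤ) * d = D
    split_ifs <;> omega

theorem exists_ang_eq_odd {h : ℕ} (h3 : 3 ≤ h) (l : ℤ) : ∃ k, ang h k = 2 * l - 1 := by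
  have h0 : (0 : ℤ) < h := by omega
  have e := Int.emod_add_mul_ediv (l - 1) h
  have h1 := Int.emod_nonneg (l - 1) h0.ne'
  have h2 := Int.emod_lt_of_pos (l - 1) h0
  generalize (l - 1) % (h : ℤ) = r at *
  generalize (l - 1) / (h : ℤ) = d at *
  by_cases hr : r + 1 < (h + 2) / 2
  · refine ⟨(h + 2) * d + (r + 1), ?_⟩
    rw [ang_eq h _ _ (by omega) (by omega)]
    generalize (h : ℤ) * d = D at *
    split_ifs <;> omega
  · refine ⟨(h + 2) * d + (r + 2), ?_⟩
    rw [ang_eq h _ _ (by omega) (by omega)]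
    generalize (h : ℤ) * d = D at *
    split_ifs <;> omega

theorem exists_ang_eq_even {h : ℕ} (h3 : 3 ≤ h) (l : ℤ) (hl : (h : ℤ) ∣ 2 * l ∨ (h : ℤ) ∣ 2 * l + 1) :
    ∃ k, ang h k = 2 * l := by
  obtain ⟨j, hj⟩ : ∃ j : ℤ, 2 * l = h * j ∨ 2 * l + 1 = h * j := by
    rcases hl with ⟨j, hj⟩ | ⟨j, hj⟩
    · exact ⟨j, Or.inl hj⟩
    · exact ⟨j, Or.inr hj⟩
  obtain ⟨d, hd⟩ : ∃ d : ℤ, j = 2 * d ∨ j = 2 * d + 1 := ⟨j / 2, by omega⟩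
  have hr : (0 : ℤ) ≤ (h + 2) / 2 ∧ ((h : ℤ) + 2) / 2 < h + 2 := by omega
  have e1 := ang_eq h d 0 le_rfl (by omega)
  have e2 := ang_eq h d ((h + 2) / 2) hr.1 hr.2
  rcases hd with rfl | rfl
  · have e : (h : ℤ) * (2 * d) = 2 * (h * d) := by ring
    rw [e] at hj
    refine ⟨_, e1.trans ?_⟩
    generalize (h : ℤ) * d = D at *
    split_ifs <;> omega
  · have e : (h : ℤ) * (2 * d + 1) = 2 * (h * d) + h := by ring
    rw [e] at hj
    refine ⟨_, e2.trans ?_⟩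
    generalize (h : ℤ) * d = D at *
    split_ifs <;> omega

theorem ang_cases (h : ℕ) (k : ℤ) : ∃ l : ℤ, ang h k = 2 * l - 1 ∨
    (ang h k = 2 * l ∧ ((h : ℤ) ∣ 2 * l ∨ (h : ℤ) ∣ 2 * l + 1)) := by
  obtain ⟨d, r, h1, h2, rfl⟩ := exists_quot_rem h k
  rw [ang_eq h _ r h1 h2]
  split_ifs with g1 g2 g3
  · exact ⟨h * d, Or.inr ⟨by ring, Or.inl ⟨2 * d, by ring⟩⟩⟩
  · exact ⟨h * d + r, Or.inl (by ring)⟩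
  · refine ⟨h * d + r - 1, Or.inr ⟨by ring, ?_⟩⟩
    rcases Nat.mod_two_eq_zero_or_one h with h4 | h4
    · refine Or.inl ⟨2 * d + 1, ?_⟩
      rw [show (h : ℤ) * (2 * d + 1) = 2 * (h * d) + h by ring]
      omega
    · refine Or.inr ⟨2 * d + 1, ?_⟩
      rw [show (h : ℤ) * (2 * d + 1) = 2 * (h * d) + h by ring]
      omega
  · exact ⟨h * d + r - 1, Or.inl (by ring)⟩

theorem ang_sv {h q : ℕ} (hq : 1 ≤ q) (hq' : q ≤ h) : ang h (sv q) + 1 = 2 * ZigZag.cyc q := by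
  unfold sv ZigZag.cyc
  split_ifs with hp
  · have := ang_eq h 0 ((q / 2 : ℕ) : ℤ) (by omega) (by omega)
    rw [mul_zero, zero_add, mul_zero, mul_zero, zero_add] at this
    rw [this]
    split_ifs <;> omega
  · have := ang_eq h (-1) (h + 2 - ((q + 1) / 2 : ℕ)) (by omega) (by omega)
    rw [show ((h : ℤ) + 2) * -1 + (h + 2 - ((q + 1) / 2 : ℕ)) = -((q + 1) / 2 : ℕ) by ring] at this
    rw [this]
    split_ifs <;> omega

end Angles

namespace Setup

variable [FiniteDimensional ℝ V] {X : Setup n V} {Z : ZigZag X.α X.σ} (O : Z.Orbit X.o)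
  (hs : SignOrtho X.α X.σ) (hc : coxNum X.α X.σ = Z.h) {s : ℤ} (hs1 : s = 1 ∨ s = -1)
  (hG : ∀ x, X.proj (Z.G x) = hst Z.h (2 * s) * X.proj x)

include hs hc in
theorem proj_eq_zero_of_G_G {x : V} (hx : Z.G (Z.G x) = x) : X.proj x = 0 :=
  (X.proj_eq_zero_iff x).2 fun _ hv => Z.inner_eq_zero_of_G_G hs hc hx hv

include hs hG in
theorem proj_y {q : ℕ} (hq : 1 ≤ q) (hq' : q ≤ Z.h) :
    X.proj (Z.y O.x₀ O.t q) = X.proj O.x₀ * hst Z.h (2 * s * ZigZag.cyc q) := by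
  rw [Z.y_eq hs O.weight hq (by omega), proj_G_zpow hG, mul_comm]

omit [FiniteDimensional ℝ V] in
theorem G_zpow_mem (ℓ : ℤ) : (Z.G ^ ℓ) O.x₀ ∈ X.o := by
  refine orbitOf_subset X.α O.mem O.closed ⟨_, ?_, rfl⟩
  exact zpow_mem (mul_mem (cSign_mem_weylGroup _ _ _) (cSign_mem_weylGroup _ _ _)) ℓ

include hs hc hG in
theorem hgon_eq : X.hgon = {a | ∃ l : ℤ, a = X.proj O.x₀ * hst Z.h (s * (2 * l))} := by
  have hp := proj_x₀_ne_zero O hs hc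
  ext a
  constructor
  · rintro ⟨x, hx, rfl, h0⟩
    rcases O.shape x hx with ⟨q, hq, hq', rfl⟩ | ⟨h, -⟩
    · refine ⟨ZigZag.cyc q, ?_⟩
      rw [proj_y O hs hG hq hq']
      congr 2; ring
    · exact absurd (proj_eq_zero_of_G_G hs hc h) h0
  · rintro ⟨l, rfl⟩
    refine ⟨_, G_zpow_mem O l, ?_, mul_ne_zero hp (hst_ne_zero _ _)⟩
    rw [proj_G_zpow hG, mul_comm]
    congr 2; ring

/-- The line `L_ε`, if `c_ε` acts on the plane as the reflection in the direction `hst h k`. -/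
theorem lineL_eq {ε : Bool} {p : ℂ} (hp : p ≠ 0) {k : ℤ} (hs : SignOrtho X.α X.σ) {h : ℕ}
    (hP : ∀ v ∈ coxPlane X.α X.σ, cSign X.α X.σ ε v ∈ coxPlane X.α X.σ)
    (href : ∀ x w, X.proj x = p * w →
      X.proj (cSign X.α X.σ ε x) = p * (hst h (2 * k) * (starRingEnd ℂ) w)) :
    X.lineL ε = {l | ∃ r : ℝ, l = p * (hst h k * r)} := by
  have hk : hst h (2 * k) * hst h (-k) = hst h k := by rw [← hst_add]; congr 1; ring
  have hk0 : hst h k * hst h (-k) = 1 := by rw [← hst_add, add_neg_cancel, hst_zero]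
  have hfix : ∀ x, (∀ i, X.σ i = ε → ⟪x, X.α i⟫_ℝ = 0) ↔ cSign X.α X.σ ε x = x := by
    intro x
    rw [cSign_eq_self_iff hs]
    simp only [inner_simple_eq_zero_iff]
  ext l
  constructor
  · rintro ⟨x, hx, hx2, rfl⟩
    rw [hfix] at hx2
    set w := X.proj x / p with hw
    have e1 : X.proj x = p * w := by rw [hw]; field_simp
    have e2 := href x w e1
    rw [hx2, e1] at e2
    have e3 := mul_left_cancel₀ hp e2
    have e4 : (starRingEnd ℂ) (hst h (-k) * w) = hst h (-k) * w := by
      rw [map_mul, hst_conj, neg_neg]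
      conv_rhs => rw [e3]
      rw [← mul_assoc, mul_comm (hst h (-k)), hk]
    obtain ⟨r, hr⟩ := Complex.conj_eq_iff_real.1 e4
    refine ⟨r, ?_⟩
    rw [e1, ← hr, ← mul_assoc (hst h k), hk0, one_mul]
  · rintro ⟨r, rfl⟩
    obtain ⟨v, hv⟩ := X.f.surjective (p * (hst h k * r))
    have hv' := X.proj_coe v
    refine ⟨v, v.2, ?_, by rw [hv', hv]⟩
    rw [hfix]
    have e1 := href v (hst h k * r) (by rw [hv', hv])
    rw [map_mul, hst_conj, Complex.conj_ofReal, ← mul_assoc (hst h (2 * k)), hk, ← hv] at e1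
    have e2 := X.proj_coe ⟨_, hP v v.2⟩
    dsimp only at e2
    rw [e2] at e1
    exact congrArg Subtype.val (X.f.injective e1)

theorem inner_lineL_iff {L : Set ℂ} {p : ℂ} {h : ℕ} {k : ℤ}
    (hL : L = {l | ∃ r : ℝ, l = p * (hst h k * r)}) (d : ℂ) :
    (∀ l ∈ L, ⟪d, l⟫_ℝ = 0) ↔ ⟪d, p * hst h k⟫_ℝ = 0 := by
  rw [hL]
  constructor
  · intro hd
    exact hd _ ⟨1, by simp⟩
  · rintro hd l ⟨r, rfl⟩
    rw [show p * (hst h k * r) = r • (p * hst h k) by rw [Complex.real_smul]; ring,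
      real_inner_smul_right, hd, mul_zero]

include hs1 in
theorem dvd_sign_mul (a b : ℤ) : a ∣ s * b ↔ a ∣ b := by
  rcases hs1 with rfl | rfl <;> simp

include hs1 in
/-- Criterion for an edge of the `h`-gon to be perpendicular to the line in direction `hst h k`. -/
theorem inner_edge_iff {p : ℂ} (hp : p ≠ 0) {h : ℕ} (h3 : 3 ≤ h) (l k : ℤ) :
    ⟪p * hst h (s * (2 * (l + 1))) - p * hst h (s * (2 * l)), p * hst h k⟫_ℝ = 0 ↔
      (h : ℤ) ∣ k - s * (2 * l + 1) := by
  have e1 : p * hst h (s * (2 * (l + 1))) - p * hst h (s * (2 * l))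
      = p * (hst h (s * (2 * l + 1)) * ((2 * (hst h s).im : ℝ) * Complex.I)) := by
    have : ((2 * (hst h s).im : ℝ) : ℂ) * Complex.I = hst h s - hst h (-s) := by
      rw [← hst_conj, Complex.sub_conj]
    rw [this, mul_sub, mul_sub, ← hst_add, ← hst_add]
    ring_nf
  have e2 : ⟪p * (hst h (s * (2 * l + 1)) * ((2 * (hst h s).im : ℝ) * Complex.I)), p * hst h k⟫_ℝ
      = ‖p‖ ^ 2 * (2 * (hst h s).im) * (hst h (k - s * (2 * l + 1))).im := by
    rw [Complex.inner, sub_eq_add_neg, hst_add, ← hst_conj]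
    simp only [map_mul, Complex.conj_I, Complex.conj_ofReal]
    have : p * hst h k * ((starRingEnd ℂ) p * ((starRingEnd ℂ) (hst h (s * (2 * l + 1))) *
        (((2 * (hst h s).im : ℝ) : ℂ) * -Complex.I))) = ((‖p‖ ^ 2 * (2 * (hst h s).im) : ℝ) : ℂ)
          * (-Complex.I * (hst h k * (starRingEnd ℂ) (hst h (s * (2 * l + 1))))) := by
      have h5 := Complex.mul_conj p
      rw [Complex.normSq_eq_norm_sq] at h5
      push_cast at h5 ⊢
      rw [← h5]; ring
    rw [this, Complex.re_ofReal_mul]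
    congr 1
    simp
  have hs0 : (hst h s).im ≠ 0 := by
    rw [ne_eq, hst_im_eq_zero_iff (by omega)]
    intro hd
    have := (dvd_sign_mul hs1 h 1).1 (by simpa using hd)
    have := Int.le_of_dvd (by norm_num) this
    omega
  rw [e1, e2, mul_eq_zero, ← hst_im_eq_zero_iff (by omega : h ≠ 0)]
  constructor
  · intro h1
    refine h1.resolve_left ?_
    exact mul_ne_zero (by positivity) (mul_ne_zero two_ne_zero hs0)
  · exact Or.inr

include hs1 in
/-- The new vertex over an edge of the `h`-gon lies on the circle, in the middle of the arc. -/
theorem ear_eq {p : ℂ} (hp : p ≠ 0) {h : ℕ} (h3 : 3 ≤ h) (l : ℤ) {a b : ℂ}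
    (ha : a = p * hst h (s * (2 * l))) (hb : b = p * hst h (s * (2 * (l + 1)))) :
    ((‖a‖ / ‖a + b‖ : ℝ) : ℂ) * (a + b) = p * hst h (s * (2 * l + 1)) := by
  have hpos : 0 < (hst h s).re := by
    have h4 : (hst h s).re = Real.cos (π / h) := by
      rw [hst_re]
      rcases hs1 with rfl | rfl
      · simp
      · rw [← Real.cos_neg]; congr 1; push_cast; ring
    rw [h4]
    have hpi := Real.pi_pos
    have h3' : (3 : ℝ) ≤ h := by exact_mod_cast h3
    have h5 : 0 < π / h := by positivity
    refine Real.cos_pos_of_mem_Ioo ⟨by linarith, ?_⟩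
    rw [div_lt_div_iff_of_pos_left hpi (by linarith) two_pos]
    linarith
  have e1 : a + b = p * (hst h (s * (2 * l + 1)) * (2 * (hst h s).re : ℝ)) := by
    have : ((2 * (hst h s).re : ℝ) : ℂ) = hst h s + hst h (-s) := by
      rw [← hst_conj, Complex.add_conj]
    rw [this, mul_add, ← hst_add, ← hst_add, ha, hb, mul_add, add_comm]
    ring_nf
  have hn : ‖p‖ ≠ 0 := norm_ne_zero_iff.2 hp
  rw [e1, ha, norm_mul, norm_mul, norm_mul, hst_norm, hst_norm, Complex.norm_real,
    Real.norm_of_nonneg (by positivity), one_mul, mul_one]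
  have e2 : ‖p‖ / (‖p‖ * (2 * (hst h s).re)) = (2 * (hst h s).re)⁻¹ := by field_simp
  rw [e2]
  have h6 : ((2 * (hst h s).re : ℝ) : ℂ) ≠ 0 := by
    rw [Complex.ofReal_ne_zero]; positivity
  rw [Complex.ofReal_inv]
  field_simp

include hs hc hs1 hG in
/-- The expanded polygon. -/
theorem expandedPolygon_eq :
    X.expandedPolygon = {a | ∃ k, a = X.proj O.x₀ * hst Z.h (s * (ang Z.h k + 1))} := by
  have h3 := Z.three_le
  have hp := proj_x₀_ne_zero O hs hc
  set p := X.proj O.x₀ with hpdef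
  have hG' : ∀ ℓ : ℤ, X.proj ((Z.G ^ ℓ) O.x₀) = p * hst Z.h (s * (2 * ℓ)) := by
    intro ℓ
    rw [proj_G_zpow hG, mul_comm, hpdef]; congr 2; ring
  have hP1 : ∀ v ∈ coxPlane X.α X.σ, cSign X.α X.σ (!Z.η) v ∈ coxPlane X.α X.σ :=
    fun v hv => cSign_mem_coxPlane hs hc hv
  have hP2 : ∀ v ∈ coxPlane X.α X.σ, cSign X.α X.σ Z.η v ∈ coxPlane X.α X.σ := fun v hv => by
    rw [Z.cSign_η hs]
    exact G_mem_coxPlane hs hc (hP1 v hv)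
  have hL1 := lineL_eq (X := X) (ε := !Z.η) (k := 0) (h := Z.h) hp hs hP1 (fun x w hx => by
    rw [mul_zero, hst_zero, one_mul]
    exact proj_cSign O hs hc hs1 hG x w hx)
  have hL2 := lineL_eq (X := X) (ε := Z.η) (k := s) (h := Z.h) hp hs hP2 (fun x w hx =>
    proj_cSign_η O hs hc hs1 hG x w hx)
  have hdir : ∀ l : ℤ, (∃ ε, ∀ u ∈ X.lineL ε,
      ⟪p * hst Z.h (s * (2 * (l + 1))) - p * hst Z.h (s * (2 * l)), u⟫_ℝ = 0) ↔
      ((Z.h : ℤ) ∣ 2 * l ∨ (Z.h : ℤ) ∣ 2 * l + 1) := by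
    intro l
    have e1 := (inner_lineL_iff hL1 _).trans (inner_edge_iff hs1 hp h3 l 0)
    have e2 := (inner_lineL_iff hL2 _).trans (inner_edge_iff hs1 hp h3 l s)
    rw [zero_sub, dvd_neg, dvd_sign_mul hs1] at e1
    rw [show s - s * (2 * l + 1) = -(s * (2 * l)) by ring, dvd_neg, dvd_sign_mul hs1] at e2
    rw [← e1, ← e2]
    constructor
    · rintro ⟨ε, hε⟩
      by_cases hεη : ε = Z.η
      · subst hεη; exact Or.inl hε
      · obtain rfl := Bool.eq_not_of_ne hεη
        exact Or.inr hε
    · rintro (h | h)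
      · exact ⟨_, h⟩
      · exact ⟨_, h⟩
  have hneg : ∀ a b u : ℂ, ⟪b - a, u⟫_ℝ = 0 ↔ ⟪a - b, u⟫_ℝ = 0 := by
    intro a b u
    rw [← neg_sub, inner_neg_left, neg_eq_zero]
  -- the new vertices
  have hears : ∀ d, (∃ a b, X.IsDistinguishedEdge a b ∧
      d = ((‖a‖ / ‖a + b‖ : ℝ) : ℂ) * (a + b)) ↔
      ∃ l : ℤ, ((Z.h : ℤ) ∣ 2 * l ∨ (Z.h : ℤ) ∣ 2 * l + 1) ∧ d = p * hst Z.h (s * (2 * l + 1)) := by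
    intro d
    constructor
    · rintro ⟨a, b, ⟨⟨x, hx, ha, hb, h0⟩, ε, hε⟩, rfl⟩
      rcases O.shape x hx with ⟨q, hq, hq', hy⟩ | ⟨h, -⟩
      swap
      · exact absurd (ha.trans (proj_eq_zero_of_G_G hs hc h)) h0
      rw [Z.y_eq hs O.weight hq (by omega)] at hy
      set k := ZigZag.cyc q
      rcases Z.coxElt_eq hs with hcox | hcox
      · have hx' : coxElt X.α X.σ x = (Z.G ^ (k + 1)) O.x₀ := by
          rw [hcox, hy, add_comm, zpow_add, zpow_one]; rfl
        rw [hy, hG'] at ha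
        rw [hx', hG'] at hb
        refine ⟨k, (hdir k).1 ⟨ε, ?_⟩, ear_eq hs1 hp h3 k ha hb⟩
        rw [← ha, ← hb]; exact hε
      · have hx' : coxElt X.α X.σ x = (Z.G ^ (k - 1)) O.x₀ := by
          rw [hcox, hy, sub_eq_neg_add, zpow_add, zpow_neg_one]; rfl
        rw [hy, hG'] at ha
        rw [hx', hG'] at hb
        have ha' : a = p * hst Z.h (s * (2 * (k - 1 + 1))) := by rw [ha]; congr 3; ring
        refine ⟨k - 1, (hdir (k - 1)).1 ⟨ε, fun u hu => ?_⟩, ?_⟩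
        · rw [← ha', ← hb, hneg]
          exact hε u hu
        · have := ear_eq hs1 hp h3 (k - 1) hb ha'
          rw [← this, add_comm b a]
          congr 3
          rw [ha, hb, norm_mul, norm_mul, hst_norm, hst_norm]
    · rintro ⟨l, hl, rfl⟩
      obtain ⟨ε, hε⟩ := (hdir l).2 hl
      rcases Z.coxElt_eq hs with hcox | hcox
      · have hx' : coxElt X.α X.σ ((Z.G ^ l) O.x₀) = (Z.G ^ (l + 1)) O.x₀ := by
          rw [hcox, add_comm, zpow_add, zpow_one]; rfl
        refine ⟨_, _, ⟨⟨_, G_zpow_mem O l, rfl, rfl, ?_⟩, ε, ?_⟩, ?_⟩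
        · rw [hG']; exact mul_ne_zero hp (hst_ne_zero _ _)
        · rw [hx', hG', hG']; exact hε
        · rw [hx']
          exact (ear_eq hs1 hp h3 l (hG' _) (hG' _)).symm
      · have hx' : coxElt X.α X.σ ((Z.G ^ (l + 1)) O.x₀) = (Z.G ^ l) O.x₀ := by
          conv_rhs => rw [show l = -1 + (l + 1) by ring, zpow_add, zpow_neg_one]
          rw [hcox]; rfl
        refine ⟨_, _, ⟨⟨_, G_zpow_mem O (l + 1), rfl, rfl, ?_⟩, ε, ?_⟩, ?_⟩
        · rw [hG']; exact mul_ne_zero hp (hst_ne_zero _ _)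
        · intro u hu
          rw [hx', hG', hG', hneg]; exact hε u hu
        · rw [hx', ← ear_eq hs1 hp h3 l (hG' _) (hG' _), add_comm (X.proj ((Z.G ^ l) O.x₀))]
          congr 3
          rw [hG', hG', norm_mul, norm_mul, hst_norm, hst_norm]
  ext a
  unfold expandedPolygon
  rw [Set.mem_union, Set.mem_ofPred_eq, hears, hgon_eq O hs hc hG]
  constructor
  · rintro (⟨l, rfl⟩ | ⟨l, hl, rfl⟩)
    · obtain ⟨k, hk⟩ := exists_ang_eq_odd h3 l
      exact ⟨k, by rw [hk, sub_add_cancel]⟩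
    · obtain ⟨k, hk⟩ := exists_ang_eq_even h3 l hl
      exact ⟨k, by rw [hk]⟩
  · rintro ⟨k, rfl⟩
    obtain ⟨l, hl | ⟨hl, hd⟩⟩ := ang_cases Z.h k
    · exact Or.inl ⟨l, by rw [hl, sub_add_cancel]⟩
    · exact Or.inr ⟨l, hd, by rw [hl]⟩

include hs hc hs1 hG in
/-- The vertices of the zigzag are placed at the vertices of the regular polygon in the order of
the snake. -/
theorem exists_place_y : ∃ K : ℤ, ∀ q, 1 ≤ q → q ≤ Z.h →
    X.place (Z.y O.x₀ O.t q) = .vertex (X.z * rootPt (Z.h + 2) (K + s * sv q)) := by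
  have h3 := Z.three_le
  have hp := proj_x₀_ne_zero O hs hc
  have hEP := expandedPolygon_eq O hs hc hs1 hG
  set p := X.proj O.x₀ with hpdef
  set t : ℤ → ℝ := fun k => p.arg + π * (s * (ang Z.h (s * k) + 1) : ℤ) / Z.h with ht
  have hpi := Real.pi_pos
  have hh : (0 : ℝ) < Z.h := by exact_mod_cast (by omega : 0 < Z.h)
  have hss : s * s = 1 := by rcases hs1 with rfl | rfl <;> norm_num
  have hmono : StrictMono t := by
    have h4 : StrictMono fun k : ℤ => s * (ang Z.h (s * k) + 1) := by
      rcases hs1 with rfl | rfl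
      · intro a b hab
        have := ang_strictMono h3 hab
        simpa using this
      · intro a b hab
        have := ang_strictMono h3 (neg_lt_neg hab)
        simp only [neg_mul, one_mul]
        omega
    intro a b hab
    simp only [ht]
    have h5 : ((s * (ang Z.h (s * a) + 1) : ℤ) : ℝ) < ((s * (ang Z.h (s * b) + 1) : ℤ) : ℝ) :=
      Int.cast_lt.2 (h4 hab)
    gcongr
  have hper : ∀ k, t (k + (Z.h + 2 : ℕ)) = t k + 2 * π := by
    have h4 : ∀ k, s * (ang Z.h (s * (k + (Z.h + 2 : ℕ))) + 1)
        = s * (ang Z.h (s * k) + 1) + 2 * Z.h := by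
      intro k
      rcases hs1 with rfl | rfl
      · simp only [one_mul]; rw [ang_add]; ring
      · have := ang_add Z.h (-(k + (Z.h + 2 : ℕ)))
        rw [neg_add, neg_add_cancel_right] at this
        simp only [neg_mul, one_mul]
        rw [neg_add, this]; ring_nf
    intro k
    simp only [ht]
    rw [h4]
    push_cast
    field_simp
    ring
  have hpt : ∀ k, p * hst Z.h (s * (ang Z.h (s * k) + 1))
      = ((‖p‖ : ℝ) : ℂ) * Complex.exp (t k * Complex.I) := by
    intro k
    conv_lhs => rw [← Complex.norm_mul_exp_arg_mul_I p]
    unfold hst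
    rw [mul_assoc, ← Complex.exp_add, ← add_mul]
    simp only [ht]
    rw [Complex.ofReal_add]
  have hrange : X.expandedPolygon
      = Set.range fun k => ((‖p‖ : ℝ) : ℂ) * Complex.exp (t k * Complex.I) := by
    rw [hEP]
    ext a
    constructor
    · rintro ⟨k, rfl⟩
      refine ⟨s * k, ?_⟩
      dsimp only
      rw [← hpt, ← mul_assoc, hss, one_mul]
    · rintro ⟨k, rfl⟩
      exact ⟨s * k, (hpt k).symm⟩
  obtain ⟨K, hK⟩ := exists_ncard_arg_lt (N := Z.h + 2) (by omega) hmono hper (norm_pos_iff.2 hp)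
  refine ⟨K, fun q hq hq' => ?_⟩
  have hpy := proj_y O hs hG hq hq'
  have hne : X.proj (Z.y O.x₀ O.t q) ≠ 0 := by
    rw [hpy]; exact mul_ne_zero hp (hst_ne_zero _ _)
  unfold place
  rw [if_neg hne]
  congr 1
  have h4 : X.proj (Z.y O.x₀ O.t q)
      = ((‖p‖ : ℝ) : ℂ) * Complex.exp (t (s * sv q) * Complex.I) := by
    rw [← hpt, ← mul_assoc s s, hss, one_mul, ang_sv hq hq', hpy]
    congr 2; ring
  obtain ⟨j, hj⟩ := hK (s * sv q)
  unfold regularize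
  rw [hrange, h4]
  unfold polygonVertex
  rw [hc]
  congr 1
  rw [← rootPt_add_mul _ (by omega) _ j]
  unfold rootPt
  have h5 : ∀ m : ℕ, (m : ℤ) = K + s * sv q + (Z.h + 2 : ℕ) * j →
      (m : ℂ) = ((K + s * sv q + (Z.h + 2 : ℕ) * j : ℤ) : ℂ) := by
    intro m hm
    rw [← hm]; simp
  rw [h5 _ (hj.trans (by ring))]

include hs hc in
theorem place_of_G_G {x : V} (hx : Z.G (Z.G x) = x) : X.place x = .origin x := by
  unfold place
  rw [if_pos (proj_eq_zero_of_G_G hs hc hx)]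

end Setup

/-! ### Orbits of minimal size -/

theorem hst_eq_hst_iff {h : ℕ} (hh : h ≠ 0) (k l : ℤ) :
    hst h k = hst h l ↔ (2 * h : ℤ) ∣ k - l := by
  have hh' : (h : ℂ) ≠ 0 := by exact_mod_cast hh
  have hpi : (π : ℂ) ≠ 0 := by exact_mod_cast Real.pi_ne_zero
  unfold hst
  rw [Complex.exp_eq_exp_iff_exists_int]
  constructor
  · rintro ⟨m, hm⟩
    refine ⟨m, ?_⟩
    push_cast at hm
    field_simp at hm
    have h2 : (k : ℂ) = ((l + h * 2 * m : ℤ) : ℂ) := by push_cast; rw [hm]; ring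
    have h3 : k = l + h * 2 * m := by exact_mod_cast h2
    rw [h3]; ring
  · rintro ⟨m, hm⟩
    refine ⟨m, ?_⟩
    have : (k : ℂ) = l + 2 * h * m := by
      have : ((k - l : ℤ) : ℂ) = ((2 * h * m : ℤ) : ℂ) := by rw [hm]
      push_cast at this
      linear_combination this
    push_cast
    rw [this]
    field_simp

theorem neg_hst {h : ℕ} (hh : h ≠ 0) (k : ℤ) : -hst h k = hst h (k + h) := by
  have hh' : (h : ℂ) ≠ 0 := by exact_mod_cast hh
  have : hst h h = -1 := by
    unfold hst
    push_cast
    rw [mul_div_assoc, div_self hh', mul_one, Complex.exp_pi_mul_I]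
  rw [hst_add, this, mul_neg_one]

namespace Setup

variable [FiniteDimensional ℝ V] {X : Setup n V} {Z : ZigZag X.α X.σ} (O : Z.Orbit X.o)
  (hs : SignOrtho X.α X.σ) (hc : coxNum X.α X.σ = Z.h) {s : ℤ} (hs1 : s = 1 ∨ s = -1)
  (hG : ∀ x, X.proj (Z.G x) = hst Z.h (2 * s) * X.proj x)

include hs hc in
/-- A stable set of nonzero vectors does not project to the origin: its dominant elements have
positive inner products with a vector in the Coxeter plane. -/
theorem exists_proj_ne_zero {o : Set V} (hfin : o.Finite) (hne : o.Nonempty) (h0 : (0 : V) ∉ o)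
    (hcl : ∀ i, ∀ x ∈ o, refl (X.α i) x ∈ o) : ∃ x ∈ o, X.proj x ≠ 0 := by
  set ρ : V := Z.u true + Z.u false with hρ
  have hρP : ρ ∈ coxPlane X.α X.σ :=
    Submodule.add_mem _ (Z.u_mem_coxPlane hs hc true) (Z.u_mem_coxPlane hs hc false)
  have hρsum : ρ = ∑ i, Z.Φ i • nroot X.α i := by
    rw [hρ]
    unfold ZigZag.u
    rw [Finset.sum_filter, Finset.sum_filter, ← Finset.sum_add_distrib]
    refine Finset.sum_congr rfl fun j _ => ?_
    cases X.σ j <;> simp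
  have hcos : Real.cos (π / Z.h) < 1 := by
    have h3 : (3 : ℝ) ≤ Z.h := by exact_mod_cast Z.three_le
    have hpi := Real.pi_pos
    have h1 : 0 < π / Z.h := by positivity
    have h2 : π / Z.h ≤ π := div_le_self hpi.le (by linarith)
    have := Real.strictAntiOn_cos ⟨le_rfl, hpi.le⟩ ⟨h1.le, h2⟩ h1
    rwa [Real.cos_zero] at this
  have hpos : ∀ i, 0 < ⟪nroot X.α i, ρ⟫_ℝ := by
    intro i
    have h1 := Z.gram_Φ i
    rw [hρsum, inner_sum]
    simp only [real_inner_smul_right]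
    rw [Finset.sum_congr rfl fun j _ => mul_comm _ _, h1]
    have := Z.Φ_pos i
    nlinarith
  obtain ⟨x, hx, hmax⟩ := hfin.exists_maximalFor (fun x => ⟪x, ρ⟫_ℝ) o hne
  have hdom : ∀ i, 0 ≤ ⟪nroot X.α i, x⟫_ℝ := by
    intro i
    by_contra hlt
    push Not at hlt
    have h1 : ⟪x, ρ⟫_ℝ < ⟪refl (X.α i) x, ρ⟫_ℝ := by
      rw [refl_simple, inner_sub_left, real_inner_smul_left]
      have := mul_neg_of_neg_of_pos hlt (hpos i)
      linarith
    exact absurd (hmax (hcl i x hx) h1.le) (not_le.2 h1)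
  refine ⟨x, hx, fun hpx => ?_⟩
  have h1 := (X.proj_eq_zero_iff x).1 hpx ρ hρP
  rw [hρsum, inner_sum] at h1
  have h2 := (Finset.sum_eq_zero_iff_of_nonneg fun i _ => by
    rw [real_inner_smul_right, real_inner_comm]
    exact mul_nonneg (Z.Φ_pos i).le (hdom i)).1 h1
  have h3 : x = 0 := eq_zero_of_inner_nroot X.α fun i => by
    have := h2 i (Finset.mem_univ _)
    rw [real_inner_smul_right, real_inner_comm, mul_eq_zero] at this
    exact this.resolve_left (Z.Φ_pos i).ne'
  exact h0 (h3 ▸ hx)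

omit [FiniteDimensional ℝ V] in
theorem G_zpow_mem_of_closed {o : Set V} (hcl : ∀ i, ∀ x ∈ o, refl (X.α i) x ∈ o) (l : ℤ) {x : V}
    (hx : x ∈ o) : (Z.G ^ l) x ∈ o :=
  orbitOf_subset X.α hx hcl
    ⟨_, zpow_mem (mul_mem (cSign_mem_weylGroup _ _ _) (cSign_mem_weylGroup _ _ _)) l, rfl⟩

include hs1 hG in
theorem G_pow_injOn {x : V} (hx : X.proj x ≠ 0) :
    Set.InjOn (fun l : ℕ => (Z.G ^ (l : ℤ)) x) (Finset.range Z.h : Finset ℕ) := by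
  have h3 := Z.three_le
  intro a ha b hb hab
  simp only [Finset.coe_range, Set.mem_Iio] at ha hb
  have h1 := congrArg X.proj hab
  dsimp only at h1
  rw [proj_G_zpow hG, proj_G_zpow hG] at h1
  have h2 := (hst_eq_hst_iff (by omega) _ _).1 (mul_right_cancel₀ hx h1)
  rw [show 2 * s * (a : ℤ) - 2 * s * b = 2 * (s * (a - b)) by ring,
    mul_dvd_mul_iff_left two_ne_zero, dvd_sign_mul hs1] at h2
  have := Int.eq_zero_of_abs_lt_dvd h2 (by rw [abs_lt]; omega)
  omega

include hs1 hG in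
/-- In a stable set of less than `2 h` elements, the elements that do not project to the origin form
a single cycle of the Coxeter element. -/
theorem exists_zpow_eq {o : Set V} (hfin : o.Finite) (hcl : ∀ i, ∀ x ∈ o, refl (X.α i) x ∈ o)
    (hcard : o.ncard < 2 * Z.h) {x x' : V} (hx : x ∈ o) (hx' : x' ∈ o) (hpx : X.proj x ≠ 0)
    (hpx' : X.proj x' ≠ 0) : ∃ l : ℤ, x' = (Z.G ^ l) x := by
  by_contra hno
  push Not at hno
  set A : V → Set V := fun x => (fun l : ℕ => (Z.G ^ (l : ℤ)) x) '' (Finset.range Z.h : Finset ℕ)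
    with hA
  have hAcard : ∀ x, X.proj x ≠ 0 → (A x).ncard = Z.h := by
    intro x hx
    rw [hA, (G_pow_injOn hs1 hG hx).ncard_image, Set.ncard_coe_finset, Finset.card_range]
  have hAsub : ∀ x ∈ o, A x ⊆ o := by
    rintro x hx _ ⟨l, -, rfl⟩
    exact G_zpow_mem_of_closed hcl l hx
  have hdisj : Disjoint (A x) (A x') := by
    rw [Set.disjoint_left]
    rintro _ ⟨l, -, rfl⟩ ⟨l', -, h⟩
    refine hno (-l' + l) ?_
    dsimp only at h
    rw [zpow_add]
    change x' = (Z.G ^ (-(l' : ℤ))) ((Z.G ^ (l : ℤ)) x)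
    rw [← h, zpow_neg]
    exact ((Z.G ^ (l' : ℤ)).symm_apply_apply x').symm
  have h1 := Set.ncard_union_eq hdisj (hfin.subset (hAsub x hx)) (hfin.subset (hAsub x' hx'))
  have h2 := Set.ncard_le_ncard (Set.union_subset (hAsub x hx) (hAsub x' hx')) hfin
  rw [h1, hAcard x hpx, hAcard x' hpx'] at h2
  omega

include hs1 hG in
theorem proj_ne_zero_of_ncard_le {o : Set V} (hfin : o.Finite)
    (hcl : ∀ i, ∀ x ∈ o, refl (X.α i) x ∈ o)
    (hcard : o.ncard ≤ Z.h) {x x' : V} (hx : x ∈ o) (hx' : x' ∈ o) (hpx : X.proj x ≠ 0) :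
    X.proj x' ≠ 0 := by
  intro hpx'
  set A : Set V := (fun l : ℕ => (Z.G ^ (l : ℤ)) x) '' (Finset.range Z.h : Finset ℕ) with hA
  have h1 : A.ncard = Z.h := by
    rw [hA, (G_pow_injOn hs1 hG hpx).ncard_image, Set.ncard_coe_finset, Finset.card_range]
  have h2 : A ⊆ o := by
    rintro _ ⟨l, -, rfl⟩
    exact G_zpow_mem_of_closed hcl l hx
  have h3 : A = o := Set.eq_of_subset_of_ncard_le h2 (by omega) hfin
  rw [← h3] at hx'
  obtain ⟨l, -, rfl⟩ := hx'
  dsimp only at hpx'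
  rw [proj_G_zpow hG] at hpx'
  exact mul_ne_zero (hst_ne_zero _ _) hpx hpx'

/-- Points of the same norm on a line perpendicular to the axis of a reflection are equal or mirror
images of each other. -/
theorem eq_or_eq_of_reflection {h : ℕ} {k : ℤ} {w w' : ℂ} (hn : ‖w'‖ = ‖w‖)
    (he : w' + hst h (2 * k) * (starRingEnd ℂ) w' = w + hst h (2 * k) * (starRingEnd ℂ) w) :
    w' = w ∨ w' = hst h (2 * k) * (starRingEnd ℂ) w := by
  have key : ∀ w, ∃ v, w = hst h k * v ∧ hst h (2 * k) * (starRingEnd ℂ) w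
      = hst h k * (starRingEnd ℂ) v ∧ ‖w‖ = ‖v‖ := by
    intro w
    refine ⟨hst h (-k) * w, ?_, ?_, ?_⟩
    · rw [← mul_assoc, ← hst_add, add_neg_cancel, hst_zero, one_mul]
    · rw [map_mul, hst_conj, neg_neg, ← mul_assoc, ← hst_add, two_mul]
    · rw [norm_mul, hst_norm, one_mul]
  obtain ⟨v, h1, h2, h3⟩ := key w
  obtain ⟨v', h1', h2', h3'⟩ := key w'
  rw [h2, h2'] at he
  rw [h2]
  rw [h1, h1', ← mul_add, ← mul_add] at he
  have he' := mul_left_cancel₀ (hst_ne_zero _ _) he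
  rw [Complex.add_conj, Complex.add_conj] at he'
  have hre : v'.re = v.re := by
    have : (2 * v'.re : ℝ) = 2 * v.re := by exact_mod_cast he'
    linarith
  have hsq : v'.im ^ 2 = v.im ^ 2 := by
    have h5 : ‖v'‖ ^ 2 = ‖v‖ ^ 2 := by rw [← h3, ← h3', hn]
    rw [Complex.sq_norm, Complex.sq_norm, Complex.normSq_apply, Complex.normSq_apply, hre] at h5
    nlinarith
  rw [h1, h1']
  rcases sq_eq_sq_iff_eq_or_eq_neg.1 hsq with h6 | h6
  · left; congr 1; exact Complex.ext hre h6
  · right; congr 1; exact Complex.ext (by simpa using hre) (by simpa using h6)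

include O hs hc hs1 hG in
/-- The sign classes of simple reflections act on the plane as reflections. -/
theorem exists_proj_cSign (ε : Bool) : ∃ k : ℤ, ∀ x w, X.proj x = X.proj O.x₀ * w →
    X.proj (cSign X.α X.σ ε x) = X.proj O.x₀ * (hst Z.h (2 * k) * (starRingEnd ℂ) w) := by
  by_cases h : ε = Z.η
  · subst h
    exact ⟨s, fun x w hx => proj_cSign_η O hs hc hs1 hG x w hx⟩
  · obtain rfl := Bool.eq_not_of_ne h
    refine ⟨0, fun x w hx => ?_⟩
    rw [mul_zero, hst_zero, one_mul]
    exact proj_cSign O hs hc hs1 hG x w hx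

include O hs hc hs1 hG in
/-- A simple reflection `s_j` that moves an element `x` of a small orbit acts on it as `c_ε`, as the
line through the projection of `x` perpendicular to `L_ε` contains the projections of at most two
elements, except possibly if it passes through the origin. -/
theorem eq_of_moves {o : Set V} (hfin : o.Finite) (hcl : ∀ i, ∀ x ∈ o, refl (X.α i) x ∈ o)
    (hcard : o.ncard < 2 * Z.h) {x : V} (hx : x ∈ o) (hpx : X.proj x ≠ 0) {ε : Bool}
    (hanti : X.proj (cSign X.α X.σ ε x) ≠ -X.proj x ∨ ∀ x' ∈ o, X.proj x' ≠ 0) {j k : Fin n}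
    (hj : X.σ j = ε) (hk : X.σ k = ε) (hxj : ⟪nroot X.α j, x⟫_ℝ ≠ 0)
    (hxk : ⟪nroot X.α k, x⟫_ℝ ≠ 0) : j = k := by
  have hp := proj_x₀_ne_zero O hs hc
  obtain ⟨m, hm⟩ := exists_proj_cSign O hs hc hs1 hG ε
  set p := X.proj O.x₀ with hpdef
  set y := refl (X.α j) x with hy
  have hyo : y ∈ o := hcl j x hx
  have hsum : y + cSign X.α X.σ ε y = x + cSign X.α X.σ ε x := by
    have h1 : cSign X.α X.σ ε (nroot X.α j) = -nroot X.α j := by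
      unfold nroot
      rw [map_smul, cSign_simple hs ε j hj, smul_neg]
    rw [hy, refl_simple, map_sub, map_smul, h1, smul_neg]
    abel
  obtain ⟨w, hw⟩ : ∃ w, X.proj x = p * w := ⟨X.proj x / p, by field_simp⟩
  obtain ⟨w', hw'⟩ : ∃ w, X.proj y = p * w := ⟨X.proj y / p, by field_simp⟩
  have h2 := congrArg X.proj hsum
  rw [X.proj_add, X.proj_add, hm _ _ hw, hm _ _ hw', hw, hw', ← mul_add, ← mul_add] at h2
  have h3 := mul_left_cancel₀ hp h2
  have hpy : X.proj y ≠ 0 := by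
    rcases hanti with hanti | h
    · intro h0
      have hw0 : w' = 0 := by
        rw [h0] at hw'
        exact (mul_eq_zero.1 hw'.symm).resolve_left hp
      rw [hw0, map_zero, mul_zero, add_zero] at h3
      refine hanti ?_
      rw [hm _ _ hw, hw, ← mul_neg]
      congr 1
      linear_combination -h3
    · exact h y hyo
  obtain ⟨l, hl⟩ := exists_zpow_eq hs1 hG hfin hcl hcard hx hyo hpx hpy
  have hnorm : ‖w'‖ = ‖w‖ := by
    have h4 : ‖X.proj y‖ = ‖X.proj x‖ := by
      rw [hl, proj_G_zpow hG, norm_mul, hst_norm, one_mul]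
    rw [hw, hw', norm_mul, norm_mul] at h4
    exact mul_left_cancel₀ (norm_ne_zero_iff.2 hp) h4
  -- elements with the same nonzero projection are equal
  have hinj : ∀ a ∈ o, X.proj a ≠ 0 → X.proj y = X.proj a → y = a := by
    intro a ha hpa hya
    obtain ⟨l, rfl⟩ := exists_zpow_eq hs1 hG hfin hcl hcard hyo ha hpy hpa
    rw [proj_G_zpow hG] at hya
    have h5 : hst Z.h 0 = hst Z.h (2 * s * l) := by
      rw [hst_zero]
      exact mul_right_cancel₀ hpy (by rw [one_mul]; exact hya)
    rw [hst_eq_hst_iff (by have := Z.three_le; omega), zero_sub, dvd_neg,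
      show 2 * s * l = 2 * (s * l) by ring, mul_dvd_mul_iff_left two_ne_zero,
      dvd_sign_mul hs1] at h5
    obtain ⟨d, rfl⟩ := h5
    rw [zpow_mul, zpow_natCast, O.G_pow_h hs, one_zpow]; rfl
  have hyc : y = cSign X.α X.σ ε x := by
    rcases eq_or_eq_of_reflection hnorm h3 with h4 | h4
    · exfalso
      have h5 := hinj x hx hpx (by rw [hw, hw', h4])
      rw [hy, refl_simple_eq_self_iff] at h5
      exact hxj h5
    · have h6 : X.proj y = X.proj (cSign X.α X.σ ε x) := by rw [hm _ _ hw, hw', h4]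
      refine hinj _ ?_ (h6 ▸ hpy) h6
      exact orbitOf_subset X.α hx hcl ⟨_, cSign_mem_weylGroup _ _ ε, rfl⟩
  by_contra hjk
  have h7 := congrArg (fun v => ⟪nroot X.α k, v⟫_ℝ) hyc
  rw [inner_cSign_same hs ε x k hk, hy, refl_simple, inner_sub_right, real_inner_smul_right,
    hs k j (fun h => hjk h.symm) (hk.trans hj.symm), mul_zero, sub_zero] at h7
  exact hxk (by linarith)

include O hs hc hs1 hG in
/-- A stable set of nonzero vectors with less than `2 h` elements contains a multiple `x` of a
fundamental weight, for a simple root `i` with a neighborhood restricted by the requirement that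
the next two elements of the zigzag starting at `x` are also moved by at most one simple reflection
of each sign. -/
theorem exists_weight {o : Set V} (hfin : o.Finite) (hne : o.Nonempty) (h0 : (0 : V) ∉ o)
    (hcl : ∀ i, ∀ x ∈ o, refl (X.α i) x ∈ o) (hcard : o.ncard < 2 * Z.h) :
    ∃ x ∈ o, ∃ (i : Fin n) (t : ℝ), t ≠ 0 ∧ (∀ j, ⟪nroot X.α j, x⟫_ℝ = if j = i then t else 0) ∧
      (Z.h ≠ 4 ∨ o.ncard ≤ Z.h → ∀ j j', j ≠ i → j' ≠ i → ⟪nroot X.α j, nroot X.α i⟫_ℝ ≠ 0 →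
        ⟪nroot X.α j', nroot X.α i⟫_ℝ ≠ 0 → j = j') ∧
      (Z.h ≠ 6 ∨ o.ncard ≤ Z.h → ∀ k k', X.σ k = X.σ i → X.σ k' = X.σ i →
        (∑ j with X.σ j = !X.σ i, ⟪nroot X.α k, nroot X.α j⟫_ℝ * ⟪nroot X.α j, nroot X.α i⟫_ℝ)
          - (if k = i then 1 else 0) ≠ 0 →
        (∑ j with X.σ j = !X.σ i, ⟪nroot X.α k', nroot X.α j⟫_ℝ * ⟪nroot X.α j, nroot X.α i⟫_ℝ)
          - (if k' = i then 1 else 0) ≠ 0 → k = k') := by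
  have h3 := Z.three_le
  have hh0 : Z.h ≠ 0 := by omega
  obtain ⟨x', hx', hpx'⟩ := exists_proj_ne_zero (Z := Z) hs hc hfin hne h0 hcl
  have hclc : ∀ ε, ∀ x ∈ o, cSign X.α X.σ ε x ∈ o := fun ε x hx =>
    orbitOf_subset X.α hx hcl ⟨_, cSign_mem_weylGroup _ _ ε, rfl⟩
  have hcc : ∀ ε x, cSign X.α X.σ (!ε) (cSign X.α X.σ ε x) =
      (Z.G ^ (if ε = Z.η then (-1 : ℤ) else 1)) x := by
    intro ε x
    split_ifs with h
    · subst h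
      have := Z.cSign_G_zpow hs 1 (cSign X.α X.σ (!Z.η) x)
      rw [cSign_cSign hs, zpow_one] at this
      rw [← this, Z.cSign_η hs]
    · obtain rfl := Bool.eq_not_of_ne h
      rw [Bool.not_not, zpow_one]; rfl
  have hpG : ∀ (l : ℤ) {y : V}, X.proj y ≠ 0 → X.proj ((Z.G ^ l) y) ≠ 0 := fun l y hy => by
    rw [proj_G_zpow hG]; exact mul_ne_zero (hst_ne_zero _ _) hy
  -- an element fixed by one of the sign classes
  obtain ⟨x, hx, hpx, ε, hfix⟩ : ∃ x ∈ o, X.proj x ≠ 0 ∧ ∃ ε, cSign X.α X.σ ε x = x := by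
    have hpc : X.proj (cSign X.α X.σ (!Z.η) x') ≠ 0 := by
      obtain ⟨m, hm⟩ := exists_proj_cSign O hs hc hs1 hG (!Z.η)
      have hp := proj_x₀_ne_zero O hs hc
      rw [hm x' (X.proj x' / X.proj O.x₀) (by field_simp)]
      refine mul_ne_zero hp (mul_ne_zero (hst_ne_zero _ _) ?_)
      rw [ne_eq, map_eq_zero]
      exact div_ne_zero hpx' hp
    obtain ⟨l, hl⟩ := exists_zpow_eq hs1 hG hfin hcl hcard hx' (hclc _ _ hx') hpx' hpc
    have hcomp : ∀ a b : ℤ, (Z.G ^ a) ((Z.G ^ b) x') = (Z.G ^ (a + b)) x' := by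
      intro a b; rw [zpow_add]; rfl
    rcases Int.even_or_odd l with ⟨m, hm⟩ | ⟨m, hm⟩
    · refine ⟨(Z.G ^ m) x', G_zpow_mem_of_closed hcl m hx', hpG m hpx', !Z.η, ?_⟩
      rw [Z.cSign_G_zpow hs, hl, hcomp, hm]; congr 2; ring
    · refine ⟨(Z.G ^ (m + 1)) x', G_zpow_mem_of_closed hcl _ hx', hpG _ hpx', Z.η, ?_⟩
      rw [Z.cSign_η_G_zpow hs, hl, hcomp, hm]; congr 2; ring
  obtain ⟨e, he, he'⟩ : ∃ e : ℤ, (e = 1 ∨ e = -1) ∧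
      ∀ y, cSign X.α X.σ (!ε) (cSign X.α X.σ ε y) = (Z.G ^ e) y :=
    ⟨if ε = Z.η then -1 else 1, by split_ifs <;> simp, hcc ε⟩
  obtain ⟨e2, he2, he2'⟩ : ∃ e : ℤ, (e = 1 ∨ e = -1) ∧
      ∀ y, cSign X.α X.σ ε (cSign X.α X.σ (!ε) y) = (Z.G ^ e) y :=
    ⟨if (!ε) = Z.η then -1 else 1, by split_ifs <;> simp, fun y => by simpa using hcc (!ε) y⟩
  set c := cSign X.α X.σ (!ε) with hcdef
  set c' := cSign X.α X.σ ε with hcdef'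
  -- the projections of consecutive elements of the zigzag are not antipodal
  have hanti : ∀ (l : ℤ) (y : V), X.proj y ≠ 0 → ¬ ((2 * Z.h : ℤ) ∣ 2 * s * l + Z.h) →
      X.proj ((Z.G ^ l) y) ≠ -X.proj y := by
    intro l y hy hl hc
    rw [proj_G_zpow hG, ← neg_one_mul] at hc
    have h4 := mul_right_cancel₀ hy hc
    have h5 : -hst Z.h (2 * s * l) = hst Z.h 0 := by rw [h4, neg_neg, hst_zero]
    rw [neg_hst hh0, hst_eq_hst_iff hh0, sub_zero] at h5
    exact hl h5
  have hnz : o.ncard ≤ Z.h → ∀ x' ∈ o, X.proj x' ≠ 0 := fun h x' hx' =>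
    proj_ne_zero_of_ncard_le hs1 hG hfin hcl h hx hx' hpx
  have hsmall : ∀ m : ℤ, 1 ≤ m → m ≤ 3 → (Z.h : ℤ) ≠ 2 * m → ∀ u : ℤ, (u = 1 ∨ u = -1) →
      ¬ ((2 * Z.h : ℤ) ∣ 2 * s * (u * m) + Z.h) := by
    rintro m hm1 hm2 hm3 u hu ⟨d, hd⟩
    have h4 : (Z.h : ℤ) * (2 * d - 1) = 2 * m * (s * u) := by linear_combination -hd
    obtain ⟨v, hv, hv'⟩ : ∃ v, (v = 1 ∨ v = -1) ∧ s * u = v :=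
      ⟨_, by rcases hs1 with rfl | rfl <;> rcases hu with rfl | rfl <;> simp, rfl⟩
    rw [hv'] at h4
    have h6 : (Z.h : ℤ) ∣ 2 * m := by
      refine ⟨(2 * d - 1) * v, ?_⟩
      rcases hv with rfl | rfl
      · linear_combination -h4
      · linear_combination h4
    have h8 := Int.le_of_dvd (by omega) h6
    obtain ⟨q, hq⟩ := h6
    have hq0 : 0 < q := by
      by_contra hneg
      have : (Z.h : ℤ) * q ≤ 0 := mul_nonpos_of_nonneg_of_nonpos (by omega) (by omega)
      omega
    have hq1 : q ≠ 1 := by rintro rfl; omega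
    have hq2 : q < 3 := by
      by_contra hneg
      have : (3 : ℤ) * 3 ≤ Z.h * q := mul_le_mul (by omega) (by omega) (by norm_num) (by omega)
      omega
    have hq3 : q = 2 := by omega
    subst hq3
    have h10 : (Z.h : ℤ) * (2 * d - 1) = Z.h * (2 * v) := by rw [h4, hq]; ring
    have := mul_left_cancel₀ (show (Z.h : ℤ) ≠ 0 by omega) h10
    omega
  have hxne : x ≠ 0 := fun h => h0 (h ▸ hx)
  obtain ⟨i, hi⟩ : ∃ i, ⟪nroot X.α i, x⟫_ℝ ≠ 0 := by
    by_contra hno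
    push Not at hno
    exact hxne (eq_zero_of_inner_nroot X.α hno)
  have hfix0 := (cSign_eq_self_iff hs ε x).1 hfix
  have hσi : X.σ i = !ε := Bool.eq_not_of_ne fun h => hi (hfix0 i h)
  have hcx : c x = (Z.G ^ e) x := by rw [← he', hfix]
  have huniq : ∀ j, j ≠ i → ⟪nroot X.α j, x⟫_ℝ = 0 := by
    intro j hj
    by_contra h
    have hσj : X.σ j = !ε := Bool.eq_not_of_ne fun h' => h (hfix0 j h')
    refine hj (eq_of_moves O hs hc hs1 hG hfin hcl hcard hx hpx (Or.inl ?_) hσj hσi h hi)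
    rw [← hcdef, hcx, ← mul_one e]
    exact hanti _ _ hpx (hsmall 1 le_rfl (by norm_num) (by omega) e he)
  set t := ⟪nroot X.α i, x⟫_ℝ with ht
  have hweight : ∀ j, ⟪nroot X.α j, x⟫_ℝ = if j = i then t else 0 := by
    intro j
    split_ifs with h
    · rw [h]
    · exact huniq j h
  -- the second element of the zigzag
  have hy2 : c x = x - t • nroot X.α i := by
    rw [hcdef, cSign_apply hs, Finset.sum_eq_single i]
    · intro k _ hk; rw [huniq k hk, zero_smul]
    · intro h; simp [hσi] at h
  have hpcx : X.proj (c x) ≠ 0 := hcx ▸ hpG e hpx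
  refine ⟨x, hx, i, t, hi, hweight, ?_, ?_⟩
  · intro hcond j j' hji hji' hj hj'
    have hin : ∀ j, j ≠ i → ⟪nroot X.α j, c x⟫_ℝ = -(t * ⟪nroot X.α j, nroot X.α i⟫_ℝ) := by
      intro j hj
      rw [hy2, inner_sub_right, huniq j hj, real_inner_smul_right, zero_sub]
    have hσ : ∀ j, j ≠ i → ⟪nroot X.α j, nroot X.α i⟫_ℝ ≠ 0 → X.σ j = ε := by
      intro j hj h
      by_contra h'
      exact h (hs j i hj (by rw [hσi, Bool.eq_not_of_ne h']))
    refine eq_of_moves O hs hc hs1 hG hfin hcl hcard (hclc (!ε) x hx) hpcx ?_ (hσ j hji hj)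
      (hσ j' hji' hj') ?_ ?_
    · rcases hcond with hcond | hcond
      · left
        have h4 : c' (c x) = (Z.G ^ (e2 * 2)) (c x) := by
          rw [he2', mul_two, zpow_add]
          change _ = (Z.G ^ e2) ((Z.G ^ e2) (c x))
          have e3 : (Z.G ^ e2) (c x) = x := by rw [← he2', hcdef, cSign_cSign hs, hfix]
          rw [e3]
        rw [← hcdef, ← hcdef', h4]
        exact hanti _ _ hpcx (hsmall 2 (by norm_num) (by norm_num) (by omega) e2 he2)
      · exact Or.inr (hnz hcond)
    · rw [← hcdef, hin j hji]; exact neg_ne_zero.2 (mul_ne_zero hi hj)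
    · rw [← hcdef, hin j' hji']; exact neg_ne_zero.2 (mul_ne_zero hi hj')
  · intro hcond k k' hk hk' hsum hsum'
    -- the third element of the zigzag
    have hy3 : ∀ k, X.σ k = X.σ i → ⟪nroot X.α k, c' (c x)⟫_ℝ
        = t * ((∑ j with X.σ j = !X.σ i, ⟪nroot X.α k, nroot X.α j⟫_ℝ *
          ⟪nroot X.α j, nroot X.α i⟫_ℝ) - (if k = i then 1 else 0)) := by
      intro k hk
      have e1 : ⟪nroot X.α k, c x⟫_ℝ = -(t * if k = i then 1 else 0) := by
        rw [hcdef, inner_cSign_same hs _ _ _ (hk.trans hσi), hweight]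
        split_ifs <;> simp
      have e2 : ∀ j, X.σ j = ε → ⟪nroot X.α j, c x⟫_ℝ = -(t * ⟪nroot X.α j, nroot X.α i⟫_ℝ) := by
        intro j hj
        rw [hy2, inner_sub_right, hfix0 j hj, real_inner_smul_right, zero_sub]
      rw [hcdef', cSign_apply hs, inner_sub_right, inner_sum, e1, hσi, Bool.not_not, mul_sub,
        Finset.mul_sum, sub_eq_add_neg, add_comm, ← sub_eq_add_neg]
      congr 1
      rw [← Finset.sum_neg_distrib]
      refine Finset.sum_congr rfl fun j hj => ?_
      rw [real_inner_smul_right, e2 j (by simpa using hj)]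
      ring
    have hpc : X.proj (c' (c x)) ≠ 0 := he2' x ▸ hpG e2 hpx
    refine eq_of_moves O hs hc hs1 hG hfin hcl hcard (hclc _ _ (hclc _ x hx)) hpc ?_
      (hk.trans hσi) (hk'.trans hσi) ?_ ?_
    · rcases hcond with hcond | hcond
      · left
        have h4 : c (c' (c x)) = (Z.G ^ (e * 3)) (c' (c x)) := by
          have e3 : (Z.G ^ e) (c' (c x)) = x := by
            rw [← he', hcdef', cSign_cSign hs, hcdef, cSign_cSign hs]
          rw [show e * 3 = e + (e + e) by ring, zpow_add, zpow_add]
          change _ = (Z.G ^ e) ((Z.G ^ e) ((Z.G ^ e) (c' (c x))))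
          rw [e3, ← hcx, ← he' (c x)]
        change X.proj (c (c' (c x))) ≠ _
        rw [h4]
        exact hanti _ _ hpc (hsmall 3 (by norm_num) le_rfl (by omega) e he)
      · exact Or.inr (hnz hcond)
    · change ⟪nroot X.α k, c' (c x)⟫_ℝ ≠ 0
      rw [hy3 k hk]; exact mul_ne_zero hi hsum
    · change ⟪nroot X.α k', c' (c x)⟫_ℝ ≠ 0
      rw [hy3 k' hk']; exact mul_ne_zero hi hsum'

end Setup

/-! ### Zigzags from foldings -/

section FoldZigZag

variable {α : Module.Basis (Fin n) ℝ V} {σ : Fin n → Bool}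

theorem FoldDatum.foldVec_nonneg {K 𝓕 : Type*} [Fintype K] [DecidableEq K] {B : BaseModel K 𝓕}
    (Q : FoldDatum B α σ) {x : K → ℝ} (hx : ∀ k, 0 ≤ x k) (i : Fin n) : 0 ≤ Q.foldVec x i := by
  refine Finset.sum_nonneg fun k _ => ?_
  split_ifs
  · exact mul_nonneg (Q.w_pos k).le (hx k)
  · exact le_rfl

theorem FoldDatum.foldVec_pos {K 𝓕 : Type*} [Fintype K] [DecidableEq K] {B : BaseModel K 𝓕}
    (Q : FoldDatum B α σ) {x : K → ℝ} (hx : ∀ k, 0 ≤ x k) {k : K} (hk : 0 < x k) :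
    0 < Q.foldVec x (Q.j k) := by
  refine Finset.sum_pos' (fun l _ => ?_) ⟨k, Finset.mem_univ _, ?_⟩
  · split_ifs
    · exact mul_nonneg (Q.w_pos l).le (hx l)
    · exact le_rfl
  · rw [if_pos rfl]; exact mul_pos (Q.w_pos k) hk

/-- The zigzag obtained by folding the zigzag `μ` of a simply laced diagram. -/
def FoldDatum.zigZag {K 𝓕 : Type*} [Fintype K] [DecidableEq K] {B : BaseModel K 𝓕}
    (Q : FoldDatum B α σ) (h : ℕ) (h3 : 3 ≤ h) (k₀ : K) (hw : Q.w k₀ = 1) (μ : ℕ → K → ℤ)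
    (nonneg : ∀ p k, 0 ≤ μ p k) (zero : ∀ k, μ 0 k = 0)
    (one : ∀ k, μ 1 k = if k = k₀ then 1 else 0) (last : ∀ k, μ h k = 0)
    (supp : ∀ p k, μ p k ≠ 0 → B.s k = sgnOf (B.s k₀) p)
    (recur : ∀ p, 1 ≤ p → p < h → ∀ k, μ (p + 1) k + μ (p - 1) k = ∑ l, B.adj k l * μ p l)
    (pos : ∀ p, 1 ≤ p → p < h → ∃ k, 0 < μ p k)
    (cover : ∀ k, ∃ p, 1 ≤ p ∧ p < h ∧ 0 < μ p k) : ZigZag α σ where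
  h := h
  three_le := h3
  i₀ := Q.j k₀
  κ p := Q.foldVec fun k => (μ p k : ℝ)
  nonneg p i := Q.foldVec_nonneg (fun k => Int.cast_nonneg (nonneg p k)) i
  zero i := by simp [Folding.foldVec, zero]
  one i := by
    unfold Folding.foldVec
    rw [Finset.sum_eq_single k₀]
    · simp [one, hw, eq_comm]
    · intro k _ hk; simp [one, hk]
    · simp
  last i := by simp [Folding.foldVec, last]
  supp p i hp := by
    obtain ⟨k, -, hk⟩ := Finset.exists_ne_zero_of_sum_ne_zero hp
    split_ifs at hk with hj
    · rw [← hj, Q.sign, Q.sign]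
      refine supp p k fun h0 => hk ?_
      simp [h0]
    · exact absurd rfl hk
  recur p hp hp' i := by
    rw [← Q.foldVec_adj]
    unfold Folding.foldVec
    rw [← Finset.sum_add_distrib]
    refine Finset.sum_congr rfl fun k _ => ?_
    split_ifs
    · rw [← mul_add]
      congr 1
      beta_reduce
      exact_mod_cast recur p hp hp' k
    · rw [add_zero]
  exists_pos p hp hp' := by
    obtain ⟨k, hk⟩ := pos p hp hp'
    exact ⟨Q.j k, Q.foldVec_pos (fun k => Int.cast_nonneg (nonneg p k)) (Int.cast_pos.2 hk)⟩
  cover i := by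
    obtain ⟨k, rfl⟩ := Q.j_surj i
    obtain ⟨p, hp, hp', hk⟩ := cover k
    exact ⟨p, hp, hp', Q.foldVec_pos (fun k => Int.cast_nonneg (nonneg p k)) (Int.cast_pos.2 hk)⟩

/-- A coefficient vector supported at one node. -/
theorem FoldDatum.foldVec_single {K 𝓕 : Type*} [Fintype K] [DecidableEq K] {B : BaseModel K 𝓕}
    (Q : FoldDatum B α σ) (k : K) (x : K → ℝ) (hx : ∀ l, x l = if l = k then 1 else 0)
    (i : Fin n) : Q.foldVec x i = if Q.j k = i then Q.w k else 0 := by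
  unfold Folding.foldVec
  rw [Finset.sum_eq_single k]
  · rw [hx, if_pos rfl, mul_one]
  · intro l _ hl; rw [hx, if_neg hl]; simp
  · simp

namespace ZigZag

variable (Z : ZigZag α σ) {x₀ : V} {t : ℝ}

theorem refl_y_of_zero (hx : ∀ j, ⟪nroot α j, x₀⟫_ℝ = if j = Z.i₀ then t else 0) {p : ℕ}
    (hp : 1 ≤ p) (hp' : p ≤ Z.h) {i : Fin n} (h : Z.κ p i = 0) (h' : Z.κ (p - 1) i = 0) :
    refl (α i) (Z.y x₀ t p) = Z.y x₀ t p := by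
  rw [refl_simple_eq_self_iff, Z.inner_y hx hp hp', h, h', sub_self, mul_zero]

theorem κ_pred_eq_zero {p : ℕ} (hp : 1 ≤ p) {i : Fin n} (h : Z.κ p i ≠ 0) : Z.κ (p - 1) i = 0 := by
  refine Z.κ_eq_zero fun h' => ?_
  have h1 := Z.supp p i h
  obtain ⟨q, rfl⟩ : ∃ q, p = q + 1 := ⟨p - 1, by omega⟩
  rw [sgnOf_succ] at h1
  change σ i = _ at h'
  rw [Nat.add_sub_cancel, h1] at h'
  change (!sgnOf (σ Z.i₀) q) = sgnOf (σ Z.i₀) q at h'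
  revert h'; cases sgnOf (σ Z.i₀) q <;> simp

/-- A step of the zigzag that is a multiple of a simple root is a simple reflection. -/
theorem refl_y_of_single (hx : ∀ j, ⟪nroot α j, x₀⟫_ℝ = if j = Z.i₀ then t else 0) {p : ℕ}
    (hp : 1 ≤ p) (hp' : p ≤ Z.h) {i : Fin n} (h : ∀ i', i' ≠ i → Z.κ p i' = 0)
    (hi : Z.κ p i ≠ 0) :
    refl (α i) (Z.y x₀ t p) = Z.y x₀ t (p + 1) := by
  rw [refl_simple, Z.inner_y hx hp hp', Z.κ_pred_eq_zero hp hi, sub_zero, y_succ, v,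
    Finset.sum_eq_single i, smul_smul]
  · intro j _ hj; rw [h j hj, zero_smul]
  · simp

end ZigZag

end FoldZigZag

/-! ### The zigzag in type `A` and its foldings -/

section ZigZagA

variable {α : Module.Basis (Fin n) ℝ V} {σ : Fin n → Bool} {r : ℕ} {η : Bool}

/-- The zigzag given by a folding of type `A r`. -/
def FoldDatum.zigZagA (Q : FoldDatum (baseA r η) α σ) (hr : 2 ≤ r)
    (hw : Q.w ⟨0, by omega⟩ = 1) : ZigZag α σ :=
  Q.zigZag (r + 1) (by omega) ⟨0, by omega⟩ hw (fun p k => if (k : ℕ) + 1 = p then 1 else 0)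
    (fun p k => by split_ifs <;> simp) (fun k => if_neg (by omega))
    (fun k => by simp [Fin.ext_iff])
    (fun k => if_neg (by have := k.2; omega))
    (fun p k hk => by
      change sgnOf η (k + 1) = sgnOf (sgnOf η (0 + 1)) p
      have : (k : ℕ) + 1 = p := by by_contra h; rw [if_neg h] at hk; exact hk rfl
      rw [this]; simp [sgnOf])
    (fun p hp hp' k => by
      have h := sum_adjPath (r := r) (fun l => if l = p then 1 else 0) (if_neg (by omega))
        (if_neg (by omega)) k
      refine Eq.trans ?_ h.symm
      split_ifs <;> omega)
    (fun p hp hp' => ⟨⟨p - 1, by omega⟩, by rw [if_pos (by simp; omega)]; norm_num⟩)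
    (fun k => ⟨k + 1, by omega, by have := k.2; omega, by simp⟩)

variable (Q : FoldDatum (baseA r η) α σ) (hr : 2 ≤ r) (hw : Q.w ⟨0, by omega⟩ = 1)

theorem zigZagA_κ (k : Fin r) (i : Fin n) :
    (Q.zigZagA hr hw).κ (k + 1) i = if Q.j k = i then Q.w k else 0 := by
  refine Q.foldVec_single k _ (fun l => ?_) i
  simp only [Nat.add_right_cancel_iff, Fin.ext_iff]
  split_ifs <;> simp

variable {x₀ : V} {t : ℝ} (ht : t ≠ 0)
  (hx : ∀ j, ⟪nroot α j, x₀⟫_ℝ = if j = (Q.zigZagA hr hw).i₀ then t else 0)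

include hx in
theorem refl_yA (k : Fin r) :
    refl (α (Q.j k)) ((Q.zigZagA hr hw).y x₀ t (k + 1)) = (Q.zigZagA hr hw).y x₀ t (k + 2) :=
  ZigZag.refl_y_of_single _ hx (by omega) (by have := k.2; change _ ≤ r + 1; omega)
    (fun i' hi' => by rw [zigZagA_κ, if_neg (Ne.symm hi')])
    (by rw [zigZagA_κ, if_pos rfl]; exact (Q.w_pos k).ne')

include hx in
theorem refl_yA' (k : Fin r) :
    refl (α (Q.j k)) ((Q.zigZagA hr hw).y x₀ t (k + 2)) = (Q.zigZagA hr hw).y x₀ t (k + 1) := by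
  rw [← refl_yA Q hr hw hx, refl_refl]

include hx in
/-- A simple reflection moves an element of the zigzag to a neighbor or fixes it. -/
theorem refl_yA_cases {q : ℕ} (hq : 1 ≤ q) (hq' : q ≤ r + 1) (i : Fin n) :
    (∃ k : Fin r, Q.j k = i ∧ q = k + 1) ∨ (∃ k : Fin r, Q.j k = i ∧ q = k + 2) ∨
      refl (α i) ((Q.zigZagA hr hw).y x₀ t q) = (Q.zigZagA hr hw).y x₀ t q := by
  by_cases h1 : (Q.zigZagA hr hw).κ q i = 0
  · by_cases h2 : (Q.zigZagA hr hw).κ (q - 1) i = 0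
    · exact Or.inr (Or.inr (ZigZag.refl_y_of_zero _ hx hq hq' h1 h2))
    · right; left
      have hq2 : q ≠ 1 := by rintro rfl; exact h2 ((Q.zigZagA hr hw).zero i)
      refine ⟨⟨q - 2, by omega⟩, ?_, by simp; omega⟩
      by_contra hj
      apply h2
      have := zigZagA_κ Q hr hw ⟨q - 2, by omega⟩ i
      rw [if_neg hj] at this
      rw [← this]; congr 1; simp; omega
  · left
    have hq2 : q ≠ r + 1 := by rintro rfl; exact h1 ((Q.zigZagA hr hw).last i)
    refine ⟨⟨q - 1, by omega⟩, ?_, by simp; omega⟩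
    by_contra hj
    apply h1
    have := zigZagA_κ Q hr hw ⟨q - 1, by omega⟩ i
    rw [if_neg hj] at this
    rw [← this]; congr 1; simp; omega

include hx in
theorem refl_mem_zigZagA (i : Fin n) {x : V}
    (h : ∃ p, 1 ≤ p ∧ p ≤ r + 1 ∧ x = (Q.zigZagA hr hw).y x₀ t p) :
    ∃ p, 1 ≤ p ∧ p ≤ r + 1 ∧ refl (α i) x = (Q.zigZagA hr hw).y x₀ t p := by
  obtain ⟨p, hp, hp', rfl⟩ := h
  rcases refl_yA_cases Q hr hw hx hp hp' i with ⟨k, rfl, rfl⟩ | ⟨k, rfl, rfl⟩ | h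
  · exact ⟨k + 2, by omega, by omega, refl_yA Q hr hw hx k⟩
  · exact ⟨k + 1, by omega, by omega, refl_yA' Q hr hw hx k⟩
  · exact ⟨p, hp, hp', h⟩

include ht hx in
/-- In type `A` and its foldings, the zigzag is an orbit. -/
def orbitA {o : Set V} (ho : o = orbitOf α x₀) : (Q.zigZagA hr hw).Orbit o where
  x₀ := x₀
  t := t
  t_ne := ht
  weight := hx
  mem := ho ▸ self_mem_orbitOf α x₀
  closed i x h := by rw [ho] at h ⊢; exact orbitOf_closed α h (refl_mem_weylGroup α i)
  shape x h := by
    left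
    rw [ho] at h
    refine orbitOf_subset α
      (S := {x | ∃ p, 1 ≤ p ∧ p ≤ r + 1 ∧ x = (Q.zigZagA hr hw).y x₀ t p}) ?_ ?_ h
    · exact ⟨1, le_rfl, by omega, (ZigZag.y_one _ _ _).symm⟩
    · intro i y hy; exact refl_mem_zigZagA Q hr hw hx i hy

include hx in
theorem orbitOf_subset_A :
    orbitOf α x₀ ⊆ (fun p => (Q.zigZagA hr hw).y x₀ t p) '' (Finset.Icc 1 (r + 1) : Finset ℕ) := by
  refine orbitOf_subset α ?_ ?_
  · exact ⟨1, by simp, ZigZag.y_one _ _ _⟩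
  · rintro i _ ⟨p, hp, rfl⟩
    rw [Finset.coe_Icc, Set.mem_Icc] at hp
    obtain ⟨q, h1, h2, h3⟩ := refl_mem_zigZagA Q hr hw hx i ⟨p, hp.1, hp.2, rfl⟩
    exact ⟨q, by simp [h1, h2], h3.symm⟩

end ZigZagA

/-! ### The zigzag in type `D` and its foldings -/

section ZigZagD

/-- The zigzag of type `D (m + 1)` starting at the end of the path. -/
def zigD (m p k : ℕ) : ℤ :=
  if k + 1 < m then (if k + 1 = p ∨ p + k + 1 = 2 * m then 1 else 0) else if p = m then 1 else 0

theorem zigD_spec (m p k : ℕ) :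
    (k + 1 < m ∧ (k + 1 = p ∨ p + k + 1 = 2 * m) ∧ zigD m p k = 1) ∨
    (k + 1 < m ∧ k + 1 ≠ p ∧ p + k + 1 ≠ 2 * m ∧ zigD m p k = 0) ∨
    (m ≤ k + 1 ∧ p = m ∧ zigD m p k = 1) ∨ (m ≤ k + 1 ∧ p ≠ m ∧ zigD m p k = 0) := by
  unfold zigD
  by_cases h1 : k + 1 < m
  · rw [if_pos h1]; split_ifs <;> omega
  · rw [if_neg h1]; split_ifs <;> omega

theorem zigD_nonneg (m p k : ℕ) : 0 ≤ zigD m p k := by have := zigD_spec m p k; omega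

theorem zigD_zero {m k : ℕ} (hm : 3 ≤ m) : zigD m 0 k = 0 := by
  have := zigD_spec m 0 k; omega

theorem zigD_one {m k : ℕ} (hm : 3 ≤ m) : zigD m 1 k = if k = 0 then 1 else 0 := by
  have := zigD_spec m 1 k; split_ifs <;> omega

theorem zigD_last {m k : ℕ} (hm : 3 ≤ m) : zigD m (2 * m) k = 0 := by
  have := zigD_spec m (2 * m) k; omega

theorem zigD_supp {m p k : ℕ} (hk : k ≤ m) (h : zigD m p k ≠ 0) : nodeD m k % 2 = p % 2 := by
  have h2 := nodeD_mod hk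
  have := zigD_spec m p k
  omega

theorem zigD_recur {m p k : ℕ} (hm : 3 ≤ m) (hp : 1 ≤ p) (hp' : p < 2 * m) (hk : k ≤ m) :
    zigD m (p + 1) k + zigD m (p - 1) k =
      if k + 2 < m then (if k = 0 then 0 else zigD m p (k - 1)) + zigD m p (k + 1)
      else if k + 2 = m then zigD m p (k - 1) + zigD m p (m - 1) + zigD m p m
      else zigD m p (m - 2) := by
  have h1 := zigD_spec m (p + 1) k
  have h2 := zigD_spec m (p - 1) k
  have h3 := zigD_spec m p (k - 1)
  split_ifs with h h0 h'
  · have h4 := zigD_spec m p (k + 1); omega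
  · have h4 := zigD_spec m p (k + 1); omega
  · have h4 := zigD_spec m p (m - 1); have h5 := zigD_spec m p m; omega
  · have h4 := zigD_spec m p (m - 2); omega

theorem exists_zigD_pos {m p : ℕ} (hp : 1 ≤ p) (hp' : p < 2 * m) : ∃ k ≤ m, 0 < zigD m p k := by
  rcases lt_trichotomy p m with h | h | h
  · exact ⟨p - 1, by omega, by have := zigD_spec m p (p - 1); omega⟩
  · exact ⟨m, by omega, by have := zigD_spec m p m; omega⟩
  · exact ⟨2 * m - 1 - p, by omega, by have := zigD_spec m p (2 * m - 1 - p); omega⟩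

theorem zigD_cover {m : ℕ} (hm : 3 ≤ m) (k : ℕ) : ∃ p, 1 ≤ p ∧ p < 2 * m ∧ 0 < zigD m p k := by
  by_cases h : k + 1 < m
  · exact ⟨k + 1, by omega, by omega, by have := zigD_spec m (k + 1) k; omega⟩
  · exact ⟨m, by omega, by omega, by have := zigD_spec m m k; omega⟩

/-- The two nodes at the end of the fork. -/
def forkNode (m : ℕ) (c : Bool) : Fin (m + 1) := ⟨if c then m else m - 1, by split_ifs <;> omega⟩

theorem forkNode_val (m : ℕ) (c : Bool) :
    (forkNode m c : ℕ) = if c then m else m - 1 := rfl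

theorem sgnOf_congr (η : Bool) {p q : ℕ} (h : p % 2 = q % 2) : sgnOf η p = sgnOf η q := by
  unfold sgnOf; rw [h]

variable {α : Module.Basis (Fin n) ℝ V} {σ : Fin n → Bool} {m : ℕ} {hm : 3 ≤ m} {η : Bool}

/-- The zigzag given by a folding of type `D (m + 1)`. -/
def FoldDatum.zigZagD (Q : FoldDatum (baseD m hm η) α σ) (hw : Q.w 0 = 1) : ZigZag α σ :=
  Q.zigZag (2 * m) (by omega) 0 hw (fun p k => zigD m p k) (fun p k => zigD_nonneg m p k)
    (fun k => zigD_zero hm)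
    (fun k => (zigD_one hm).trans (by
      have h0 : k = 0 ↔ (k : ℕ) = 0 := by rw [Fin.ext_iff]; rfl
      simp only [h0]))
    (fun k => zigD_last hm)
    (fun p k hk => by
      change sgnOf η (nodeD m k) = sgnOf (sgnOf η (nodeD m 0)) p
      have h0 : nodeD m 0 = 1 := if_pos (by omega)
      have h1 : sgnOf η 1 = η := if_pos rfl
      rw [h0, h1]
      exact sgnOf_congr η (zigD_supp (Nat.le_of_lt_succ k.2) hk))
    (fun p hp hp' k => (zigD_recur hm hp hp' (Nat.le_of_lt_succ k.2)).trans
      (sum_adjD hm (fun l => zigD m p l) k).symm)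
    (fun p hp hp' => by
      obtain ⟨k, hk, h⟩ := exists_zigD_pos hp hp'
      exact ⟨⟨k, Nat.lt_succ_of_le hk⟩, h⟩)
    (fun k => zigD_cover hm k)

variable (Q : FoldDatum (baseD m hm η) α σ) (hw : Q.w 0 = 1)

theorem zigZagD_κ_of_ne {p : ℕ} (hp : p ≠ m) (k : Fin (m + 1)) (hk : (k : ℕ) + 1 < m)
    (hkp : (k : ℕ) + 1 = p ∨ p + k + 1 = 2 * m) (i : Fin n) :
    (Q.zigZagD hw).κ p i = if Q.j k = i then Q.w k else 0 := by
  refine Q.foldVec_single k _ (fun l => ?_) i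
  have := l.2
  rw [show ((if l = k then (1 : ℝ) else 0)) = ((if (l : ℕ) = k then (1 : ℤ) else 0 : ℤ) : ℝ) by
    simp only [Fin.ext_iff]; split_ifs <;> simp]
  congr 1
  have h := zigD_spec m p l
  change zigD m p l = _
  split_ifs <;> omega

theorem zigZagD_κ_m (hne : Q.j (forkNode m true) ≠ Q.j (forkNode m false)) (i : Fin n) :
    (Q.zigZagD hw).κ m i = if Q.j (forkNode m false) = i then Q.w (forkNode m false)
      else if Q.j (forkNode m true) = i then Q.w (forkNode m true) else 0 := by
  have hadd : (Q.zigZagD hw).κ m i =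
      Q.foldVec (fun l => if l = forkNode m false then 1 else 0) i
      + Q.foldVec (fun l => if l = forkNode m true then 1 else 0) i := by
    change Q.foldVec (fun l => ((zigD m m l : ℤ) : ℝ)) i = _
    unfold Folding.foldVec
    rw [← Finset.sum_add_distrib]
    refine Finset.sum_congr rfl fun l _ => ?_
    have hl := l.2
    split_ifs with h
    · beta_reduce
      rw [← mul_add]
      congr 1
      have h2 : zigD m m l = (if (l : ℕ) = m - 1 then 1 else 0) + (if (l : ℕ) = m then 1 else 0) := by
        have := zigD_spec m m l; split_ifs <;> omega
      rw [h2]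
      simp only [Fin.ext_iff, forkNode_val]
      push_cast
      simp
    · rw [add_zero]
  rw [hadd, Q.foldVec_single (forkNode m false) _ (fun _ => rfl),
    Q.foldVec_single (forkNode m true) _ (fun _ => rfl)]
  split_ifs with h1 h2 h2
  · exact absurd (h2.trans h1.symm) hne
  · rw [add_zero]
  · rw [zero_add]
  · rw [add_zero]

theorem zigZagD_κ_fork (hne : Q.j (forkNode m true) ≠ Q.j (forkNode m false)) (c : Bool) (i : Fin n) :
    (Q.zigZagD hw).κ m i = if Q.j (forkNode m c) = i then Q.w (forkNode m c)
      else if Q.j (forkNode m (!c)) = i then Q.w (forkNode m (!c)) else 0 := by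
  rw [zigZagD_κ_m Q hw hne]
  cases c
  · rfl
  · simp only [Bool.not_true]
    split_ifs with h1 h2 h2
    · exact absurd (h2.trans h1.symm) hne
    · rfl
    · rfl
    · rfl

/-- The neighbor of the end nodes of the fork is the previous node of the zigzag. -/
theorem fold_fork (c : Bool) {i : Fin n} (hi : i ≠ Q.j (forkNode m c)) :
    ⟪nroot α i, nroot α (Q.j (forkNode m c))⟫_ℝ * Q.w (forkNode m c) =
      -(Q.zigZagD hw).κ (m - 1) i := by
  have h := Q.fold i (forkNode m c) hi
  rw [neg_mul] at h
  rw [eq_neg_iff_add_eq_zero, ← neg_eq_iff_add_eq_zero, ← h]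
  refine Finset.sum_congr rfl fun k _ => ?_
  split_ifs
  · rw [mul_comm]
    congr 1
    beta_reduce
    congr 1
    change adjD m k (forkNode m c) = zigD m (m - 1) k
    have h1 := zigD_spec m (m - 1) k
    have h2 : ((forkNode m c : ℕ) = m ∨ (forkNode m c : ℕ) = m - 1) := by
      rw [forkNode_val]; split_ifs <;> simp
    have h3 : ((k : ℕ) + 1 = m - 1 ↔ (((k : ℕ) + 1 = forkNode m c ∧ (forkNode m c : ℕ) < m) ∨
      ((forkNode m c : ℕ) + 1 = k ∧ (k : ℕ) < m) ∨ ((k : ℕ) + 2 = m ∧ (forkNode m c : ℕ) = m) ∨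
      ((forkNode m c : ℕ) + 2 = m ∧ (k : ℕ) = m))) := by omega
    have := k.2
    unfold adjD
    rw [← if_congr h3 rfl rfl]
    split_ifs <;> omega
  · rfl

variable {x₀ : V} {t : ℝ} (ht : t ≠ 0)
  (hx : ∀ j, ⟪nroot α j, x₀⟫_ℝ = if j = (Q.zigZagD hw).i₀ then t else 0)
  (hne : Q.j (forkNode m true) ≠ Q.j (forkNode m false))

/-- The elements of the orbit that are projected to the origin. -/
def originPt (x₀ : V) (t : ℝ) (c : Bool) : V :=
  (Q.zigZagD hw).y x₀ t m - (t * Q.w (forkNode m c)) • nroot α (Q.j (forkNode m c))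

include hx hne in
theorem inner_originPt (c : Bool) (i : Fin n) :
    ⟪nroot α i, originPt Q hw x₀ t c⟫_ℝ = t * ((if Q.j (forkNode m (!c)) = i then
      Q.w (forkNode m (!c)) else 0) - (if Q.j (forkNode m c) = i then Q.w (forkNode m c) else 0)) := by
  have hne' : Q.j (forkNode m c) ≠ Q.j (forkNode m (!c)) := by
    cases c
    · exact hne.symm
    · exact hne
  unfold originPt
  rw [inner_sub_right, (Q.zigZagD hw).inner_y hx (by omega) (show m ≤ 2 * m by omega),
    real_inner_smul_right, zigZagD_κ_fork Q hw hne c]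
  by_cases h1 : Q.j (forkNode m c) = i
  · have h0 : (Q.zigZagD hw).κ (m - 1) i = 0 := by
      refine (Q.zigZagD hw).κ_pred_eq_zero (by omega) ?_
      rw [zigZagD_κ_fork Q hw hne c, if_pos h1]; exact (Q.w_pos _).ne'
    rw [if_pos h1, if_pos h1, if_neg (fun h => hne' (h1.trans h.symm)), h0, ← h1, nroot_self]
    ring
  · have h2 := fold_fork Q hw c (Ne.symm h1)
    rw [if_neg h1, if_neg h1, mul_assoc, mul_comm (Q.w _), h2]
    ring

include hx hne in
theorem refl_y_fork (c : Bool) : refl (α (Q.j (forkNode m c))) ((Q.zigZagD hw).y x₀ t m)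
    = originPt Q hw x₀ t c := by
  have h1 : (Q.zigZagD hw).κ m (Q.j (forkNode m c)) = Q.w (forkNode m c) := by
    rw [zigZagD_κ_fork Q hw hne c, if_pos rfl]
  rw [refl_simple, (Q.zigZagD hw).inner_y hx (by omega) (show m ≤ 2 * m by omega),
    (Q.zigZagD hw).κ_pred_eq_zero (by omega) (h1 ▸ (Q.w_pos _).ne'), h1, sub_zero]
  rfl

/-- Both ways around the fork agree: `y (m + 1)` is reached from either of the two origin points,
because the difference of `y m` and `y (m + 1)` is the sum of the two fork vectors. -/
theorem y_succ_fork (hne : Q.j (forkNode m true) ≠ Q.j (forkNode m false)) (c : Bool) :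
    (Q.zigZagD hw).y x₀ t (m + 1) = originPt Q hw x₀ t (!c)
      - (t * Q.w (forkNode m c)) • nroot α (Q.j (forkNode m c)) := by
  have hne' : Q.j (forkNode m c) ≠ Q.j (forkNode m (!c)) := by
    cases c
    · exact hne.symm
    · exact hne
  have hv : (Q.zigZagD hw).v m = Q.w (forkNode m c) • nroot α (Q.j (forkNode m c))
      + Q.w (forkNode m (!c)) • nroot α (Q.j (forkNode m (!c))) := by
    unfold ZigZag.v
    rw [Finset.sum_eq_add (Q.j (forkNode m c)) (Q.j (forkNode m (!c))) hne']
    · rw [zigZagD_κ_fork Q hw hne c, if_pos rfl, zigZagD_κ_fork Q hw hne c, if_neg hne', if_pos rfl]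
    · intro i _ hi
      rw [zigZagD_κ_fork Q hw hne c, if_neg (Ne.symm hi.1), if_neg (Ne.symm hi.2), zero_smul]
    · simp
    · simp
  rw [ZigZag.y_succ, hv]
  unfold originPt
  module

include hx hne in
theorem refl_y_succ_fork (c : Bool) :
    refl (α (Q.j (forkNode m c))) ((Q.zigZagD hw).y x₀ t (m + 1)) = originPt Q hw x₀ t (!c) := by
  have hne' : Q.j (forkNode m c) ≠ Q.j (forkNode m (!c)) := by
    cases c
    · exact hne.symm
    · exact hne
  have h : refl (α (Q.j (forkNode m c))) (originPt Q hw x₀ t (!c))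
      = (Q.zigZagD hw).y x₀ t (m + 1) := by
    rw [refl_simple, inner_originPt Q hw hx hne, y_succ_fork Q hw hne c, Bool.not_not, if_pos rfl,
      if_neg hne'.symm, sub_zero]
  rw [← h, refl_refl]

include hx in
theorem refl_yD {p : ℕ} (hp : 1 ≤ p) (hpm : p ≠ m) {k : Fin (m + 1)}
    (hk : (k : ℕ) + 1 < m) (hkp : (k : ℕ) + 1 = p ∨ p + k + 1 = 2 * m) :
    refl (α (Q.j k)) ((Q.zigZagD hw).y x₀ t p) = (Q.zigZagD hw).y x₀ t (p + 1) :=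
  ZigZag.refl_y_of_single _ hx hp (by change _ ≤ 2 * m; omega)
    (fun i' hi' => by rw [zigZagD_κ_of_ne Q hw hpm k hk hkp, if_neg (Ne.symm hi')])
    (by rw [zigZagD_κ_of_ne Q hw hpm k hk hkp, if_pos rfl]; exact (Q.w_pos k).ne')

include hx in
theorem refl_yD' {p : ℕ} (hp : 1 ≤ p) (hpm : p ≠ m) {k : Fin (m + 1)}
    (hk : (k : ℕ) + 1 < m) (hkp : (k : ℕ) + 1 = p ∨ p + k + 1 = 2 * m) :
    refl (α (Q.j k)) ((Q.zigZagD hw).y x₀ t (p + 1)) = (Q.zigZagD hw).y x₀ t p := by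
  rw [← refl_yD Q hw hx hp hpm hk hkp, refl_refl]

theorem exists_of_κ_ne_zero {p : ℕ} (hp : p ≤ 2 * m) {i : Fin n} (h : (Q.zigZagD hw).κ p i ≠ 0) :
    (1 ≤ p ∧ p ≠ m ∧ ∃ k : Fin (m + 1), (k : ℕ) + 1 < m ∧ ((k : ℕ) + 1 = p ∨ p + k + 1 = 2 * m) ∧
      Q.j k = i) ∨ (p = m ∧ ∃ c, Q.j (forkNode m c) = i) := by
  change Q.foldVec (fun l => ((zigD m p l : ℤ) : ℝ)) i ≠ 0 at h
  obtain ⟨k, -, hk⟩ := Finset.exists_ne_zero_of_sum_ne_zero h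
  have hkm := k.2
  split_ifs at hk with hj
  · have hz : zigD m p k ≠ 0 := fun h0 => hk (by simp [h0])
    rcases zigD_spec m p k with ⟨h1, h2, -⟩ | ⟨-, -, -, h⟩ | ⟨h1, h2, -⟩ | ⟨-, -, h⟩
    · exact Or.inl ⟨by omega, by omega, k, h1, h2, hj⟩
    · exact absurd h hz
    · refine Or.inr ⟨h2, decide ((k : ℕ) = m), ?_⟩
      rw [← hj]
      congr 1
      rw [Fin.ext_iff, forkNode_val]
      by_cases h3 : (k : ℕ) = m <;> simp [h3] <;> omega
    · exact absurd h hz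
  · exact absurd rfl hk

/-- A simple reflection moves an element of the zigzag to a neighbor or to the origin, or
fixes it. -/
theorem refl_yD_cases (hx : ∀ j, ⟪nroot α j, x₀⟫_ℝ = if j = (Q.zigZagD hw).i₀ then t else 0)
    {q : ℕ} (hq : 1 ≤ q) (hq' : q ≤ 2 * m) (i : Fin n) :
    (q ≠ m ∧ ∃ k : Fin (m + 1), (k : ℕ) + 1 < m ∧ ((k : ℕ) + 1 = q ∨ q + k + 1 = 2 * m) ∧ Q.j k = i) ∨
    (2 ≤ q ∧ q - 1 ≠ m ∧ ∃ k : Fin (m + 1), (k : ℕ) + 1 < m ∧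
      ((k : ℕ) + 1 = q - 1 ∨ q - 1 + k + 1 = 2 * m) ∧ Q.j k = i) ∨
    (q = m ∧ ∃ c, Q.j (forkNode m c) = i) ∨ (q = m + 1 ∧ ∃ c, Q.j (forkNode m c) = i) ∨
      refl (α i) ((Q.zigZagD hw).y x₀ t q) = (Q.zigZagD hw).y x₀ t q := by
  by_cases h1 : (Q.zigZagD hw).κ q i = 0
  · by_cases h2 : (Q.zigZagD hw).κ (q - 1) i = 0
    · exact Or.inr (Or.inr (Or.inr (Or.inr (ZigZag.refl_y_of_zero _ hx hq hq' h1 h2))))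
    · rcases exists_of_κ_ne_zero Q hw (by omega) h2 with ⟨h3, h4, h5⟩ | ⟨h3, h4⟩
      · exact Or.inr (Or.inl ⟨by omega, h4, h5⟩)
      · exact Or.inr (Or.inr (Or.inr (Or.inl ⟨by omega, h4⟩)))
  · rcases exists_of_κ_ne_zero Q hw hq' h1 with ⟨h3, h4, h5⟩ | h3
    · exact Or.inl ⟨h4, h5⟩
    · exact Or.inr (Or.inr (Or.inl h3))

include hx hne in
theorem refl_originPt_cases (c : Bool) (i : Fin n) :
    (∃ d, Q.j (forkNode m d) = i) ∨
      refl (α i) (originPt Q hw x₀ t c) = originPt Q hw x₀ t c := by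
  by_cases h : ∃ d, Q.j (forkNode m d) = i
  · exact Or.inl h
  · right
    push Not at h
    rw [refl_simple_eq_self_iff, inner_originPt Q hw hx hne, if_neg (h _), if_neg (h _), sub_self,
      mul_zero]

include hx hne in
theorem refl_originPt (c d : Bool) : refl (α (Q.j (forkNode m d))) (originPt Q hw x₀ t c)
    = if d = c then (Q.zigZagD hw).y x₀ t m else (Q.zigZagD hw).y x₀ t (m + 1) := by
  split_ifs with h
  · rw [h, ← refl_y_fork Q hw hx hne, refl_refl]
  · have : c = !d := by revert h; cases c <;> cases d <;> simp
    rw [this, ← refl_y_succ_fork Q hw hx hne, refl_refl]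

include hx hne in
theorem orbit_closed_D (i : Fin n) {x : V}
    (h : (∃ p, 1 ≤ p ∧ p ≤ 2 * m ∧ x = (Q.zigZagD hw).y x₀ t p) ∨ ∃ c, x = originPt Q hw x₀ t c) :
    (∃ p, 1 ≤ p ∧ p ≤ 2 * m ∧ refl (α i) x = (Q.zigZagD hw).y x₀ t p) ∨
      ∃ c, refl (α i) x = originPt Q hw x₀ t c := by
  rcases h with ⟨p, hp, hp', rfl⟩ | ⟨c, rfl⟩
  · rcases refl_yD_cases Q hw hx hp hp' i with ⟨h1, k, hk, hkp, rfl⟩ | ⟨h0, h1, k, hk, hkp, rfl⟩ |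
      ⟨rfl, c, rfl⟩ | ⟨rfl, c, rfl⟩ | h
    · exact Or.inl ⟨p + 1, by omega, by omega, refl_yD Q hw hx hp h1 hk hkp⟩
    · refine Or.inl ⟨p - 1, by omega, by omega, ?_⟩
      have := refl_yD' Q hw hx (p := p - 1) (by omega) h1 hk hkp
      rwa [show p - 1 + 1 = p by omega] at this
    · exact Or.inr ⟨c, refl_y_fork Q hw hx hne c⟩
    · exact Or.inr ⟨!c, refl_y_succ_fork Q hw hx hne c⟩
    · exact Or.inl ⟨p, hp, hp', h⟩
  · rcases refl_originPt_cases Q hw hx hne c i with ⟨d, rfl⟩ | h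
    · left
      rw [refl_originPt Q hw hx hne]
      split_ifs
      · exact ⟨m, by omega, by omega, rfl⟩
      · exact ⟨m + 1, by omega, by omega, rfl⟩
    · exact Or.inr ⟨c, h⟩

include hx hne in
theorem originPt_injective (ht : t ≠ 0) : originPt Q hw x₀ t true ≠ originPt Q hw x₀ t false := by
  intro h
  have h1 := inner_originPt Q hw hx hne true (Q.j (forkNode m true))
  rw [h, inner_originPt Q hw hx hne, if_neg hne.symm, if_pos rfl] at h1
  simp only [Bool.not_false, if_true, Bool.not_true, if_neg hne.symm] at h1
  have h2 := mul_left_cancel₀ ht h1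
  have := Q.w_pos (forkNode m true)
  linarith

include hx hne in
/-- The elements at the origin are exchanged or fixed by `c₊` and `c₋`. -/
theorem cSign_originPt (hs : SignOrtho α σ) (ε : Bool) (c : Bool) :
    cSign α σ ε (originPt Q hw x₀ t c)
      = originPt Q hw x₀ t (if sgnOf η m = ε then !c else c) := by
  have hne' : ∀ c, Q.j (forkNode m c) ≠ Q.j (forkNode m (!c)) := by
    intro c; cases c
    · exact hne.symm
    · exact hne
  have hσ : ∀ c, σ (Q.j (forkNode m c)) = sgnOf η m := by
    intro c
    rw [Q.sign]
    change sgnOf η (nodeD m (forkNode m c)) = _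
    congr 1
    have := nodeD_mod (m := m) (k := forkNode m c) (by have := (forkNode m c).2; omega)
    rw [forkNode_val] at *
    cases c <;> simp at this ⊢ <;> omega
  rw [cSign_apply hs]
  split_ifs with h
  · rw [Finset.sum_eq_add (Q.j (forkNode m c)) (Q.j (forkNode m (!c))) (hne' c),
      inner_originPt Q hw hx hne, inner_originPt Q hw hx hne, if_pos rfl, if_pos rfl,
      if_neg (hne' c), if_neg (hne' c).symm]
    · unfold originPt; module
    · intro i _ hi
      rw [inner_originPt Q hw hx hne, if_neg (Ne.symm hi.1), if_neg (Ne.symm hi.2)]; simp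
    · intro h'; exact absurd (by simp [hσ, h]) h'
    · intro h'; exact absurd (by simp [hσ, h]) h'
  · rw [sub_eq_self]
    refine Finset.sum_eq_zero fun i hi => ?_
    have hi' : ∀ c, Q.j (forkNode m c) ≠ i := by
      rintro c rfl
      exact h ((hσ c).symm.trans (Finset.mem_filter.1 hi).2)
    rw [inner_originPt Q hw hx hne, if_neg (hi' _), if_neg (hi' _)]; simp

include hx hne in
theorem G_G_originPt (hs : SignOrtho α σ) (c : Bool) :
    (Q.zigZagD hw).G ((Q.zigZagD hw).G (originPt Q hw x₀ t c)) = originPt Q hw x₀ t c := by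
  have h : ∀ c, (Q.zigZagD hw).G (originPt Q hw x₀ t c) = originPt Q hw x₀ t (!c) := by
    intro c
    change cSign α σ (Q.zigZagD hw).η (cSign α σ (!(Q.zigZagD hw).η) _) = _
    rw [cSign_originPt Q hw hx hne hs, cSign_originPt Q hw hx hne hs]
    congr 1
    generalize sgnOf η m = a; generalize (Q.zigZagD hw).η = b
    revert a b c; decide
  rw [h, h, Bool.not_not]

include hx hne in
/-- In type `D` and its foldings, the orbit consists of the zigzag and two elements at the
origin. -/
def orbitD (ht : t ≠ 0) (hs : SignOrtho α σ) {o : Set V} (ho : o = orbitOf α x₀) :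
    (Q.zigZagD hw).Orbit o where
  x₀ := x₀
  t := t
  t_ne := ht
  weight := hx
  mem := ho ▸ self_mem_orbitOf α x₀
  closed i x h := by rw [ho] at h ⊢; exact orbitOf_closed α h (refl_mem_weylGroup α i)
  shape x h := by
    rw [ho] at h
    have := orbitOf_subset α
      (S := {x | (∃ p, 1 ≤ p ∧ p ≤ 2 * m ∧ x = (Q.zigZagD hw).y x₀ t p) ∨
        ∃ c, x = originPt Q hw x₀ t c})
      (Or.inl ⟨1, le_rfl, by omega, (ZigZag.y_one _ _ _).symm⟩)
      (fun i y hy => orbit_closed_D Q hw hx hne i hy) h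
    rcases this with h | ⟨c, rfl⟩
    · exact Or.inl h
    · exact Or.inr ⟨G_G_originPt Q hw hx hne hs c, m, two_mul m⟩

include hx hne in
theorem orbitOf_subset_D :
    orbitOf α x₀ ⊆ (fun p => (Q.zigZagD hw).y x₀ t p) '' (Finset.Icc 1 (2 * m) : Finset ℕ) ∪
      {originPt Q hw x₀ t true, originPt Q hw x₀ t false} := by
  intro x h
  have := orbitOf_subset α
    (S := {x | (∃ p, 1 ≤ p ∧ p ≤ 2 * m ∧ x = (Q.zigZagD hw).y x₀ t p) ∨
      ∃ c, x = originPt Q hw x₀ t c})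
    (Or.inl ⟨1, le_rfl, by omega, (ZigZag.y_one _ _ _).symm⟩)
    (fun i y hy => orbit_closed_D Q hw hx hne i hy) h
  rcases this with ⟨p, h1, h2, rfl⟩ | ⟨c, rfl⟩
  · exact Or.inl ⟨p, by simp [h1, h2], rfl⟩
  · right; cases c <;> simp

end ZigZagD

/-! ### Axes and the gray zone -/

section Axes

open Complex

/-- The direction of the axis of the reflection `swp H e` of the polygon. -/
def axDir (H e : ℕ) : ℂ := exp (π * I * axisShift e / (H + 1 : ℕ))

theorem norm_axDir (H e : ℕ) : ‖axDir H e‖ = 1 := by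
  unfold axDir
  rw [show (π * I * axisShift e / (H + 1 : ℕ) : ℂ)
    = ((π * axisShift e / ((H + 1 : ℕ) : ℝ) : ℝ) : ℂ) * I by push_cast; ring]
  exact norm_exp_ofReal_mul_I _

theorem inner_axDir_mul (H e : ℕ) (x y : ℂ) : ⟪axDir H e * x, axDir H e * y⟫_ℝ = ⟪x, y⟫_ℝ := by
  have h : axDir H e * (starRingEnd ℂ) (axDir H e) = 1 := by
    rw [mul_conj, normSq_eq_norm_sq, norm_axDir]; simp
  rw [Complex.inner, Complex.inner, map_mul]
  rw [show axDir H e * y * ((starRingEnd ℂ) (axDir H e) * (starRingEnd ℂ) x)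
    = (axDir H e * (starRingEnd ℂ) (axDir H e)) * (y * (starRingEnd ℂ) x) by ring, h, one_mul]

variable (E : ℂ ≃ₗᵢ[ℝ] ℂ) (r : ℝ) (H : ℕ)

/-- The vertices of the regular polygon in the plane, in snake order. -/
def plc (q : ℕ) : ℂ := E (r • snakePt H q)

/-- The direction perpendicular to the axis of the reflection `swp H e`. -/
def nrmDir (e : ℕ) : ℂ := E (axDir H e * I)

theorem nrmDir_ne_zero (e : ℕ) : nrmDir E H e ≠ 0 := by
  intro h
  have h1 : axDir H e * I = 0 := by
    have := E.map_eq_iff (x := axDir H e * I) (y := 0)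
    exact this.1 (by rw [map_zero]; exact h)
  rcases mul_eq_zero.1 h1 with h2 | h2
  · have := norm_axDir H e; rw [h2, norm_zero] at this; exact zero_ne_one this
  · exact I_ne_zero h2

theorem plc_eq {e : ℕ} (he : e < 2) (q : ℕ) : plc E r H q = E (axDir H e * (r • frm (H + 1) e q)) := by
  unfold plc
  rw [snakePt_eq H e q he, mul_smul_comm]
  rfl

theorem plc_sub {p : ℕ} (hp : p + 1 ≤ H) :
    plc E r H p - plc E r H (p + 1) = (2 * r * (frm (H + 1) (p % 2) p).im) • nrmDir E H (p % 2) := by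
  have h1 := frm_swp (H := H) (e := p % 2) (q := p) (by omega) (by omega)
  rw [(swp_fixed hp rfl).1] at h1
  rw [plc_eq E r H (e := p % 2) (by omega), plc_eq E r H (e := p % 2) (by omega), h1, ← E.map_sub]
  unfold nrmDir
  rw [← E.map_smul]
  congr 1
  rw [← mul_sub, ← mul_smul_comm]
  congr 1
  apply Complex.ext <;> simp <;> ring

theorem plc_injOn {r : ℝ} (hr : 0 < r) {a b : ℕ} (ha : a ≤ H) (hb : b ≤ H)
    (h : plc E r H a = plc E r H b) : a = b :=
  snakePt_injOn ha hb (smul_right_injective ℂ hr.ne' (E.injective h))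

theorem plc_ne_zero {r : ℝ} (hr : 0 < r) (q : ℕ) : plc E r H q ≠ 0 := by
  intro h
  have h1 : ‖plc E r H q‖ = r := by
    unfold plc
    rw [E.norm_map, norm_smul, snakePt_norm, mul_one, Real.norm_of_nonneg hr.le]
  rw [h, norm_zero] at h1
  exact hr.ne h1

theorem norm_plc {r : ℝ} (hr : 0 < r) (q : ℕ) : ‖plc E r H q‖ = r := by
  unfold plc
  rw [E.norm_map, norm_smul, snakePt_norm, mul_one, Real.norm_of_nonneg hr.le]

theorem plc_antipode {m q : ℕ} (h : q ≤ 2 * m + 1) :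
    plc E r (2 * m + 1) (2 * m + 1 - q) = -plc E r (2 * m + 1) q := by
  unfold plc
  rw [snakePt_antipode (by omega) h, smul_neg, map_neg]

theorem crosses_plc {r : ℝ} (hr : 0 < r) (a b c d : ℕ) :
    Crosses (plc E r H a) (plc E r H b) (plc E r H c) (plc E r H d) ↔
      Crosses (snakePt H a) (snakePt H b) (snakePt H c) (snakePt H d) :=
  (crosses_map E.toLinearEquiv.toLinearMap E.injective (r • snakePt H a) (r • snakePt H b)
    (r • snakePt H c) (r • snakePt H d)).trans
    (crosses_map (LinearMap.lsmul ℝ ℂ r) (smul_right_injective ℂ hr.ne') (snakePt H a)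
      (snakePt H b) (snakePt H c) (snakePt H d))

theorem refl_plc {e : ℕ} (he : e < 2) {q : ℕ} (hq : q ≤ H) :
    refl (nrmDir E H e) (plc E r H q) = plc E r H (swp H e q) := by
  rw [refl_apply, plc_eq E r H he, plc_eq E r H he, frm_swp he hq]
  unfold nrmDir
  rw [LinearIsometryEquiv.inner_map_map, LinearIsometryEquiv.inner_map_map, inner_axDir_mul,
    inner_axDir_mul, ← E.map_smul, ← map_sub]
  congr 1
  rw [← mul_smul_comm, ← mul_sub]
  congr 1
  apply Complex.ext <;> simp [Complex.inner] <;> ring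

/-- The direction of the axis of a reflection. -/
def axVec (e : ℕ) : ℂ := E (axDir H e)

theorem inner_plc_axVec {e : ℕ} (he : e < 2) (q : ℕ) :
    ⟪plc E r H q, axVec E H e⟫_ℝ = r * Real.cos (π * lev e q / (H + 1 : ℕ)) := by
  rw [plc_eq E r H he]
  unfold axVec
  rw [LinearIsometryEquiv.inner_map_map]
  conv_lhs => rw [← mul_one (axDir H e), mul_assoc]
  rw [inner_axDir_mul, Complex.inner]
  simp [frm]

theorem mem_orthogonal_nrmDir (e : ℕ) (u : ℂ) :
    u ∈ (ℝ ∙ nrmDir E H e)ᗮ ↔ ∃ a : ℝ, u = a • axVec E H e := by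
  rw [Submodule.mem_orthogonal_singleton_iff_inner_right]
  constructor
  · intro h
    obtain ⟨w, rfl⟩ := E.surjective u
    have h0 : axDir H e ≠ 0 := by
      intro h'; have := norm_axDir H e; rw [h', norm_zero] at this; exact zero_ne_one this
    obtain ⟨x, rfl⟩ : ∃ x, w = axDir H e * x := ⟨w / axDir H e, by field_simp⟩
    unfold nrmDir at h
    rw [LinearIsometryEquiv.inner_map_map, inner_axDir_mul, Complex.inner] at h
    refine ⟨x.re, ?_⟩
    unfold axVec
    rw [← map_smul]
    congr 1
    rw [← mul_one (axDir H e), mul_assoc, ← mul_smul_comm, one_mul]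
    congr 1
    apply Complex.ext
    · simp
    · simpa using h
  · rintro ⟨a, rfl⟩
    rw [real_inner_smul_right]
    unfold nrmDir axVec
    rw [LinearIsometryEquiv.inner_map_map]
    have h := inner_axDir_mul H e I 1
    rw [mul_one] at h
    rw [h, Complex.inner]
    simp

theorem inner_axVec {e e' : ℕ} (he : e < 2) (he' : e' < 2) (hH : 2 ≤ H) :
    0 < ⟪axVec E H e, axVec E H e'⟫_ℝ := by
  have hcos : 0 < Real.cos (π / (H + 1 : ℕ)) := by
    have h2 : (3 : ℝ) ≤ (H + 1 : ℕ) := by exact_mod_cast (by omega : 3 ≤ H + 1)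
    have hp := Real.pi_pos
    have h3 : 0 < π / (H + 1 : ℕ) := by positivity
    apply Real.cos_pos_of_mem_Ioo
    constructor
    · linarith
    · rw [div_lt_div_iff₀ (by linarith) (by norm_num)]; nlinarith
  have h1 : axDir H 1 = 1 := by simp [axDir, axisShift]
  have h0 : axDir H 0 = ⟨Real.cos (π / (H + 1 : ℕ)), -Real.sin (π / (H + 1 : ℕ))⟩ := by
    unfold axDir axisShift
    rw [if_neg (by norm_num), show (π * I * ((-1 : ℤ) : ℂ) / (H + 1 : ℕ) : ℂ)
      = ((-(π / ((H + 1 : ℕ) : ℝ)) : ℝ) : ℂ) * I by push_cast; ring]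
    apply Complex.ext
    · rw [exp_ofReal_mul_I_re, Real.cos_neg]
    · rw [exp_ofReal_mul_I_im, Real.sin_neg]
  have hself : ∀ e, 0 < ⟪axVec E H e, axVec E H e⟫_ℝ := by
    intro e
    rw [real_inner_self_eq_norm_sq]
    unfold axVec
    rw [E.norm_map, norm_axDir]; norm_num
  have h01 : 0 < ⟪axVec E H 0, axVec E H 1⟫_ℝ := by
    unfold axVec
    rw [LinearIsometryEquiv.inner_map_map, h1, h0, Complex.inner]
    simpa using hcos
  rcases (by omega : e = 0 ∨ e = 1) with rfl | rfl <;>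
    rcases (by omega : e' = 0 ∨ e' = 1) with rfl | rfl
  · exact hself 0
  · exact h01
  · rw [real_inner_comm]; exact h01
  · exact hself 1

theorem lev_le_of_le {m e q : ℕ} (h : q ≤ m) : lev e q ≤ m + 1 := by
  unfold lev; split_ifs <;> omega

/-- The vertices before the middle of the snake are on one side of the gray zone. -/
theorem inner_plc_nonneg {r : ℝ} (hr : 0 < r) {m e q : ℕ} (he : e < 2) (hq : q ≤ m) :
    0 ≤ ⟪plc E r (2 * m + 1) q, axVec E (2 * m + 1) e⟫_ℝ := by
  rw [inner_plc_axVec E r _ he]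
  refine mul_nonneg hr.le (Real.cos_nonneg_of_mem_Icc ⟨?_, ?_⟩)
  · have := Real.pi_pos
    have h : 0 ≤ π * lev e q / (2 * m + 1 + 1 : ℕ) := by positivity
    linarith
  · have h1 : (lev e q : ℝ) ≤ m + 1 := by exact_mod_cast lev_le_of_le (e := e) hq
    rw [div_le_div_iff₀ (by positivity) (by norm_num)]
    push_cast
    nlinarith [Real.pi_pos]

theorem inner_plc_pos {r : ℝ} (hr : 0 < r) {m q : ℕ} (hq : q ≤ m) :
    0 < ⟪plc E r (2 * m + 1) q, axVec E (2 * m + 1) 0⟫_ℝ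
      + ⟪plc E r (2 * m + 1) q, axVec E (2 * m + 1) 1⟫_ℝ := by
  have key : ∀ e < 2, q % 2 ≠ e → 0 < ⟪plc E r (2 * m + 1) q, axVec E (2 * m + 1) e⟫_ℝ := by
    intro e he hne
    rw [inner_plc_axVec E r _ he]
    refine mul_pos hr (Real.cos_pos_of_mem_Ioo ⟨?_, ?_⟩)
    · have := Real.pi_pos
      have h : 0 ≤ π * lev e q / (2 * m + 1 + 1 : ℕ) := by positivity
      linarith
    · have h1 : (lev e q : ℝ) ≤ m := by
        unfold lev; rw [if_neg hne]; exact_mod_cast hq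
      rw [div_lt_div_iff₀ (by positivity) (by norm_num)]
      push_cast
      nlinarith [Real.pi_pos]
  rcases Nat.mod_two_eq_zero_or_one q with h | h
  · exact add_pos_of_nonneg_of_pos (inner_plc_nonneg E hr (by norm_num) hq)
      (key 1 (by norm_num) (by omega))
  · exact add_pos_of_pos_of_nonneg (key 0 (by norm_num) (by omega))
      (inner_plc_nonneg E hr (by norm_num) hq)

/-- The side of the gray zone that contains the vertices before the middle of the snake. -/
def firstSide (m : ℕ) : Set ℂ := graySide (axVec E (2 * m + 1) 0) (axVec E (2 * m + 1) 1)

/-- The side of the gray zone that contains the vertices after the middle of the snake. -/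
def secondSide (m : ℕ) : Set ℂ := graySide (-axVec E (2 * m + 1) 0) (-axVec E (2 * m + 1) 1)

theorem plc_mem_firstSide {r : ℝ} (hr : 0 < r) {m q : ℕ} (hq : q ≤ m) :
    plc E r (2 * m + 1) q ∈ firstSide E m :=
  ⟨plc_ne_zero E _ hr q, inner_plc_nonneg E hr (by norm_num) hq,
    inner_plc_nonneg E hr (by norm_num) hq⟩

theorem plc_mem_secondSide {r : ℝ} (hr : 0 < r) {m q : ℕ} (hq : m < q) (hq' : q ≤ 2 * m + 1) :
    plc E r (2 * m + 1) q ∈ secondSide E m := by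
  have h := plc_antipode E r hq'
  have h1 := inner_plc_nonneg E hr (m := m) (e := 0) (q := 2 * m + 1 - q) (by norm_num) (by omega)
  have h2 := inner_plc_nonneg E hr (m := m) (e := 1) (q := 2 * m + 1 - q) (by norm_num) (by omega)
  rw [h] at h1 h2
  refine ⟨plc_ne_zero E _ hr q, ?_, ?_⟩
  · rwa [inner_neg_right, ← inner_neg_left]
  · rwa [inner_neg_right, ← inner_neg_left]

/-- The positive multiples of a vertex before the middle of the snake are not on the second
side. -/
theorem notMem_secondSide {r : ℝ} (hr : 0 < r) {m q : ℕ} (hq : q ≤ m) {c : ℝ} (hc : 0 ≤ c) :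
    c • plc E r (2 * m + 1) q ∉ secondSide E m := by
  rintro ⟨h0, h1, h2⟩
  have hc' : 0 < c := hc.lt_of_ne (by rintro rfl; simp at h0)
  have h3 := inner_plc_pos E hr hq
  rw [inner_neg_right, real_inner_smul_left] at h1 h2
  nlinarith

theorem notMem_firstSide {r : ℝ} (hr : 0 < r) {m q : ℕ} (hq : m < q) (hq' : q ≤ 2 * m + 1) {c : ℝ}
    (hc : 0 ≤ c) : c • plc E r (2 * m + 1) q ∉ firstSide E m := by
  rintro ⟨h0, h1, h2⟩
  refine notMem_secondSide E hr (m := m) (q := 2 * m + 1 - q) (by omega) hc ⟨?_, ?_, ?_⟩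
  · rw [plc_antipode E r hq', smul_neg]; exact neg_ne_zero.2 h0
  · rwa [plc_antipode E r hq', smul_neg, inner_neg_neg]
  · rwa [plc_antipode E r hq', smul_neg, inner_neg_neg]

end Axes

/-! ### Diagrams of figures -/

section Segments

theorem graySide_smul {a b : ℝ} (ha : 0 < a) (hb : 0 < b) (u v : ℂ) :
    graySide (a • u) (b • v) = graySide u v := by
  ext z
  simp only [graySide, Set.mem_ofPred_eq, real_inner_smul_right, mul_nonneg_iff_of_pos_left ha,
    mul_nonneg_iff_of_pos_left hb]

theorem graySide_comm (u v : ℂ) : graySide u v = graySide v u := by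
  ext z
  simp only [graySide, Set.mem_ofPred_eq]
  tauto

theorem reflection_congr {K K' : Submodule ℝ ℂ} (h : K = K') (z : ℂ) :
    K.reflection z = K'.reflection z := by
  subst h; rfl

theorem mem_orthogonal_iff_reflection (K : Submodule ℝ ℂ) (z : ℂ) :
    z ∈ Kᗮ ↔ K.reflection z = -z := by
  refine ⟨K.reflection_mem_subspace_orthogonalComplement_eq_neg, fun h => ?_⟩
  rw [Submodule.mem_orthogonal]
  intro a ha
  have h1 := K.reflection.inner_map_map a z
  rw [Submodule.reflection_mem_subspace_eq_self ha, h, inner_neg_right] at h1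
  linarith

variable [FiniteDimensional ℝ V] {X : Setup n V}

namespace Setup

theorem noCrossing_singleton (A B A' B' : DiagramPoint V) :
    NoCrossing {s(A, B)} {s(A', B')} ↔
      (Crosses A.pos B.pos A'.pos B'.pos → s(A.pos, B.pos) = s(A'.pos, B'.pos)) := by
  constructor
  · intro h; exact h A B A' B' rfl rfl
  · intro h C D C' D' h1 h2 hc
    have e1 : s(C.pos, D.pos) = s(A.pos, B.pos) :=
      congrArg (Sym2.map DiagramPoint.pos) (Set.mem_singleton_iff.1 h1)
    have e2 : s(C'.pos, D'.pos) = s(A'.pos, B'.pos) :=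
      congrArg (Sym2.map DiagramPoint.pos) (Set.mem_singleton_iff.1 h2)
    rw [e1, e2]
    apply h
    rwa [← crosses_sym2 e1, crosses_comm, ← crosses_sym2 e2, crosses_comm]

theorem noCrossing_iff (C C' : Diagram V) :
    NoCrossing C C' ↔ ∀ e ∈ C, ∀ e' ∈ C', NoCrossing {e} {e'} := by
  constructor
  · rintro h e he e' he' A B A' B' h1 h2
    exact h A B A' B' (Set.mem_singleton_iff.1 h1 ▸ he) (Set.mem_singleton_iff.1 h2 ▸ he')
  · intro h A B A' B' h1 h2
    exact h _ h1 _ h2 A B A' B' rfl rfl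

theorem originCondition_iff (C C' : Diagram V) :
    X.OriginCondition C C' ↔ ∀ e ∈ C, ∀ e' ∈ C', X.OriginCondition {e} {e'} := by
  constructor
  · rintro h e he e' he' x A B h1 h2
    exact h x A B (Set.mem_singleton_iff.1 h1 ▸ he) (Set.mem_singleton_iff.1 h2 ▸ he')
  · intro h x A B h1 h2
    exact h _ h1 _ h2 x A B rfl rfl

theorem originCondition_half (x y : V) (a b : ℂ) :
    X.OriginCondition {s(.origin x, .vertex a)} {s(.origin y, .vertex b)} ↔
      (x = y → Collinear ℝ {0, a, b} ∨ ¬ X.CrossesGrayZone (segment ℝ 0 a ∪ segment ℝ 0 b)) := by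
  constructor
  · rintro h rfl
    exact h x (.vertex a) (.vertex b) (Set.mem_singleton _) (Set.mem_singleton _)
  · intro h w A B h1 h2
    rw [Set.mem_singleton_iff, Sym2.eq_iff] at h1 h2
    simp only [DiagramPoint.origin.injEq, reduceCtorEq, false_and, or_false] at h1 h2
    obtain ⟨rfl, rfl⟩ := h1
    obtain ⟨rfl, rfl⟩ := h2
    exact h rfl

theorem originCondition_chord_left (a b : ℂ) (e : Sym2 (DiagramPoint V)) :
    X.OriginCondition {s(.vertex a, .vertex b)} {e} := by
  intro w A B h1 h2
  rw [Set.mem_singleton_iff, Sym2.eq_iff] at h1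
  simp at h1

theorem originCondition_chord_right (a b : ℂ) (e : Sym2 (DiagramPoint V)) :
    X.OriginCondition {e} {s(.vertex a, .vertex b)} := by
  intro w A B h1 h2
  rw [Set.mem_singleton_iff, Sym2.eq_iff] at h2
  simp at h2

variable {E : ℂ ≃ₗᵢ[ℝ] ℂ} {r : ℝ} (hr : 0 < r) {H : ℕ} {η : Bool}
  (hax : ∀ ε, X.axis ε = (ℝ ∙ nrmDir E H (parOf η ε))ᗮ)

/-- The axes are determined by the segments of the negative simple roots. -/
theorem axis_eq (ε : Bool) (h : ∀ i A B, X.σ i ≠ ε → s(A, B) ∈ X.negSimpleDiagram i →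
      ∃ c : ℝ, A.pos - B.pos = c • nrmDir E H (parOf η ε))
    (h' : ∃ i A B, X.σ i ≠ ε ∧ s(A, B) ∈ X.negSimpleDiagram i ∧ A.pos ≠ B.pos) :
    X.axis ε = (ℝ ∙ nrmDir E H (parOf η ε))ᗮ := by
  unfold axis
  congr 1
  apply le_antisymm
  · rw [Submodule.span_le]
    rintro d ⟨i, A, B, hi, he, rfl⟩
    obtain ⟨c, hc⟩ := h i A B hi he
    rw [hc]
    exact Submodule.smul_mem _ _ (Submodule.mem_span_singleton_self _)
  · rw [Submodule.span_le, Set.singleton_subset_iff]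
    obtain ⟨i, A, B, hi, he, hne⟩ := h'
    obtain ⟨c, hc⟩ := h i A B hi he
    have hc0 : c ≠ 0 := by rintro rfl; rw [zero_smul, sub_eq_zero] at hc; exact hne hc
    have h1 : nrmDir E H (parOf η ε) = c⁻¹ • (A.pos - B.pos) := by
      rw [hc, smul_smul, inv_mul_cancel₀ hc0, one_smul]
    rw [h1]
    exact Submodule.smul_mem _ _ (Submodule.subset_span ⟨i, A, B, hi, he, rfl⟩)

include hax

theorem reflection_plc (ε : Bool) {q : ℕ} (hq : q ≤ H) :
    (X.axis ε).reflection (plc E r H q) = plc E r H (swp H (parOf η ε) q) := by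
  rw [reflection_congr (hax ε), ← refl_plc E r H (parOf_lt η ε) hq]
  rfl

theorem exists_areAxisVectors (hH : 2 ≤ H) : ∃ u v, X.AreAxisVectors u v := by
  refine ⟨axVec E H (parOf η true), axVec E H (parOf η false), ?_, ?_,
    inner_axVec E H (parOf_lt _ _) (parOf_lt _ _) hH⟩
  · rw [hax, mem_orthogonal_nrmDir]; exact ⟨1, (one_smul _ _).symm⟩
  · rw [hax, mem_orthogonal_nrmDir]; exact ⟨1, (one_smul _ _).symm⟩

omit hax in
/-- The two sides of the gray zone. -/
theorem graySide_eq {m : ℕ} (hm : 1 ≤ m)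
    (hax : ∀ ε, X.axis ε = (ℝ ∙ nrmDir E (2 * m + 1) (parOf η ε))ᗮ) {u v : ℂ}
    (h : X.AreAxisVectors u v) :
    (graySide u v = firstSide E m ∧ graySide (-u) (-v) = secondSide E m) ∨
    (graySide u v = secondSide E m ∧ graySide (-u) (-v) = firstSide E m) := by
  obtain ⟨hu, hv, hpos⟩ := h
  rw [hax, mem_orthogonal_nrmDir] at hu hv
  obtain ⟨a, rfl⟩ := hu
  obtain ⟨b, rfl⟩ := hv
  have h1 := inner_axVec E (2 * m + 1) (parOf_lt η true) (parOf_lt η false) (by omega)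
  rw [real_inner_smul_left, real_inner_smul_right, ← mul_assoc] at hpos
  have hab : 0 < a * b := pos_of_mul_pos_left hpos h1.le
  have key : (graySide (axVec E (2 * m + 1) (parOf η true)) (axVec E (2 * m + 1) (parOf η false))
      = firstSide E m) ∧ graySide (-axVec E (2 * m + 1) (parOf η true))
        (-axVec E (2 * m + 1) (parOf η false)) = secondSide E m := by
    unfold firstSide secondSide
    cases η
    · exact ⟨graySide_comm _ _, graySide_comm _ _⟩
    · exact ⟨rfl, rfl⟩
  rcases pos_and_pos_or_neg_and_neg_of_mul_pos hab with ⟨ha, hb⟩ | ⟨ha, hb⟩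
  · left
    rw [← smul_neg, ← smul_neg, graySide_smul ha hb, graySide_smul ha hb]
    exact key
  · right
    have e : ∀ (x : ℝ) (w : ℂ), x • w = (-x) • -w := fun x w => by rw [smul_neg, neg_smul, neg_neg]
    rw [← smul_neg a, ← smul_neg b, e a (axVec _ _ _), e b (axVec _ _ _), e a (-axVec _ _ _),
      e b (-axVec _ _ _), graySide_smul (neg_pos.2 ha) (neg_pos.2 hb),
      graySide_smul (neg_pos.2 ha) (neg_pos.2 hb), neg_neg, neg_neg]
    exact ⟨key.2, key.1⟩

omit hax in
theorem crossesGrayZone_iff {m : ℕ} (hm : 1 ≤ m)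
    (hax : ∀ ε, X.axis ε = (ℝ ∙ nrmDir E (2 * m + 1) (parOf η ε))ᗮ) (T : Set ℂ) :
    X.CrossesGrayZone T ↔ (T ∩ firstSide E m).Nonempty ∧ (T ∩ secondSide E m).Nonempty := by
  constructor
  · rintro ⟨u, v, huv, h1, h2⟩
    rcases graySide_eq hm hax huv with ⟨e1, e2⟩ | ⟨e1, e2⟩
    · rw [e1] at h1; rw [e2] at h2; exact ⟨h1, h2⟩
    · rw [e1] at h1; rw [e2] at h2; exact ⟨h2, h1⟩
  · rintro ⟨h1, h2⟩
    obtain ⟨u, v, huv⟩ := exists_areAxisVectors hax (by omega)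
    refine ⟨u, v, huv, ?_⟩
    rcases graySide_eq hm hax huv with ⟨e1, e2⟩ | ⟨e1, e2⟩
    · rw [e1, e2]; exact ⟨h1, h2⟩
    · rw [e1, e2]; exact ⟨h2, h1⟩

omit hax in
theorem mem_segment_zero {a w : ℂ} (h : w ∈ segment ℝ 0 a) : ∃ c : ℝ, 0 ≤ c ∧ w = c • a := by
  obtain ⟨s, t, hs, ht, -, rfl⟩ := h
  exact ⟨t, ht, by rw [smul_zero, zero_add]⟩

include hr in
omit hax in
/-- Two radii cross the gray zone if they end at different halves of the snake. -/
theorem crossesGrayZone_radii {m : ℕ} (hm : 1 ≤ m)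
    (hax : ∀ ε, X.axis ε = (ℝ ∙ nrmDir E (2 * m + 1) (parOf η ε))ᗮ) {q p : ℕ}
    (hq : q ≤ 2 * m + 1) (hp : p ≤ 2 * m + 1) :
    X.CrossesGrayZone (segment ℝ 0 (plc E r (2 * m + 1) q) ∪ segment ℝ 0 (plc E r (2 * m + 1) p)) ↔
      ¬ (q ≤ m ↔ p ≤ m) := by
  rw [crossesGrayZone_iff hm hax]
  have key1 : ∀ q, q ≤ 2 * m + 1 →
      ((segment ℝ 0 (plc E r (2 * m + 1) q) ∩ firstSide E m).Nonempty ↔ q ≤ m) := by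
    intro q hq
    constructor
    · rintro ⟨w, hw, hw'⟩
      by_contra hqm
      obtain ⟨c, hc, rfl⟩ := mem_segment_zero hw
      exact notMem_firstSide E hr (by omega) hq hc hw'
    · intro h
      exact ⟨_, right_mem_segment _ _ _, plc_mem_firstSide E hr h⟩
  have key2 : ∀ q, q ≤ 2 * m + 1 →
      ((segment ℝ 0 (plc E r (2 * m + 1) q) ∩ secondSide E m).Nonempty ↔ ¬ q ≤ m) := by
    intro q hq
    constructor
    · rintro ⟨w, hw, hw'⟩ hqm
      obtain ⟨c, hc, rfl⟩ := mem_segment_zero hw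
      exact notMem_secondSide E hr hqm hc hw'
    · intro h
      exact ⟨_, right_mem_segment _ _ _, plc_mem_secondSide E hr (by omega) hq⟩
  rw [Set.union_inter_distrib_right, Set.union_inter_distrib_right, Set.union_nonempty,
    Set.union_nonempty, key1 q hq, key1 p hp, key2 q hq, key2 p hp]
  tauto

/-- A segment between vertices is mapped by the reflection. -/
theorem tauSegment_chord (ε : Bool) {q q' : ℕ} (hq : q ≤ H) (hq' : q' ≤ H) :
    X.tauSegment ε s(.vertex (plc E r H q), .vertex (plc E r H q')) =
      s(.vertex (plc E r H (swp H (parOf η ε) q)), .vertex (plc E r H (swp H (parOf η ε) q'))) := by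
  unfold tauSegment
  rw [if_neg]
  · simp only [Sym2.map_mk, tauPoint, reflection_plc hax ε hq, reflection_plc hax ε hq']
  · rintro ⟨x, z, h, -⟩
    rw [Sym2.eq_iff] at h
    simp at h

include hr in
omit hax in
/-- A radius is mapped by the reflection, unless it is perpendicular to the axis. -/
theorem tauSegment_half {m : ℕ}
    (hax : ∀ ε, X.axis ε = (ℝ ∙ nrmDir E (2 * m + 1) (parOf η ε))ᗮ) (ε : Bool) {q : ℕ}
    (hq : q ≤ 2 * m + 1) (x : V) :
    X.tauSegment ε s(.origin x, .vertex (plc E r (2 * m + 1) q)) =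
      if swp (2 * m + 1) (parOf η ε) q = 2 * m + 1 - q then
        s(.origin x, .vertex (plc E r (2 * m + 1) q))
      else s(.origin (cSign X.α X.σ ε x),
        .vertex (plc E r (2 * m + 1) (swp (2 * m + 1) (parOf η ε) q))) := by
  have h1 : (∃ x' z, s(DiagramPoint.origin x, .vertex (plc E r (2 * m + 1) q)) =
      s(.origin x', .vertex z) ∧ z ∈ (X.axis ε)ᗮ) ↔
      swp (2 * m + 1) (parOf η ε) q = 2 * m + 1 - q := by
    have h2 : (∃ x' z, s(DiagramPoint.origin x, .vertex (plc E r (2 * m + 1) q)) =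
      s(.origin x', .vertex z) ∧ z ∈ (X.axis ε)ᗮ) ↔ plc E r (2 * m + 1) q ∈ (X.axis ε)ᗮ := by
      constructor
      · rintro ⟨x', z, h, hz⟩
        rw [Sym2.eq_iff] at h
        simp only [DiagramPoint.origin.injEq, DiagramPoint.vertex.injEq, reduceCtorEq, false_and,
          or_false] at h
        rwa [h.2]
      · intro h; exact ⟨_, _, rfl, h⟩
    rw [h2, mem_orthogonal_iff_reflection, reflection_plc hax ε hq, ← plc_antipode E r hq]
    exact ⟨fun h => plc_injOn E _ hr (swp_le hq) (by omega) h, fun h => by rw [h]⟩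
  unfold tauSegment
  simp only [h1]
  split_ifs
  · rfl
  · simp only [Sym2.map_mk, tauPoint, reflection_plc hax ε hq]

end Setup

/-- The diagram of a diagonal. -/
def chordSegs (E : ℂ ≃ₗᵢ[ℝ] ℂ) (r : ℝ) {k : ℕ} (F : ChordFig k) : Diagram V :=
  {s(.vertex (plc E r (k + 2) F.1.1), .vertex (plc E r (k + 2) F.1.2))}

/-- The diagram of a figure of type `D`: a diameter is replaced by its halves, which end at the
two origin points `zc c`. -/
def segsD (E : ℂ ≃ₗᵢ[ℝ] ℂ) (r : ℝ) {m : ℕ} (zc : Bool → V) (F : DFig m) : Diagram V :=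
  if F.IsDiam then {s(.origin (zc F.1.2.2), .vertex (plc E r (2 * m + 1) F.1.1)),
    s(.origin (zc !F.1.2.2), .vertex (plc E r (2 * m + 1) F.1.2.1))}
  else {s(.vertex (plc E r (2 * m + 1) F.1.1), .vertex (plc E r (2 * m + 1) F.1.2.1))}

theorem sym2_min_max {α : Type*} (f : ℕ → α) (a b : ℕ) : s(f (min a b), f (max a b)) = s(f a, f b) := by
  rcases le_total a b with h | h
  · rw [min_eq_left h, max_eq_right h]
  · rw [min_eq_right h, max_eq_left h, Sym2.eq_swap]

variable {E : ℂ ≃ₗᵢ[ℝ] ℂ} {r : ℝ} (hr : 0 < r) {η : Bool}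

theorem tauSegment_chordSegs {k : ℕ}
    (hax : ∀ ε, X.axis ε = (ℝ ∙ nrmDir E (k + 2) (parOf η ε))ᗮ) (ε : Bool) (F : ChordFig k) :
    X.tauSegment ε '' chordSegs E r F = chordSegs E r ((baseA k η).T ε F) := by
  obtain ⟨f1, f2, -⟩ := F.2
  unfold chordSegs
  rw [Set.image_singleton, Setup.tauSegment_chord hax ε (by omega) f2]
  congr 1
  exact (sym2_min_max (fun q => DiagramPoint.vertex (plc E r (k + 2) q)) _ _).symm

include hr in
/-- The labels are exchanged by `c_ε` iff the color of diameters changes. The reflection preserves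
both sides of the gray zone, except for the snake diameter, whose halves are fixed by the special
rule. -/
theorem tauSegment_segsD {m : ℕ} {zc : Bool → V}
    (hz : ∀ ε c, cSign X.α X.σ ε (zc c) = zc (if sgnOf η m = ε then !c else c))
    (hax : ∀ ε, X.axis ε = (ℝ ∙ nrmDir E (2 * m + 1) (parOf η ε))ᗮ) (hm : 3 ≤ m) (ε : Bool)
    (F : DFig m) : X.tauSegment ε '' segsD E r zc F = segsD E r zc ((baseD m hm η).T ε F) := by
  obtain ⟨f1, f2, -⟩ := F.2.1
  have he := parOf_lt η ε
  have hsum := swp_add (m := m) (q := F.1.1) (q' := F.1.2.1) he (by omega) f2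
  have hdT : ((baseD m hm η).T ε F).IsDiam ↔ F.IsDiam := by
    change min _ _ + max _ _ = _ ↔ _
    rw [min_add_max]; exact hsum
  unfold segsD
  simp only [hdT]
  by_cases hd : F.IsDiam
  · rw [if_pos hd, if_pos hd, Set.image_pair, Setup.tauSegment_half hr hax ε (by omega),
      Setup.tauSegment_half hr hax ε f2, hz, hz]
    have hd' : F.1.1 + F.1.2.1 = 2 * m + 1 := hd
    have s1 := swp_spec (H := 2 * m + 1) (e := parOf η ε) (q := F.1.1) (by omega)
    have s2 := swp_spec (H := 2 * m + 1) (e := parOf η ε) f2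
    have hsg := sgnOf_eq_iff η ε m
    change _ = ({s(DiagramPoint.origin (zc (if _ ∧ _ then _ else _)), DiagramPoint.vertex (plc E r _ (min _ _))),
      s(DiagramPoint.origin (zc !(if _ ∧ _ then _ else _)), DiagramPoint.vertex (plc E r _ (max _ _)))} : Diagram V)
    by_cases h1 : F.1.1 % 2 = parOf η ε ∧ F.1.2.1 = F.1.1 + 1
    · have e1 : swp (2 * m + 1) (parOf η ε) F.1.1 = F.1.2.1 := by omega
      have e2 : swp (2 * m + 1) (parOf η ε) F.1.2.1 = F.1.1 := by omega
      have h3 : ¬(F.1.1 + F.1.2.1 = 2 * m + 1 ∧ m % 2 ≠ parOf η ε) := by omega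
      rw [e1, e2, if_pos (show F.1.2.1 = 2 * m + 1 - F.1.1 by omega),
        if_pos (show F.1.1 = 2 * m + 1 - F.1.2.1 by omega), min_eq_right f1.le, max_eq_left f1.le,
        if_neg h3]
    · have hlt := swp_lt he f1 f2 h1
      rw [if_neg (show ¬(swp (2 * m + 1) (parOf η ε) F.1.1 = 2 * m + 1 - F.1.1) by omega),
        if_neg (show ¬(swp (2 * m + 1) (parOf η ε) F.1.2.1 = 2 * m + 1 - F.1.2.1) by omega),
        min_eq_left hlt.le, max_eq_right hlt.le]
      by_cases h2 : sgnOf η m = ε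
      · rw [if_pos h2, if_pos h2, if_pos ⟨hd', hsg.1 h2⟩]
      · rw [if_neg h2, if_neg h2, if_neg (fun h => h2 (hsg.2 h.2))]
  · rw [if_neg hd, if_neg hd, Set.image_singleton, Setup.tauSegment_chord hax ε (by omega) f2]
    congr 1
    exact (sym2_min_max (fun q => DiagramPoint.vertex (plc E r (2 * m + 1) q)) _ _).symm

end Segments

/-! ### The compatibility criterion for figures -/

section Criterion

variable [FiniteDimensional ℝ V] {X : Setup n V} {E : ℂ ≃ₗᵢ[ℝ] ℂ} {r : ℝ} (hr : 0 < r) {η : Bool}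

include hr

omit [FiniteDimensional ℝ V] in
theorem plc_pair_ne {H a b c d : ℕ} (hab : a < b) (hb : b ≤ H) (hcd : c < d) (hd : d ≤ H)
    (hne : ¬(a = c ∧ b = d)) :
    s(plc E r H a, plc E r H b) ≠ s(plc E r H c, plc E r H d) := by
  intro h
  rw [Sym2.eq_iff] at h
  rcases h with ⟨h1, h2⟩ | ⟨h1, h2⟩
  · exact hne ⟨plc_injOn E _ hr (by omega) (by omega) h1, plc_injOn E _ hr hb hd h2⟩
  · have h3 := plc_injOn E _ hr (by omega) hd h1
    have h4 := plc_injOn E _ hr hb (by omega) h2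
    omega

theorem chordSegs_iff {k : ℕ} {F G : ChordFig k} (hne : F ≠ G) :
    (Setup.NoCrossing (chordSegs (V := V) E r F) (chordSegs E r G) ∧
      X.OriginCondition (chordSegs E r F) (chordSegs E r G)) ↔ (baseA k η).FC F G := by
  obtain ⟨f1, f2, -⟩ := F.2
  obtain ⟨g1, g2, -⟩ := G.2
  have h1 := plc_pair_ne (E := E) hr f1 f2 g1 g2
    (fun h => hne (Subtype.ext (Prod.ext h.1 h.2)))
  unfold chordSegs
  rw [Setup.noCrossing_singleton, and_iff_left (Setup.originCondition_chord_left _ _ _)]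
  change (Crosses (plc E r (k + 2) F.1.1) (plc E r (k + 2) F.1.2) (plc E r (k + 2) G.1.1)
    (plc E r (k + 2) G.1.2) → s(plc E r (k + 2) F.1.1, plc E r (k + 2) F.1.2) =
    s(plc E r (k + 2) G.1.1, plc E r (k + 2) G.1.2)) ↔ ¬ Crosses _ _ _ _
  rw [crosses_plc E _ hr]
  tauto

theorem noCrossing_half (x y : V) {H q p : ℕ} :
    Setup.NoCrossing {s(.origin x, .vertex (plc E r H q))} {s(.origin y, .vertex (plc E r H p))} := by
  rw [Setup.noCrossing_singleton]
  intro h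
  change s((0 : ℂ), plc E r H q) = s(0, plc E r H p)
  have e : plc E r H q = plc E r H p :=
    eq_of_crosses_half (by rw [norm_plc E H hr, norm_plc E H hr]) (plc_ne_zero E H hr p) h
  rw [e]

theorem not_collinear_plc {m q p : ℕ} (hq : q ≤ 2 * m + 1) (hp : p ≤ 2 * m + 1) (h1 : q ≠ p)
    (h2 : q + p ≠ 2 * m + 1) :
    ¬ Collinear ℝ {0, plc E r (2 * m + 1) q, plc E r (2 * m + 1) p} := by
  intro h
  rw [collinear_iff_of_mem (p₀ := (0 : ℂ)) (by simp)] at h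
  obtain ⟨v, hv⟩ := h
  obtain ⟨a, ha⟩ := hv (plc E r (2 * m + 1) q) (by simp)
  obtain ⟨b, hb⟩ := hv (plc E r (2 * m + 1) p) (by simp)
  rw [vadd_eq_add, add_zero] at ha hb
  have hna := norm_plc E (2 * m + 1) hr q
  have hnb := norm_plc E (2 * m + 1) hr p
  rw [ha, norm_smul, Real.norm_eq_abs] at hna
  rw [hb, norm_smul, Real.norm_eq_abs] at hnb
  have hv0 : ‖v‖ ≠ 0 := by rintro h0; rw [h0, mul_zero] at hna; exact hr.ne hna
  have hab : |a| = |b| := mul_right_cancel₀ hv0 (hna.trans hnb.symm)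
  rcases abs_eq_abs.1 hab with rfl | rfl
  · exact h1 (plc_injOn E _ hr hq hp (ha.trans hb.symm))
  · rw [neg_smul, ← hb, ← plc_antipode E r hp] at ha
    have := plc_injOn E _ hr hq (by omega) ha
    omega

omit hr in
theorem collinear_antipode {m q p : ℕ} (hp : p ≤ 2 * m + 1) (h : q + p = 2 * m + 1) :
    Collinear ℝ {0, plc E r (2 * m + 1) q, plc E r (2 * m + 1) p} := by
  rw [collinear_iff_of_mem (p₀ := (0 : ℂ)) (by simp)]
  refine ⟨plc E r (2 * m + 1) p, ?_⟩
  rintro w (rfl | rfl | rfl)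
  · exact ⟨0, by simp⟩
  · refine ⟨-1, ?_⟩
    have := plc_antipode E r hp
    rw [show 2 * m + 1 - p = q by omega] at this
    rw [this]; simp
  · exact ⟨1, by simp⟩

/-- The origin condition for two radii at the same origin point. -/
theorem originCondition_radii {m : ℕ} (hm : 1 ≤ m)
    (hax : ∀ ε, X.axis ε = (ℝ ∙ nrmDir E (2 * m + 1) (parOf η ε))ᗮ) (x y : V) {q p : ℕ}
    (hq : q ≤ 2 * m + 1) (hp : p ≤ 2 * m + 1) :
    X.OriginCondition {s(.origin x, .vertex (plc E r (2 * m + 1) q))}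
      {s(.origin y, .vertex (plc E r (2 * m + 1) p))} ↔
      (x = y → q + p = 2 * m + 1 ∨ (q ≤ m ↔ p ≤ m)) := by
  rw [Setup.originCondition_half, Setup.crossesGrayZone_radii hr hm hax hq hp, not_not]
  refine imp_congr_right fun _ => ?_
  by_cases h1 : q + p = 2 * m + 1
  · exact iff_of_true (Or.inl (collinear_antipode hp h1)) (Or.inl h1)
  · by_cases h2 : q = p
    · subst h2; simp
    · rw [or_iff_right h1, or_iff_right (not_collinear_plc hr hq hp h2 h1)]

/-- A diagonal that is not a diameter crosses a diameter if and only if it crosses one of its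
halves. -/
theorem noCrossing_diam_chord (x y : V) {m q q' a b : ℕ} (hq : q ≤ 2 * m + 1)
    (hqq : q + q' = 2 * m + 1) (hab : a < b) (hb : b ≤ 2 * m + 1) (hd : a + b ≠ 2 * m + 1) :
    Setup.NoCrossing {s(.origin x, .vertex (plc E r (2 * m + 1) q)),
      s(.origin y, .vertex (plc E r (2 * m + 1) q'))}
      {s(.vertex (plc E r (2 * m + 1) a), .vertex (plc E r (2 * m + 1) b))} ↔
    ¬ Crosses (snakePt (2 * m + 1) q) (snakePt (2 * m + 1) q') (snakePt (2 * m + 1) a)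
      (snakePt (2 * m + 1) b) := by
  have hq' : plc E r (2 * m + 1) q' = -plc E r (2 * m + 1) q := by
    rw [← plc_antipode E r hq, show 2 * m + 1 - q = q' by omega]
  have hne : ∀ w : ℂ, s((0 : ℂ), w) ≠ s(plc E r (2 * m + 1) a, plc E r (2 * m + 1) b) := by
    intro w h
    rw [Sym2.eq_iff] at h
    rcases h with ⟨h, -⟩ | ⟨h, -⟩
    · exact plc_ne_zero E _ hr a h.symm
    · exact plc_ne_zero E _ hr b h.symm
  have h0 : (0 : ℂ) ∉ openSegment ℝ (plc E r (2 * m + 1) a) (plc E r (2 * m + 1) b) := by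
    have h1 := zero_notMem_openSegment (snakePt_norm (2 * m + 1) a) (snakePt_norm (2 * m + 1) b) (by
      intro h
      rw [← snakePt_antipode (by omega) (by omega)] at h
      have := snakePt_injOn hb (by omega) h
      omega)
    intro h
    apply h1
    have h2 := image_openSegment ℝ
      (E.toLinearEquiv.toLinearMap ∘ₗ LinearMap.lsmul ℝ ℂ r).toAffineMap (snakePt (2 * m + 1) a)
      (snakePt (2 * m + 1) b)
    have h3 : (0 : ℂ) ∈ (E.toLinearEquiv.toLinearMap ∘ₗ LinearMap.lsmul ℝ ℂ r).toAffineMap ''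
      openSegment ℝ (snakePt (2 * m + 1) a) (snakePt (2 * m + 1) b) := by rw [h2]; exact h
    obtain ⟨w, hw, hw0⟩ := h3
    have hw1 : r • w = 0 := E.injective (hw0.trans (map_zero E).symm)
    rcases smul_eq_zero.1 hw1 with h4 | h4
    · exact absurd h4 hr.ne'
    · exact h4 ▸ hw
  rw [← crosses_plc E _ hr, crosses_comm, hq', crosses_diameter h0, Setup.noCrossing_iff]
  simp only [Set.mem_insert_iff, Set.mem_singleton_iff, forall_eq_or_imp, forall_eq,
    Setup.noCrossing_singleton]
  change ((Crosses 0 (plc E r (2 * m + 1) q) (plc E r (2 * m + 1) a) (plc E r (2 * m + 1) b) →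
    s((0 : ℂ), _) = s(plc E r (2 * m + 1) a, plc E r (2 * m + 1) b)) ∧
    (Crosses 0 (-plc E r (2 * m + 1) q) (plc E r (2 * m + 1) a) (plc E r (2 * m + 1) b) →
    s((0 : ℂ), _) = s(plc E r (2 * m + 1) a, plc E r (2 * m + 1) b))) ↔ _
  rw [imp_iff_not (hne _), imp_iff_not (hne _), crosses_comm 0, crosses_comm 0, not_or]

omit hr in
theorem Setup.noCrossing_comm (C C' : Diagram V) :
    Setup.NoCrossing C C' ↔ Setup.NoCrossing C' C :=
  ⟨fun h A B A' B' h1 h2 hc => (h A' B' A B h2 h1 ((crosses_comm _ _ _ _).1 hc)).symm,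
    fun h A B A' B' h1 h2 hc => (h A' B' A B h2 h1 ((crosses_comm _ _ _ _).1 hc)).symm⟩

/-- The compatibility criterion for the diagrams of two figures of type `D`. For two diameters, the
halves with the same label lie on the same side of the gray zone iff the colors agree. -/
theorem segsD_iff {m : ℕ} (hm : 3 ≤ m) {zc : Bool → V} (hzc : zc true ≠ zc false)
    (hax : ∀ ε, X.axis ε = (ℝ ∙ nrmDir E (2 * m + 1) (parOf η ε))ᗮ) {F G : DFig m} (hne : F ≠ G) :
    (Setup.NoCrossing (segsD E r zc F) (segsD E r zc G) ∧
      X.OriginCondition (segsD E r zc F) (segsD E r zc G)) ↔ (baseD m hm η).FC F G := by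
  obtain ⟨f1, f2, -⟩ := F.2.1
  obtain ⟨g1, g2, -⟩ := G.2.1
  have hinj : ∀ c c', zc c = zc c' ↔ c = c' := by
    intro c c'; cases c <;> cases c' <;> simp [hzc, hzc.symm]
  change _ ↔ fcD F G
  unfold segsD fcD
  by_cases hF : F.IsDiam <;> by_cases hG : G.IsDiam
  · have hF' : F.1.1 + F.1.2.1 = 2 * m + 1 := hF
    have hG' : G.1.1 + G.1.2.1 = 2 * m + 1 := hG
    have hcol : F.1.2.2 = G.1.2.2 → F.1.1 ≠ G.1.1 := fun h h' =>
      hne (Subtype.ext (Prod.ext h' (Prod.ext (by omega) h)))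
    rw [if_pos hF, if_pos hG, if_pos ⟨hF, hG⟩, Setup.noCrossing_iff, Setup.originCondition_iff]
    simp only [Set.mem_insert_iff, Set.mem_singleton_iff, forall_eq_or_imp, forall_eq]
    rw [originCondition_radii hr (by omega) hax _ _ (by omega) (by omega),
      originCondition_radii hr (by omega) hax _ _ (by omega) (by omega),
      originCondition_radii hr (by omega) hax _ _ (by omega) (by omega),
      originCondition_radii hr (by omega) hax _ _ (by omega) (by omega)]
    simp only [noCrossing_half hr, true_and, and_true, hinj]
    by_cases hc : F.1.2.2 = G.1.2.2
    · have := hcol hc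
      rw [hc]
      simp only [Bool.eq_not_self, Bool.not_eq_self, false_imp_iff, true_and, and_true]
      refine iff_of_true ⟨fun _ => by omega, fun _ => by omega⟩ ?_
      simpa using this
    · have hc' : G.1.2.2 = !F.1.2.2 := by
        revert hc; cases F.1.2.2 <;> cases G.1.2.2 <;> simp
      rw [hc']
      simp only [Bool.not_not, Bool.eq_not_self, Bool.not_eq_self, false_imp_iff, true_and, and_true,
        true_imp_iff, false_iff, not_not]
      omega
  · have hF' : F.1.1 + F.1.2.1 = 2 * m + 1 := hF
    rw [if_pos hF, if_neg hG, if_neg (fun h => hG h.2), noCrossing_diam_chord hr _ _ (by omega) hF' g1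
      g2 hG]
    refine and_iff_left ?_
    rw [Setup.originCondition_iff]
    rintro e - e' rfl
    exact Setup.originCondition_chord_right _ _ _
  · have hG' : G.1.1 + G.1.2.1 = 2 * m + 1 := hG
    rw [if_neg hF, if_pos hG, if_neg (fun h => hF h.1), Setup.noCrossing_comm,
      noCrossing_diam_chord hr _ _ (by omega) hG' f1 f2 hF, crosses_comm]
    refine and_iff_left ?_
    rw [Setup.originCondition_iff]
    rintro e rfl e' -
    exact Setup.originCondition_chord_left _ _ _
  · rw [if_neg hF, if_neg hG, if_neg (fun h => hF h.1), Setup.noCrossing_singleton,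
      and_iff_left (Setup.originCondition_chord_left _ _ _)]
    have h1 := plc_pair_ne (E := E) hr f1 f2 g1 g2 (by
      rintro ⟨h, h'⟩
      refine hne (Subtype.ext (Prod.ext h (Prod.ext h' ?_)))
      rw [F.2.2 hF, G.2.2 hG])
    change (Crosses (plc E r (2 * m + 1) F.1.1) (plc E r (2 * m + 1) F.1.2.1)
      (plc E r (2 * m + 1) G.1.1) (plc E r (2 * m + 1) G.1.2.1) →
      s(plc E r (2 * m + 1) F.1.1, plc E r (2 * m + 1) F.1.2.1) =
      s(plc E r (2 * m + 1) G.1.1, plc E r (2 * m + 1) G.1.2.1)) ↔ ¬ Crosses _ _ _ _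
    rw [crosses_plc E _ hr]
    tauto

end Criterion

/-! ### Diagrams of almost positive roots -/

section Assignment

variable [FiniteDimensional ℝ V] {X : Setup n V} {Φ : Set V} {K 𝓕 : Type*} [Fintype K] [DecidableEq K]
  {B : BaseModel K 𝓕} (Q : FoldDatum B X.α X.σ) (segs : 𝓕 → Diagram V)

/-- The diagram of the root represented by a figure. -/
def FoldDatum.classDiagram (F : 𝓕) : Diagram V := {e | ∃ G, Q.Eqv G F ∧ e ∈ segs G}

variable {segs}
  (hneg : ∀ i, X.negSimpleDiagram i = {e | ∃ k F, Q.j k = i ∧ B.IsB F k ∧ e ∈ segs F})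
  (htau : ∀ ε F, X.tauSegment ε '' segs F = segs (B.T ε F))

include hneg htau in
/-- The diagrams of almost positive roots are the diagrams of the figures representing them. -/
theorem existsUnique_diagramAssignment (hΦ : IsRootSystemWithBase Φ X.α)
    (hs : SignOrtho X.α X.σ) :
    (∃! D, X.IsDiagramAssignment Φ D) ∧ ∀ D, X.IsDiagramAssignment Φ D → ∀ (β : almostPos X.α Φ) F,
      Q.toRootModel.Rel (β : V) F → D β = Q.classDiagram segs F := by
  obtain ⟨D, h1, h2, h3, h4⟩ := Q.toRootModel.existsUnique_assignment hΦ hs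
    (Q.classDiagram segs) (fun ε d => X.tauSegment ε '' d)
    (fun F G hFG => by
      ext e
      constructor
      · rintro ⟨F', h, he⟩; exact ⟨F', Q.eqv.trans h hFG, he⟩
      · rintro ⟨F', h, he⟩; exact ⟨F', Q.eqv.trans h (Q.eqv.symm hFG), he⟩)
    (fun ε F => by
      ext e
      constructor
      · rintro ⟨G, h, he⟩
        have h' := Q.eqv_T ε _ _ h
        change Q.Eqv _ (B.T ε (B.T ε F)) at h'
        rw [B.T_T] at h'
        have h2 := htau ε (B.T ε G)
        rw [B.T_T] at h2
        rw [← h2] at he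
        obtain ⟨e', he', rfl⟩ := he
        exact ⟨e', ⟨_, h', he'⟩, rfl⟩
      · rintro ⟨e', ⟨G, h, he'⟩, rfl⟩
        refine ⟨_, Q.eqv_T ε _ _ h, ?_⟩
        rw [← htau]
        exact ⟨e', he', rfl⟩)
  have hb : ∀ i, Q.classDiagram segs (Q.bFig i) = X.negSimpleDiagram i := by
    intro i
    rw [hneg]
    ext e
    constructor
    · rintro ⟨G, h, he⟩
      obtain ⟨k, hk, hb⟩ := (Q.eqv_bFig G i).1 h
      exact ⟨k, G, hk, hb, he⟩
    · rintro ⟨k, G, hk, hb, he⟩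
      exact ⟨G, (Q.eqv_bFig G i).2 ⟨k, hk, hb⟩, he⟩
  have huniq : ∀ D', X.IsDiagramAssignment Φ D' → D' = D := fun D' hD' =>
    h4 D' (fun i β hβ => (hD'.negSimple i β hβ).trans (hb i).symm) hD'.equivariant
  exact ⟨⟨D, ⟨fun i β hβ => (h2 i β hβ).trans (hb i), h3⟩, huniq⟩, fun D' hD' => huniq D' hD' ▸ h1⟩

include hneg htau in
/-- The compatibility criterion follows from the criterion for pairs of different figures. -/
theorem criterion_of_figures (hΦ : IsRootSystemWithBase Φ X.α) (hs : SignOrtho X.α X.σ)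
    (hfc : ∀ F G, F ≠ G → ((Setup.NoCrossing (segs F) (segs G) ∧ X.OriginCondition (segs F) (segs G)) ↔
      B.FC F G)) {R : almostPos X.α Φ → almostPos X.α Φ → Prop} {D : almostPos X.α Φ → Diagram V}
    (hR : IsCompatibility X.α X.σ Φ R) (hD : X.IsDiagramAssignment Φ D) {β γ : almostPos X.α Φ}
    (hne : β ≠ γ) :
    R β γ ↔ Setup.NoCrossing (D β) (D γ) ∧ X.OriginCondition (D β) (D γ) := by
  obtain ⟨F, hF⟩ := Q.toRootModel.exists_rel hΦ hs β β.2
  obtain ⟨G, hG⟩ := Q.toRootModel.exists_rel hΦ hs γ γ.2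
  have hFG := Q.toRootModel.not_eqv hΦ hs hne hF hG
  have hDF := (existsUnique_diagramAssignment Q hneg htau hΦ hs).2 D hD
  rw [(Q.toRootModel.compatibility hΦ hs B.FC B.FC_T Q.FC_bFig).2 R hR β γ F G hF hG, hDF β F hF,
    hDF γ G hG]
  have key : ∀ F' G', Q.Eqv F' F → Q.Eqv G' G → F' ≠ G' := by
    rintro F' G' h1 h2 rfl
    exact hFG (Q.eqv.trans (Q.eqv.symm h1) h2)
  constructor
  · intro h
    constructor
    · rintro A C A' C' ⟨F', h1, h1'⟩ ⟨G', h2, h2'⟩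
      exact ((hfc F' G' (key _ _ h1 h2)).2 (h F' G' h1 h2)).1 A C A' C' h1' h2'
    · rintro x A C ⟨F', h1, h1'⟩ ⟨G', h2, h2'⟩
      exact ((hfc F' G' (key _ _ h1 h2)).2 (h F' G' h1 h2)).2 x A C h1' h2'
  · rintro ⟨h, h'⟩ F' G' h1 h2
    refine (hfc F' G' (key _ _ h1 h2)).1 ⟨?_, ?_⟩
    · exact fun A C A' C' e1 e2 => h A C A' C' ⟨F', h1, e1⟩ ⟨G', h2, e2⟩
    · exact fun x A C e1 e2 => h' x A C ⟨F', h1, e1⟩ ⟨G', h2, e2⟩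

include hneg in
theorem axisSpec_of_figures {v : ℂ} (hv : v ≠ 0) (ε : Bool) (hax : X.axis ε = (ℝ ∙ v)ᗮ)
    (hpos : ∀ F, Sym2.map (X.axis ε).reflection '' (Sym2.map DiagramPoint.pos '' segs F) =
      Sym2.map DiagramPoint.pos '' segs (B.T ε F)) : X.AxisSpec ε := by
  constructor
  · rw [hax]
    have : Fact (Module.finrank ℝ ℂ = 1 + 1) := ⟨Complex.finrank_real_complex⟩
    exact Submodule.finrank_orthogonal_span_singleton hv
  · intro i hi
    have hsub : Sym2.map (X.axis ε).reflection '' (Sym2.map DiagramPoint.pos '' X.negSimpleDiagram i)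
        ⊆ Sym2.map DiagramPoint.pos '' X.negSimpleDiagram i := by
      rintro _ ⟨_, ⟨e, he, rfl⟩, rfl⟩
      rw [hneg] at he
      obtain ⟨k, F, hk, hb, he⟩ := he
      have h1 : Sym2.map (X.axis ε).reflection (Sym2.map DiagramPoint.pos e) ∈
          Sym2.map DiagramPoint.pos '' segs (B.T ε F) := by
        rw [← hpos]; exact ⟨_, ⟨e, he, rfl⟩, rfl⟩
      obtain ⟨e', he', h2⟩ := h1
      refine ⟨e', ?_, h2⟩
      rw [hneg]
      exact ⟨k, _, hk, B.T_isB ε F k (by rwa [← Q.sign, hk]) hb, he'⟩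
    refine hsub.antisymm ?_
    intro e he
    refine ⟨Sym2.map (X.axis ε).reflection e, hsub ⟨e, he, rfl⟩, ?_⟩
    rw [Sym2.map_map]
    have : ((X.axis ε).reflection : ℂ → ℂ) ∘ (X.axis ε).reflection = id := by
      funext z; exact (X.axis ε).reflection_reflection z
    rw [this, Sym2.map_id]; rfl

end Assignment

/-! ### The diagrams of the negative simple roots -/

section Realization

theorem rootPt_add (N : ℕ) (a b : ℤ) : rootPt N (a + b) = rootPt N a * rootPt N b := by
  unfold rootPt
  rw [← Complex.exp_add]
  congr 1
  push_cast
  ring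

theorem norm_rootPt (N : ℕ) (a : ℤ) : ‖rootPt N a‖ = 1 := by
  unfold rootPt
  rw [show (2 * π * Complex.I * a / N : ℂ) = ((2 * π * a / N : ℝ) : ℂ) * Complex.I by
    push_cast; ring]
  exact Complex.norm_exp_ofReal_mul_I _

theorem conj_rootPt (N : ℕ) (a : ℤ) : (starRingEnd ℂ) (rootPt N a) = rootPt N (-a) := by
  unfold rootPt
  rw [← Complex.exp_conj]
  congr 1
  simp only [map_div₀, map_mul, Complex.conj_ofReal, Complex.conj_I, map_intCast, map_natCast,
    map_ofNat]
  push_cast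
  ring

/-- Renumbering the vertices of a regular polygon in a way that preserves the cyclic order, up to
orientation, is an isometry. -/
theorem exists_isometry_rootPt (N : ℕ) {z : ℂ} (hz : z ≠ 0) (K : ℤ) {s : ℤ} (hs : s = 1 ∨ s = -1) :
    ∃ E : ℂ ≃ₗᵢ[ℝ] ℂ, ∀ a : ℤ, E (‖z‖ • rootPt N a) = z * rootPt N (K + s * a) := by
  have hz' : (‖z‖ : ℂ) ≠ 0 := by exact_mod_cast norm_ne_zero_iff.2 hz
  let u : Circle := ⟨z / ‖z‖ * rootPt N K, by
    rw [Submonoid.unitSphere]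
    simp [norm_rootPt, hz]⟩
  have hu : ∀ w : ℂ, rotation u w = z / ‖z‖ * rootPt N K * w := fun w => rotation_apply _ _
  rcases hs with rfl | rfl
  · refine ⟨rotation u, fun a => ?_⟩
    rw [hu, one_mul, rootPt_add, Complex.real_smul]
    field_simp
  · refine ⟨Complex.conjLIE.trans (rotation u), fun a => ?_⟩
    rw [LinearIsometryEquiv.trans_apply, hu, rootPt_add, Complex.real_smul, Complex.conjLIE_apply,
      map_mul, Complex.conj_ofReal, conj_rootPt, neg_one_mul]
    field_simp

variable [FiniteDimensional ℝ V] {X : Setup n V}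

/-- The elements of the zigzag are placed on a regular polygon in snake order. -/
theorem exists_plc {Z : ZigZag X.α X.σ} (O : Z.Orbit X.o) (hs : SignOrtho X.α X.σ) (hz : X.z ≠ 0) :
    ∃ E : ℂ ≃ₗᵢ[ℝ] ℂ, (∃ (K s : ℤ), (s = 1 ∨ s = -1) ∧
        ∀ a : ℤ, E (‖X.z‖ • rootPt (Z.h + 2) a) = X.z * rootPt (Z.h + 2) (K + s * a)) ∧
      ∀ q, 1 ≤ q → q ≤ Z.h → X.place (Z.y O.x₀ O.t q) = .vertex (plc E ‖X.z‖ (Z.h + 1) q) := by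
  have hc := O.coxNum_eq hs
  obtain ⟨s, hs1, hG⟩ := X.exists_rotation (Z := Z) hs hc
  obtain ⟨K, hK⟩ := Setup.exists_place_y O hs hc hs1 hG
  obtain ⟨E, hE⟩ := exists_isometry_rootPt (Z.h + 2) hz K hs1
  refine ⟨E, ⟨K, s, hs1, hE⟩, fun q h1 h2 => ?_⟩
  rw [hK q h1 h2, ← hE]
  rfl

section TypeA

variable {r : ℕ} {η : Bool} (Q : FoldDatum (baseA r η) X.α X.σ) (hr : 2 ≤ r)
  (hw : Q.w ⟨0, by omega⟩ = 1) (hs : SignOrtho X.α X.σ) {x₀ : V} {t : ℝ} (ht : t ≠ 0)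
  (hx : ∀ j, ⟪nroot X.α j, x₀⟫_ℝ = if j = (Q.zigZagA hr hw).i₀ then t else 0)
  (ho : X.o = orbitOf X.α x₀) {E : ℂ ≃ₗᵢ[ℝ] ℂ} {ρ : ℝ} (hρ : 0 < ρ)
  (hE : ∀ q, 1 ≤ q → q ≤ r + 1 →
    X.place ((Q.zigZagA hr hw).y x₀ t q) = .vertex (plc E ρ (r + 2) q))

include hs ht hx ho hE in
/-- The simple reflection `s_i` exchanges the ends of the steps of the zigzag over the node `i` and
fixes its other elements, so the diagram of `-α i` consists of snake diagonals. -/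
theorem negSimpleDiagram_A (i : Fin n) :
    X.negSimpleDiagram i =
      {e | ∃ k F, Q.j k = i ∧ (baseA r η).IsB F k ∧ e ∈ chordSegs E ρ F} := by
  have hchord : ∀ (k : Fin r) (F : ChordFig r), (baseA r η).IsB F k →
      (chordSegs E ρ F : Diagram V) =
        {s(.vertex (plc E ρ (r + 2) (k + 1)), .vertex (plc E ρ (r + 2) (k + 2)))} := by
    rintro k F ⟨h1, h2⟩
    unfold chordSegs
    rw [h1, h2]
  have hne : ∀ k : Fin r, (Q.zigZagA hr hw).y x₀ t (k + 1) ≠ (Q.zigZagA hr hw).y x₀ t (k + 2) :=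
    fun k => ZigZag.y_injOn _ ht (by omega) (by have := k.2; change _ ≤ r + 1; omega) (by omega)
  ext e
  constructor
  · rintro ⟨x, hxo, hmv, rfl⟩
    rw [ho] at hxo
    obtain ⟨q, hq, rfl⟩ := orbitOf_subset_A Q hr hw hx hxo
    rw [Finset.coe_Icc, Set.mem_Icc] at hq
    rcases refl_yA_cases Q hr hw hx hq.1 hq.2 i with ⟨k, rfl, rfl⟩ | ⟨k, rfl, rfl⟩ | h
    · obtain ⟨F, hF⟩ := (baseA r η).exists_isB k
      refine ⟨k, F, rfl, hF, ?_⟩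
      beta_reduce
      rw [hchord k F hF, refl_yA Q hr hw hx k, hE _ (by omega) (by omega),
        hE _ (by omega) (by have := k.2; omega)]
      rfl
    · obtain ⟨F, hF⟩ := (baseA r η).exists_isB k
      refine ⟨k, F, rfl, hF, ?_⟩
      beta_reduce
      rw [hchord k F hF, refl_yA' Q hr hw hx k, hE _ (by omega) (by omega),
        hE _ (by omega) (by have := k.2; omega), Sym2.eq_swap]
      rfl
    · exact absurd h hmv
  · rintro ⟨k, F, rfl, hF, he⟩
    rw [hchord k F hF, Set.mem_singleton_iff] at he
    have hk := k.2
    refine ⟨(Q.zigZagA hr hw).y x₀ t (k + 1), ?_, ?_, ?_⟩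
    · exact (orbitA Q hr hw ht hx ho).y_mem hs (by omega) (by change _ ≤ r + 1; omega)
    · rw [refl_yA Q hr hw hx]; exact (hne k).symm
    · rw [he, refl_yA Q hr hw hx, hE _ (by omega) (by omega), hE _ (by omega) (by omega)]

include hr hs ht hx ho hE hρ in
theorem axis_A (ε : Bool) : X.axis ε = (ℝ ∙ nrmDir E (r + 2) (parOf η ε))ᗮ := by
  have hneg := negSimpleDiagram_A Q hr hw hs ht hx ho hE
  refine Setup.axis_eq ε ?_ ?_
  · intro i A B hi he
    rw [hneg] at he
    obtain ⟨k, F, rfl, hF, he⟩ := he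
    have hk := k.2
    have hsub := plc_sub E ρ (r + 2) (p := k + 1) (by omega)
    rw [Q.sign] at hi
    rw [(sgnOf_ne_iff η ε _).1 hi] at hsub
    unfold chordSegs at he
    rw [hF.1, hF.2, Set.mem_singleton_iff, Sym2.eq_iff] at he
    rcases he with ⟨rfl, rfl⟩ | ⟨rfl, rfl⟩
    · exact ⟨_, hsub⟩
    · refine ⟨-(2 * ρ * (frm (r + 2 + 1) (parOf η ε) (k + 1)).im), ?_⟩
      change plc E ρ (r + 2) (k + 1 + 1) - plc E ρ (r + 2) (k + 1) = _
      rw [← neg_sub, hsub, ← neg_smul]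
  · obtain ⟨k, hk⟩ : ∃ k : Fin r, (k + 1 : ℕ) % 2 = parOf η ε := by
      have := parOf_lt η ε
      rcases (by omega : parOf η ε = 1 ∨ parOf η ε = 0) with h | h
      · exact ⟨⟨0, by omega⟩, by simp [h]⟩
      · exact ⟨⟨1, by omega⟩, by simp [h]⟩
    obtain ⟨F, hF⟩ := (baseA r η).exists_isB k
    refine ⟨Q.j k, .vertex (plc E ρ (r + 2) (k + 1)), .vertex (plc E ρ (r + 2) (k + 2)), ?_, ?_, ?_⟩
    · rw [Q.sign]; exact (sgnOf_ne_iff η ε _).2 hk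
    · rw [hneg]
      refine ⟨k, F, rfl, hF, ?_⟩
      unfold chordSegs
      rw [hF.1, hF.2]; rfl
    · intro h
      have := plc_injOn E (r + 2) hρ (a := k + 1) (b := k + 2) (by omega) (by omega) h
      omega

end TypeA

/-- The diagrams are well defined and the compatibility criterion holds. -/
def DiagramsWork (X : Setup n V) (Φ : Set V) : Prop :=
  (∀ ε, X.AxisSpec ε) ∧ (∃ u v, X.AreAxisVectors u v) ∧ (∃! D, X.IsDiagramAssignment Φ D) ∧
    ∀ R D, IsCompatibility X.α X.σ Φ R → X.IsDiagramAssignment Φ D →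
      ∀ β γ : almostPos X.α Φ, β ≠ γ →
        (R β γ ↔ Setup.NoCrossing (D β) (D γ) ∧ X.OriginCondition (D β) (D γ))

/-- The result for types that are obtained from type `A` by folding. -/
theorem diagramsWork_A {Φ : Set V} (hΦ : IsRootSystemWithBase Φ X.α) (hs : SignOrtho X.α X.σ)
    (hz : X.z ≠ 0) {r : ℕ} {η : Bool} (Q : FoldDatum (baseA r η) X.α X.σ) (hr : 2 ≤ r)
    (hw : Q.w ⟨0, by omega⟩ = 1) {x₀ : V} {t : ℝ} (ht : t ≠ 0)
    (hx : ∀ j, ⟪nroot X.α j, x₀⟫_ℝ = if j = Q.j ⟨0, by omega⟩ then t else 0)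
    (ho : X.o = orbitOf X.α x₀) : DiagramsWork X Φ := by
  obtain ⟨E, -, hE⟩ := exists_plc (orbitA Q hr hw ht hx ho) hs hz
  have hρ : 0 < ‖X.z‖ := norm_pos_iff.2 hz
  have hneg := negSimpleDiagram_A Q hr hw hs ht hx ho hE
  have hax := axis_A Q hr hw hs ht hx ho hρ hE
  have htau := tauSegment_chordSegs (X := X) (r := ‖X.z‖) hax
  refine ⟨fun ε => ?_, Setup.exists_areAxisVectors hax (by omega),
    (existsUnique_diagramAssignment Q hneg htau hΦ hs).1, fun R D hR hD β γ hne =>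
      criterion_of_figures Q hneg htau hΦ hs (fun F G h => chordSegs_iff hρ h) hR hD hne⟩
  refine axisSpec_of_figures Q hneg (nrmDir_ne_zero E (r + 2) (parOf η ε)) ε (hax ε) fun F => ?_
  have hF := F.2.2.1
  rw [← htau]
  unfold chordSegs
  rw [Set.image_singleton, Set.image_singleton, Set.image_singleton, Set.image_singleton,
    Setup.tauSegment_chord hax ε (by have := F.2.1; omega) hF]
  simp only [Sym2.map_mk, DiagramPoint.pos]
  rw [Setup.reflection_plc hax ε (by have := F.2.1; omega), Setup.reflection_plc hax ε hF]

end Realization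

section RealizationD

variable [FiniteDimensional ℝ V] {X : Setup n V}

/-- A diagonal of the snake, colored if it is a diameter. -/
def snakeD {m q : ℕ} (h1 : 1 ≤ q) (h2 : q < 2 * m) (c : Bool) (hc : q ≠ m → c = false) : DFig m :=
  ⟨(q, q + 1, c), by unfold IsDiag; dsimp only; omega, fun h => hc (by dsimp only at h; omega)⟩

theorem eq_forkNode {m : ℕ} {k : Fin (m + 1)} (h : ¬ (k : ℕ) + 1 < m) :
    k = forkNode m (decide ((k : ℕ) = m)) := by
  rw [Fin.ext_iff, forkNode_val]
  have := k.2
  by_cases h3 : (k : ℕ) = m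
  · simp [h3]
  · simp [h3]; omega

theorem not_forkNode_lt {m : ℕ} (c : Bool) : ¬ (forkNode m c : ℕ) + 1 < m := by
  rw [forkNode_val]; split_ifs <;> omega

/-- The snake diameter of color `c`. -/
abbrev snakeDiam {m : ℕ} (hm : 3 ≤ m) (c : Bool) : DFig m :=
  snakeD (q := m) (by omega) (by omega) c fun h => absurd rfl h

theorem isB_snakeDiam {m : ℕ} (hm : 3 ≤ m) {η : Bool} (c : Bool) :
    (baseD m hm η).IsB (snakeDiam hm c) (forkNode m c) := by
  change IsBD m _ _
  unfold IsBD snakeDiam snakeD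
  rw [if_neg (not_forkNode_lt c)]
  refine ⟨rfl, rfl, ?_⟩
  change c = _
  rw [forkNode_val]
  cases c <;> simp
  omega

theorem segsD_snakeDiam {V : Type*} (E : ℂ ≃ₗᵢ[ℝ] ℂ) (ρ : ℝ) {m : ℕ} (hm : 3 ≤ m) (zc : Bool → V)
    (c : Bool) : segsD E ρ zc (snakeDiam hm c) =
      {s(.origin (zc c), .vertex (plc E ρ (2 * m + 1) m)),
        s(.origin (zc !c), .vertex (plc E ρ (2 * m + 1) (m + 1)))} := by
  unfold segsD
  rw [if_pos (by unfold DFig.IsDiam snakeDiam snakeD; dsimp only; omega)]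
  rfl

variable {m : ℕ} {hm : 3 ≤ m} {η : Bool} (Q : FoldDatum (baseD m hm η) X.α X.σ) (hw : Q.w 0 = 1)
  (hs : SignOrtho X.α X.σ) {x₀ : V} {t : ℝ} (ht : t ≠ 0)
  (hx : ∀ j, ⟪nroot X.α j, x₀⟫_ℝ = if j = (Q.zigZagD hw).i₀ then t else 0)
  (hne : Q.j (forkNode m true) ≠ Q.j (forkNode m false))
  (ho : X.o = orbitOf X.α x₀) {E : ℂ ≃ₗᵢ[ℝ] ℂ} {ρ : ℝ} (hρ : 0 < ρ)
  (hE : ∀ q, 1 ≤ q → q ≤ 2 * m →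
    X.place ((Q.zigZagD hw).y x₀ t q) = .vertex (plc E ρ (2 * m + 1) q))
  (hO : ∀ c, X.place (originPt Q hw x₀ t c) = .origin (originPt Q hw x₀ t c))

include hs ht hx hne ho in
theorem yD_mem {q : ℕ} (h1 : 1 ≤ q) (h2 : q ≤ 2 * m) : (Q.zigZagD hw).y x₀ t q ∈ X.o :=
  (orbitD Q hw hx hne ht hs ho).y_mem hs h1 h2

include hs ht hx hne ho in
theorem originPt_mem (c : Bool) : originPt Q hw x₀ t c ∈ X.o := by
  rw [← refl_y_fork Q hw hx hne c]
  exact (orbitD Q hw hx hne ht hs ho).closed _ _ (yD_mem Q hw hs ht hx hne ho (by omega) (by omega))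

include hs ht hx hne ho hE hO in
/-- As in type `A`, but `s_i` for an end `i` of the fork exchanges `y m` and `y (m + 1)` with the
two origin points; this gives the halves of the snake diameter. -/
theorem negSimpleDiagram_D (i : Fin n) :
    X.negSimpleDiagram i = {e | ∃ k F, Q.j k = i ∧ (baseD m hm η).IsB F k ∧
      e ∈ segsD E ρ (originPt Q hw x₀ t) F} := by
  set y := (Q.zigZagD hw).y x₀ t with hy
  set zc := originPt Q hw x₀ t with hzc
  have hchord : ∀ q (h1 : 1 ≤ q) (h2 : q < 2 * m) (hqm : q ≠ m),
      s(DiagramPoint.vertex (plc E ρ (2 * m + 1) q), .vertex (plc E ρ (2 * m + 1) (q + 1))) ∈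
        segsD E ρ zc (snakeD h1 h2 false fun _ => rfl) := by
    intro q h1 h2 hqm
    unfold segsD
    rw [if_neg (by unfold DFig.IsDiam snakeD; dsimp only; omega)]
    rfl
  have hBchord : ∀ q (h1 : 1 ≤ q) (h2 : q < 2 * m) (k : Fin (m + 1)), (k : ℕ) + 1 < m →
      ((k : ℕ) + 1 = q ∨ q + k + 1 = 2 * m) →
      (baseD m hm η).IsB (snakeD h1 h2 false fun _ => rfl) k := by
    intro q h1 h2 k hk hkq
    change IsBD m _ _
    unfold IsBD snakeD
    rw [if_pos hk]
    dsimp only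
    omega
  ext e
  constructor
  · rintro ⟨x, hxo, hmv, rfl⟩
    rw [ho] at hxo
    rcases orbitOf_subset_D Q hw hx hne hxo with ⟨q, hq, rfl⟩ | hxz
    · rw [Finset.coe_Icc, Set.mem_Icc] at hq
      beta_reduce at hmv ⊢
      rw [hE q hq.1 hq.2]
      rcases refl_yD_cases Q hw hx hq.1 hq.2 i with ⟨h1, k, hk, hkq, rfl⟩ |
        ⟨h0, h1, k, hk, hkq, rfl⟩ | ⟨rfl, c, rfl⟩ | ⟨rfl, c, rfl⟩ | h
      · rw [refl_yD Q hw hx hq.1 h1 hk hkq, hE (q + 1) (by omega) (by omega)]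
        exact ⟨k, _, rfl, hBchord q hq.1 (by omega) k hk hkq, hchord q hq.1 (by omega) h1⟩
      · have hr := refl_yD' Q hw hx (p := q - 1) (by omega) h1 hk hkq
        rw [show q - 1 + 1 = q by omega] at hr
        rw [hr, hE (q - 1) (by omega) (by omega), Sym2.eq_swap]
        refine ⟨k, _, rfl, hBchord (q - 1) (by omega) (by omega) k hk hkq, ?_⟩
        have := hchord (q - 1) (by omega) (by omega) h1
        rwa [show q - 1 + 1 = q by omega] at this
      · rw [refl_y_fork Q hw hx hne, hO]
        refine ⟨_, _, rfl, isB_snakeDiam hm c, ?_⟩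
        rw [segsD_snakeDiam]
        exact Or.inl Sym2.eq_swap
      · rw [refl_y_succ_fork Q hw hx hne, hO]
        refine ⟨_, _, rfl, isB_snakeDiam hm c, ?_⟩
        rw [segsD_snakeDiam]
        exact Or.inr Sym2.eq_swap
      · exact absurd h hmv
    · obtain ⟨c, rfl⟩ : ∃ c, x = zc c := by
        rcases hxz with h | h
        · exact ⟨true, h⟩
        · exact ⟨false, h⟩
      rcases refl_originPt_cases Q hw hx hne c i with ⟨d, rfl⟩ | h
      · refine ⟨_, _, rfl, isB_snakeDiam hm d, ?_⟩
        rw [segsD_snakeDiam, hO, refl_originPt Q hw hx hne]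
        split_ifs with h
        · subst h
          rw [hE m (by omega) (by omega)]
          exact Or.inl rfl
        · obtain rfl : c = !d := Bool.eq_not_of_ne (Ne.symm h)
          rw [hE (m + 1) (by omega) (by omega)]
          exact Or.inr rfl
      · exact absurd h hmv
  · rintro ⟨k, F, rfl, hF, he⟩
    change IsBD m F k at hF
    unfold IsBD at hF
    unfold segsD at he
    split_ifs at hF with hk
    · have h1 : 1 ≤ F.1.1 := by omega
      have h2 : F.1.1 ≠ m := by omega
      have h3 : F.1.2.1 = F.1.1 + 1 := by omega
      have h4 : (k : ℕ) + 1 = F.1.1 ∨ F.1.1 + k + 1 = 2 * m := by omega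
      have h5 : F.1.1 + 1 ≤ 2 * m := by omega
      rw [if_neg (by unfold DFig.IsDiam; omega), Set.mem_singleton_iff, h3] at he
      refine ⟨y F.1.1, yD_mem Q hw hs ht hx hne ho h1 (by omega), ?_, ?_⟩
      · rw [refl_yD Q hw hx h1 h2 hk h4]
        exact (ZigZag.y_injOn _ ht h1 h5 (by omega)).symm
      · rw [he, refl_yD Q hw hx h1 h2 hk h4, hE _ h1 (by omega), hE _ (by omega) h5]
    · obtain ⟨h1, h2, h3⟩ := hF
      rw [if_pos (show F.IsDiam by unfold DFig.IsDiam; omega), h1, h2, h3] at he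
      have hk' := eq_forkNode hk
      set c := decide ((k : ℕ) = m)
      rw [hk']
      rcases he with rfl | he
      · have hr := refl_originPt Q hw hx hne c c
        rw [if_pos rfl] at hr
        refine ⟨zc c, originPt_mem Q hw hs ht hx hne ho c, fun h => ?_, ?_⟩
        · have h5 := hE m (by omega) (by omega)
          rw [hy, ← hr, ← hzc, h, hO] at h5
          cases h5
        · rw [hr, hO, hE m (by omega) (by omega)]
      · have hr := refl_y_succ_fork Q hw hx hne c
        rw [Set.mem_singleton_iff] at he
        refine ⟨y (m + 1), yD_mem Q hw hs ht hx hne ho (by omega) (by omega), fun h => ?_, ?_⟩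
        · have h5 := hE (m + 1) (by omega) (by omega)
          rw [← h, hy, hr, ← hzc, hO] at h5
          cases h5
        · rw [hr, hO, hE (m + 1) (by omega) (by omega), he, Sym2.eq_swap]

include hs ht hx hne ho hE hO hρ in
/-- All segments in the diagrams of the negative simple roots of one sign are parallel, so they
determine the axis. -/
theorem axis_D (ε : Bool) : X.axis ε = (ℝ ∙ nrmDir E (2 * m + 1) (parOf η ε))ᗮ := by
  set d := nrmDir E (2 * m + 1) (parOf η ε) with hd
  have hneg := negSimpleDiagram_D Q hw hs ht hx hne ho hE hO
  refine Setup.axis_eq ε ?_ ?_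
  · intro i A B hi he
    rw [hneg] at he
    obtain ⟨k, F, rfl, hF, he⟩ := he
    have hkm := k.2
    rw [Q.sign] at hi
    change sgnOf η (nodeD m k) ≠ ε at hi
    rw [sgnOf_ne_iff] at hi
    have hn := nodeD_mod (m := m) (k := k) (by omega)
    change IsBD m F k at hF
    have key : F.1.2.1 = F.1.1 + 1 ∧ F.1.1 % 2 = parOf η ε ∧ F.1.1 + 1 ≤ 2 * m + 1 ∧
        (F.IsDiam → F.1.1 = m) := by
      unfold IsBD at hF
      unfold DFig.IsDiam
      split_ifs at hF <;> omega
    have hsub := plc_sub E ρ (2 * m + 1) key.2.2.1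
    rw [key.2.1] at hsub
    set a := 2 * ρ * (frm (2 * m + 1 + 1) (parOf η ε) F.1.1).im
    have hcl : ∀ A B : DiagramPoint V, (∃ c : ℝ, A.pos - B.pos = c • d) →
        ∃ c : ℝ, B.pos - A.pos = c • d := by
      rintro A B ⟨c, hc⟩
      exact ⟨-c, by rw [neg_smul, ← hc, neg_sub]⟩
    have hfin : ∀ C D : DiagramPoint V, (∃ c : ℝ, C.pos - D.pos = c • d) →
        s(A, B) = s(C, D) → ∃ c : ℝ, A.pos - B.pos = c • d := by
      intro C D h h'
      rw [Sym2.eq_iff] at h'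
      rcases h' with ⟨rfl, rfl⟩ | ⟨rfl, rfl⟩
      · exact h
      · exact hcl _ _ h
    unfold segsD at he
    split_ifs at he with hd
    · have hm1 := key.2.2.2 hd
      have hanti := plc_antipode E ρ (m := m) (q := m) (by omega)
      rw [show 2 * m + 1 - m = m + 1 by omega] at hanti
      rw [hm1, hanti, sub_neg_eq_add, ← two_smul ℝ] at hsub
      have hV : plc E ρ (2 * m + 1) m = (a / 2) • d := by
        rw [div_eq_inv_mul, mul_smul, ← hsub, smul_smul]; norm_num
      rw [key.1, hm1] at he
      rcases he with he | he
      · refine hfin _ _ ⟨-(a / 2), ?_⟩ he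
        change 0 - plc E ρ (2 * m + 1) m = _
        rw [hV]; module
      · refine hfin _ _ ⟨a / 2, ?_⟩ he
        change 0 - plc E ρ (2 * m + 1) (m + 1) = _
        rw [hanti, hV]; module
    · refine hfin _ _ ⟨a, ?_⟩ he
      rw [key.1]
      exact hsub
  · obtain ⟨q, hq, hq1, hq2⟩ : ∃ q : ℕ, q % 2 = parOf η ε ∧ 1 ≤ q ∧ q ≤ 2 := by
      have := parOf_lt η ε
      rcases (by omega : parOf η ε = 1 ∨ parOf η ε = 0) with h | h
      · exact ⟨1, by omega, le_rfl, by omega⟩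
      · exact ⟨2, by omega, by omega, le_rfl⟩
    refine ⟨Q.j ⟨q - 1, by omega⟩, .vertex (plc E ρ (2 * m + 1) q),
      .vertex (plc E ρ (2 * m + 1) (q + 1)), ?_, ?_, ?_⟩
    · rw [Q.sign]
      change sgnOf η (nodeD m (q - 1)) ≠ ε
      rw [sgnOf_ne_iff]
      have hn := nodeD_mod (m := m) (k := q - 1) (by omega)
      omega
    · rw [hneg]
      refine ⟨_, snakeD (q := q) hq1 (by omega) false fun _ => rfl, rfl, ?_, ?_⟩
      · change IsBD m _ _
        unfold IsBD snakeD
        rw [if_pos (by dsimp only; omega)]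
        dsimp only
        omega
      · unfold segsD
        rw [if_neg (by unfold DFig.IsDiam snakeD; dsimp only; omega)]
        rfl
    · intro h
      have := plc_injOn E (2 * m + 1) hρ (a := q) (b := q + 1) (by omega) (by omega) h
      omega

/-- The image of the diagram of a figure under the reflections, without labels. -/
theorem map_reflection_segsD (hax : ∀ ε, X.axis ε = (ℝ ∙ nrmDir E (2 * m + 1) (parOf η ε))ᗮ)
    (zc : Bool → V) (ε : Bool) (F : DFig m) :
    Sym2.map (X.axis ε).reflection '' (Sym2.map DiagramPoint.pos '' segsD E ρ zc F) =
      Sym2.map DiagramPoint.pos '' segsD E ρ zc ((baseD m hm η).T ε F) := by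
  obtain ⟨f1, f2, -⟩ := F.2.1
  have he := parOf_lt η ε
  have hsum := swp_add (m := m) (q := F.1.1) (q' := F.1.2.1) he (by omega) f2
  have hdT : ((baseD m hm η).T ε F).IsDiam ↔ F.IsDiam := by
    change min _ _ + max _ _ = _ ↔ _
    rw [min_add_max]; exact hsum
  have e1 := Setup.reflection_plc (r := ρ) hax ε (q := F.1.1) (by omega)
  have e2 := Setup.reflection_plc (r := ρ) hax ε f2
  unfold segsD
  simp only [hdT]
  by_cases hd : F.IsDiam
  · rw [if_pos hd, if_pos hd, Set.image_pair, Set.image_pair, Set.image_pair]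
    simp only [Sym2.map_mk, DiagramPoint.pos, map_zero, e1, e2]
    change _ = ({s((0 : ℂ), plc E ρ _ (min _ _)), s((0 : ℂ), plc E ρ _ (max _ _))} : Set (Sym2 ℂ))
    rcases le_total (swp (2 * m + 1) (parOf η ε) F.1.1) (swp (2 * m + 1) (parOf η ε) F.1.2.1)
      with h | h
    · rw [min_eq_left h, max_eq_right h]
    · rw [min_eq_right h, max_eq_left h, Set.pair_comm]
  · rw [if_neg hd, if_neg hd, Set.image_singleton, Set.image_singleton, Set.image_singleton]
    simp only [Sym2.map_mk, DiagramPoint.pos, e1, e2]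
    congr 1
    exact (sym2_min_max (fun q => plc E ρ (2 * m + 1) q) _ _).symm

end RealizationD

section

variable [FiniteDimensional ℝ V] {X : Setup n V}

/-- The result for types that are obtained from type `D` by folding. -/
theorem diagramsWork_D {Φ : Set V} (hΦ : IsRootSystemWithBase Φ X.α) (hs : SignOrtho X.α X.σ)
    (hz : X.z ≠ 0) {m : ℕ} {hm : 3 ≤ m} {η : Bool} (Q : FoldDatum (baseD m hm η) X.α X.σ)
    (hw : Q.w 0 = 1) {x₀ : V} {t : ℝ} (ht : t ≠ 0)
    (hx : ∀ j, ⟪nroot X.α j, x₀⟫_ℝ = if j = Q.j 0 then t else 0)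
    (hne : Q.j (forkNode m true) ≠ Q.j (forkNode m false)) (ho : X.o = orbitOf X.α x₀) :
    DiagramsWork X Φ := by
  have O := orbitD Q hw hx hne ht hs ho
  obtain ⟨E, -, hE⟩ := exists_plc (orbitD Q hw hx hne ht hs ho) hs hz
  have hρ : 0 < ‖X.z‖ := norm_pos_iff.2 hz
  have hO := fun c => Setup.place_of_G_G hs (O.coxNum_eq hs) (G_G_originPt Q hw hx hne hs c)
  have hneg := negSimpleDiagram_D Q hw hs ht hx hne ho hE hO
  have hax := axis_D Q hw hs ht hx hne ho hρ hE hO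
  have htau := tauSegment_segsD hρ (cSign_originPt Q hw hx hne hs) hax hm
  exact ⟨fun ε => axisSpec_of_figures Q hneg (nrmDir_ne_zero E _ _) ε (hax ε)
      (map_reflection_segsD hax _ ε), Setup.exists_areAxisVectors hax (by omega),
    (existsUnique_diagramAssignment Q hneg htau hΦ hs).1, fun R D hR hD β γ hne' =>
      criterion_of_figures Q hneg htau hΦ hs
        (fun F G h => segsD_iff hρ hm (originPt_injective Q hw hx hne ht) hax h) hR hD hne'⟩

end

/-! ### Orbits of smallest size -/

section SmallestOrbit

variable {α : Module.Basis (Fin n) ℝ V} {σ : Fin n → Bool} {M : CoxeterMatrix (Fin n)} {Φ : Set V}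
  {o : Set V}

theorem HasGram.signOrtho (h : HasGram α M) (hσ : IsBipartition M σ) (h0 : ∀ i j, M i j ≠ 0) :
    SignOrtho α σ := by
  intro i j hij hs
  have h2 : M i j = 2 := by
    have h1 := M.off_diagonal i j hij
    have h3 : ¬ 3 ≤ M i j := fun h3 => hσ i j h3 hs
    have := h0 i j
    omega
  rw [h i j hij, h2]
  simp

theorem FoldDatum.existsUnique_isCompatibility {K 𝓕 : Type*} [Fintype K] [DecidableEq K]
    {B : BaseModel K 𝓕} (Q : FoldDatum B α σ) (hΦ : IsRootSystemWithBase Φ α)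
    (hs : SignOrtho α σ) : ∃! R, IsCompatibility α σ Φ R :=
  (Q.toRootModel.compatibility hΦ hs B.FC B.FC_T Q.FC_bFig).1

theorem exists_fundamental_weight (α : Module.Basis (Fin n) ℝ V) (i : Fin n) :
    ∃ x, ∀ j, ⟪nroot α j, x⟫_ℝ = if j = i then 1 else 0 := by
  have := α.finiteDimensional_of_finite
  let L : V →ₗ[ℝ] (Fin n → ℝ) := LinearMap.pi fun j => innerₛₗ ℝ (nroot α j)
  have hinj : Function.Injective L := by
    rw [← LinearMap.ker_eq_bot, LinearMap.ker_eq_bot']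
    exact fun v hv => eq_zero_of_inner_nroot α fun j => congrFun hv j
  obtain ⟨x, hx⟩ := (LinearMap.injective_iff_surjective_of_finrank_eq_finrank
    (by rw [Module.finrank_eq_card_basis α]; simp)).1 hinj fun j => if j = i then 1 else 0
  exact ⟨x, fun j => congrFun hx j⟩

theorem zero_notMem_orbitOf {x : V} (hx : x ≠ 0) : (0 : V) ∉ orbitOf α x := by
  rintro ⟨w, -, hw⟩
  exact hx (w.injective (by rw [← hw, map_zero]))

theorem refl_mem_orbitOf (x : V) (i : Fin n) {y : V} (hy : y ∈ orbitOf α x) :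
    refl (α i) y ∈ orbitOf α x := orbitOf_closed α hy (refl_mem_weylGroup α i)

/-- At most one node is joined to the node `i` of the diagram. -/
def IsLeaf (α : Module.Basis (Fin n) ℝ V) (i : Fin n) : Prop :=
  ∀ j j', j ≠ i → j' ≠ i → ⟪nroot α j, nroot α i⟫_ℝ ≠ 0 → ⟪nroot α j', nroot α i⟫_ℝ ≠ 0 → j = j'

/-- At most one simple reflection moves the third element of the zigzag that starts at the
fundamental weight of the node `i`. -/
def IsTame (α : Module.Basis (Fin n) ℝ V) (σ : Fin n → Bool) (i : Fin n) : Prop :=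
  ∀ k k', σ k = σ i → σ k' = σ i →
    (∑ j with σ j = !σ i, ⟪nroot α k, nroot α j⟫_ℝ * ⟪nroot α j, nroot α i⟫_ℝ)
      - (if k = i then 1 else 0) ≠ 0 →
    (∑ j with σ j = !σ i, ⟪nroot α k', nroot α j⟫_ℝ * ⟪nroot α j, nroot α i⟫_ℝ)
      - (if k' = i then 1 else 0) ≠ 0 → k = k'

variable [FiniteDimensional ℝ V]

/-- An orbit of smallest size is generated by a multiple of a fundamental weight. -/
theorem IsSmallestOrbit.exists_weight (ho : IsSmallestOrbit α o) (hs : SignOrtho α σ)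
    {Z : ZigZag α σ} {ω : V} (O : Z.Orbit (orbitOf α ω)) (hω : ω ≠ 0) {N : ℕ}
    (hfin : (orbitOf α ω).Finite) (hN : (orbitOf α ω).ncard ≤ N) (hN2 : N < 2 * Z.h) :
    ∃ x i t, o = orbitOf α x ∧ t ≠ 0 ∧ (∀ j, ⟪nroot α j, x⟫_ℝ = if j = i then t else 0) ∧
      (Z.h ≠ 4 ∨ N ≤ Z.h → IsLeaf α i) ∧ (Z.h ≠ 6 ∨ N ≤ Z.h → IsTame α σ i) := by
  obtain ⟨x, hx0, rfl, hmin⟩ := ho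
  have hle := hmin ω hω
  have hfin' : (orbitOf α x).Finite := Set.encard_lt_top_iff.1 (hle.trans_lt hfin.encard_lt_top)
  have hcard : (orbitOf α x).ncard ≤ N := (ENat.toNat_le_toNat hle hfin.encard_lt_top.ne).trans hN
  have f : coxPlane α σ ≃ₗᵢ[ℝ] ℂ := 
    (stdOrthonormalBasis ℝ _).equiv Complex.orthonormalBasisOneI (finCongr (O.finrank_coxPlane hs))
  let X : Setup n V := ⟨α, σ, orbitOf α ω, f, 1⟩
  have hc : coxNum X.α X.σ = Z.h := O.coxNum_eq hs
  obtain ⟨s, hs1, hG⟩ := X.exists_rotation (Z := Z) hs hc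
  obtain ⟨x', hx', i, t, ht, hxt, h4, h6⟩ := Setup.exists_weight (X := X) O hs hc hs1 hG
    hfin' ⟨x, self_mem_orbitOf α x⟩ (zero_notMem_orbitOf hx0)
    (fun i y hy => refl_mem_orbitOf x i hy) (by omega)
  exact ⟨x', i, t, orbitOf_eq_of_mem α hx', ht, hxt, fun h => h4 (by omega),
    fun h => h6 (by omega)⟩

/-- The Coxeter plane is a plane, compatibility is well defined, and the diagrams work. -/
def Works (Φ : Set V) (α : Module.Basis (Fin n) ℝ V) (σ : Fin n → Bool) (o : Set V) : Prop :=
  Module.finrank ℝ (coxPlane α σ) = 2 ∧ (∃! R, IsCompatibility α σ Φ R) ∧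
    ∀ (f : coxPlane α σ ≃ₗᵢ[ℝ] ℂ) (z : ℂ), z ≠ 0 → DiagramsWork ⟨α, σ, o, f, z⟩ Φ

/-- Types obtained from type `A` by folding: the orbit of the weight at the first node bounds the
size of an orbit `o` of smallest size from above, so `o` is the orbit of a multiple of the weight of
a leaf `i`. By `H`, the snake can be started at `i`. -/
theorem works_A (hΦ : IsRootSystemWithBase Φ α) (hs : SignOrtho α σ) (ho : IsSmallestOrbit α o)
    {r : ℕ} (hr : 2 ≤ r) {η : Bool} (Q : Folding (baseA r η) α σ) (hw : Q.w ⟨0, by omega⟩ = 1)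
    (H : ∀ i, IsLeaf α i → IsTame α σ i → ∃ (η' : Bool) (Q' : Folding (baseA r η') α σ),
      Q'.w ⟨0, by omega⟩ = 1 ∧ Q'.j ⟨0, by omega⟩ = i) : Works Φ α σ o := by
  obtain ⟨ω, hω⟩ := exists_fundamental_weight α (Q.j ⟨0, by omega⟩)
  have hω0 : ω ≠ 0 := by
    rintro rfl
    simpa using hω (Q.j ⟨0, by omega⟩)
  have O := orbitA Q.toFoldDatum hr hw one_ne_zero hω rfl
  have hsub := orbitOf_subset_A Q.toFoldDatum hr hw hω
  have hfin := (Set.toFinite ((fun p => (Q.toFoldDatum.zigZagA hr hw).y ω 1 p) ''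
    (Finset.Icc 1 (r + 1) : Finset ℕ))).subset hsub
  have hcard : (orbitOf α ω).ncard ≤ r + 1 := by
    refine (Set.ncard_le_ncard hsub (Set.toFinite _)).trans ((Set.ncard_image_le).trans ?_)
    rw [Set.ncard_coe_finset]; simp
  obtain ⟨x, i, t, hox, ht, hx, h4, h6⟩ := ho.exists_weight hs O hω0 hfin hcard
    (by change _ < 2 * (r + 1); omega)
  obtain ⟨η', Q', hw', rfl⟩ := H i (h4 (Or.inr le_rfl)) (h6 (Or.inr le_rfl))
  exact ⟨O.finrank_coxPlane hs, Q.toFoldDatum.existsUnique_isCompatibility hΦ hs,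
    fun f z hz => diagramsWork_A (X := ⟨α, σ, o, f, z⟩) hΦ hs hz Q'.toFoldDatum hr hw' ht hx hox⟩

/-- The analogue of `works_A` for types obtained from type `D`, where two more orbit elements are
allowed. For `m = 3` tameness is not available, and all three leaves of `D 4` occur. -/
theorem works_D (hΦ : IsRootSystemWithBase Φ α) (hs : SignOrtho α σ) (ho : IsSmallestOrbit α o)
    {m : ℕ} {hm : 3 ≤ m} {η : Bool} (Q : Folding (baseD m hm η) α σ) (hw : Q.w 0 = 1)
    (hne : Q.j (forkNode m true) ≠ Q.j (forkNode m false))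
    (H : ∀ i, IsLeaf α i → (m ≠ 3 → IsTame α σ i) →
      ∃ (η' : Bool) (Q' : Folding (baseD m hm η') α σ),
        Q'.w 0 = 1 ∧ Q'.j (forkNode m true) ≠ Q'.j (forkNode m false) ∧ Q'.j 0 = i) :
    Works Φ α σ o := by
  obtain ⟨ω, hω⟩ := exists_fundamental_weight α (Q.j 0)
  have hω0 : ω ≠ 0 := by
    rintro rfl
    simpa using hω (Q.j 0)
  have O := orbitD Q.toFoldDatum hw hω hne one_ne_zero hs rfl
  have hsub := orbitOf_subset_D Q.toFoldDatum hw hω hne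
  have hfin := (Set.toFinite _).subset hsub
  have hcard : (orbitOf α ω).ncard ≤ 2 * m + 2 := by
    refine (Set.ncard_le_ncard hsub (Set.toFinite _)).trans ((Set.ncard_union_le _ _).trans ?_)
    refine add_le_add ((Set.ncard_image_le).trans ?_) ?_
    · rw [Set.ncard_coe_finset]; simp
    · exact (Set.ncard_insert_le _ _).trans (by rw [Set.ncard_singleton])
  have hh : (Q.toFoldDatum.zigZagD hw).h = 2 * m := rfl
  obtain ⟨x, i, t, hox, ht, hx, h4, h6⟩ := ho.exists_weight hs O hω0 hfin hcard (by omega)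
  obtain ⟨η', Q', hw', hne', rfl⟩ := H i (h4 (Or.inl (by omega)))
    fun h => h6 (Or.inl (by omega))
  exact ⟨O.finrank_coxPlane hs, Q.toFoldDatum.existsUnique_isCompatibility hΦ hs,
    fun f z hz => diagramsWork_D (X := ⟨α, σ, o, f, z⟩) hΦ hs hz Q'.toFoldDatum hw' ht hx hne' hox⟩

end SmallestOrbit

/-! ### Foldings for the listed types -/

section Types

variable {α : Module.Basis (Fin n) ℝ V} {σ : Fin n → Bool} {M : CoxeterMatrix (Fin n)} {Φ : Set V}
  {o : Set V}

theorem HasGram.eq_zero (hG : HasGram α M) {i j : Fin n} (h : M i j = 2) :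
    ⟪nroot α i, nroot α j⟫_ℝ = 0 := by
  rw [hG i j (by rintro rfl; simp at h), h]
  simp

theorem HasGram.eq_neg_one (hG : HasGram α M) {i j : Fin n} (h : M i j = 3) :
    ⟪nroot α i, nroot α j⟫_ℝ = -1 := by
  rw [hG i j (by rintro rfl; simp at h), h]
  norm_num

theorem HasGram.ne_zero (hG : HasGram α M) {i j : Fin n} (h : 3 ≤ M i j) :
    ⟪nroot α i, nroot α j⟫_ℝ ≠ 0 := by
  have h3 : (3 : ℝ) ≤ M i j := by exact_mod_cast h
  rw [hG i j (by rintro rfl; simp at h), neg_ne_zero]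
  have hpi := Real.pi_pos
  have : 0 < Real.cos (π / M i j) := by
    refine Real.cos_pos_of_mem_Ioo ⟨by linarith [div_nonneg hpi.le (by linarith : (0:ℝ) ≤ M i j)], ?_⟩
    rw [div_lt_div_iff₀ (by linarith) two_pos]
    nlinarith
  positivity

theorem IsBipartition.ne (hσ : IsBipartition M σ) {i j : Fin n} (h : 3 ≤ M i j) : σ i ≠ σ j :=
  hσ i j h

/-- A leaf has only one neighbor. -/
theorem IsLeaf.eq (hG : HasGram α M) {i j j' : Fin n} (h : IsLeaf α i) (hj : 3 ≤ M j i)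
    (hj' : 3 ≤ M j' i) : j = j' :=
  h j j' (by rintro rfl; simp at hj) (by rintro rfl; simp at hj') (hG.ne_zero hj) (hG.ne_zero hj')

/-- The condition on the third element of the zigzag, for a leaf `i` with neighbor `p`. -/
theorem IsTame.eq (hG : HasGram α M) (hσ : IsBipartition M σ) {i p : Fin n} (h : IsTame α σ i)
    (hp : 3 ≤ M p i) (hi : ∀ j, j ≠ i → j ≠ p → M j i = 2) {k k' : Fin n} (hk : 3 ≤ M k p)
    (hk' : 3 ≤ M k' p)
    (h1 : ⟪nroot α k, nroot α p⟫_ℝ * ⟪nroot α p, nroot α i⟫_ℝ ≠ if k = i then 1 else 0)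
    (h2 : ⟪nroot α k', nroot α p⟫_ℝ * ⟪nroot α p, nroot α i⟫_ℝ ≠ if k' = i then 1 else 0) :
    k = k' := by
  have hne := hσ.ne hp
  have hbool : ∀ {a b c : Bool}, a ≠ b → c ≠ b → a = c := by decide
  have hsum : ∀ k : Fin n, (∑ j with σ j = !σ i,
      ⟪nroot α k, nroot α j⟫_ℝ * ⟪nroot α j, nroot α i⟫_ℝ)
      = ⟪nroot α k, nroot α p⟫_ℝ * ⟪nroot α p, nroot α i⟫_ℝ := fun k => by
    refine Finset.sum_eq_single_of_mem p (by simp [Bool.eq_not.2 hne]) fun j hj hjp => ?_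
    rw [Finset.mem_filter] at hj
    rw [hG.eq_zero (hi j (by rintro rfl; simp at hj) hjp), mul_zero]
  refine h k k' (hbool (hσ.ne hk) hne.symm) (hbool (hσ.ne hk') hne.symm) ?_ ?_
  · rw [hsum]; exact sub_ne_zero.2 h1
  · rw [hsum]; exact sub_ne_zero.2 h2

/-- A folding given in terms of the Coxeter matrix, composed with an automorphism of the diagram. -/
def Folding.ofMatrix {K 𝓕 : Type*} [Fintype K] [DecidableEq K] {B : BaseModel K 𝓕}
    (hG : HasGram α M) (e : Equiv.Perm (Fin n)) (he : ∀ i j, M (e i) (e j) = M i j)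
    (j : K → Fin n) (w : K → ℝ) (w_pos : ∀ k, 0 < w k) (surj : Function.Surjective j)
    (sign : ∀ k, σ (e (j k)) = B.s k)
    (fold : ∀ i l, i ≠ j l → ∑ k, (if j k = i then (B.adj k l : ℝ) * w k else 0)
      = 2 * Real.cos (π / M i (j l)) * w l) : Folding B α σ where
  j k := e (j k)
  w := w
  w_pos := w_pos
  j_surj := e.surjective.comp surj
  sign := sign
  fold i l hil := by
    obtain ⟨i, rfl⟩ := e.surjective i
    have hil' : i ≠ j l := fun h => hil (h ▸ rfl)
    simp only [EmbeddingLike.apply_eq_iff_eq]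
    rw [hG _ _ hil, he, fold i l hil', neg_neg]

theorem sign_alternating {r : ℕ} {s : ℕ → Bool} (h : ∀ k, k + 1 < r → s k ≠ s (k + 1)) {k : ℕ}
    (hk : k < r) : s k = sgnOf (s 0) (k + 1) := by
  induction k with
  | zero => rfl
  | succ k ih =>
    rw [sgnOf_succ, ← ih (by omega)]
    exact Bool.eq_not.2 (h k hk).symm

theorem sign_baseA (hσ : IsBipartition M σ) (e : Equiv.Perm (Fin n))
    (he : ∀ i j, M (e i) (e j) = M i j) {r : ℕ} (hr : 0 < r) {j : Fin r → Fin n}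
    (hj : ∀ k l : Fin r, (k : ℕ) + 1 = l → 3 ≤ M (j k) (j l)) (k : Fin r) :
    σ (e (j k)) = (baseA r (σ (e (j ⟨0, hr⟩)))).s k := by
  have := sign_alternating (r := r) (k := k)
    (s := fun k => if h : k < r then σ (e (j ⟨k, h⟩)) else true) (fun k hk => by
      rw [dif_pos hk, dif_pos (by omega)]
      exact hσ.ne (by rw [he]; exact hj _ _ rfl)) k.2
  rwa [dif_pos k.2, dif_pos hr] at this

theorem sign_baseD (hσ : IsBipartition M σ) (e : Equiv.Perm (Fin n))
    (he : ∀ i j, M (e i) (e j) = M i j) {m : ℕ} (hm : 3 ≤ m) {j : Fin (m + 1) → Fin n}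
    (hj : ∀ k l : Fin (m + 1), (k : ℕ) + 1 = l → (l : ℕ) < m → 3 ≤ M (j k) (j l))
    (hj' : ∀ k l : Fin (m + 1), (k : ℕ) + 2 = m → (l : ℕ) = m → 3 ≤ M (j k) (j l))
    (k : Fin (m + 1)) : σ (e (j k)) = (baseD m hm (σ (e (j 0)))).s k := by
  have key := fun k : ℕ => sign_alternating (r := m) (k := k)
    (s := fun k => if h : k < m then σ (e (j ⟨k, by omega⟩)) else true) (fun k hk => by
      rw [dif_pos hk, dif_pos (by omega)]
      exact hσ.ne (by rw [he]; exact hj _ _ rfl hk))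
  have hk := k.2
  change _ = sgnOf _ (nodeD m k)
  unfold nodeD
  split_ifs with h
  · have := key k h
    rwa [dif_pos h, dif_pos (by omega)] at this
  · have h1 := key (m - 2) (by omega)
    rw [dif_pos (by omega), dif_pos (by omega), show m - 2 + 1 = m - 1 by omega] at h1
    have h2 := sgnOf_succ (σ (e (j 0))) (m - 1)
    rw [show m - 1 + 1 = m by omega] at h2
    change _ = sgnOf (σ (e (j 0))) (m - 1) at h1
    rw [h2, ← h1]
    refine Bool.eq_not.2 (hσ.ne ?_).symm
    rw [he]
    exact hj' _ _ (by dsimp only; omega) (by omega)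

theorem sum_adjPath_mul {r : ℕ} (f : ℕ → ℝ) (l : Fin r) :
    ∑ k : Fin r, (adjPath r k l : ℝ) * f k =
      (if (l : ℕ) = 0 then 0 else f (l - 1)) + if (l : ℕ) + 1 < r then f (l + 1) else 0 := by
  have hl := l.2
  have h1 : ∀ k : Fin r, (adjPath r k l : ℝ) * f k
      = (if (l : ℕ) = k + 1 then f k else 0) + if (l : ℕ) + 1 = k then f k else 0 := by
    intro k
    unfold adjPath
    split_ifs <;> first | omega | simp
  simp only [h1, Finset.sum_add_distrib]
  congr 1
  · rw [Fin.sum_univ_eq_sum_range (fun k => if (l : ℕ) = k + 1 then f k else 0) r]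
    split_ifs with h
    · exact Finset.sum_eq_zero fun k _ => if_neg (by omega)
    · rw [Finset.sum_eq_single_of_mem ((l : ℕ) - 1) (by simp; omega) fun k _ hk => if_neg (by omega),
        if_pos (by omega)]
  · rw [Fin.sum_univ_eq_sum_range (fun k => if (l : ℕ) + 1 = k then f k else 0) r,
      Finset.sum_ite_eq]
    simp

variable [FiniteDimensional ℝ V]

theorem works_typeA (hn : 2 ≤ n) (hΦ : IsRootSystemWithBase Φ α)
    (hG : HasGram α (CoxeterMatrix.A n)) (hσ : IsBipartition (CoxeterMatrix.A n) σ)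
    (ho : IsSmallestOrbit α o) : Works Φ α σ o := by
  have hM : ∀ i j : Fin n, CoxeterMatrix.A n i j = if i = j then 1
      else (if (j : ℕ) + 1 = i ∨ (i : ℕ) + 1 = j then 3 else 2) := fun i j => rfl
  have hM3 : ∀ i j : Fin n, ((j : ℕ) + 1 = i ∨ (i : ℕ) + 1 = j) → CoxeterMatrix.A n i j = 3 :=
    fun i j h => by rw [hM, if_neg (by rintro rfl; omega), if_pos h]
  have hQ : ∀ e : Equiv.Perm (Fin n),
      (∀ i j, CoxeterMatrix.A n (e i) (e j) = CoxeterMatrix.A n i j) →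
      ∃ (η : Bool) (Q : Folding (baseA n η) α σ), Q.w ⟨0, by omega⟩ = 1 ∧
        Q.j ⟨0, by omega⟩ = e ⟨0, by omega⟩ := fun e he =>
    ⟨_, Folding.ofMatrix hG e he id (fun _ => 1) (fun _ => one_pos) Function.surjective_id
      (sign_baseA hσ e he (by omega) fun k l h => (hM3 _ _ (Or.inr h)).ge) (fun i l hil => by
        simp only [id, mul_one, Finset.sum_ite_eq', Finset.mem_univ, if_true]
        change ((adjPath n i l : ℤ) : ℝ) = _
        rw [hM, if_neg (show ¬ i = l from hil)]
        unfold adjPath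
        split_ifs <;> first | omega | norm_num), rfl, rfl⟩
  obtain ⟨η, Q, hw, -⟩ := hQ 1 fun _ _ => rfl
  refine works_A hΦ (hG.signOrtho hσ fun i j => ?_) ho hn Q hw fun i hl _ => ?_
  · rw [hM]; split_ifs <;> norm_num
  · have hi := i.2
    rcases (by omega : (i : ℕ) = 0 ∨ (i : ℕ) + 1 = n ∨ 0 < (i : ℕ) ∧ (i : ℕ) + 1 < n) with h | h | h
    · obtain ⟨η, Q, h1, h2⟩ := hQ 1 fun _ _ => rfl
      exact ⟨η, Q, h1, h2.trans (Fin.ext h.symm)⟩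
    · obtain ⟨η, Q, h1, h2⟩ := hQ Fin.revPerm fun i j => by
        have := i.2
        have := j.2
        simp only [hM, Fin.ext_iff, Fin.revPerm_apply, Fin.val_rev]
        split_ifs <;> omega
      refine ⟨η, Q, h1, h2.trans (Fin.ext ?_)⟩
      rw [Fin.revPerm_apply, Fin.val_rev]
      dsimp only
      omega
    · have := hl.eq hG (j := ⟨i - 1, by omega⟩) (j' := ⟨i + 1, h.2⟩)
        (hM3 _ _ (Or.inr (by dsimp only; omega))).ge (hM3 _ _ (Or.inl rfl)).ge
      rw [Fin.mk.injEq] at this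
      omega

/-- The path with `m + 1` nodes folds onto the diagram of `I₂(m + 2)` by the parity of the nodes;
the weights are the components of the Perron–Frobenius eigenvector of the path. -/
theorem works_dihedral {α : Module.Basis (Fin 2) ℝ V} {σ : Fin 2 → Bool}
    {M : CoxeterMatrix (Fin 2)} {m : ℕ} (hm : 1 ≤ m) (hM : M 0 1 = m + 2)
    (hΦ : IsRootSystemWithBase Φ α) (hG : HasGram α M) (hσ : IsBipartition M σ)
    (ho : IsSmallestOrbit α o) : Works Φ α σ o := by
  have hM' : ∀ i j, i ≠ j → M i j = m + 2 := by
    intro i j h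
    have := M.symmetric 0 1
    fin_cases i <;> fin_cases j <;> simp_all
  have hθ : 0 < Real.sin (π / (m + 2)) :=
    Real.sin_pos_of_pos_of_lt_pi (by positivity) (div_lt_self Real.pi_pos (by linarith))
  set θ := π / (m + 2) with hθdef
  have hmθ : (m + 2) * θ = π := by rw [hθdef]; field_simp
  have hQ : ∀ e : Equiv.Perm (Fin 2), ∃ (η : Bool) (Q : Folding (baseA (m + 1) η) α σ),
      Q.w 0 = 1 ∧ Q.j 0 = e 0 := by
    intro e
    have he : ∀ i j, M (e i) (e j) = M i j := by
      intro i j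
      by_cases h : i = j
      · rw [h]; simp
      · rw [hM' _ _ h, hM' _ _ (e.injective.ne h)]
    let j : ℕ → Fin 2 := fun k => if k % 2 = 0 then 0 else 1
    let w : ℕ → ℝ := fun k => Real.sin ((k + 1 : ℝ) * θ) / Real.sin θ
    have hj : ∀ k l : ℕ, k + 1 = l → j k ≠ j l := by
      rintro k l rfl
      dsimp only [j]
      split_ifs <;> omega
    refine ⟨_, Folding.ofMatrix hG e he (fun k : Fin (m + 1) => j k) (fun k => w k) (fun k => ?_)
      (fun i => ?_) (sign_baseA hσ e he (Nat.succ_pos m) fun k l h => ?_) (fun i l hil => ?_),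
      ?_, rfl⟩
    · refine div_pos (Real.sin_pos_of_pos_of_lt_pi (by positivity) ?_) hθ
      rw [← hmθ]
      have : (k : ℝ) + 1 ≤ m + 1 := by exact_mod_cast k.2
      have : 0 < θ := by positivity
      nlinarith
    · fin_cases i
      · exact ⟨0, rfl⟩
      · exact ⟨⟨1, by omega⟩, rfl⟩
    · rw [hM' _ _ (hj k l h)]; omega
    · have h1 : ∀ k : Fin (m + 1), (if j k = i then (((baseA (m + 1) (σ (e (j 0)))).adj k l : ℤ) : ℝ)
          * w k else 0) = (adjPath (m + 1) k l : ℝ) * (if j k = i then w k else 0) := fun k => by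
        rw [mul_ite, mul_zero]; rfl
      have h2 : ∀ k : ℕ, k + 1 = l ∨ l + 1 = k → j k = i := by
        intro k hk
        have h3 : j k ≠ j l := hk.elim (fun h => hj _ _ h) fun h => (hj _ _ h).symm
        generalize j k = a at *; generalize j l = b at *
        omega
      have h3 : w (l + 1) + Real.sin (l * θ) / Real.sin θ = 2 * Real.cos θ * w l := by
        dsimp only [w]
        push_cast
        rw [show ((l : ℝ) + 1 + 1) * θ = (l + 1) * θ + θ by ring,
          show (l : ℝ) * θ = (l + 1) * θ - θ by ring, Real.sin_add, Real.sin_sub]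
        field_simp
        ring
      rw [Finset.sum_congr rfl fun k _ => h1 k, sum_adjPath_mul (fun k => if j k = i then w k else 0),
        hM' _ _ hil, h2 (l + 1) (Or.inr rfl), if_pos rfl]
      push_cast
      rw [← hθdef, ← h3, add_comm]
      congr 1
      · split_ifs with h
        · rfl
        · have := l.2
          rw [show ((l : ℕ) : ℕ) = m by omega]
          dsimp only [w]
          rw [show ((m + 1 : ℕ) + 1 : ℝ) * θ = π by rw [← hmθ]; push_cast; ring, Real.sin_pi,
            zero_div]
      · split_ifs with h h'
        · simp [h]
        · dsimp only [w]
          rw [Nat.cast_sub (by omega)]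
          norm_num
        · exact absurd (h2 (l - 1) (Or.inl (by omega))) h'
    · change w 0 = 1
      dsimp only [w]
      rw [Nat.cast_zero, zero_add, one_mul, div_self hθ.ne']
  obtain ⟨η, Q, hw, -⟩ := hQ 1
  refine works_A hΦ (hG.signOrtho hσ fun i j => ?_) ho (r := m + 1) (by omega) Q hw fun i _ _ => ?_
  · by_cases h : i = j
    · rw [h]; simp
    · rw [hM' i j h]; omega
  · obtain ⟨η, Q, h1, h2⟩ := hQ (Equiv.swap 0 i)
    exact ⟨η, Q, h1, h2.trans (Equiv.swap_apply_left 0 i)⟩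

end Types

section Types

variable {α : Module.Basis (Fin n) ℝ V} {σ : Fin n → Bool} {Φ : Set V}
  {o : Set V} [FiniteDimensional ℝ V]

theorem matrixB_apply (i j : Fin n) : CoxeterMatrix.B n i j = if i = j then 1
    else (if (i : ℕ) = n - 1 ∧ (j : ℕ) = n - 2 ∨ (j : ℕ) = n - 1 ∧ (i : ℕ) = n - 2 then 4
      else (if (j : ℕ) + 1 = i ∨ (i : ℕ) + 1 = j then 3 else 2)) := by
  change (if i = j then 1 else _) = _
  congr 2

theorem two_mul_cos_B {i j : Fin n} (hij : i ≠ j) :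
    2 * Real.cos (π / CoxeterMatrix.B n i j) =
      if (i : ℕ) = n - 1 ∧ (j : ℕ) = n - 2 ∨ (j : ℕ) = n - 1 ∧ (i : ℕ) = n - 2 then √2
        else (if (j : ℕ) + 1 = i ∨ (i : ℕ) + 1 = j then 1 else 0) := by
  rw [matrixB_apply, if_neg hij]
  split_ifs
  · push_cast; rw [Real.cos_pi_div_four]; ring
  · push_cast; rw [Real.cos_pi_div_three]; ring
  · push_cast; rw [Real.cos_pi_div_two]; ring

/-- The path with `2 n - 1` nodes is folded in the middle. -/
def foldMapB (hn : 0 < n) (k : ℕ) : Fin n := ⟨min k (2 * n - 2 - k), by omega⟩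

/-- The weights for type `B n`: only the middle node of the path has a weight different from `1`. -/
def foldWeightB (n k : ℕ) : ℝ := if k = n - 1 then √2 else 1

theorem foldB_eq (hn : 3 ≤ n) {l : ℕ} (hl : l < 2 * n - 1) {i : Fin n}
    (hi : i ≠ foldMapB (by omega) l) :
    ((if l = 0 then 0 else if foldMapB (by omega) (l - 1) = i then foldWeightB n (l - 1) else 0) +
      if l + 1 < 2 * n - 1 then
        (if foldMapB (by omega) (l + 1) = i then foldWeightB n (l + 1) else 0) else 0)
    = 2 * Real.cos (π / CoxeterMatrix.B n i (foldMapB (by omega) l)) * foldWeightB n l := by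
  have h2 : (√2 : ℝ) * √2 = 2 := Real.mul_self_sqrt (by norm_num)
  rw [two_mul_cos_B hi]
  have hin := i.2
  rw [ne_eq, Fin.ext_iff] at hi
  simp only [foldMapB, foldWeightB, Fin.ext_iff] at hi ⊢
  rcases lt_trichotomy l (n - 1) with h | h | h
  · simp only [show min l (2 * n - 2 - l) = l by omega,
      show min (l - 1) (2 * n - 2 - (l - 1)) = l - 1 by omega,
      show min (l + 1) (2 * n - 2 - (l + 1)) = l + 1 by omega] at hi ⊢
    rw [if_neg (by omega : ¬ l = n - 1), if_neg (by omega : ¬ l - 1 = n - 1),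
      if_pos (by omega : l + 1 < 2 * n - 1)]
    split_ifs <;> first | omega | simp
  · simp only [show min l (2 * n - 2 - l) = l by omega,
      show min (l - 1) (2 * n - 2 - (l - 1)) = l - 1 by omega,
      show min (l + 1) (2 * n - 2 - (l + 1)) = l - 1 by omega] at hi ⊢
    rw [if_pos h, if_neg (by omega : ¬ l - 1 = n - 1), if_neg (by omega : ¬ l + 1 = n - 1),
      if_pos (by omega : l + 1 < 2 * n - 1), if_neg (by omega : ¬ l = 0)]
    split_ifs <;> first | omega | linarith
  · obtain ⟨a, ha⟩ : ∃ a, a + l + 2 = 2 * n := ⟨2 * n - 2 - l, by omega⟩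
    simp only [show min l (2 * n - 2 - l) = a by omega,
      show min (l - 1) (2 * n - 2 - (l - 1)) = a + 1 by omega,
      show min (l + 1) (2 * n - 2 - (l + 1)) = a - 1 by omega] at hi ⊢
    rw [if_neg (by omega : ¬ l = n - 1), if_neg (by omega : ¬ l + 1 = n - 1),
      if_neg (by omega : ¬ l = 0)]
    split_ifs <;> first | omega | simp

theorem works_typeB (hn : 3 ≤ n) (hΦ : IsRootSystemWithBase Φ α)
    (hG : HasGram α (CoxeterMatrix.B n)) (hσ : IsBipartition (CoxeterMatrix.B n) σ)
    (ho : IsSmallestOrbit α o) : Works Φ α σ o := by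
  have hM := matrixB_apply (n := n)
  have hM3 : ∀ i j : Fin n, ((j : ℕ) + 1 = i ∨ (i : ℕ) + 1 = j) → 3 ≤ CoxeterMatrix.B n i j := by
    intro i j h
    rw [hM, if_neg (by rintro rfl; omega)]
    split_ifs <;> omega
  have h2 : (√2 : ℝ) * √2 = 2 := Real.mul_self_sqrt (by norm_num)
  let j : ℕ → Fin n := foldMapB (by omega)
  let w : ℕ → ℝ := foldWeightB n
  have hadj : ∀ k l : Fin (2 * n - 1), (k : ℕ) + 1 = l →
      3 ≤ CoxeterMatrix.B n (j k) (j l) := by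
    intro k l h
    have := l.2
    apply hM3
    simp only [j, foldMapB]
    omega
  let Q := Folding.ofMatrix (σ := σ) hG 1 (fun _ _ => rfl) (fun k : Fin (2 * n - 1) => j k)
    (fun k => w k) (fun k => by dsimp only [w, foldWeightB]; split_ifs <;> positivity)
    (fun i => ⟨⟨i, by omega⟩, Fin.ext (by have := i.2; simp only [j, foldMapB]; omega)⟩)
    (sign_baseA hσ 1 (fun _ _ => rfl) (by omega) hadj) (fun i l hil => by
      have h1 : ∀ k : Fin (2 * n - 1),
          (if j k = i then (((baseA (2 * n - 1) (σ (j 0))).adj k l : ℤ) : ℝ) * w k else 0)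
          = (adjPath (2 * n - 1) k l : ℝ) * (if j k = i then w k else 0) := fun k => by
        rw [mul_ite, mul_zero]; rfl
      rw [← foldB_eq hn l.2 hil, ← sum_adjPath_mul (fun k => if j k = i then w k else 0)]
      exact Finset.sum_congr rfl fun k _ => h1 k)
  have hw : Q.w ⟨0, by omega⟩ = 1 := if_neg (by omega : ¬ 0 = n - 1)
  refine works_A hΦ (hG.signOrtho hσ fun i j => ?_) ho (by omega) Q hw fun i hl ht =>
    ⟨_, Q, hw, ?_⟩
  · rw [hM]; split_ifs <;> norm_num
  · have hi := i.2
    change j 0 = i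
    simp only [j, foldMapB]
    rcases (by omega : (i : ℕ) = 0 ∨ (i : ℕ) + 1 = n ∨ 0 < (i : ℕ) ∧ (i : ℕ) + 1 < n) with h | h | h
    · exact Fin.ext (by dsimp only; omega)
    · -- the long end of the diagram is excluded by the third element of the zigzag
      have h4 : ∀ a b : Fin n, ((a : ℕ) = n - 1 ∧ (b : ℕ) = n - 2 ∨ (b : ℕ) = n - 1 ∧ (a : ℕ) = n - 2) →
          ⟪nroot α a, nroot α b⟫_ℝ = -√2 := fun a b hab => by
        have hne : a ≠ b := by rintro rfl; omega
        rw [hG a b hne, two_mul_cos_B hne, if_pos hab]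
      have hp := h4 ⟨n - 2, by omega⟩ i (Or.inr ⟨by omega, rfl⟩)
      have := ht.eq hG hσ (p := ⟨n - 2, by omega⟩) (hM3 _ _ (Or.inr (by dsimp only; omega)))
        (fun j h1 h2 => by
          rw [ne_eq, Fin.ext_iff] at h1 h2
          dsimp only at h2
          rw [hM, if_neg (by rintro rfl; omega), if_neg (by omega), if_neg (by omega)])
        (k := i) (k' := ⟨n - 3, by omega⟩) (hM3 _ _ (Or.inl (by dsimp only; omega)))
        (hM3 _ _ (Or.inr (by dsimp only; omega)))
        (by rw [hp, h4 _ _ (Or.inl ⟨by omega, rfl⟩), if_pos rfl, neg_mul_neg, h2]; norm_num)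
        (by
          rw [hp, if_neg (by rw [Fin.ext_iff]; dsimp only; omega), hG.eq_neg_one]
          · simp
          · rw [hM, if_neg (by rw [Fin.ext_iff]; dsimp only; omega),
              if_neg (by dsimp only; omega), if_pos (Or.inr (by dsimp only; omega))])
      rw [Fin.ext_iff] at this
      dsimp only at this
      omega
    · have := hl.eq hG (j := ⟨i - 1, by omega⟩) (j' := ⟨i + 1, h.2⟩)
        (hM3 _ _ (Or.inr (by dsimp only; omega))) (hM3 _ _ (Or.inl rfl))
      rw [Fin.mk.injEq] at this
      omega

theorem forkNode_ne {m : ℕ} (hm : 3 ≤ m) : forkNode m true ≠ forkNode m false := by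
  rw [ne_eq, Fin.ext_iff, forkNode_val, forkNode_val]
  simp
  omega

theorem matrixD_apply {m : ℕ} (i l : Fin (m + 1)) : matrixD (m + 1) i l = if i = l then 1
    else if ((i : ℕ) + 1 = l ∧ (l : ℕ) + 1 < m + 1) ∨ ((l : ℕ) + 1 = i ∧ (i : ℕ) + 1 < m + 1) ∨
        ((i : ℕ) + 3 = m + 1 ∧ (l : ℕ) + 1 = m + 1) ∨ ((l : ℕ) + 3 = m + 1 ∧ (i : ℕ) + 1 = m + 1)
      then 3 else 2 := rfl

theorem matrixD_eq_three {m : ℕ} {i l : Fin (m + 1)}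
    (h : ((i : ℕ) + 1 = l ∧ (l : ℕ) < m) ∨ ((l : ℕ) + 1 = i ∧ (i : ℕ) < m) ∨
      ((i : ℕ) + 2 = m ∧ (l : ℕ) = m) ∨ ((l : ℕ) + 2 = m ∧ (i : ℕ) = m)) :
    matrixD (m + 1) i l = 3 := by
  rw [matrixD_apply, if_neg (by rintro rfl; omega), if_pos (by omega)]

theorem adjD_eq {m : ℕ} {i l : Fin (m + 1)} (hil : i ≠ l) :
    (adjD m i l : ℝ) = 2 * Real.cos (π / matrixD (m + 1) i l) := by
  rw [matrixD_apply, if_neg hil]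
  unfold adjD
  split_ifs <;> first | omega | norm_num

/-- The unfolded diagram of type `D`, up to an automorphism of the diagram. -/
def foldingD {m : ℕ} (hm : 3 ≤ m) {α : Module.Basis (Fin (m + 1)) ℝ V} {σ : Fin (m + 1) → Bool}
    (hG : HasGram α (matrixD (m + 1))) (hσ : IsBipartition (matrixD (m + 1)) σ)
    (e : Equiv.Perm (Fin (m + 1)))
    (he : ∀ i j, matrixD (m + 1) (e i) (e j) = matrixD (m + 1) i j) {η : Bool} (hη : σ (e 0) = η) :
    Folding (baseD m hm η) α σ :=
  Folding.ofMatrix hG e he id (fun _ => 1) (fun _ => one_pos) Function.surjective_id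
    (hη ▸ sign_baseD hσ e he hm (fun _ _ h h' => (matrixD_eq_three (Or.inl ⟨h, h'⟩)).ge)
      fun _ _ h h' => (matrixD_eq_three (Or.inr (Or.inr (Or.inl ⟨h, h'⟩)))).ge)
    (fun i l hil => by
      simp only [id, mul_one, Finset.sum_ite_eq', Finset.mem_univ, if_true]
      exact adjD_eq hil)

theorem signOrtho_matrixD {m : ℕ} {α : Module.Basis (Fin (m + 1)) ℝ V} {σ : Fin (m + 1) → Bool}
    (hG : HasGram α (matrixD (m + 1))) (hσ : IsBipartition (matrixD (m + 1)) σ) :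
    SignOrtho α σ :=
  hG.signOrtho hσ fun i j => by rw [matrixD_apply]; split_ifs <;> norm_num

theorem matrixD_four_swap : ∀ i : Fin 4, i = 2 ∨ i = 3 → ∀ a b : Fin 4,
    (matrixD 4 (Equiv.swap 0 i a) (Equiv.swap 0 i b) : ℕ) = matrixD 4 a b := by
  rintro i (rfl | rfl) a b <;> fin_cases a <;> fin_cases b <;> rfl

theorem works_typeD {m : ℕ} (hm : 3 ≤ m) {α : Module.Basis (Fin (m + 1)) ℝ V}
    {σ : Fin (m + 1) → Bool} (hΦ : IsRootSystemWithBase Φ α) (hG : HasGram α (matrixD (m + 1)))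
    (hσ : IsBipartition (matrixD (m + 1)) σ) (ho : IsSmallestOrbit α o) : Works Φ α σ o := by
  have hs := signOrtho_matrixD hG hσ
  have hne := forkNode_ne hm
  refine works_D hΦ hs ho (foldingD hm hG hσ 1 (fun _ _ => rfl) rfl) rfl hne fun i hl ht => ?_
  have hi := i.2
  rcases (by omega : (i : ℕ) = 0 ∨ 0 < (i : ℕ) ∧ (i : ℕ) + 1 < m ∨ m ≤ (i : ℕ) + 1) with h | h | h
  · exact ⟨_, foldingD hm hG hσ 1 (fun _ _ => rfl) rfl, rfl, hne, Fin.ext h.symm⟩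
  · have := hl.eq hG (j := ⟨i - 1, by omega⟩) (j' := ⟨i + 1, by omega⟩)
      (matrixD_eq_three (by dsimp only; omega)).ge (matrixD_eq_three (by dsimp only; omega)).ge
    rw [Fin.mk.injEq] at this
    omega
  by_cases hm3 : m = 3
  · subst hm3
    have he := matrixD_four_swap i (by
      simp only [Fin.ext_iff]
      change (i : ℕ) = 2 ∨ (i : ℕ) = 3
      omega)
    exact ⟨_, foldingD hm hG hσ _ he rfl, rfl, fun h => hne ((Equiv.swap 0 i).injective h),
      Equiv.swap_apply_left 0 i⟩
  · -- for `n > 4`, the two short ends are excluded by the third element of the zigzag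
    exfalso
    have key : ∀ k k' : Fin (m + 1), k ≠ k' → k ≠ i → k' ≠ i →
        matrixD (m + 1) k ⟨m - 2, by omega⟩ = 3 → matrixD (m + 1) k' ⟨m - 2, by omega⟩ = 3 →
        False := fun k k' h1 h2 h3 h4 h5 => by
      have hp : matrixD (m + 1) ⟨m - 2, by omega⟩ i = 3 :=
        matrixD_eq_three (by dsimp only; omega)
      refine h1 ((ht hm3).eq hG hσ hp.ge (fun j hj hj' => ?_) h4.ge h5.ge ?_ ?_)
      · rw [ne_eq, Fin.ext_iff] at hj hj'
        dsimp only at hj'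
        rw [matrixD_apply, if_neg (by rintro rfl; omega), if_neg (by omega)]
      · rw [hG.eq_neg_one h4, hG.eq_neg_one hp, if_neg h2]; norm_num
      · rw [hG.eq_neg_one h5, hG.eq_neg_one hp, if_neg h3]; norm_num
    refine key ⟨m - 3, by omega⟩ ⟨if (i : ℕ) = m then m - 1 else m, by split_ifs <;> omega⟩ ?_ ?_ ?_
      (matrixD_eq_three (by dsimp only; omega))
      (matrixD_eq_three (by dsimp only; split_ifs <;> omega)) <;>
    · rw [ne_eq, Fin.ext_iff]
      dsimp only
      try split_ifs
      all_goals omega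

/-- The diagram of type `D 6` folds onto the one of `H₃`, with weights `1` and the golden ratio `φ`
in each fiber; the fold equations reduce to `φ ^ 2 = φ + 1`. -/
theorem works_typeH {α : Module.Basis (Fin 3) ℝ V} {σ : Fin 3 → Bool}
    (hΦ : IsRootSystemWithBase Φ α) (hG : HasGram α CoxeterMatrix.H₃)
    (hσ : IsBipartition CoxeterMatrix.H₃ σ) (ho : IsSmallestOrbit α o) : Works Φ α σ o := by
  obtain ⟨φ, hφ⟩ : ∃ φ : ℝ, φ = 2 * Real.cos (π / 5) := ⟨_, rfl⟩
  have h5 : (√5 : ℝ) * √5 = 5 := Real.mul_self_sqrt (by norm_num)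
  have hφ' : φ = (1 + √5) / 2 := by rw [hφ, Real.cos_pi_div_five]; ring
  have hφ2 : φ * φ = 1 + φ := by rw [hφ']; linarith
  have hφ0 : 0 < φ := by rw [hφ']; positivity
  have hM : ∀ i j, CoxeterMatrix.H₃ i j = !![1, 3, 2; 3, 1, 5; 2, 5, 1] i j := fun i j => rfl
  have hM0 : ∀ i j, CoxeterMatrix.H₃ i j ≠ 0 := fun i j => by
    clear hG hσ
    rw [hM]
    fin_cases i <;> fin_cases j <;> simp
  have hc : ∀ i j, i ≠ j → 2 * Real.cos (π / CoxeterMatrix.H₃ i j) =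
      (!![2, 1, 0; 1, 2, φ; 0, φ, 2] : Matrix (Fin 3) (Fin 3) ℝ) i j := by
    intro i j h
    rw [hM, hφ]
    fin_cases i <;> fin_cases j <;> first | exact absurd rfl h | simp
  let j : Fin 6 → Fin 3 := ![0, 1, 2, 1, 2, 0]
  let w : Fin 6 → ℝ := ![1, 1, φ, φ, 1, φ]
  have hne : j (forkNode 5 true) ≠ j (forkNode 5 false) := by decide
  -- the diagram of type `D 6` is folded onto the one of type `H₃`
  let Q : Folding (baseD 5 (by norm_num) (σ 0)) α σ := Folding.ofMatrix hG 1 (fun _ _ => rfl) j w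
    (fun k => by fin_cases k <;> simp [w, hφ0]) (by decide)
    (sign_baseD hσ 1 (fun _ _ => rfl) (by norm_num) (j := j) (by decide) (by decide))
    (fun i l hil => by
      change ∑ k : Fin 6, (if j k = i then ((adjD 5 k l : ℤ) : ℝ) * w k else 0) = _
      rw [Fin.sum_univ_six, hc _ _ hil]
      fin_cases i <;> fin_cases l <;>
        first
        | exact absurd rfl hil
        | simp [j, w, adjD, hφ2, add_comm])
  have hg : ⟪nroot α 1, nroot α 2⟫_ℝ = -φ ∧ ⟪nroot α 2, nroot α 1⟫_ℝ = -φ := by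
    constructor <;> rw [hG _ _ (by decide), hc _ _ (by decide)] <;> simp
  refine works_D hΦ (hG.signOrtho hσ hM0) ho Q rfl hne fun i hl ht => ?_
  obtain rfl | rfl | rfl := (by decide : ∀ i : Fin 3, i = 0 ∨ i = 1 ∨ i = 2) i
  · exact ⟨_, Q, rfl, hne, rfl⟩
  · have := hl.eq hG (j := 0) (j' := 2) (by decide) (by decide)
    exact absurd this (by decide)
  · have := (ht (by norm_num)).eq hG hσ (p := 1) (k := 0) (k' := 2) (by decide) (by decide)
      (by decide) (by decide)
      (by rw [hG.eq_neg_one (by decide), hg.1, if_neg (by decide)]; simpa using hφ0.ne')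
      (by rw [hg.1, hg.2, if_pos rfl, neg_mul_neg, hφ2]; simpa using hφ0.ne')
    exact absurd this (by decide)

end Types

/-! ### The model of type `D` with colored diameters -/

section ColoredModel

variable {m : ℕ}

/-- The vertices of the `2 n`-gon of the model in snake order, where `n = m + 1`. -/
def vz (m q : ℕ) : ZMod (2 * (m + 1)) := (sv q : ℤ)

theorem vz_eq_of_sub {q : ℕ} {a b : ℤ} (h : sv q - a = (2 * (m + 1) : ℕ) * b) :
    vz m q = (a : ZMod (2 * (m + 1))) := by
  unfold vz
  rw [← sub_eq_zero, ← Int.cast_sub, h]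
  rw [Int.cast_mul, Int.cast_natCast, ZMod.natCast_self, zero_mul]

theorem rootPt_val (a : ℤ) :
    rootPt (2 * (m + 1)) (a : ZMod (2 * (m + 1))).val = rootPt (2 * (m + 1)) a := by
  rw [rootPt_eq_iff _ (by omega), ZMod.val_intCast, ← Int.modEq_iff_dvd]
  exact (Int.mod_modEq _ _).symm

theorem vz_injOn {q q' : ℕ} (h : q ≤ 2 * m + 1) (h' : q' ≤ 2 * m + 1) (he : vz m q = vz m q') :
    q = q' := by
  refine snakePt_injOn h h' ?_
  have h1 : rootPt (2 * (m + 1)) (vz m q).val = rootPt (2 * (m + 1)) (vz m q').val := by rw [he]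
  exact (rootPt_val (sv q)).symm.trans (h1.trans (rootPt_val (sv q')))

theorem sv_even (k : ℕ) : sv (2 * k) = k := by
  unfold sv
  rw [if_pos (by omega), Nat.mul_div_cancel_left k two_pos]

theorem sv_odd (k : ℕ) : sv (2 * k + 1) = -(k + 1) := by
  unfold sv
  rw [if_neg (by omega), show (2 * k + 1 + 1) / 2 = k + 1 by omega, Nat.cast_succ]

theorem sv_swp {q : ℕ} (hq : q ≤ 2 * m + 1) : sv (swp (2 * m + 1) 0 q) = -1 - sv q ∧
    (sv (swp (2 * m + 1) 1 q) = -sv q ∨ sv (swp (2 * m + 1) 1 q) = -sv q - 2 * (m + 1)) := by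
  unfold swp
  obtain ⟨k, rfl | rfl⟩ := Nat.even_or_odd' q
  · rw [if_pos (by omega), if_pos (by omega), if_neg (by omega), sv_odd, sv_even]
    refine ⟨by ring, Or.inl ?_⟩
    cases k with
    | zero => rfl
    | succ k => rw [show 2 * (k + 1) - 1 = 2 * k + 1 by omega, sv_odd]; push_cast; ring
  · rw [if_neg (by omega), if_pos (by omega), Nat.add_sub_cancel, sv_odd, sv_even]
    refine ⟨by ring, ?_⟩
    split_ifs with h
    · rw [show 2 * k + 1 + 1 = 2 * (k + 1) by ring, sv_even]
      left; push_cast; ring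
    · rw [sv_odd]
      right; omega

theorem vz_swp {q : ℕ} (hq : q ≤ 2 * m + 1) (ε : Bool) :
    vz m (swp (2 * m + 1) (parOf true ε) q) = polygonRefl (2 * (m + 1)) ε (vz m q) := by
  obtain ⟨h0, h1⟩ := sv_swp hq
  cases ε
  · have h2 : vz m (swp (2 * m + 1) 1 q) = ((-sv q : ℤ) : ZMod (2 * (m + 1))) := by
      rcases h1 with h | h
      · exact vz_eq_of_sub (b := 0) (by rw [h]; ring)
      · exact vz_eq_of_sub (b := -1) (by rw [h]; push_cast; ring)
    rw [Int.cast_neg] at h2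
    exact h2
  · have h2 : vz m (swp (2 * m + 1) 0 q) = ((-1 - sv q : ℤ) : ZMod (2 * (m + 1))) :=
      vz_eq_of_sub (b := 0) (by rw [h0]; ring)
    rw [Int.cast_sub, Int.cast_neg, Int.cast_one] at h2
    exact h2

theorem vz_antipode {q : ℕ} (hq : q ≤ 2 * m + 1) :
    vz m (2 * m + 1 - q) = vz m q + ((m + 1 : ℕ) : ZMod (2 * (m + 1))) := by
  have : sv (2 * m + 1 - q) - (sv q + (m + 1 : ℕ)) = (2 * (m + 1) : ℕ) * 0 ∨
      sv (2 * m + 1 - q) - (sv q + (m + 1 : ℕ)) = (2 * (m + 1) : ℕ) * -1 := by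
    unfold sv; push_cast; split_ifs <;> omega
  rcases this with h | h <;>
  · rw [vz_eq_of_sub h, Int.cast_add, Int.cast_natCast]; rfl

theorem snakeVertex_eq (k : ℕ) : snakeVertex (2 * (m + 1)) k = vz m (k + 1) := by
  unfold snakeVertex vz sv
  rcases Nat.even_or_odd k with h | h
  · rw [if_pos h, if_neg (by rw [Nat.even_iff] at h; omega), show (k + 1 + 1) / 2 = k / 2 + 1 by omega]
    push_cast; rfl
  · rw [if_neg (Nat.not_even_iff_odd.2 h), if_pos (by rw [Nat.odd_iff] at h; omega),
      show (k + 1) / 2 = k / 2 + 1 by rw [Nat.odd_iff] at h; omega]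
    push_cast; rfl

theorem swp_antipode {e q : ℕ} (he : e < 2) (hq : q ≤ 2 * m + 1) :
    swp (2 * m + 1) e (2 * m + 1 - q) = 2 * m + 1 - swp (2 * m + 1) e q := by
  unfold swp; split_ifs <;> omega

/-- The image of a figure under the half-turn of the polygon. -/
def antipD (F : DFig m) : DFig m :=
  ⟨(2 * m + 1 - F.1.2.1, 2 * m + 1 - F.1.1, F.1.2.2), by
    obtain ⟨h1, h2, h3, h4, h5⟩ := F.2.1
    refine ⟨?_, fun h => F.2.2 ?_⟩
    · unfold IsDiag; dsimp only; omega
    · dsimp only at h; omega⟩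

theorem antipD_antipD (F : DFig m) : antipD (antipD F) = F := by
  obtain ⟨h1, h2, -⟩ := F.2.1
  refine Subtype.ext (Prod.ext ?_ (Prod.ext ?_ rfl)) <;> change 2 * m + 1 - (2 * m + 1 - _) = _ <;>
    omega

theorem antipD_of_isDiam {F : DFig m} (h : F.IsDiam) : antipD F = F := by
  unfold DFig.IsDiam at h
  refine Subtype.ext (Prod.ext ?_ (Prod.ext ?_ rfl)) <;> change 2 * m + 1 - _ = _ <;> omega

theorem isDiam_antipD {F : DFig m} : (antipD F).IsDiam ↔ F.IsDiam := by
  obtain ⟨h1, h2, -⟩ := F.2.1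
  change 2 * m + 1 - _ + (2 * m + 1 - _) = _ ↔ _ + _ = _
  omega

theorem swpFigD_antipD {e : ℕ} (he : e < 2) (F : DFig m) :
    swpFigD m e he (antipD F) = antipD (swpFigD m e he F) := by
  obtain ⟨h1, h2, -⟩ := F.2.1
  have a := swp_le (e := e) (show F.1.1 ≤ 2 * m + 1 by omega)
  have b := swp_le (e := e) h2
  refine Subtype.ext (Prod.ext ?_ (Prod.ext ?_ ?_))
  · change min (swp _ _ (_ - _)) (swp _ _ (_ - _)) = _ - max _ _
    rw [swp_antipode he h2, swp_antipode he (show F.1.1 ≤ 2 * m + 1 by omega)]; omega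
  · change max (swp _ _ (_ - _)) (swp _ _ (_ - _)) = _ - min _ _
    rw [swp_antipode he h2, swp_antipode he (show F.1.1 ≤ 2 * m + 1 by omega)]; omega
  · have : (2 * m + 1 - F.1.2.1 + (2 * m + 1 - F.1.1) = 2 * m + 1 ∧ m % 2 ≠ e) ↔
        (F.1.1 + F.1.2.1 = 2 * m + 1 ∧ m % 2 ≠ e) := by omega
    change (if 2 * m + 1 - F.1.2.1 + (2 * m + 1 - F.1.1) = 2 * m + 1 ∧ m % 2 ≠ e then !F.1.2.2
      else F.1.2.2) = if F.1.1 + F.1.2.1 = 2 * m + 1 ∧ m % 2 ≠ e then !F.1.2.2 else F.1.2.2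
    simp only [this]

theorem dD_antipD (hm : 3 ≤ m) (F : DFig m) (k : Fin (m + 1)) :
    dD m (antipD F).1.1 (antipD F).1.2.1 (antipD F).1.2.2 k = dD m F.1.1 F.1.2.1 F.1.2.2 k := by
  obtain ⟨h1, h2, -⟩ := F.2.1
  by_cases h : F.IsDiam
  · rw [antipD_of_isDiam h]
  · have key : ∀ p, p ≤ 2 * m →
        dch (2 * m + 1 - F.1.2.1) (2 * m + 1 - F.1.1) p = dch F.1.1 F.1.2.1 (2 * m - p) := by
      intro p hp
      unfold dch
      split_ifs <;> omega
    have hk := k.2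
    rw [dD_not_diam (fun h' => h (isDiam_antipD.1 h')), dD_not_diam h]
    change (if _ then dch (2 * m + 1 - F.1.2.1) (2 * m + 1 - F.1.1) (k + 1)
      + dch (2 * m + 1 - F.1.2.1) (2 * m + 1 - F.1.1) (2 * m - (k + 1))
      else dch (2 * m + 1 - F.1.2.1) (2 * m + 1 - F.1.1) m) = _
    rw [key _ (by omega), key _ (by omega), key _ (by omega),
      show 2 * m - (2 * m - (k + 1 : ℕ)) = k + 1 by omega, show 2 * m - m = m by omega]
    split_ifs
    · exact add_comm _ _
    · rfl

/-- Equality of figures up to the half-turn of the polygon. -/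
def EqvD (G F : DFig m) : Prop := G = F ∨ G = antipD F

theorem EqvD.isDiam {F G : DFig m} (h : EqvD G F) : G.IsDiam ↔ F.IsDiam := by
  rcases h with rfl | rfl
  · rfl
  · exact isDiam_antipD

theorem eqvD_iff_of_isDiam {F G : DFig m} (h : F.IsDiam) : EqvD G F ↔ G = F := by
  unfold EqvD
  rw [antipD_of_isDiam h, or_self]

/-- The folding data of type `D`, where figures are identified with their images under the
half-turn. -/
def foldDatumD {V : Type*} [NormedAddCommGroup V] [InnerProductSpace ℝ V] [FiniteDimensional ℝ V]
    (hm : 3 ≤ m) {α : Module.Basis (Fin (m + 1)) ℝ V} {σ : Fin (m + 1) → Bool}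
    (hG : HasGram α (matrixD (m + 1))) (hσ : IsBipartition (matrixD (m + 1)) σ) (h0 : σ 0 = true) :
    FoldDatum (baseD m hm true) α σ where
  toFolding := foldingD hm hG hσ 1 (fun _ _ => rfl) h0
  Eqv := EqvD
  eqv :=
    { refl := fun F => Or.inl rfl
      symm := by
        rintro F G (rfl | rfl)
        · exact Or.inl rfl
        · exact Or.inr (antipD_antipD _).symm
      trans := by
        rintro F G H (rfl | rfl) (rfl | rfl)
        · exact Or.inl rfl
        · exact Or.inr rfl
        · exact Or.inr rfl
        · exact Or.inl (antipD_antipD _) }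
  eqv_T := by
    rintro ε F G (rfl | rfl)
    · exact Or.inl rfl
    · exact Or.inr (swpFigD_antipD (parOf_lt _ _) G)
  eqv_isB F k hF G := by
    have hk := k.2
    change IsBD m F k at hF
    have : (∃ k', (foldingD hm hG hσ 1 (fun _ _ => rfl) h0).j k' =
        (foldingD hm hG hσ 1 (fun _ _ => rfl) h0).j k ∧ (baseD m hm true).IsB G k') ↔
        IsBD m G k := by
      constructor
      · rintro ⟨k', h, h'⟩
        obtain rfl : k' = k := h
        exact h'
      · exact fun h => ⟨k, rfl, h⟩
    rw [this]
    obtain ⟨f1, f2, -⟩ := F.2.1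
    unfold EqvD
    obtain ⟨A, hA⟩ : ∃ A, A = antipD F := ⟨_, rfl⟩
    have ha : A.1.1 = 2 * m + 1 - F.1.2.1 ∧ A.1.2.1 = 2 * m + 1 - F.1.1 ∧ A.1.2.2 = F.1.2.2 := by
      rw [hA]; exact ⟨rfl, rfl, rfl⟩
    rw [← hA]
    clear hA this
    constructor
    · rintro (h | h)
      · rwa [h]
      · rw [h]
        unfold IsBD at hF ⊢
        split_ifs at hF ⊢ with h
        · omega
        · exact ⟨by omega, by omega, ha.2.2.trans hF.2.2⟩
    · intro hG
      have h2 : ∀ H : DFig m, G.1.1 = H.1.1 → G.1.2.1 = H.1.2.1 → G.1.2.2 = H.1.2.2 → G = H :=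
        fun H a b c => Subtype.ext (Prod.ext a (Prod.ext b c))
      unfold IsBD at hF hG
      split_ifs at hF hG with h
      · have hcF := F.2.2 (by omega)
        have hcG := G.2.2 (by omega)
        by_cases h3 : G.1.1 = F.1.1
        · exact Or.inl (h2 F h3 (by omega) (hcG.trans hcF.symm))
        · exact Or.inr (h2 _ (by omega) (by omega) (hcG.trans (ha.2.2.trans hcF).symm))
      · exact Or.inl (h2 F (by omega) (by omega) (hG.2.2.trans hF.2.2.symm))
  eqv_zero := by
    rintro F G (rfl | rfl) i h k hk
    · exact h k hk
    · have := h k hk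
      change dD m _ _ _ _ = 0 at this
      rwa [dD_antipD hm] at this

/-- The colors of diameters. -/
def diamColor (c : Bool) : DiamColor := if c then .gray else .dashed

/-- The diagonal of the model corresponding to a figure. -/
def chordD (F : DFig m) : Sym2 (ZMod (2 * (m + 1))) := s(vz m F.1.1, vz m F.1.2.1)

/-- The figure of the model corresponding to a figure and its image under the half-turn. -/
def modelFigure (F : DFig m) : Figure (2 * (m + 1)) where
  chords := {chordD F, chordD (antipD F)}
  color := if F.IsDiam then some (diamColor F.1.2.2) else none

theorem mem_chords_modelFigure {F : DFig m} {e : Sym2 (ZMod (2 * (m + 1)))} :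
    e ∈ (modelFigure F).chords ↔ ∃ G, EqvD G F ∧ e = chordD G := by
  constructor
  · rintro (rfl | rfl)
    · exact ⟨F, Or.inl rfl, rfl⟩
    · exact ⟨_, Or.inr rfl, rfl⟩
  · rintro ⟨G, rfl | rfl, rfl⟩
    · exact Or.inl rfl
    · exact Or.inr rfl

theorem modelFigure_eqv {F G : DFig m} (h : EqvD G F) : modelFigure G = modelFigure F := by
  rcases h with rfl | rfl
  · rfl
  · unfold modelFigure
    rw [antipD_antipD, Set.pair_comm]
    simp only [isDiam_antipD]
    rfl

theorem modelFigure_T (hm : 3 ≤ m) (ε : Bool) (F : DFig m) :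
    modelFigure ((baseD m hm true).T ε F) = tauFigure (m + 1) ε (modelFigure F) := by
  have hc : ∀ F : DFig m, chordD ((baseD m hm true).T ε F) =
      Sym2.map (polygonRefl (2 * (m + 1)) ε) (chordD F) := by
    intro F
    obtain ⟨h1, h2, -⟩ := F.2.1
    change s(vz m (min _ _), vz m (max _ _)) = _
    rw [sym2_min_max, vz_swp (by omega), vz_swp h2]
    rfl
  obtain ⟨h1, h2, -⟩ := F.2.1
  have hd : ((baseD m hm true).T ε F).IsDiam ↔ F.IsDiam := by
    change min _ _ + max _ _ = _ ↔ _
    rw [min_add_max]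
    exact swp_add (parOf_lt _ _) (by omega) h2
  unfold modelFigure tauFigure
  ext1
  · dsimp only
    rw [Set.image_pair, ← hc, ← hc]
    congr 3
    exact (swpFigD_antipD (parOf_lt _ _) F).symm
  · simp only [hd]
    by_cases h : F.IsDiam
    · rw [if_pos h, if_pos h]
      change some (diamColor (if F.1.1 + F.1.2.1 = 2 * m + 1 ∧ m % 2 ≠ parOf true ε then !F.1.2.2
        else F.1.2.2)) = _
      have : (m % 2 ≠ parOf true ε) ↔ (ε = true ↔ Even (m + 1)) := by
        rw [Nat.even_iff]
        cases ε
        · rw [show parOf true false = 1 from rfl]; simp; omega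
        · rw [show parOf true true = 0 from rfl]; simp; omega
      by_cases h3 : m % 2 ≠ parOf true ε
      · rw [if_pos ⟨h, h3⟩, if_pos (this.1 h3)]
        cases F.1.2.2 <;> rfl
      · rw [if_neg (fun h' => h3 h'.2), if_neg (fun h' => h3 (this.2 h'))]
    · rw [if_neg h, if_neg h]
      simp

theorem modelFigure_isB (hm : 3 ≤ m) {F : DFig m} {k : Fin (m + 1)}
    (h : (baseD m hm true).IsB F k) : modelFigure F = snakeFigure (m + 1) k := by
  have hk := k.2
  change IsBD m F k at h
  have hsn : ∀ i, snakeChord (2 * (m + 1)) i = s(vz m (i + 1), vz m (i + 2)) := fun i => by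
    unfold snakeChord
    rw [snakeVertex_eq, snakeVertex_eq]
  have hnd : ∀ F : DFig m, (k : ℕ) + 1 < m → F.1.1 = k + 1 → F.1.2.1 = k + 2 →
      modelFigure F = snakeFigure (m + 1) k := by
    intro F hkm h1 h2
    unfold modelFigure snakeFigure
    rw [if_neg (by unfold DFig.IsDiam; omega), if_pos (by omega), hsn, Sym2.map_mk,
      ← vz_antipode (by omega), ← vz_antipode (by omega)]
    have h3 : chordD (antipD F) = s(vz m (2 * m + 1 - F.1.2.1), vz m (2 * m + 1 - F.1.1)) := rfl
    rw [h3, Sym2.eq_swap]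
    unfold chordD
    rw [h1, h2]
  by_cases hkm : (k : ℕ) + 1 < m
  · unfold IsBD at h
    rw [if_pos hkm] at h
    rcases h with ⟨h1, h2⟩ | ⟨h1, h2⟩
    · exact hnd F hkm h1 h2
    · rw [← modelFigure_eqv (Or.inr rfl : EqvD (antipD F) F)]
      refine hnd _ hkm ?_ ?_
      · change 2 * m + 1 - F.1.2.1 = _; omega
      · change 2 * m + 1 - F.1.1 = _; omega
  · unfold IsBD at h
    rw [if_neg hkm] at h
    obtain ⟨h1, h2, h3⟩ := h
    have hd : F.IsDiam := by unfold DFig.IsDiam; omega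
    have hs : snakeFigure (m + 1) k = ⟨{snakeChord (2 * (m + 1)) (m + 1 - 2)},
        some (if (k : ℕ) + 2 = m + 1 then .dashed else .gray)⟩ := if_neg (by omega)
    rw [hs, hsn]
    unfold modelFigure
    rw [antipD_of_isDiam hd, if_pos hd, Set.pair_eq_singleton]
    unfold chordD
    rw [h1, h2, h3, show m + 1 - 2 + 1 = m by omega, show m + 1 - 2 + 2 = m + 1 by omega]
    congr 2
    unfold diamColor
    simp only [decide_eq_true_eq]
    split_ifs <;> first | rfl | omega

theorem chordsCross_iff {a b c d : ℕ} : ChordsCross (vz m a) (vz m b) (vz m c) (vz m d) ↔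
    Crosses (snakePt (2 * m + 1) a) (snakePt (2 * m + 1) b) (snakePt (2 * m + 1) c)
      (snakePt (2 * m + 1) d) := by
  have h : ∀ q, Complex.exp (2 * π * Complex.I * (vz m q).val / (2 * (m + 1) : ℕ)) =
      snakePt (2 * m + 1) q := fun q => by
    refine Eq.trans ?_ (rootPt_val (sv q))
    unfold rootPt
    rw [Int.cast_natCast]
    rfl
  unfold ChordsCross
  simp only [h]

/-- Compatibility in the model is compatibility of all representing figures. -/
theorem figureCompatible_iff {F G : DFig m} (hne : F ≠ G) :
    FigureCompatible (modelFigure F) (modelFigure G) ↔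
      ∀ F' G', EqvD F' F → EqvD G' G → fcD F' G' := by
  have hcol : ∀ F : DFig m, (modelFigure F).color.isSome = true ↔ F.IsDiam := by
    intro F
    unfold modelFigure
    by_cases h : F.IsDiam <;> simp [h]
  unfold FigureCompatible
  simp only [hcol]
  split_ifs with h
  · obtain ⟨hF, hG⟩ := h
    have hF' : F.1.1 + F.1.2.1 = 2 * m + 1 := hF
    have hG' : G.1.1 + G.1.2.1 = 2 * m + 1 := hG
    obtain ⟨f1, f2, -⟩ := F.2.1
    obtain ⟨g1, g2, -⟩ := G.2.1
    simp only [eqvD_iff_of_isDiam hF, eqvD_iff_of_isDiam hG, forall_eq_apply_imp_iff, forall_eq]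
    unfold fcD modelFigure
    rw [if_pos hF, if_pos hG, antipD_of_isDiam hF, antipD_of_isDiam hG, if_pos (show F.IsDiam ∧ G.IsDiam from ⟨hF, hG⟩)]
    have hc : some (diamColor F.1.2.2) = some (diamColor G.1.2.2) ↔ F.1.2.2 = G.1.2.2 := by
      unfold diamColor
      cases F.1.2.2 <;> cases G.1.2.2 <;> simp
    have hq : (({chordD F, chordD F} : Set (Sym2 (ZMod (2 * (m + 1))))) = {chordD G, chordD G}) ↔
        F.1.1 = G.1.1 := by
      rw [Set.pair_eq_singleton, Set.pair_eq_singleton, Set.singleton_eq_singleton_iff]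
      unfold chordD
      constructor
      · intro h
        rw [Sym2.eq_iff] at h
        rcases h with ⟨h1, -⟩ | ⟨h1, -⟩
        · exact vz_injOn (by omega) (by omega) h1
        · have h2 := vz_injOn (by omega) (by omega) h1
          omega
      · intro h
        rw [h, show F.1.2.1 = G.1.2.1 by omega]
    rw [hc, hq]
    have : F.1.2.2 = G.1.2.2 → F.1.1 ≠ G.1.1 := fun h h' =>
      hne (Subtype.ext (Prod.ext h' (Prod.ext (by omega) h)))
    tauto
  · have hfc : ∀ F' G', EqvD F' F → EqvD G' G → (fcD F' G' ↔
        ¬ ChordsCross (vz m F'.1.1) (vz m F'.1.2.1) (vz m G'.1.1) (vz m G'.1.2.1)) := by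
      intro F' G' h1 h2
      unfold fcD
      simp only [h1.isDiam, h2.isDiam]
      rw [if_neg h, chordsCross_iff]
    constructor
    · intro hc F' G' h1 h2
      exact (hfc F' G' h1 h2).2 (hc _ _ _ _ (mem_chords_modelFigure.2 ⟨F', h1, rfl⟩)
        (mem_chords_modelFigure.2 ⟨G', h2, rfl⟩))
    · intro hc a b c d hab hcd
      obtain ⟨F', h1, e1⟩ := mem_chords_modelFigure.1 hab
      obtain ⟨G', h2, e2⟩ := mem_chords_modelFigure.1 hcd
      have key := (hfc F' G' h1 h2).1 (hc F' G' h1 h2)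
      unfold chordD at e1 e2
      rw [Sym2.eq_iff] at e1 e2
      unfold ChordsCross at key ⊢
      rcases e1 with ⟨rfl, rfl⟩ | ⟨rfl, rfl⟩ <;> rcases e2 with ⟨rfl, rfl⟩ | ⟨rfl, rfl⟩
      · exact key
      · rwa [crosses_swap_right]
      · rwa [crosses_swap_left]
      · rwa [crosses_swap_left, crosses_swap_right]

end ColoredModel

/-! ### The correspondence in type `D` -/

section Correspondence

variable {m n : ℕ} {V : Type*}

theorem halfDiameters_pair {pt : ZMod (2 * n) → ℂ} {left right : Set ℂ} {a b : ZMod (2 * n)}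
    (ha : pt a ∈ left) (hb : pt b ∈ right) (hb' : pt b ∉ left) (x y : V) :
    Setup.halfDiameters pt left right x y {s(a, b), s(a, b)} =
      {s(.origin x, .vertex (pt a)), s(.origin y, .vertex (pt b))} := by
  ext e
  constructor
  · rintro ⟨a', b', h, h1, h2, he⟩
    rw [Set.pair_eq_singleton, Set.mem_singleton_iff, Sym2.eq_iff] at h
    rcases h with ⟨rfl, rfl⟩ | ⟨rfl, rfl⟩
    · exact he
    · exact absurd h1 hb'
  · exact fun he => ⟨a, b, Or.inl rfl, ha, hb, he⟩

/-- The diagram corresponding to a figure of the model, if the sides and the colors of the origin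
points are chosen in one of the two consistent ways. -/
theorem figureDiagram_modelFigure {E : ℂ ≃ₗᵢ[ℝ] ℂ} {ρ : ℝ} (hρ : 0 < ρ) (zc : Bool → V)
    {pt : ZMod (2 * (m + 1)) → ℂ} (hpt : ∀ q, pt (vz m q) = plc E ρ (2 * m + 1) q)
    {left right : Set ℂ} {r : Bool}
    (hside : (r = false ∧ left = firstSide E m ∧ right = secondSide E m) ∨
      (r = true ∧ left = secondSide E m ∧ right = firstSide E m)) (F : DFig m) :
    Setup.figureDiagram pt left right (zc r) (zc !r) (modelFigure F) =
      {e | ∃ G, EqvD G F ∧ e ∈ segsD E ρ zc G} := by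
  obtain ⟨h1, h2, -⟩ := F.2.1
  have hsegs : ∀ F : DFig m, ¬ F.IsDiam → (segsD E ρ zc F : Diagram V) =
      {Sym2.map (fun k => DiagramPoint.vertex (pt k)) (chordD F)} := by
    intro F h
    unfold segsD chordD
    rw [if_neg h, Sym2.map_mk, hpt, hpt]
  by_cases h : F.IsDiam
  · have hF : F.1.1 + F.1.2.1 = 2 * m + 1 := h
    have e1 := plc_mem_firstSide E hρ (show F.1.1 ≤ m by omega)
    have e2 := plc_mem_secondSide E hρ (show m < F.1.2.1 by omega) h2
    have e3 := notMem_secondSide E hρ (show F.1.1 ≤ m by omega) zero_le_one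
    have e4 := notMem_firstSide E hρ (show m < F.1.2.1 by omega) h2 zero_le_one
    rw [one_smul, ← hpt] at e3 e4
    rw [← hpt] at e1 e2
    have hcol : Setup.figureDiagram pt left right (zc r) (zc !r) (modelFigure F) =
        Setup.halfDiameters pt left right (zc (F.1.2.2 ^^ r)) (zc !(F.1.2.2 ^^ r))
          {chordD F, chordD F} := by
      unfold Setup.figureDiagram modelFigure
      rw [if_pos h, antipD_of_isDiam h]
      cases F.1.2.2
      · simp [diamColor]
      · simp [diamColor]
    have hset : {e | ∃ G, EqvD G F ∧ e ∈ segsD E ρ zc G} = segsD E ρ zc F := by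
      ext e
      simp only [eqvD_iff_of_isDiam h, Set.mem_ofPred_eq, exists_eq_left]
    rw [hcol, hset]
    unfold segsD chordD
    rw [if_pos h]
    rcases hside with ⟨rfl, rfl, rfl⟩ | ⟨rfl, rfl, rfl⟩
    · rw [halfDiameters_pair e1 e2 e4, hpt, hpt, Bool.xor_false]
    · rw [Sym2.eq_swap, halfDiameters_pair e2 e1 e3, hpt, hpt, Bool.xor_true, Bool.not_not,
        Set.pair_comm]
  · unfold Setup.figureDiagram modelFigure
    rw [if_neg h]
    dsimp only
    rw [Set.image_pair]
    ext e
    constructor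
    · rintro (rfl | rfl)
      · exact ⟨F, Or.inl rfl, by rw [hsegs F h]; rfl⟩
      · exact ⟨_, Or.inr rfl, by rw [hsegs _ (fun h' => h (isDiam_antipD.1 h'))]; rfl⟩
    · rintro ⟨G, hGF, he⟩
      rw [hsegs G (fun h' => h (hGF.isDiam.1 h')), Set.mem_singleton_iff] at he
      rcases hGF with rfl | rfl
      · exact Or.inl he
      · exact Or.inr he

/-- Placing the polygon of the model: a symmetry of the polygon that sends the vertices of the snake
to prescribed positions. -/
theorem exists_place_polygon [NormedAddCommGroup V] [InnerProductSpace ℝ V]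
    [FiniteDimensional ℝ V] {X : Setup (m + 1) V} (hz : X.z ≠ 0)
    (hc : coxNum X.α X.σ = 2 * m) {E : ℂ ≃ₗᵢ[ℝ] ℂ} {K s : ℤ} (hs : s = 1 ∨ s = -1)
    (hE : ∀ a : ℤ, E (‖X.z‖ • rootPt (2 * m + 2) a) = X.z * rootPt (2 * m + 2) (K + s * a)) :
    ∃ g : ℂ ≃ₗᵢ[ℝ] ℂ, g '' Set.range X.polygonVertex = Set.range X.polygonVertex ∧
      ∀ q, g (X.polygonVertex (vz m q).val) = plc E ‖X.z‖ (2 * m + 1) q := by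
  have hz' : (‖X.z‖ : ℂ) ≠ 0 := by exact_mod_cast norm_ne_zero_iff.2 hz
  let u : Circle := ⟨‖X.z‖ / X.z, by rw [Submonoid.unitSphere]; simp [hz]⟩
  have hpv : ∀ k : ℕ, X.polygonVertex k = X.z * rootPt (2 * m + 2) k := fun k => by
    unfold Setup.polygonVertex rootPt
    rw [hc, Int.cast_natCast]
  have hg : ∀ k : ℕ, ((rotation u).trans E) (X.polygonVertex k) =
      E (‖X.z‖ • rootPt (2 * m + 2) k) := fun k => by
    rw [LinearIsometryEquiv.trans_apply, hpv, rotation_apply, Complex.real_smul]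
    congr 1
    change ‖X.z‖ / X.z * (X.z * _) = _
    field_simp
  -- every integer has a representative among the natural numbers
  have hnat : ∀ a : ℤ, ∃ k : ℕ, ∃ b : ℤ, (k : ℤ) = a + (2 * m + 2 : ℕ) * b := fun a =>
    ⟨(a % (2 * m + 2 : ℕ)).toNat, -(a / (2 * m + 2 : ℕ)), by
      rw [Int.toNat_of_nonneg (Int.emod_nonneg _ (by omega)), Int.emod_def]; ring⟩
  refine ⟨(rotation u).trans E, ?_, fun q => ?_⟩
  · ext w
    constructor
    · rintro ⟨_, ⟨k, rfl⟩, rfl⟩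
      obtain ⟨l, b, hl⟩ := hnat (K + s * k)
      refine ⟨l, ?_⟩
      rw [hg, hE, hpv, hl, rootPt_add_mul _ (by omega)]
    · rintro ⟨k, rfl⟩
      obtain ⟨l, b, hl⟩ := hnat (s * (k - K))
      refine ⟨_, ⟨l, rfl⟩, ?_⟩
      have hs2 : s * s = 1 := by rcases hs with rfl | rfl <;> norm_num
      rw [hg, hE, hpv, hl, show K + s * (s * (k - K) + (2 * m + 2 : ℕ) * b) =
        k + (2 * m + 2 : ℕ) * (s * b) by linear_combination (k - K) * hs2,
        rootPt_add_mul _ (by omega)]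
  · rw [hg]
    exact congrArg (fun w => E (‖X.z‖ • w)) (rootPt_val (sv q))

/-- The correspondence between diagrams and figures in type `D`. -/
theorem model_typeD [NormedAddCommGroup V] [InnerProductSpace ℝ V] [FiniteDimensional ℝ V]
    {X : Setup (m + 1) V} {Φ : Set V} (hΦ : IsRootSystemWithBase Φ X.α) (hm : 3 ≤ m)
    (hG : HasGram X.α (matrixD (m + 1))) (hσ : IsBipartition (matrixD (m + 1)) X.σ)
    (h0 : X.σ 0 = true) (hz : X.z ≠ 0) {x₀ : V} {t : ℝ} (ht : t ≠ 0)
    (hx : ∀ j, ⟪nroot X.α j, x₀⟫_ℝ = if j = 0 then t else 0) (ho : X.o = orbitOf X.α x₀) :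
    (∃! F, X.IsModelAssignment Φ F) ∧
      ∀ R D F, IsCompatibility X.α X.σ Φ R → X.IsDiagramAssignment Φ D →
        X.IsModelAssignment Φ F → X.Corresponds Φ D F ∧
        ∀ β γ : almostPos X.α Φ, β ≠ γ → (R β γ ↔ FigureCompatible (F β) (F γ)) := by
  have hs := signOrtho_matrixD hG hσ
  let Q := foldDatumD hm hG hσ h0
  have hw : Q.w 0 = 1 := rfl
  have hne : Q.j (forkNode m true) ≠ Q.j (forkNode m false) := forkNode_ne hm
  obtain ⟨F₀, hF1, hF2, hF3, hF4⟩ := Q.toRootModel.existsUnique_assignment hΦ hs modelFigure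
    (tauFigure (m + 1)) (fun F G h => modelFigure_eqv h) (modelFigure_T hm)
  have hb : ∀ i, modelFigure (Q.bFig i) = snakeFigure (m + 1) i := by
    intro i
    obtain ⟨k, rfl, hk⟩ := Q.bFig_spec i
    exact modelFigure_isB hm hk
  have huniq : ∀ F, X.IsModelAssignment Φ F → F = F₀ := fun F hF =>
    hF4 F (fun i β hβ => (hF.negSimple i β hβ).trans (hb i).symm) hF.equivariant
  refine ⟨⟨F₀, ⟨fun i β hβ => (hF2 i β hβ).trans (hb i), hF3⟩, huniq⟩, ?_⟩
  intro R D F hR hD hF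
  obtain rfl := huniq F hF
  refine ⟨?_, fun β γ hβγ => ?_⟩
  · have O := orbitD Q hw hx hne ht hs ho
    have hc : coxNum X.α X.σ = 2 * m := O.coxNum_eq hs
    obtain ⟨E, ⟨K, s, hs1, hEK⟩, hE⟩ := exists_plc (orbitD Q hw hx hne ht hs ho) hs hz
    have hρ : 0 < ‖X.z‖ := norm_pos_iff.2 hz
    have hO := fun c => Setup.place_of_G_G hs (O.coxNum_eq hs) (G_G_originPt Q hw hx hne hs c)
    have hneg := negSimpleDiagram_D Q hw hs ht hx hne ho hE hO
    have hax := axis_D Q hw hs ht hx hne ho hρ hE hO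
    have htau := tauSegment_segsD hρ (cSign_originPt Q hw hx hne hs) hax hm
    have hDF := (existsUnique_diagramAssignment Q hneg htau hΦ hs).2 D hD
    obtain ⟨g, hg1, hg2⟩ := exists_place_polygon hz hc hs1 hEK
    refine ⟨by rw [hc]; ring, fun u v huv => ?_⟩
    obtain ⟨r, hside⟩ : ∃ r : Bool,
        (r = false ∧ graySide (-u) (-v) = firstSide E m ∧ graySide u v = secondSide E m) ∨
        (r = true ∧ graySide (-u) (-v) = secondSide E m ∧ graySide u v = firstSide E m) := by
      rcases Setup.graySide_eq (by omega) hax huv with ⟨h1, h2⟩ | ⟨h1, h2⟩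
      · exact ⟨true, Or.inr ⟨rfl, h2, h1⟩⟩
      · exact ⟨false, Or.inl ⟨rfl, h2, h1⟩⟩
    set zc := originPt Q hw x₀ t
    have hzinj : zc true ≠ zc false := originPt_injective Q hw hx hne ht
    -- the diagrams of the last two negative simple roots consist of two half-diameters each
    have hhalf : ∀ c : Bool, ∀ i : Fin (m + 1), i = forkNode m c →
        (∃ p ∈ graySide (-u) (-v), s(.origin (zc (c ^^ r)), .vertex p) ∈ X.negSimpleDiagram i) ∧
        (∃ p ∈ graySide u v, s(.origin (zc !(c ^^ r)), .vertex p) ∈ X.negSimpleDiagram i) := by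
      rintro c _ rfl
      have hmem : ∀ e ∈ segsD E ‖X.z‖ zc (snakeDiam hm c),
          e ∈ X.negSimpleDiagram (forkNode m c) := fun e he => by
        rw [hneg]
        exact ⟨forkNode m c, _, rfl, isB_snakeDiam hm c, he⟩
      rw [segsD_snakeDiam] at hmem
      have e1 := plc_mem_firstSide E hρ (le_refl m)
      have e2 := plc_mem_secondSide E hρ (Nat.lt_succ_self m) (by omega)
      have m1 := hmem _ (Or.inl rfl)
      have m2 := hmem _ (Or.inr rfl)
      rcases hside with ⟨rfl, h1, h2⟩ | ⟨rfl, h1, h2⟩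
      · rw [h1, h2, Bool.xor_false]
        exact ⟨⟨_, e1, m1⟩, ⟨_, e2, m2⟩⟩
      · rw [h1, h2, Bool.xor_true, Bool.not_not]
        exact ⟨⟨_, e2, m2⟩, ⟨_, e1, m1⟩⟩
    refine ⟨zc r, zc !r, ?_, ?_, ?_, ?_, g, hg1, fun β => ?_⟩
    · cases r
      · exact hzinj.symm
      · exact hzinj
    · have hzset : ({zc r, zc !r} : Set V) = {zc true, zc false} := by
        cases r
        · exact Set.pair_comm _ _
        · rfl
      have hp : ∀ c, X.proj (zc c) = 0 := fun c => by
        by_contra hcon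
        have := hO c
        unfold Setup.place at this
        rw [if_neg hcon] at this
        cases this
      rw [hzset]
      ext x
      constructor
      · rintro ⟨hxo, hx0⟩
        rw [ho] at hxo
        rcases orbitOf_subset_D Q hw hx hne hxo with ⟨q, hq, rfl⟩ | h
        · rw [Finset.coe_Icc, Set.mem_Icc] at hq
          have h5 : X.place ((Q.zigZagD hw).y x₀ t q) = _ := hE q hq.1 hq.2
          unfold Setup.place at h5
          rw [if_pos (show X.proj ((Q.zigZagD hw).y x₀ t q) = 0 from hx0)] at h5
          cases h5
        · exact h
      · rintro (rfl | rfl)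
        · exact ⟨originPt_mem Q hw hs ht hx hne ho true, hp true⟩
        · exact ⟨originPt_mem Q hw hs ht hx hne ho false, hp false⟩
    · intro i hi
      have := hhalf false i (Fin.ext (by rw [forkNode_val]; simp; omega))
      rwa [Bool.false_xor] at this
    · intro i hi
      have := hhalf true i (Fin.ext (by rw [forkNode_val]; simp; omega))
      rwa [Bool.true_xor, Bool.not_not] at this
    · obtain ⟨G, hG⟩ := Q.toRootModel.exists_rel hΦ hs β β.2
      rw [hDF β G hG, hF1 β G hG]
      exact (figureDiagram_modelFigure hρ zc hg2 hside G).symm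
  · obtain ⟨F, hF⟩ := Q.toRootModel.exists_rel hΦ hs β β.2
    obtain ⟨G, hG⟩ := Q.toRootModel.exists_rel hΦ hs γ γ.2
    have hFG := Q.toRootModel.not_eqv hΦ hs hβγ hF hG
    rw [(Q.toRootModel.compatibility hΦ hs (baseD m hm true).FC (baseD m hm true).FC_T
      Q.FC_bFig).2 R hR β γ F G hF hG, hF1 β F hF, hF1 γ G hG]
    exact (figureCompatible_iff (by rintro rfl; exact hFG (Or.inl rfl))).symm

end Correspondence

end CoxeterDiagram

end

open CoxeterDiagram in
theorem mainTheorem1 {n : ℕ} {V : Type*} [NormedAddCommGroup V] [InnerProductSpace ℝ V]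
    [FiniteDimensional ℝ V] (M : CoxeterMatrix (Fin n)) (hM : IsListedType M)
    (Φ : Set V) (α : Module.Basis (Fin n) ℝ V) (hΦ : IsRootSystemWithBase Φ α)
    (hα : HasCoxeterMatrix α M) (σ : Fin n → Bool) (hσ : IsBipartition M σ)
    (o : Set V) (ho : IsSmallestOrbit α o) :
    -- the Coxeter plane is a plane
    Module.finrank ℝ (coxPlane α σ) = 2 ∧
    -- compatibility is well defined
    (∃! R, IsCompatibility α σ Φ R) ∧
    ∀ (f : coxPlane α σ ≃ₗᵢ[ℝ] ℂ) (z : ℂ), z ≠ 0 →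
      let X : Setup n V := ⟨α, σ, o, f, z⟩
      -- the diagrams are well defined
      (∀ ε, X.AxisSpec ε) ∧ (∃ u v, X.AreAxisVectors u v) ∧ (∃! D, X.IsDiagramAssignment Φ D) ∧
      -- the compatibility criterion
      (∀ R D, IsCompatibility α σ Φ R → X.IsDiagramAssignment Φ D →
        ∀ β γ : almostPos α Φ, β ≠ γ →
          (R β γ ↔ Setup.NoCrossing (D β) (D γ) ∧ X.OriginCondition (D β) (D γ))) ∧
      -- in type `D n`, the correspondence with the colored-diameter model, where `o` is the
      -- orbit of a vector orthogonal to all simple roots but the first, and `s_1` is in `S₊`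
      (4 ≤ n → M = matrixD n → (∀ i : Fin n, (i : ℕ) = 0 → σ i = true) →
        (∃ x ∈ o, ∀ i : Fin n, (i : ℕ) ≠ 0 → inner ℝ x (α i) = 0) →
        (∃! F, X.IsModelAssignment Φ F) ∧
        ∀ R D F, IsCompatibility α σ Φ R → X.IsDiagramAssignment Φ D →
          X.IsModelAssignment Φ F →
          X.Corresponds Φ D F ∧
          ∀ β γ : almostPos α Φ, β ≠ γ → (R β γ ↔ FigureCompatible (F β) (F γ))) := by
  have hG := hasGram hΦ hα
  have hW : Works Φ α σ o := by
    cases hM with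
    | typeA n hn => exact works_typeA hn hΦ hG hσ ho
    | typeB n hn =>
      obtain rfl | hn := (by omega : n = 2 ∨ 3 ≤ n)
      · exact works_dihedral (m := 2) (by norm_num) rfl hΦ hG hσ ho
      · exact works_typeB hn hΦ hG hσ ho
    | typeD n hn =>
      obtain ⟨m, rfl⟩ : ∃ m, n = m + 1 := ⟨n - 1, by omega⟩
      exact works_typeD (by omega) hΦ hG hσ ho
    | typeI m hm => exact works_dihedral hm rfl hΦ hG hσ ho
    | typeH => exact works_typeH hΦ hG hσ ho
  obtain ⟨h1, h2, h3⟩ := hW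
  refine ⟨h1, h2, fun f z hz => ?_⟩
  obtain ⟨h4, h5, h6, h7⟩ := h3 f z hz
  refine ⟨h4, h5, h6, h7, ?_⟩
  rintro hn rfl h0 ⟨x, hxo, hx⟩
  obtain ⟨m, rfl⟩ : ∃ m, n = m + 1 := ⟨n - 1, by omega⟩
  obtain ⟨y, hy, rfl, -⟩ := ho
  have hx0 : x ≠ 0 := by rintro rfl; exact zero_notMem_orbitOf hy hxo
  have hxj : ∀ j, ⟪nroot α j, x⟫_ℝ = if j = 0 then ⟪nroot α 0, x⟫_ℝ else 0 := by
    intro j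
    split_ifs with h
    · rw [h]
    · rw [← inner_simple_eq_zero_iff]
      exact hx j fun h' => h (Fin.ext h')
  refine model_typeD (X := ⟨α, σ, orbitOf α y, f, z⟩) hΦ (by omega) hG hσ (h0 0 rfl) hz
    (t := ⟪nroot α 0, x⟫_ℝ) (fun ht => hx0 ?_) hxj (orbitOf_eq_of_mem α hxo)
  exact eq_zero_of_inner_nroot α fun j => by rw [hxj, ht, ite_self]
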